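/- **Setting.** Let $\phi:\mathbb R\to\mathbb R$ be Lipschitz, $\dot\phi$ its (almost everywhere defined) derivative, $\sigma_w,\sigma_b,\sigma_o\in\mathbb R$. Call a random $a\times b$ matrix $\omega$ *uniform scaled orthogonal* if $\omega=\sqrt{\max(a,b)}\,Q$, where $Q$ is the upper left $a\times b$ block of a Haar distributed orthogonal matrix of size $\max(a,b)$; thus $\omega^T\omega=a\,\mathbf I$ if $a\ge b$, $\omega\omega^T=b\,\mathbf I$ if $a\le b$, and the entries have variance $1$. Let $L\ge 1$, and fix $n_0$ and $n_L$. At orthogonal initialization all weight matrices below are independent and uniform scaled orthogonal, and all biases $b^l_i$ are i.i.d. $\mathcal N(0,1)$, independent of the weights. The empirical NTK of a network output $f(\theta,x)\in\mathbb R^{n_L}$ with parameters $\theta$ (all $\omega$ and $b$) is the matrix $\Theta^L_0(x,x')=\nabla_\theta f(\theta,x)\,\nabla_\theta f(\theta,x')^T\in\mathbb R^{n_L\times n_L}$, taken at initialization. "As $n_1,\dots,n_{L-1}\to\infty$" means: along every sequence of widths for which $n_1,\dots,n_{L-1}$ all tend to infinity (simultaneously, at arbitrary relative rates). **FCN.**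 Let $x^0=x\in\mathbb R^{n_0}$, $h^l_i=\frac{\sigma_w}{\sqrt{n_{l-1}}}\sum_{j}\omega^l_{ij}x^{l-1}_j+\sigma_b b^l_i$ for $1\le l\le L$ and $1\le i\le n_l$, $x^l_i=\phi(h^l_i)$, and $f(\theta,x)=h^L$. Then for all $x,x'\in\mathbb R^{n_0}$, as $n_1,\dots,n_{L-1}\to\infty$, in probability, $$\Theta^L_0(x,x')\to\Theta^L_\infty(x,x')\,\mathbf I_{n_L\times n_L},$$ where $$\Sigma^1(x,x')=\tfrac{\sigma_w^2}{n_0}x^Tx'+\sigma_b^2,\qquad \Sigma^l(x,x')=\sigma_w^2\,\mathbb E_{f\sim\mathcal N(0,\Sigma^{l-1})}[\phi(f(x))\phi(f(x'))]+\sigma_b^2,$$ $$\dot\Sigma^l(x,x')=\mathbb E_{f\sim\mathcal N(0,\Sigma^{l-1})}[\dot\phi(f(x))\dot\phi(f(x'))],$$ $$\Theta^1_\infty=\Sigma^1,\qquad \Theta^l_\infty(x,x')=\sigma_w^2\,\dot\Sigma^l(x,x')\,\Theta^{l-1}_\infty(x,x')+\Sigma^l(x,x').$$ **CNN.** Let $L\ge2$,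 $m\ge1$, $k\ge0$, with positions $\alpha\in\mathbb Z/m\mathbb Z$ and offsets $\beta\in\{-k,\dots,k\}$; inputs are $x=(x_{j,\alpha})$ with $1\le j\le n_0$, and $x_\alpha=(x_{j,\alpha})_j\in\mathbb R^{n_0}$. For $1\le l\le L-1$ let $h^l_{i,\alpha}=\frac{\sigma_w}{\sqrt{(2k+1)n_{l-1}}}\sum_{\beta}\sum_j\omega^l_{ij,\beta}x^{l-1}_{j,\alpha+\beta}+\sigma_b b^l_i$, $x^l_{i,\alpha}=\phi(h^l_{i,\alpha})$, and let $f_i(\theta,x)=\frac{\sigma_o}{\sqrt{n_{L-1}}}\sum_\alpha\sum_j\omega^L_{ij,\alpha}x^{L-1}_{j,\alpha}$, where the matrices $\omega^l_\beta$ (all $l<L$, $\beta$) and $\omega^L_\alpha$ (all $\alpha$) are independent and uniform scaled orthogonal. Then for all inputs $x,x'$, as $n_1,\dots,n_{L-1}\to\infty$, in probability, $\Theta^L_0(x,x')\to\Theta^L_\infty(x,x')\,\mathbf I_{n_L\times n_L}$, where $$\Sigma^1_{\alpha,\alpha'}(x,x')=\tfrac{\sigma_w^2}{n_0(2k+1)}\sum_\beta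 x_{\alpha+\beta}^Tx'_{\alpha'+\beta}+\sigma_b^2,$$ and, with $\mathbb E^{l}_{\alpha,\alpha'}[g]=\mathbb E_{f\sim\mathcal N(0,\Sigma^{l})}[g(f_\alpha(x))\,g(f_{\alpha'}(x'))]$ and $\dot\Sigma^l_{\alpha,\alpha'}=\mathbb E^{l-1}_{\alpha,\alpha'}[\dot\phi]$, for $2\le l\le L-1$ $$\Sigma^l_{\alpha,\alpha'}=\tfrac{\sigma_w^2}{2k+1}\sum_\beta\mathbb E^{l-1}_{\alpha+\beta,\alpha'+\beta}[\phi]+\sigma_b^2,$$ $$\Theta^1_{\alpha,\alpha'}=\Sigma^1_{\alpha,\alpha'},\qquad \Theta^l_{\alpha,\alpha'}=\tfrac{\sigma_w^2}{2k+1}\sum_\beta\dot\Sigma^l_{\alpha+\beta,\alpha'+\beta}\,\Theta^{l-1}_{\alpha+\beta,\alpha'+\beta}+\Sigma^l_{\alpha,\alpha'},$$ $$\Theta^L_\infty(x,x')=\sigma_o^2\sum_\alpha\Big[\dot\Sigma^L_{\alpha,\alpha}\,\Theta^{L-1}_{\alpha,\alpha}+\Sigma^L_{\alpha,\alpha}\Big],\qquad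 \Sigma^L_{\alpha,\alpha}=\mathbb E^{L-1}_{\alpha,\alpha}[\phi].$$ -/

import Mathlib

open MeasureTheory ProbabilityTheory Filter Topology
open scoped NNReal ENNReal

noncomputable section

/-! ### Uniformly distributed scaled orthogonal matrices -/

/-- The orthogonal group `O(N)`. -/
abbrev OrthGroup (N : ℕ) : Type := Matrix.orthogonalGroup (Fin N) ℝ

instance OrthGroup.instMeasurableSpace (N : ℕ) : MeasurableSpace (OrthGroup N) := borel _

instance OrthGroup.instBorelSpace (N : ℕ) : BorelSpace (OrthGroup N) := ⟨rfl⟩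

instance OrthGroup.instCompactSpace (N : ℕ) : CompactSpace (OrthGroup N) := by
  refine isCompact_iff_compactSpace.mp ?_
  have hK : IsCompact (Set.pi Set.univ fun _ : Fin N =>
      Set.pi Set.univ fun _ : Fin N => Set.Icc (-1 : ℝ) 1) :=
    isCompact_univ_pi fun _ => isCompact_univ_pi fun _ => isCompact_Icc
  refine IsCompact.of_isClosed_subset (t := (Matrix.orthogonalGroup (Fin N) ℝ :
    Set (Matrix (Fin N) (Fin N) ℝ))) hK ?_ ?_
  · have : ((Matrix.orthogonalGroup (Fin N) ℝ : Set (Matrix (Fin N) (Fin N) ℝ)))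
        = {A | A * star A = 1} := by
      ext A
      exact Matrix.mem_unitaryGroup_iff
    rw [this]
    exact isClosed_eq (by fun_prop) continuous_const
  · intro A hA i _ j _
    have := entry_norm_bound_of_unitary (𝕜 := ℝ) hA i j
    exact abs_le.mp (by simpa using this)

/-- The Haar probability measure on `O(N)`. -/
def haarOrth (N : ℕ) : Measure (OrthGroup N) := Measure.haarMeasure ⊤

/-- The `a × b` matrix obtained from an orthogonal matrix of size `max a b` by keeping its first
`a` rows and its first `b` columns and multiplying by `√(max a b)`. The result `ω` satisfies
`ωᵀ ω = a I` if `b ≤ a`, and `ω ωᵀ = b I` if `a ≤ b`. -/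
def scaledBlock (a b : ℕ) (Q : OrthGroup (max a b)) : Fin a → Fin b → ℝ := fun i j =>
  √((max a b : ℕ) : ℝ) *
    Q.1 (Fin.castLE (le_max_left a b) i) (Fin.castLE (le_max_right a b) j)

/-- The uniform law on scaled (semi-)orthogonal `a × b` matrices (entries of variance one). -/
def orthInit (a b : ℕ) : Measure (Fin a → Fin b → ℝ) := (haarOrth (max a b)).map (scaledBlock a b)

instance haarOrth.instIsProbabilityMeasure (N : ℕ) : IsProbabilityMeasure (haarOrth N) :=
  ⟨by simpa [haarOrth] using Measure.haarMeasure_self (K₀ := (⊤ : TopologicalSpace.PositiveCompacts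
    (OrthGroup N)))⟩

theorem continuous_scaledBlock (a b : ℕ) : Continuous (scaledBlock a b) := by
  refine continuous_pi fun i => continuous_pi fun j => continuous_const.mul ?_
  exact (continuous_apply_apply _ _).comp continuous_subtype_val

instance orthInit.instIsProbabilityMeasure (a b : ℕ) : IsProbabilityMeasure (orthInit a b) :=
  Measure.isProbabilityMeasure_map (continuous_scaledBlock a b).measurable.aemeasurable

/-! ### Gaussian expectations -/

/-- `𝔼[g(u) g(v)]` for a centered Gaussian vector `(u, v)` with `Var u = a`, `Cov(u, v) = c`,
`Var v = b`. -/
def gaussProd (g : ℝ → ℝ) (a c b : ℝ) : ℝ :=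
  ∫ z, g (z 0) * g (z 1) ∂(multivariateGaussian (0 : EuclideanSpace ℝ (Fin 2)) !![a, c; c, b])

/-! ### Fully-connected networks

`n l` is the width of layer `l`; there are `H` hidden layers, so the depth is `L = H + 1`.
The entry `l : Fin (H + 1)` of a parameter family holds the parameters of layer `l + 1`, which maps
layer `l` to layer `l + 1`. -/

/-- Weights `ω` and biases `β` of a fully-connected network of depth `H + 1`. -/
abbrev FCNParam (n : ℕ → ℕ) (H : ℕ) : Type :=
  ((l : Fin (H + 1)) → Fin (n (l + 1)) → Fin (n l) → ℝ) × ((l : Fin (H + 1)) → Fin (n (l + 1)) → ℝ)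

/-- One fully-connected layer in ntk-parameterization,
`h_i = (σ_w / √b) ∑_j ω_{ij} x_j + σ_b β_i`. -/
def fcnLayer (σw σb : ℝ) {a b : ℕ} (ω : Fin a → Fin b → ℝ) (β : Fin a → ℝ) (x : Fin b → ℝ) :
    Fin a → ℝ := fun i =>
  σw / √(b : ℝ) * ∑ j, ω i j * x j + σb * β i

/-- The post-activations `x^l(x)` of the layers `l ≤ H`, with `x^0(x) = x`. -/
def fcnPost (σw σb : ℝ) (φ : ℝ → ℝ) (n : ℕ → ℕ) (H : ℕ) (θ : FCNParam n H) (x : Fin (n 0) → ℝ) :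
    (l : ℕ) → l ≤ H → Fin (n l) → ℝ
  | 0, _ => x
  | l + 1, hl => fun i =>
      φ (fcnLayer σw σb (θ.1 ⟨l, by omega⟩) (θ.2 ⟨l, by omega⟩)
        (fcnPost σw σb φ n H θ x l (by omega)) i)

/-- The network output `f(θ, x) = h^{H+1}(x)`. -/
def fcnOutput (σw σb : ℝ) (φ : ℝ → ℝ) (n : ℕ → ℕ) (H : ℕ) (x : Fin (n 0) → ℝ)
    (θ : FCNParam n H) : Fin (n (H + 1)) → ℝ :=
  fcnLayer σw σb (θ.1 (Fin.last H)) (θ.2 (Fin.last H)) (fcnPost σw σb φ n H θ x H le_rfl)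

/-- The law of the parameters at orthogonal initialization: all layers are independent, weights are
uniform scaled orthogonal matrices, biases are i.i.d. standard Gaussian and independent of them. -/
def fcnInit (n : ℕ → ℕ) (H : ℕ) : Measure (FCNParam n H) :=
  (Measure.pi fun l : Fin (H + 1) => orthInit (n (l + 1)) (n l)).prod
    (Measure.pi fun l : Fin (H + 1) => Measure.pi fun _ : Fin (n (l + 1)) => gaussianReal 0 1)

/-- The coordinate direction of the weight `ω^{l+1}_{ij}`. -/
def fcnDirW (n : ℕ → ℕ) (H : ℕ) (l : Fin (H + 1)) (i : Fin (n (l + 1))) (j : Fin (n l)) :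
    FCNParam n H :=
  (Pi.single l (Pi.single i (Pi.single j 1)), 0)

/-- The coordinate direction of the bias `β^{l+1}_i`. -/
def fcnDirB (n : ℕ → ℕ) (H : ℕ) (l : Fin (H + 1)) (i : Fin (n (l + 1))) : FCNParam n H :=
  (0, Pi.single l (Pi.single i 1))

/-- The empirical neural tangent kernel `∇_θ f(θ, x) ∇_θ f(θ, x')ᵀ`: the sum over all parameters `p`
of `∂_p f_k(θ, x) ∂_p f_{k'}(θ, x')`. -/
def fcnNTK (σw σb : ℝ) (φ : ℝ → ℝ) (n : ℕ → ℕ) (H : ℕ) (x x' : Fin (n 0) → ℝ)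
    (θ : FCNParam n H) : Matrix (Fin (n (H + 1))) (Fin (n (H + 1))) ℝ :=
  Matrix.of fun k k' =>
    let D := fderiv ℝ (fun t => fcnOutput σw σb φ n H x t k) θ
    let D' := fderiv ℝ (fun t => fcnOutput σw σb φ n H x' t k') θ
    ∑ l, ∑ i, ∑ j, D (fcnDirW n H l i j) * D' (fcnDirW n H l i j)
      + ∑ l, ∑ i, D (fcnDirB n H l i) * D' (fcnDirB n H l i)

/-- The covariance `Σ^l(x, x')` for `l ≥ 1` (the value at `l = 0` is a placeholder). -/
def fcnSigma (σw σb : ℝ) (φ : ℝ → ℝ) {n₀ : ℕ} : ℕ → (Fin n₀ → ℝ) → (Fin n₀ → ℝ) → ℝ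
  | 0, _, _ => 0
  | 1, x, x' => σw ^ 2 / n₀ * ∑ j, x j * x' j + σb ^ 2
  | l + 2, x, x' =>
      σw ^ 2 * gaussProd φ (fcnSigma σw σb φ (l + 1) x x) (fcnSigma σw σb φ (l + 1) x x')
        (fcnSigma σw σb φ (l + 1) x' x') + σb ^ 2

/-- `Σ̇^l(x, x')`, the expectation of `φ'(f(x)) φ'(f(x'))` for `f ∼ N(0, Σ^{l-1})`, `l ≥ 2`. -/
def fcnSigmaDot (σw σb : ℝ) (φ : ℝ → ℝ) {n₀ : ℕ} (l : ℕ) (x x' : Fin n₀ → ℝ) : ℝ :=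
  gaussProd (deriv φ) (fcnSigma σw σb φ (l - 1) x x) (fcnSigma σw σb φ (l - 1) x x')
    (fcnSigma σw σb φ (l - 1) x' x')

/-- The limiting kernel `Θ^l_∞(x, x')` for `l ≥ 1` (the value at `l = 0` is a placeholder). -/
def fcnTheta (σw σb : ℝ) (φ : ℝ → ℝ) {n₀ : ℕ} : ℕ → (Fin n₀ → ℝ) → (Fin n₀ → ℝ) → ℝ
  | 0, _, _ => 0
  | 1, x, x' => fcnSigma σw σb φ 1 x x'
  | l + 2, x, x' =>
      σw ^ 2 * fcnSigmaDot σw σb φ (l + 2) x x' * fcnTheta σw σb φ (l + 1) x x'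
        + fcnSigma σw σb φ (l + 2) x x'

/-! ### Convolutional networks

One-dimensional convolutions on `m` positions with periodic boundary (positions `α : ZMod m`) and
filter offsets `β ∈ {-k, …, k}`. There are `H` convolutional layers, followed by a fully-connected
output layer without bias, so the depth is `L = H + 1`; `n l` is the number of channels of layer
`l`, and `n (H + 1)` the number of outputs. -/

/-- The filter offsets `{-k, …, k}`. -/
abbrev FilterPos (k : ℕ) : Type := Finset.Icc (-(k : ℤ)) (k : ℤ)

/-- Weights `ω^{l+1}_{β,ij}` and biases `β^{l+1}_i` of the convolutional layers, and weights
`ω^{H+1}_{α,ij}` of the output layer. -/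
abbrev CNNParam (n : ℕ → ℕ) (H m k : ℕ) : Type :=
  ((l : Fin H) → FilterPos k → Fin (n (l + 1)) → Fin (n l) → ℝ) ×
    ((l : Fin H) → Fin (n (l + 1)) → ℝ) ×
      (ZMod m → Fin (n (H + 1)) → Fin (n H) → ℝ)

/-- One convolutional layer in ntk-parameterization,
`h_{i,α} = ∑_β (σ_w / √((2k+1) b)) ∑_j ω_{β,ij} x_{j,α+β} + σ_b β_i`. -/
def cnnLayer (σw σb : ℝ) {m k a b : ℕ} (ω : FilterPos k → Fin a → Fin b → ℝ) (β : Fin a → ℝ)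
    (x : Fin b → ZMod m → ℝ) : Fin a → ZMod m → ℝ := fun i α =>
  σw / √((2 * k + 1) * b : ℝ) * ∑ s : FilterPos k, ∑ j, ω s i j * x j (α + ((s : ℤ) : ZMod m))
    + σb * β i

/-- The post-activations `x^l(x)` of the layers `l ≤ H`, with `x^0(x) = x`. -/
def cnnPost (σw σb : ℝ) (φ : ℝ → ℝ) (n : ℕ → ℕ) (H m k : ℕ) (θ : CNNParam n H m k)
    (x : Fin (n 0) → ZMod m → ℝ) : (l : ℕ) → l ≤ H → Fin (n l) → ZMod m → ℝ
  | 0, _ => x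
  | l + 1, hl => fun i α =>
      φ (cnnLayer σw σb (θ.1 ⟨l, by omega⟩) (θ.2.1 ⟨l, by omega⟩)
        (cnnPost σw σb φ n H m k θ x l (by omega)) i α)

/-- The network output `f_i(θ, x) = (σ_o / √n_H) ∑_α ∑_j ω_{α,ij} x^H_{j,α}`. -/
def cnnOutput (σw σb σo : ℝ) (φ : ℝ → ℝ) (n : ℕ → ℕ) (H m k : ℕ) [NeZero m]
    (x : Fin (n 0) → ZMod m → ℝ) (θ : CNNParam n H m k) : Fin (n (H + 1)) → ℝ := fun i =>
  σo / √(n H : ℝ) * ∑ α : ZMod m, ∑ j, θ.2.2 α i j * cnnPost σw σb φ n H m k θ x H le_rfl j α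

/-- The law of the parameters at orthogonal initialization: the matrices `ω^l_β`, for all layers and
all offsets (all positions, in the output layer), are independent uniform scaled orthogonal
matrices; the biases are i.i.d. standard Gaussian and independent of them. -/
def cnnInit (n : ℕ → ℕ) (H m k : ℕ) [NeZero m] : Measure (CNNParam n H m k) :=
  (Measure.pi fun l : Fin H => Measure.pi fun _ : FilterPos k => orthInit (n (l + 1)) (n l)).prod
    ((Measure.pi fun l : Fin H => Measure.pi fun _ : Fin (n (l + 1)) => gaussianReal 0 1).prod
      (Measure.pi fun _ : ZMod m => orthInit (n (H + 1)) (n H)))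

/-- The coordinate direction of the weight `ω^{l+1}_{s,ij}`. -/
def cnnDirW (n : ℕ → ℕ) (H m k : ℕ) (l : Fin H) (s : FilterPos k) (i : Fin (n (l + 1)))
    (j : Fin (n l)) : CNNParam n H m k :=
  (Pi.single l (Pi.single s (Pi.single i (Pi.single j 1))), 0, 0)

/-- The coordinate direction of the bias `β^{l+1}_i`. -/
def cnnDirB (n : ℕ → ℕ) (H m k : ℕ) (l : Fin H) (i : Fin (n (l + 1))) : CNNParam n H m k :=
  (0, Pi.single l (Pi.single i 1), 0)

/-- The coordinate direction of the output weight `ω^{H+1}_{α,ij}`. -/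
def cnnDirO (n : ℕ → ℕ) (H m k : ℕ) (α : ZMod m) (i : Fin (n (H + 1))) (j : Fin (n H)) :
    CNNParam n H m k :=
  (0, 0, Pi.single α (Pi.single i (Pi.single j 1)))

/-- The empirical neural tangent kernel `∇_θ f(θ, x) ∇_θ f(θ, x')ᵀ`. -/
def cnnNTK (σw σb σo : ℝ) (φ : ℝ → ℝ) (n : ℕ → ℕ) (H m k : ℕ) [NeZero m]
    (x x' : Fin (n 0) → ZMod m → ℝ) (θ : CNNParam n H m k) :
    Matrix (Fin (n (H + 1))) (Fin (n (H + 1))) ℝ :=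
  Matrix.of fun i i' =>
    let D := fderiv ℝ (fun t => cnnOutput σw σb σo φ n H m k x t i) θ
    let D' := fderiv ℝ (fun t => cnnOutput σw σb σo φ n H m k x' t i') θ
    ∑ l, ∑ s, ∑ p, ∑ j, D (cnnDirW n H m k l s p j) * D' (cnnDirW n H m k l s p j)
      + ∑ l, ∑ p, D (cnnDirB n H m k l p) * D' (cnnDirB n H m k l p)
      + ∑ α, ∑ p, ∑ j, D (cnnDirO n H m k α p j) * D' (cnnDirO n H m k α p j)

/-- The covariance `Σ^l_{α,α'}(x, x')` of the convolutional layers `l ≥ 1` (the value at `l = 0` is a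
placeholder). -/
def cnnSigma (σw σb : ℝ) (φ : ℝ → ℝ) {n₀ m : ℕ} (k : ℕ) :
    ℕ → (Fin n₀ → ZMod m → ℝ) → (Fin n₀ → ZMod m → ℝ) → ZMod m → ZMod m → ℝ
  | 0, _, _, _, _ => 0
  | 1, x, x', α, α' =>
      σw ^ 2 / (n₀ * (2 * k + 1)) *
        ∑ s : FilterPos k, ∑ j, x j (α + ((s : ℤ) : ZMod m)) * x' j (α' + ((s : ℤ) : ZMod m))
        + σb ^ 2
  | l + 2, x, x', α, α' =>
      σw ^ 2 / (2 * k + 1) *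
        ∑ s : FilterPos k,
          gaussProd φ
            (cnnSigma σw σb φ k (l + 1) x x (α + ((s : ℤ) : ZMod m)) (α + ((s : ℤ) : ZMod m)))
            (cnnSigma σw σb φ k (l + 1) x x' (α + ((s : ℤ) : ZMod m)) (α' + ((s : ℤ) : ZMod m)))
            (cnnSigma σw σb φ k (l + 1) x' x' (α' + ((s : ℤ) : ZMod m)) (α' + ((s : ℤ) : ZMod m)))
        + σb ^ 2

/-- `𝔼[g(f_α(x)) g(f_{α'}(x'))]` for `f ∼ N(0, Σ^l)`. -/
def cnnExpect (g : ℝ → ℝ) (σw σb : ℝ) (φ : ℝ → ℝ) {n₀ m : ℕ} (k l : ℕ)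
    (x x' : Fin n₀ → ZMod m → ℝ) (α α' : ZMod m) : ℝ :=
  gaussProd g (cnnSigma σw σb φ k l x x α α) (cnnSigma σw σb φ k l x x' α α')
    (cnnSigma σw σb φ k l x' x' α' α')

/-- `Σ̇^l_{α,α'}(x, x')`, the expectation of `φ'(f_α(x)) φ'(f_{α'}(x'))` for `f ∼ N(0, Σ^{l-1})`,
`l ≥ 2`. -/
def cnnSigmaDot (σw σb : ℝ) (φ : ℝ → ℝ) {n₀ m : ℕ} (k l : ℕ) (x x' : Fin n₀ → ZMod m → ℝ)
    (α α' : ZMod m) : ℝ :=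
  cnnExpect (deriv φ) σw σb φ k (l - 1) x x' α α'

/-- The kernel `Θ^l_{α,α'}(x, x')` of the convolutional layers `l ≥ 1` (the value at `l = 0` is a
placeholder). -/
def cnnTheta (σw σb : ℝ) (φ : ℝ → ℝ) {n₀ m : ℕ} (k : ℕ) :
    ℕ → (Fin n₀ → ZMod m → ℝ) → (Fin n₀ → ZMod m → ℝ) → ZMod m → ZMod m → ℝ
  | 0, _, _, _, _ => 0
  | 1, x, x', α, α' => cnnSigma σw σb φ k 1 x x' α α'
  | l + 2, x, x', α, α' =>
      σw ^ 2 / (2 * k + 1) *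
        ∑ s : FilterPos k,
          cnnSigmaDot σw σb φ k (l + 2) x x' (α + ((s : ℤ) : ZMod m)) (α' + ((s : ℤ) : ZMod m)) *
            cnnTheta σw σb φ k (l + 1) x x' (α + ((s : ℤ) : ZMod m)) (α' + ((s : ℤ) : ZMod m))
        + cnnSigma σw σb φ k (l + 2) x x' α α'

/-- The limiting kernel of the whole network of depth `H + 1`: the trace over positions of
`Σ̇^{H+1}_{α,α'} Θ^H_{α,α'} + Σ^{H+1}_{α,α'}`, times `σ_o²`, where
`Σ^{H+1}_{α,α'} = 𝔼[φ(f_α(x)) φ(f_{α'}(x'))]`, `f ∼ N(0, Σ^H)`. -/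
def cnnThetaOut (σw σb σo : ℝ) (φ : ℝ → ℝ) {n₀ m : ℕ} [NeZero m] (k H : ℕ)
    (x x' : Fin n₀ → ZMod m → ℝ) : ℝ :=
  σo ^ 2 * ∑ α : ZMod m,
    (cnnSigmaDot σw σb φ k (H + 1) x x' α α * cnnTheta σw σb φ k H x x' α α
      + cnnExpect φ σw σb φ k H x x' α α)

/-! ### Convergence in probability -/

/-- The random matrices `X s`, defined on the probability spaces `(Ω s, P s)`, converge in
probability to `c I` as `s → ∞`, in the maximum norm of the entries. -/
def TendstoInProbScalar {Ω : ℕ → Type*} [∀ s, MeasurableSpace (Ω s)] (P : ∀ s, Measure (Ω s))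
    {q : ℕ → ℕ} (X : ∀ s, Ω s → Matrix (Fin (q s)) (Fin (q s)) ℝ) (c : ℝ) : Prop :=
  ∀ ε : ℝ, 0 < ε →
    Tendsto (fun s => P s {ω | ∃ i j, ε ≤ |(X s ω - c • (1 : Matrix (Fin (q s)) (Fin (q s)) ℝ)) i j|})
      atTop (𝓝 0)

end

open scoped Matrix

/-! ### Product measures -/

/-! Both networks are instances of one abstract layer: neuron `i` at position `β` reads the inputs
at the positions `π β s` through independent matrices `ω s`. The two inputs are treated as two
positions, so the position set is `Bool` for fully-connected and `Bool × ZMod m` for convolutional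
networks, and all joint statements about a pair of inputs become statements about one layer. The
induction over depth carries `NearLimit`, which says three things about the post-activations `x` of
a layer and the Gram matrix `M` of their parameter gradients: the empirical covariance of `x` is
near `Γ`, the averaged diagonal of `M` is near `T`, and the Hilbert-Schmidt norm of `M` between
neurons is `o(n)`. The last property makes the kernel of the next layer concentrate.

Given the earlier layers, one layer is analysed by two mechanisms, both uniform in the size `N` of
the orthogonal matrices, so that widths may grow at arbitrary relative rates.

(1) Kernel. The new kernel is a sum of conjugations `Q P Q'ᵀ` with `Q`, `Q'` Haar. By
`integral_conj_sub_trace_sq_le` an entry of `N Q P Qᵀ` is within `O(‖P‖)` (Frobenius norm, in mean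
square) of `δᵢⱼ tr P`; this uses only permutation invariance and one rotation by 45 degrees. For
independent `Q` and `Q'` the entries are centred, by `lintegral_bilin_sq`.

(2) Activations. If `g`, `g'` are independent Gaussian vectors, they are nearly orthogonal of norm
about `√N`, so some rotation takes a given pair `u`, `u'` close to `p g`, `q g + r g'`. Right
invariance of Haar measure inserts this rotation for free, and `Q g`, `Q g'` are again Gaussian.
Hence averages over neurons of functions of quadratic growth obey the law of large numbers with the
Gaussian limit: `QuadTame.exists_lintegral_rowPre_le`. The derivative of `φ` is merely bounded and
measurable. It is replaced by difference quotients, which are Lipschitz; the error is controlled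
because a pre-activation has an almost bounded density (`exists_lintegral_rowPre_le_volume`),
obtained by averaging over rotations in a coordinate plane.

Since the kernel is close to a constant neuron by neuron and `deriv φ` is bounded, the product of
both is averaged without any independence between them. This gives `exists_layer_step`.

Two points need care. Where the limiting variance is zero the law of the pre-activation is a point
mass and `φ` may fail to be differentiable there; but then the pre-activation vanishes identically
in the parameters and its limiting tangent kernel is zero (`LimitAdmissible`, `VanishDegenerate`).
Where it is positive, the pre-activations almost surely avoid the null set of non-differentiability
of `φ` (`ae_rowPre_notMem`), so the chain rule computes the true gradient
(`LayeredParam.exists_gradient`). Finally, resampling the parameters of one layer preserves the law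
of all parameters, which turns the conditional estimates into a union bound over layers
(`exists_measure_not_good_le`, `exists_measure_tangentKernel_le`). -/

theorem measurePreserving_pi_update {ι : Type*} [Fintype ι] [DecidableEq ι] {X : ι → Type*}
    [∀ i, MeasurableSpace (X i)] (μ : ∀ i, Measure (X i)) [∀ i, IsProbabilityMeasure (μ i)]
    (i : ι) :
    MeasurePreserving (fun p : (∀ i, X i) × X i => Function.update p.1 i p.2)
      ((Measure.pi μ).prod (μ i)) (Measure.pi μ) := by
  have hm : Measurable fun p : (∀ i, X i) × X i => Function.update p.1 i p.2 :=
    measurable_update'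
  refine ⟨hm, (Measure.pi_eq fun s hs => ?_).symm⟩
  rw [Measure.map_apply hm (MeasurableSet.univ_pi hs)]
  have : (fun p : (∀ i, X i) × X i => Function.update p.1 i p.2) ⁻¹' Set.univ.pi s
      = (Set.univ.pi (Function.update s i Set.univ)) ×ˢ s i := by
    ext p
    simp only [Set.mem_preimage, Set.mem_pi, Set.mem_univ, true_implies, Set.mem_prod]
    constructor
    · intro h
      refine ⟨fun j => ?_, by simpa using h i⟩
      rcases eq_or_ne j i with rfl | hj
      · simp
      · simpa [hj] using h j
    · rintro ⟨h1, h2⟩ j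
      rcases eq_or_ne j i with rfl | hj
      · simpa using h2
      · simpa [hj] using h1 j
  rw [this, Measure.prod_prod, Measure.pi_pi, ← Finset.mul_prod_erase _ _ (Finset.mem_univ i),
    ← Finset.mul_prod_erase _ (fun i => μ i (s i)) (Finset.mem_univ i)]
  simp only [Function.update_self, measure_univ, one_mul]
  rw [mul_comm]
  congr 1
  refine Finset.prod_congr rfl fun j hj => ?_
  rw [Function.update_of_ne (Finset.ne_of_mem_erase hj)]

/-- Distinct coordinates of an i.i.d. family are i.i.d.; the coordinates outside the range of `e`
integrate to one. -/
theorem measurePreserving_pi_comp_injective {ι ι' X : Type*} [Fintype ι] [Fintype ι']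
    [MeasurableSpace X] (μ : Measure X) [IsProbabilityMeasure μ] {e : ι' → ι}
    (he : Function.Injective e) :
    MeasurePreserving (fun ω : ι → X => fun i => ω (e i)) (Measure.pi fun _ => μ)
      (Measure.pi fun _ => μ) := by
  classical
  have hm : Measurable fun ω : ι → X => fun i => ω (e i) := by fun_prop
  refine ⟨hm, (Measure.pi_eq fun s hs => ?_).symm⟩
  rw [Measure.map_apply hm (MeasurableSet.univ_pi hs)]
  -- Writing the factors with an implication makes the factor the whole space off the range of `e`,
  -- without a choice of inverse.
  have : (fun ω : ι → X => fun i => ω (e i)) ⁻¹' Set.univ.pi s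
      = Set.univ.pi (fun k => {y | ∀ i, e i = k → y ∈ s i}) := by
    ext ω
    simp only [Set.mem_preimage, Set.mem_pi, Set.mem_univ, true_implies, Set.mem_ofPred_eq]
    exact ⟨fun h k i hk => hk ▸ h i, fun h i => h _ i rfl⟩
  rw [this, Measure.pi_pi]
  symm
  refine Fintype.prod_of_injective e he _ _ (fun k hk => ?_) fun i => ?_
  · have : {y | ∀ i, e i = k → y ∈ s i} = Set.univ := by
      ext y
      simp only [Set.mem_ofPred_eq, Set.mem_univ, iff_true]
      exact fun i hi => absurd ⟨i, hi⟩ hk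
    rw [this, measure_univ]
  · congr 1
    ext y
    simp only [Set.mem_ofPred_eq]
    exact ⟨fun h j hj => he hj ▸ h, fun h => h i rfl⟩

theorem measurePreserving_pi_uncurry {ι κ X : Type*} [Fintype ι] [Fintype κ]
    [MeasurableSpace X] (μ : Measure X) [IsProbabilityMeasure μ] :
    MeasurePreserving (fun ω : ι → κ → X => fun q : ι × κ => ω q.1 q.2)
      (Measure.pi fun _ => Measure.pi fun _ => μ) (Measure.pi fun _ => μ) := by
  have hm : Measurable fun ω : ι → κ → X => fun q : ι × κ => ω q.1 q.2 := by fun_prop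
  refine ⟨hm, (Measure.pi_eq fun s hs => ?_).symm⟩
  rw [Measure.map_apply hm (MeasurableSet.univ_pi hs)]
  have : (fun ω : ι → κ → X => fun q : ι × κ => ω q.1 q.2) ⁻¹' Set.univ.pi s
      = Set.univ.pi (fun i => Set.univ.pi fun k => s (i, k)) := by
    ext ω
    simp
  rw [this, Measure.pi_pi, Fintype.prod_prod_type]
  simp_rw [Measure.pi_pi]

theorem measurePreserving_pi_curry {ι κ X : Type*} [Fintype ι] [Fintype κ]
    [MeasurableSpace X] (μ : Measure X) [IsProbabilityMeasure μ] :
    MeasurePreserving (fun ω : ι × κ → X => fun i k => ω (i, k))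
      (Measure.pi fun _ => μ) (Measure.pi fun _ => Measure.pi fun _ => μ) := by
  have hm : Measurable fun ω : ι × κ → X => fun i k => ω (i, k) := by fun_prop
  refine ⟨hm, ?_⟩
  rw [← (measurePreserving_pi_uncurry (ι := ι) (κ := κ) μ).map_eq, Measure.map_map hm (by fun_prop)]
  exact Measure.map_id

/-- Turns a family of Gaussian vectors in `ℝᴺ` into a family of rows indexed by neurons, keeping
only the rows which occur in the upper left block. -/
theorem measurePreserving_pi_flip_comp {ι κ κ' X : Type*} [Fintype ι] [Fintype κ] [Fintype κ']
    [MeasurableSpace X] (μ : Measure X) [IsProbabilityMeasure μ] {e : κ' → κ}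
    (he : Function.Injective e) :
    MeasurePreserving (fun ω : ι → κ → X => fun k i => ω i (e k))
      (Measure.pi fun _ => Measure.pi fun _ => μ) (Measure.pi fun _ => Measure.pi fun _ => μ) := by
  have h1 := measurePreserving_pi_uncurry (ι := ι) (κ := κ) μ
  have hinj : Function.Injective fun q : κ' × ι => (q.2, e q.1) := by
    rintro ⟨a, b⟩ ⟨c, d⟩ h
    simp only [Prod.mk.injEq] at h
    exact Prod.ext (he h.2) h.1
  have h2 := measurePreserving_pi_comp_injective μ hinj
  have h3 := measurePreserving_pi_curry (ι := κ') (κ := ι) μ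
  exact h3.comp (h2.comp h1)

/-! ### The weak law of large numbers in mean -/

/-- Mean estimates are phrased as lower integrals, which are monotone without any integrability of
`f`. This is the passage from a Bochner integral of a majorant. -/
theorem lintegral_ofReal_le_of_le {Ω : Type*} [MeasurableSpace Ω] {μ : Measure Ω} {f g : Ω → ℝ}
    {c : ℝ} (hg : Integrable g μ) (hg0 : ∀ ω, 0 ≤ g ω) (h : ∀ ω, f ω ≤ g ω) (hc : ∫ ω, g ω ∂μ ≤ c) :
    ∫⁻ ω, ENNReal.ofReal (f ω) ∂μ ≤ ENNReal.ofReal c := by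
  calc ∫⁻ ω, ENNReal.ofReal (f ω) ∂μ ≤ ∫⁻ ω, ENNReal.ofReal (g ω) ∂μ :=
        lintegral_mono fun ω => ENNReal.ofReal_le_ofReal (h ω)
    _ = ENNReal.ofReal (∫ ω, g ω ∂μ) :=
        (ofReal_integral_eq_lintegral_ofReal hg (ae_of_all _ hg0)).symm
    _ ≤ _ := ENNReal.ofReal_le_ofReal hc

/-- Markov's inequality for a real random variable whose mean is estimated by a lower integral. -/
theorem measure_le_of_lintegral_ofReal_le {Ω : Type*} [MeasurableSpace Ω] {μ : Measure Ω}
    {f : Ω → ℝ} (hf : Measurable f) {c ε : ℝ} (hε : 0 < ε)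
    (h : ∫⁻ ω, ENNReal.ofReal (f ω) ∂μ ≤ ENNReal.ofReal c) :
    μ {ω | ε ≤ f ω} ≤ ENNReal.ofReal (c / ε) := by
  have h1 := mul_meas_ge_le_lintegral₀ (μ := μ) (f := fun ω => ENNReal.ofReal (f ω))
    hf.ennreal_ofReal.aemeasurable (ENNReal.ofReal ε)
  have h2 : {ω | ε ≤ f ω} ⊆ {ω | ENNReal.ofReal ε ≤ ENNReal.ofReal (f ω)} :=
    fun ω hω => ENNReal.ofReal_le_ofReal hω
  rw [ENNReal.ofReal_div_of_pos hε, ENNReal.le_div_iff_mul_le (by simp [hε]) (by simp), mul_comm]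
  exact (mul_le_mul_right (measure_mono h2) _).trans (h1.trans h)

theorem sq_integral_abs_le {Ω : Type*} [MeasurableSpace Ω] {P : Measure Ω}
    [IsProbabilityMeasure P] {Z : Ω → ℝ} (hZ : MemLp Z 2 P) :
    (∫ ω, |Z ω| ∂P) ^ 2 ≤ ∫ ω, Z ω ^ 2 ∂P := by
  have hv := variance_nonneg (fun ω => |Z ω|) P
  have hZ' : MemLp (fun ω => |Z ω|) 2 P := hZ.abs
  rw [variance_eq_sub hZ'] at hv
  simp only [Pi.pow_apply, sq_abs] at hv
  linarith

theorem lintegral_abs_le_sqrt {Ω : Type*} [MeasurableSpace Ω] {P : Measure Ω}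
    [IsProbabilityMeasure P] {Z : Ω → ℝ} (hZ : MemLp Z 2 P) {c : ℝ}
    (hc : ∫ ω, Z ω ^ 2 ∂P ≤ c) :
    ∫⁻ ω, ENNReal.ofReal |Z ω| ∂P ≤ ENNReal.ofReal √c :=
  lintegral_ofReal_le_of_le (hZ.integrable one_le_two).abs (fun _ => abs_nonneg _)
    (fun _ => le_rfl) (Real.le_sqrt_of_sq_le ((sq_integral_abs_le hZ).trans hc))

/-- The variance of an average of independent copies is the variance divided by `a`; Cauchy-Schwarz
passes from the second to the first absolute moment. -/
theorem lintegral_abs_average_sub_integral_le {X : Type*} [MeasurableSpace X] (μ : Measure X)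
    [IsProbabilityMeasure μ] {f : X → ℝ} (hf : MemLp f 2 μ) {a : ℕ} (ha : 0 < a) :
    ∫⁻ ω, ENNReal.ofReal |(1 / a : ℝ) * ∑ i, f (ω i) - ∫ x, f x ∂μ|
      ∂(Measure.pi fun _ : Fin a => μ) ≤ ENNReal.ofReal √(Var[f; μ] / a) := by
  set P := Measure.pi fun _ : Fin a => μ
  set c := ∫ x, f x ∂μ
  have ha' : (0 : ℝ) < a := by exact_mod_cast ha
  have hev : ∀ i : Fin a, MemLp (fun ω : Fin a → X => f (ω i)) 2 P := fun i =>
    hf.comp_measurePreserving (measurePreserving_eval (fun _ => μ) i)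
  set Y : (Fin a → X) → ℝ := ∑ i, fun ω => f (ω i)
  have hY : MemLp Y 2 P := memLp_finsetSum' _ fun i _ => hev i
  have hmean : ∫ ω, Y ω ∂P = a * c := by
    have h1 : ∀ i : Fin a, ∫ ω, f (ω i) ∂P = c := fun i =>
      integral_comp_eval (μ := fun _ => μ) hf.aestronglyMeasurable
    simp only [Y, Finset.sum_apply]
    rw [integral_finsetSum _ fun i _ => (hev i).integrable one_le_two]
    simp [h1]
  have hvar : Var[Y; P] = a * Var[f; μ] := by
    have := variance_sum_pi (X := fun _ : Fin a => f) (μ := fun _ => μ) fun _ => hf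
    simpa using this
  have hZ : MemLp (fun ω => (1 / a : ℝ) * Y ω - c) 2 P := (hY.const_mul _).sub (memLp_const _)
  have hsq : ∫ ω, ((1 / a : ℝ) * Y ω - c) ^ 2 ∂P = Var[f; μ] / a := by
    have h1 : ∀ ω, ((1 / a : ℝ) * Y ω - c) ^ 2 = (1 / a : ℝ) ^ 2 * (Y ω - ∫ ω, Y ω ∂P) ^ 2 := by
      intro ω
      rw [hmean]
      field_simp
    simp_rw [h1]
    rw [integral_const_mul, ← variance_eq_integral hY.aemeasurable, hvar]
    field_simp
  simpa [Y, Finset.sum_apply] using lintegral_abs_le_sqrt hZ hsq.le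

/-! ### Haar measure on the orthogonal group -/

instance haarOrth.instIsHaarMeasure (N : ℕ) : (haarOrth N).IsHaarMeasure := by
  unfold haarOrth; infer_instance

theorem measurePreserving_mul_left_haarOrth {N : ℕ} (R : OrthGroup N) :
    MeasurePreserving (fun Q => R * Q) (haarOrth N) (haarOrth N) :=
  measurePreserving_mul_left _ R

/-- A right translate of a left Haar probability measure is again one, so uniqueness gives right
invariance on this compact group. -/
theorem measurePreserving_mul_right_haarOrth {N : ℕ} (R : OrthGroup N) :
    MeasurePreserving (fun Q => Q * R) (haarOrth N) (haarOrth N) := by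
  refine ⟨measurable_mul_const R, ?_⟩
  have : IsProbabilityMeasure ((haarOrth N).map fun Q => Q * R) :=
    Measure.isProbabilityMeasure_map (measurable_mul_const R).aemeasurable
  exact Measure.isHaarMeasure_eq_of_isProbabilityMeasure _ _

theorem OrthGroup.transpose_mul_self {N : ℕ} (Q : OrthGroup N) : Q.1ᵀ * Q.1 = 1 :=
  (Matrix.mem_orthogonalGroup_iff' _ _).mp Q.2

theorem OrthGroup.mulVec_dotProduct_mulVec {N : ℕ} (Q : OrthGroup N) (v w : Fin N → ℝ) :
    (Q.1 *ᵥ v) ⬝ᵥ (Q.1 *ᵥ w) = v ⬝ᵥ w := by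
  rw [Matrix.dotProduct_mulVec, Matrix.vecMul_mulVec, Q.transpose_mul_self, Matrix.vecMul_one]

theorem OrthGroup.continuous_mulVec {N : ℕ} (w : Fin N → ℝ) (i : Fin N) :
    Continuous fun Q : OrthGroup N => (Q.1 *ᵥ w) i := by
  have : Continuous fun Q : OrthGroup N => Q.1 *ᵥ w :=
    continuous_subtype_val.matrix_mulVec continuous_const
  exact (continuous_apply i).comp this

theorem OrthGroup.continuous_apply {N : ℕ} (i j : Fin N) :
    Continuous fun Q : OrthGroup N => Q.1 i j :=
  (continuous_apply_apply i j).comp continuous_subtype_val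

theorem integrable_haarOrth_of_continuous {N : ℕ} {f : OrthGroup N → ℝ} (hf : Continuous f) :
    Integrable f (haarOrth N) :=
  hf.integrable_of_hasCompactSupport (HasCompactSupport.of_compactSpace f)

/-- Any orthonormal family indexed by a set of coordinates consists of columns of an orthogonal
matrix. -/
theorem exists_orthGroup_col {N : ℕ} (s : Set (Fin N)) (f : Fin N → Fin N → ℝ)
    (hf : ∀ i ∈ s, ∀ j ∈ s, f i ⬝ᵥ f j = if i = j then 1 else 0) :
    ∃ R : OrthGroup N, ∀ i ∈ s, R.1 *ᵥ Pi.single i 1 = f i := by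
  have hv : Orthonormal ℝ (s.domRestrict fun i => (WithLp.toLp 2 (f i) : EuclideanSpace ℝ (Fin N))) := by
    rw [orthonormal_iff_ite]
    rintro ⟨i, hi⟩ ⟨j, hj⟩
    have := hf i hi j hj
    simp only [Set.domRestrict_apply, EuclideanSpace.inner_eq_star_dotProduct, Subtype.mk.injEq]
    rw [dotProduct_comm]
    simpa using this
  obtain ⟨b, hb⟩ := hv.exists_orthonormalBasis_extension_of_card_eq (by simp)
  refine ⟨⟨Matrix.of fun k l => (b l).ofLp k, ?_⟩, fun i hi => ?_⟩
  · rw [Matrix.mem_orthogonalGroup_iff']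
    ext k l
    have := orthonormal_iff_ite.mp b.orthonormal k l
    rw [EuclideanSpace.inner_eq_star_dotProduct, dotProduct_comm] at this
    simpa [Matrix.mul_apply, Matrix.one_apply, dotProduct] using this
  · ext k
    simp [hb i hi]

theorem exists_orthGroup_pair {N : ℕ} {i j : Fin N} (hij : i ≠ j) {f g : Fin N → ℝ}
    (hf : f ⬝ᵥ f = 1) (hg : g ⬝ᵥ g = 1) (hfg : f ⬝ᵥ g = 0) :
    ∃ R : OrthGroup N, R.1 *ᵥ Pi.single i 1 = f ∧ R.1 *ᵥ Pi.single j 1 = g := by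
  obtain ⟨R, hR⟩ := exists_orthGroup_col {i, j} (fun k => if k = i then f else g) (by
    rintro k (rfl | rfl) l (rfl | rfl)
    · simp [hf]
    · simp [hij, hij.symm, hfg]
    · rw [dotProduct_comm] at hfg
      simp [hij.symm, hfg]
    · simp [hij.symm, hg])
  exact ⟨R, by simpa using hR i (by simp), by simpa [hij.symm] using hR j (by simp)⟩

theorem exists_orthGroup_single {N : ℕ} (i : Fin N) {f : Fin N → ℝ}
    (hf : f ⬝ᵥ f = 1) :
    ∃ R : OrthGroup N, R.1 *ᵥ Pi.single i 1 = f := by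
  obtain ⟨R, hR⟩ := exists_orthGroup_col {i} (fun _ => f) (by
    rintro k rfl l rfl
    simp [hf])
  exact ⟨R, hR i (by simp)⟩

/-- The standard Gaussian measure is invariant under orthogonal matrices. -/
theorem measurePreserving_mulVec_gaussian {N : ℕ} (Q : OrthGroup N) :
    MeasurePreserving (fun g : Fin N → ℝ => Q.1 *ᵥ g) (Measure.pi fun _ => gaussianReal 0 1)
      (Measure.pi fun _ => gaussianReal 0 1) := by
  have hm : Measurable fun g : Fin N → ℝ => Q.1 *ᵥ g :=
    (Continuous.matrix_mulVec continuous_const continuous_id).measurable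
  refine ⟨hm, ?_⟩
  let L : EuclideanSpace ℝ (Fin N) ≃ₗᵢ[ℝ] EuclideanSpace ℝ (Fin N) :=
    Unitary.linearIsometryEquiv
      ⟨Matrix.toEuclideanCLM (n := Fin N) (𝕜 := ℝ) Q.1, Unitary.map_mem _ Q.2⟩
  have hL : ∀ g : Fin N → ℝ, L (WithLp.toLp 2 g) = WithLp.toLp 2 (Q.1 *ᵥ g) := by
    intro g
    change Matrix.toEuclideanCLM (n := Fin N) (𝕜 := ℝ) Q.1 (WithLp.toLp 2 g) = _
    simp
  have h1 := map_pi_eq_stdGaussian (ι := Fin N)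
  have h2 := stdGaussian_map L
  rw [← h1, Measure.map_map (by fun_prop) (by fun_prop)] at h2
  have h3 : (⇑L ∘ WithLp.toLp 2) = (WithLp.toLp 2) ∘ fun g : Fin N → ℝ => Q.1 *ᵥ g := by
    ext1 g; exact hL g
  rw [h3, ← Measure.map_map (by fun_prop) hm] at h2
  have h4 := congrArg (Measure.map (WithLp.ofLp : EuclideanSpace ℝ (Fin N) → (Fin N → ℝ))) h2
  rw [Measure.map_map (by fun_prop) (by fun_prop)] at h4
  have h5 : Measure.map (WithLp.ofLp : EuclideanSpace ℝ (Fin N) → (Fin N → ℝ))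
      (Measure.map (WithLp.toLp 2) (Measure.pi fun _ => gaussianReal 0 1))
      = Measure.pi fun _ => gaussianReal 0 1 := by
    rw [Measure.map_map (by fun_prop) (by fun_prop)]
    exact Measure.map_id
  have h6 : (WithLp.ofLp : EuclideanSpace ℝ (Fin N) → (Fin N → ℝ)) ∘ WithLp.toLp 2 = id := rfl
  rw [h5, h6, Measure.map_id] at h4
  exact h4

/-! ### Second and fourth order moments of Haar orthogonal matrices -/

/-- Permutation matrices as elements of the orthogonal group. -/
theorem exists_orthGroup_perm {N : ℕ} (σ : Equiv.Perm (Fin N)) :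
    ∃ R : OrthGroup N, ∀ A : Matrix (Fin N) (Fin N) ℝ, ∀ i j, (R.1 * A) i j = A (σ i) j := by
  obtain ⟨R, hR⟩ := exists_orthGroup_col (Set.univ) (fun j => Pi.single (σ.symm j) (1 : ℝ)) (by
    intro i _ j _
    rw [dotProduct_single_one, Pi.single_apply]
    simp [eq_comm])
  refine ⟨R, fun A i j => ?_⟩
  have h : ∀ i k, R.1 i k = if i = σ.symm k then 1 else 0 := by
    intro i k
    have := congrFun (hR k (Set.mem_univ k)) i
    simpa [Pi.single_apply] using this
  simp [Matrix.mul_apply, h, Equiv.eq_symm_apply]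

/-- The coordinates of `Q w` are exchangeable under row swaps, and their squares always sum to `w ⬝ᵥ
w`. -/
theorem integral_mulVec_sq_haarOrth {N : ℕ} (w : Fin N → ℝ) (i : Fin N) :
    ∫ Q : OrthGroup N, (Q.1 *ᵥ w) i ^ 2 ∂(haarOrth N) = (w ⬝ᵥ w) / N := by
  have hsym : ∀ j, ∫ Q : OrthGroup N, (Q.1 *ᵥ w) j ^ 2 ∂(haarOrth N)
      = ∫ Q : OrthGroup N, (Q.1 *ᵥ w) i ^ 2 ∂(haarOrth N) := by
    intro j
    obtain ⟨R, hR⟩ := exists_orthGroup_perm (Equiv.swap i j)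
    have h := (measurePreserving_mul_left_haarOrth R).integral_comp'
      (f := MeasurableEquiv.mulLeft R) (fun Q : OrthGroup N => (Q.1 *ᵥ w) i ^ 2)
    rw [← h]
    refine integral_congr_ae (ae_of_all _ fun Q => ?_)
    simp [Matrix.mulVec, dotProduct, hR]
  have hsum : ∑ j, ∫ Q : OrthGroup N, (Q.1 *ᵥ w) j ^ 2 ∂(haarOrth N) = w ⬝ᵥ w := by
    have hi : ∀ j, Integrable (fun Q : OrthGroup N => (Q.1 *ᵥ w) j ^ 2) (haarOrth N) := fun j =>
      integrable_haarOrth_of_continuous ((OrthGroup.continuous_mulVec w j).pow 2)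
    rw [← integral_finsetSum _ fun j _ => hi j]
    have : ∀ Q : OrthGroup N, ∑ j, (Q.1 *ᵥ w) j ^ 2 = w ⬝ᵥ w := by
      intro Q
      rw [← Q.mulVec_dotProduct_mulVec]
      simp [dotProduct, sq]
    simp [this]
  have hN : (N : ℝ) ≠ 0 := by
    have := i.pos
    positivity
  simp_rw [hsym] at hsum
  simp only [Finset.sum_const, Finset.card_univ, Fintype.card_fin, nsmul_eq_mul] at hsum
  field_simp
  linarith

theorem Matrix.sum_sq_eq_trace {m n : Type*} [Fintype m] [Fintype n] (A : Matrix m n ℝ) :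
    ∑ i, ∑ j, A i j ^ 2 = (Aᵀ * A).trace := by
  simp only [Matrix.trace, Matrix.diag, Matrix.mul_apply, Matrix.transpose_apply, ← sq]
  exact Finset.sum_comm

theorem OrthGroup.sum_sq_mul {N : ℕ} (Q : OrthGroup N) (A : Matrix (Fin N) (Fin N) ℝ) :
    ∑ i, ∑ j, (Q.1 * A) i j ^ 2 = ∑ i, ∑ j, A i j ^ 2 := by
  rw [Matrix.sum_sq_eq_trace, Matrix.sum_sq_eq_trace, Matrix.transpose_mul, Matrix.mul_assoc,
    ← Matrix.mul_assoc Q.1ᵀ, Q.transpose_mul_self, Matrix.one_mul]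

theorem OrthGroup.sum_sq_mul_transpose {N : ℕ} (Q : OrthGroup N) (A : Matrix (Fin N) (Fin N) ℝ) :
    ∑ i, ∑ j, (A * Q.1ᵀ) i j ^ 2 = ∑ i, ∑ j, A i j ^ 2 := by
  have h := Q.sum_sq_mul Aᵀ
  have e : ∀ i j, (A * Q.1ᵀ) i j = (Q.1 * Aᵀ) j i := fun i j => by
    rw [← Matrix.transpose_apply (Q.1 * Aᵀ), Matrix.transpose_mul, Matrix.transpose_transpose]
  simp_rw [e]
  rw [Finset.sum_comm, h, Finset.sum_comm]
  rfl

theorem OrthGroup.continuous_conj {N : ℕ} (M : Matrix (Fin N) (Fin N) ℝ) (i j : Fin N) :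
    Continuous fun Q : OrthGroup N => (Q.1 * M * Q.1ᵀ) i j := by
  have : Continuous fun Q : OrthGroup N => Q.1 * M * Q.1ᵀ :=
    (continuous_subtype_val.matrix_mul continuous_const).matrix_mul
      continuous_subtype_val.matrix_transpose
  exact (continuous_apply_apply i j).comp this

theorem exists_perm_of_ne {α : Type*} [DecidableEq α] {i j k l : α} (hij : i ≠ j) (hkl : k ≠ l) :
    ∃ σ : Equiv.Perm α, σ i = k ∧ σ j = l := by
  refine ⟨Equiv.swap (Equiv.swap i k j) l * Equiv.swap i k, ?_, ?_⟩
  · have h1 : k ≠ Equiv.swap i k j := by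
      intro h
      have := congrArg (Equiv.swap i k) h
      rw [Equiv.swap_apply_right, Equiv.swap_apply_self] at this
      exact hij this
    simp [Equiv.swap_apply_of_ne_of_ne h1 hkl]
  · simp

theorem integral_conj_comp_mul_left_haarOrth {N : ℕ} (R : OrthGroup N) (F : OrthGroup N → ℝ) :
    ∫ Q, F (R * Q) ∂(haarOrth N) = ∫ Q, F Q ∂(haarOrth N) :=
  (measurePreserving_mul_left_haarOrth R).integral_comp' (f := MeasurableEquiv.mulLeft R) F

/-- Permutations act transitively on ordered pairs of distinct indices, so all `N (N - 1)`
off-diagonal entries have the same second moment; together they are at most the Frobenius norm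
squared, which conjugation preserves. -/
theorem integral_conj_offDiag_sq_le {N : ℕ} (M : Matrix (Fin N) (Fin N) ℝ) {i j : Fin N}
    (hij : i ≠ j) :
    N * (N - 1) * ∫ Q : OrthGroup N, (Q.1 * M * Q.1ᵀ) i j ^ 2 ∂(haarOrth N)
      ≤ ∑ k, ∑ l, M k l ^ 2 := by
  have hi : ∀ k l, Integrable (fun Q : OrthGroup N => (Q.1 * M * Q.1ᵀ) k l ^ 2) (haarOrth N) :=
    fun k l => integrable_haarOrth_of_continuous ((OrthGroup.continuous_conj M k l).pow 2)
  have hsym : ∀ k l, k ≠ l → ∫ Q : OrthGroup N, (Q.1 * M * Q.1ᵀ) k l ^ 2 ∂(haarOrth N)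
      = ∫ Q : OrthGroup N, (Q.1 * M * Q.1ᵀ) i j ^ 2 ∂(haarOrth N) := by
    intro k l hkl
    obtain ⟨σ, hσi, hσj⟩ := exists_perm_of_ne hij hkl
    obtain ⟨R, hR⟩ := exists_orthGroup_perm σ
    rw [← integral_conj_comp_mul_left_haarOrth R fun Q => (Q.1 * M * Q.1ᵀ) i j ^ 2]
    refine integral_congr_ae (ae_of_all _ fun Q => ?_)
    have h : ((R * Q).1 * M * (R * Q).1ᵀ) i j = (Q.1 * M * Q.1ᵀ) k l := by
      have e1 : (R * Q).1 * M * (R * Q).1ᵀ = R.1 * (Q.1 * M * (R.1 * Q.1)ᵀ) := by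
        simp [Matrix.mul_assoc]
      rw [e1, hR, Matrix.mul_apply, Matrix.mul_apply]
      refine Finset.sum_congr rfl fun c _ => ?_
      rw [Matrix.transpose_apply, hR, hσi, hσj, Matrix.transpose_apply]
    simp only [h]
  have hsum : ∑ k, ∑ l, ∫ Q : OrthGroup N, (Q.1 * M * Q.1ᵀ) k l ^ 2 ∂(haarOrth N)
      = ∑ k, ∑ l, M k l ^ 2 := by
    simp_rw [← integral_finsetSum _ fun l _ => hi _ l]
    rw [← integral_finsetSum _ fun k _ => integrable_finsetSum _ fun l _ => hi k l]
    have : ∀ Q : OrthGroup N, ∑ k, ∑ l, (Q.1 * M * Q.1ᵀ) k l ^ 2 = ∑ k, ∑ l, M k l ^ 2 := by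
      intro Q
      rw [Q.sum_sq_mul_transpose, Q.sum_sq_mul]
    simp [this]
  rw [← hsum]
  set I := ∫ Q : OrthGroup N, (Q.1 * M * Q.1ᵀ) i j ^ 2 ∂(haarOrth N)
  have hrow : ∀ k, ((N : ℝ) - 1) * I
      ≤ ∑ l, ∫ Q : OrthGroup N, (Q.1 * M * Q.1ᵀ) k l ^ 2 ∂(haarOrth N) := by
    intro k
    rw [← Finset.add_sum_erase _ _ (Finset.mem_univ k)]
    have h1 : ∑ l ∈ Finset.univ.erase k, ∫ Q : OrthGroup N, (Q.1 * M * Q.1ᵀ) k l ^ 2 ∂(haarOrth N)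
        = ((N : ℝ) - 1) * I := by
      rw [Finset.sum_congr rfl fun l hl => hsym k l (Finset.ne_of_mem_erase hl).symm]
      have := k.pos
      simp [Finset.card_erase_of_mem, Nat.cast_sub (Nat.succ_le_of_lt this)]
    rw [h1]
    have : 0 ≤ ∫ Q : OrthGroup N, (Q.1 * M * Q.1ᵀ) k k ^ 2 ∂(haarOrth N) :=
      integral_nonneg fun Q => sq_nonneg _
    linarith
  calc (N : ℝ) * (N - 1) * I = ∑ k : Fin N, ((N : ℝ) - 1) * I := by simp; ring
    _ ≤ _ := Finset.sum_le_sum fun k _ => hrow k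

/-- A rotation by 45 degrees in the plane of `i` and `j` moves differences of diagonal entries off
the diagonal, where second moments are already known. -/
theorem exists_orthGroup_conj_eq {N : ℕ} {i j : Fin N} (hij : i ≠ j) :
    ∃ R : OrthGroup N, ∀ X : Matrix (Fin N) (Fin N) ℝ,
      (R.1 * X * R.1ᵀ) i j = 1 / 2 * (X i i - X i j + X j i - X j j) := by
  have h2 : (√2)⁻¹ * (√2)⁻¹ = (1 / 2 : ℝ) := by
    rw [← mul_inv, Real.mul_self_sqrt (by norm_num)]; norm_num
  obtain ⟨R, hRi, hRj⟩ := exists_orthGroup_pair hij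
    (f := (√2)⁻¹ • (Pi.single i 1 + Pi.single j 1)) (g := (√2)⁻¹ • (Pi.single i 1 - Pi.single j 1))
    (by simp [hij, hij.symm]; linarith) (by simp [hij, hij.symm]; linarith)
    (by simp [hij, hij.symm])
  refine ⟨R⁻¹, fun X => ?_⟩
  have e0 : (R⁻¹).1 = R.1ᵀ := rfl
  have e2 : (R.1ᵀ * X * R.1) i j = (R.1 *ᵥ Pi.single i 1) ⬝ᵥ (X *ᵥ (R.1 *ᵥ Pi.single j 1)) := by
    rw [Matrix.mulVec_mulVec, Matrix.mul_assoc, Matrix.mul_apply]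
    simp [dotProduct]
  rw [e0, Matrix.transpose_transpose, e2, hRi, hRj]
  simp only [Matrix.mulVec_smul, smul_dotProduct, dotProduct_smul, smul_eq_mul,
    Matrix.mulVec_sub, add_dotProduct, dotProduct_sub, single_one_dotProduct,
    Matrix.mulVec_single_one, Matrix.col_apply]
  linear_combination (X i i + X j i - X i j - X j j) * h2

theorem integral_sq_le_of_eq_two_mul_add_sub {Ω : Type*} [MeasurableSpace Ω] {μ : Measure Ω}
    {d y p q : Ω → ℝ} (hd : Integrable (fun ω => d ω ^ 2) μ)
    (hy : Integrable (fun ω => y ω ^ 2) μ) (hp : Integrable (fun ω => p ω ^ 2) μ)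
    (hq : Integrable (fun ω => q ω ^ 2) μ) (h : ∀ ω, d ω = 2 * y ω + p ω - q ω) :
    ∫ ω, d ω ^ 2 ∂μ
      ≤ 12 * ∫ ω, y ω ^ 2 ∂μ + 3 * ∫ ω, p ω ^ 2 ∂μ + 3 * ∫ ω, q ω ^ 2 ∂μ := by
  have a1 := hy.const_mul 12
  have a2 := hp.const_mul 3
  have a3 := hq.const_mul 3
  have a12 : Integrable (fun ω => 12 * y ω ^ 2 + 3 * p ω ^ 2) μ := a1.add a2
  rw [← integral_const_mul, ← integral_const_mul, ← integral_const_mul, ← integral_add a1 a2,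
    ← integral_add a12 a3]
  refine integral_mono hd (a12.add a3) fun ω => ?_
  simp only [h ω]
  nlinarith [sq_nonneg (2 * y ω - p ω), sq_nonneg (2 * y ω + q ω), sq_nonneg (p ω + q ω)]

/-- With `X` the conjugated matrix and `Y` its 45 degree rotation, `X i i - X j j = 2 Y i j + X i j
- X j i`, and `Y` has the law of `X` by left invariance. Hence only off-diagonal moments enter, with
constant `18 = 12 + 3 + 3`. -/
theorem integral_conj_diag_sub_sq_le {N : ℕ} (M : Matrix (Fin N) (Fin N) ℝ) {i j : Fin N}
    (hij : i ≠ j) :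
    N * (N - 1) * ∫ Q : OrthGroup N, ((Q.1 * M * Q.1ᵀ) i i - (Q.1 * M * Q.1ᵀ) j j) ^ 2 ∂(haarOrth N)
      ≤ 18 * ∑ k, ∑ l, M k l ^ 2 := by
  have h3 := integral_conj_offDiag_sq_le M hij
  have h4 := integral_conj_offDiag_sq_le M hij.symm
  obtain ⟨R, hR⟩ := exists_orthGroup_conj_eq hij
  have hi : ∀ k l, Integrable (fun Q : OrthGroup N => (Q.1 * M * Q.1ᵀ) k l ^ 2) (haarOrth N) :=
    fun k l => integrable_haarOrth_of_continuous ((OrthGroup.continuous_conj M k l).pow 2)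
  have hle := integral_sq_le_of_eq_two_mul_add_sub (μ := haarOrth N)
    (d := fun Q : OrthGroup N => (Q.1 * M * Q.1ᵀ) i i - (Q.1 * M * Q.1ᵀ) j j)
    (y := fun Q : OrthGroup N => (R.1 * (Q.1 * M * Q.1ᵀ) * R.1ᵀ) i j)
    (p := fun Q : OrthGroup N => (Q.1 * M * Q.1ᵀ) i j)
    (q := fun Q : OrthGroup N => (Q.1 * M * Q.1ᵀ) j i)
    (integrable_haarOrth_of_continuous
      (((OrthGroup.continuous_conj M i i).sub (OrthGroup.continuous_conj M j j)).pow 2))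
    (by
      simp_rw [hR]
      exact integrable_haarOrth_of_continuous ((continuous_const.mul
        ((((OrthGroup.continuous_conj M i i).sub (OrthGroup.continuous_conj M i j)).add
          (OrthGroup.continuous_conj M j i)).sub (OrthGroup.continuous_conj M j j))).pow 2))
    (hi i j) (hi j i) (fun Q => by rw [hR]; ring)
  have hYeq : ∫ Q : OrthGroup N, (R.1 * (Q.1 * M * Q.1ᵀ) * R.1ᵀ) i j ^ 2 ∂(haarOrth N)
      = ∫ Q : OrthGroup N, (Q.1 * M * Q.1ᵀ) i j ^ 2 ∂(haarOrth N) := by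
    rw [← integral_conj_comp_mul_left_haarOrth R fun Q => (Q.1 * M * Q.1ᵀ) i j ^ 2]
    refine integral_congr_ae (ae_of_all _ fun Q => ?_)
    have e0 : (R * Q).1 = R.1 * Q.1 := rfl
    simp only [e0, Matrix.transpose_mul, Matrix.mul_assoc]
  rw [hYeq] at hle
  have hN : (0 : ℝ) ≤ N * (N - 1) := by
    have : (1 : ℝ) ≤ N := by exact_mod_cast i.pos
    exact mul_nonneg (by positivity) (by linarith)
  have h5 := mul_le_mul_of_nonneg_left hle hN
  linarith

/-- The quadratic form `N qᵢᵀ M qⱼ` of two rows of a Haar orthogonal matrix concentrates around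
`δᵢⱼ tr M`. -/
theorem integral_conj_sub_trace_sq_le {N : ℕ} (M : Matrix (Fin N) (Fin N) ℝ) (i j : Fin N) :
    ∫ Q : OrthGroup N, (N * (Q.1 * M * Q.1ᵀ) i j - if i = j then M.trace else 0) ^ 2 ∂(haarOrth N)
      ≤ 36 * ∑ k, ∑ l, M k l ^ 2 := by
  set F := ∑ k, ∑ l, M k l ^ 2
  have hF : 0 ≤ F := Finset.sum_nonneg fun _ _ => Finset.sum_nonneg fun _ _ => sq_nonneg _
  have hN1 : (1 : ℝ) ≤ N := by exact_mod_cast i.pos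
  have hN2 : ∀ {k l : Fin N}, k ≠ l → (2 : ℝ) ≤ N := by
    intro k l hkl
    have : 2 ≤ N := by
      have h1 := k.isLt
      have h2 := l.isLt
      have h3 : k.1 ≠ l.1 := fun h => hkl (Fin.ext h)
      omega
    exact_mod_cast this
  rcases eq_or_ne i j with rfl | hij
  · simp only [if_true]
    have htr : ∀ Q : OrthGroup N, M.trace = ∑ k, (Q.1 * M * Q.1ᵀ) k k := by
      intro Q
      change _ = (Q.1 * M * Q.1ᵀ).trace
      rw [Matrix.trace_mul_comm, ← Matrix.mul_assoc, Q.transpose_mul_self, Matrix.one_mul]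
    -- The trace is invariant, so the deviation of `N` times one diagonal entry is the sum of its
    -- differences to all diagonal entries. Cauchy-Schwarz costs a factor `N`, each difference gains
    -- `1 / (N (N - 1))`, and `N ^ 2 ≤ 2 N (N - 1)` doubles `18` to `36`.
    have hpt : ∀ Q : OrthGroup N, (N * (Q.1 * M * Q.1ᵀ) i i - M.trace) ^ 2
        ≤ N * ∑ k, ((Q.1 * M * Q.1ᵀ) i i - (Q.1 * M * Q.1ᵀ) k k) ^ 2 := by
      intro Q
      have h1 : N * (Q.1 * M * Q.1ᵀ) i i - M.trace
          = ∑ k, ((Q.1 * M * Q.1ᵀ) i i - (Q.1 * M * Q.1ᵀ) k k) := by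
        rw [htr Q]; simp
      rw [h1]
      simpa using sq_sum_le_card_mul_sum_sq (s := Finset.univ)
        (f := fun k => (Q.1 * M * Q.1ᵀ) i i - (Q.1 * M * Q.1ᵀ) k k)
    have hi : ∀ k, Integrable (fun Q : OrthGroup N =>
        ((Q.1 * M * Q.1ᵀ) i i - (Q.1 * M * Q.1ᵀ) k k) ^ 2) (haarOrth N) := fun k =>
      integrable_haarOrth_of_continuous
        (((OrthGroup.continuous_conj M i i).sub (OrthGroup.continuous_conj M k k)).pow 2)
    have hle : ∀ k, N * N * ∫ Q : OrthGroup N,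
        ((Q.1 * M * Q.1ᵀ) i i - (Q.1 * M * Q.1ᵀ) k k) ^ 2 ∂(haarOrth N) ≤ 36 * F := by
      intro k
      rcases eq_or_ne i k with rfl | hik
      · simpa using hF
      · have h1 := integral_conj_diag_sub_sq_le M hik
        have h2 := hN2 hik
        have h3 : 0 ≤ ∫ Q : OrthGroup N,
          ((Q.1 * M * Q.1ᵀ) i i - (Q.1 * M * Q.1ᵀ) k k) ^ 2 ∂(haarOrth N) :=
          integral_nonneg fun _ => sq_nonneg _
        have h4 : (N : ℝ) * N ≤ 2 * (N * (N - 1)) := by nlinarith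
        nlinarith [mul_le_mul_of_nonneg_right h4 h3]
    refine (integral_mono (integrable_haarOrth_of_continuous
      (((continuous_const.mul (OrthGroup.continuous_conj M i i)).sub continuous_const).pow 2))
      ((integrable_finsetSum _ fun k _ => hi k).const_mul _) hpt).trans ?_
    rw [integral_const_mul, integral_finsetSum _ fun k _ => hi k]
    have hsum := Finset.sum_le_sum fun k (_ : k ∈ Finset.univ) => hle k
    rw [← Finset.mul_sum] at hsum
    simp only [Finset.sum_const, Finset.card_univ, Fintype.card_fin, nsmul_eq_mul] at hsum
    have hNpos : (0 : ℝ) < N := by linarith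
    refine le_of_mul_le_mul_left ?_ hNpos
    linarith
  · simp only [hij, if_false, sub_zero, mul_pow]
    rw [integral_const_mul]
    have h1 := integral_conj_offDiag_sq_le M hij
    have h2 := hN2 hij
    have h3 : 0 ≤ ∫ Q : OrthGroup N, (Q.1 * M * Q.1ᵀ) i j ^ 2 ∂(haarOrth N) :=
      integral_nonneg fun _ => sq_nonneg _
    have h4 : (N : ℝ) ^ 2 ≤ 2 * (N * (N - 1)) := by nlinarith
    nlinarith [mul_le_mul_of_nonneg_right h4 h3]

/-! ### Gaussian vectors in the plane -/

theorem posSemidef_gram_pair {ι : Type*} [Fintype ι] (A B : ι → ℝ) :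
    Matrix.PosSemidef !![A ⬝ᵥ A, A ⬝ᵥ B; A ⬝ᵥ B, B ⬝ᵥ B] := by
  have h := Matrix.posSemidef_conjTranspose_mul_self (R := ℝ)
    (Matrix.of fun (k : ι) (i : Fin 2) => (![A, B] i) k)
  convert h using 1
  ext i j
  fin_cases i <;> fin_cases j <;> simp [Matrix.mul_apply, dotProduct, mul_comm]

theorem measurable_linear_pair {ι : Type*} [Fintype ι] (A B : ι → ℝ) :
    Measurable fun z : ι → ℝ => (WithLp.toLp 2 ![A ⬝ᵥ z, B ⬝ᵥ z] : EuclideanSpace ℝ (Fin 2)) := by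
  refine (WithLp.measurable_toLp 2 _).comp (measurable_pi_lambda _ fun i => ?_)
  fin_cases i <;> simp [dotProduct] <;> fun_prop

/-- The image of the standard Gaussian measure under a pair of linear forms. -/
theorem map_pi_gaussian_linear_pair {ι : Type*} [Fintype ι] (A B : ι → ℝ) :
    (Measure.pi fun _ : ι => gaussianReal 0 1).map
      (fun z => (WithLp.toLp 2 ![A ⬝ᵥ z, B ⬝ᵥ z] : EuclideanSpace ℝ (Fin 2)))
      = multivariateGaussian 0 !![A ⬝ᵥ A, A ⬝ᵥ B; A ⬝ᵥ B, B ⬝ᵥ B] := by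
  have hm := measurable_linear_pair A B
  have hprob : IsProbabilityMeasure ((Measure.pi fun _ : ι => gaussianReal 0 1).map
      (fun z => (WithLp.toLp 2 ![A ⬝ᵥ z, B ⬝ᵥ z] : EuclideanSpace ℝ (Fin 2)))) :=
    Measure.isProbabilityMeasure_map hm.aemeasurable
  apply Measure.ext_of_charFun
  ext t
  rw [charFun_multivariateGaussian (posSemidef_gram_pair A B), charFun_apply,
    integral_map hm.aemeasurable (by fun_prop)]
  -- The characteristic function of the pair at `t` is that of the standard Gaussian at `t 0 • A + t
  -- 1 • B`, whose squared norm is the Gram form at `t`.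
  have h2 := charFun_stdGaussian (E := EuclideanSpace ℝ ι) (WithLp.toLp 2 (t 0 • A + t 1 • B))
  rw [← map_pi_eq_stdGaussian, charFun_apply, integral_map (by fun_prop) (by fun_prop)] at h2
  have e1 : ∀ z : ι → ℝ, inner ℝ (WithLp.toLp 2 ![A ⬝ᵥ z, B ⬝ᵥ z] : EuclideanSpace ℝ (Fin 2)) t
      = inner ℝ (WithLp.toLp 2 z : EuclideanSpace ℝ ι) (WithLp.toLp 2 (t 0 • A + t 1 • B)) := by
    intro z
    rw [EuclideanSpace.inner_eq_star_dotProduct, EuclideanSpace.inner_eq_star_dotProduct]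
    simp [dotProduct, Fin.sum_univ_two, Finset.mul_sum, add_mul, Finset.sum_add_distrib, mul_assoc]
  simp_rw [e1]
  rw [h2, ← Complex.ofReal_pow, EuclideanSpace.real_norm_sq_eq]
  congr 1
  simp only [inner_zero_right, Complex.ofReal_zero, zero_mul, zero_sub]
  rw [neg_div]
  congr 2
  norm_cast
  simp only [dotProduct, Matrix.mulVec, Fin.sum_univ_two, Matrix.of_apply, Matrix.cons_val',
    Matrix.cons_val_zero, Matrix.cons_val_one, Matrix.cons_val_fin_one, Pi.add_apply, Pi.smul_apply,
    smul_eq_mul, Finset.sum_mul, Finset.mul_sum, ← Finset.sum_add_distrib]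
  exact Finset.sum_congr rfl fun i _ => by ring

/-- The triangular (Cholesky) factor of a positive semidefinite matrix of size two. For `a = 0` the
hypothesis forces `c = 0`. -/
theorem exists_gram_factor {a c b : ℝ} (ha : 0 ≤ a) (hb : 0 ≤ b) (hc : c ^ 2 ≤ a * b) :
    ∃ p q r : ℝ, p ^ 2 = a ∧ p * q = c ∧ q ^ 2 + r ^ 2 = b := by
  rcases ha.eq_or_lt with rfl | ha
  · refine ⟨0, 0, √b, by simp, ?_, by simp [Real.sq_sqrt hb]⟩
    have : c ^ 2 ≤ 0 := by simpa using hc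
    have : c = 0 := by nlinarith [sq_nonneg c]
    simp [this]
  · have hs : 0 < √a := Real.sqrt_pos.mpr ha
    have hq : (c / √a) ^ 2 ≤ b := by
      rw [div_pow, Real.sq_sqrt ha.le, div_le_iff₀ ha]; linarith
    refine ⟨√a, c / √a, √(b - (c / √a) ^ 2), Real.sq_sqrt ha.le, ?_, ?_⟩
    · field_simp
    · rw [Real.sq_sqrt (by linarith)]; ring

/-- The expectation of a function of a centred Gaussian vector in the plane. -/
noncomputable def gaussPair (Ψ : ℝ → ℝ → ℝ) (a c b : ℝ) : ℝ :=
  ∫ z, Ψ (z 0) (z 1) ∂(multivariateGaussian (0 : EuclideanSpace ℝ (Fin 2)) !![a, c; c, b])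

theorem gaussProd_eq_gaussPair (g : ℝ → ℝ) (a c b : ℝ) :
    gaussProd g a c b = gaussPair (fun u v => g u * g v) a c b := rfl

/-- Only the Gram matrix of the two linear forms matters. The Gaussian expectation can thus be
realised in the plane, for continuity arguments, or on the weight row of a neuron, for the law of
large numbers. -/
theorem gaussPair_gram {ι : Type*} [Fintype ι] (A B : ι → ℝ) {Ψ : ℝ → ℝ → ℝ}
    (hΨ : Measurable (Function.uncurry Ψ)) :
    gaussPair Ψ (A ⬝ᵥ A) (A ⬝ᵥ B) (B ⬝ᵥ B)
      = ∫ z, Ψ (A ⬝ᵥ z) (B ⬝ᵥ z) ∂(Measure.pi fun _ : ι => gaussianReal 0 1) := by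
  have hm : Measurable fun z : EuclideanSpace ℝ (Fin 2) => Ψ (z 0) (z 1) := by
    have h2 : Measurable fun z : EuclideanSpace ℝ (Fin 2) => (z 0, z 1) := by fun_prop
    exact hΨ.comp h2
  rw [gaussPair, ← map_pi_gaussian_linear_pair,
    integral_map (measurable_linear_pair A B).aemeasurable hm.aestronglyMeasurable]
  simp

theorem gaussPair_factor (p q r : ℝ) {Ψ : ℝ → ℝ → ℝ} (hΨ : Measurable (Function.uncurry Ψ)) :
    gaussPair Ψ (p ^ 2) (p * q) (q ^ 2 + r ^ 2)
      = ∫ z : Fin 2 → ℝ, Ψ (p * z 0) (q * z 0 + r * z 1)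
        ∂(Measure.pi fun _ : Fin 2 => gaussianReal 0 1) := by
  have := gaussPair_gram ![p, 0] ![q, r] hΨ
  simpa [dotProduct, Fin.sum_univ_two, ← sq] using this

theorem measurePreserving_dotProduct_gaussian {ι : Type*} [Fintype ι] (A : ι → ℝ) :
    MeasurePreserving (fun z : ι → ℝ => A ⬝ᵥ z) (Measure.pi fun _ : ι => gaussianReal 0 1)
      (gaussianReal 0 (A ⬝ᵥ A).toNNReal) := by
  have h1 : MeasurePreserving
      (fun z => (WithLp.toLp 2 ![A ⬝ᵥ z, A ⬝ᵥ z] : EuclideanSpace ℝ (Fin 2)))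
      (Measure.pi fun _ : ι => gaussianReal 0 1) _ :=
    ⟨measurable_linear_pair A A, map_pi_gaussian_linear_pair A A⟩
  have h2 := (measurePreserving_eval_multivariateGaussian (μ := 0)
    (posSemidef_gram_pair A A) (i := 0)).comp h1
  simpa [Function.comp_def] using h2

theorem memLp_dotProduct_gaussian {ι : Type*} [Fintype ι] (A : ι → ℝ) (p : ℝ≥0) :
    MemLp (fun z : ι → ℝ => A ⬝ᵥ z) p (Measure.pi fun _ : ι => gaussianReal 0 1) :=
  (memLp_id_gaussianReal p).comp_measurePreserving (measurePreserving_dotProduct_gaussian A)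

theorem integral_dotProduct_sq_gaussian {ι : Type*} [Fintype ι] (A : ι → ℝ) :
    ∫ z : ι → ℝ, (A ⬝ᵥ z) ^ 2 ∂(Measure.pi fun _ : ι => gaussianReal 0 1) = A ⬝ᵥ A := by
  have hnn : 0 ≤ A ⬝ᵥ A := by
    simp only [dotProduct, ← sq]; exact Finset.sum_nonneg fun _ _ => sq_nonneg _
  have h := (measurePreserving_dotProduct_gaussian A)
  have h1 : ∫ y, y ^ 2 ∂(gaussianReal 0 (A ⬝ᵥ A).toNNReal) = A ⬝ᵥ A := by
    have := variance_id_gaussianReal (μ := 0) (v := (A ⬝ᵥ A).toNNReal)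
    rw [variance_eq_sub (memLp_id_gaussianReal 2)] at this
    simpa [hnn] using this
  rw [← h1, ← h.map_eq, integral_map h.measurable.aemeasurable (by fun_prop)]

/-- The fourth moment of the standard Gaussian distribution. -/
noncomputable def gaussFourth : ℝ := ∫ y, y ^ 4 ∂(gaussianReal 0 1)

theorem gaussFourth_nonneg : 0 ≤ gaussFourth := integral_nonneg fun _ => by positivity

theorem integral_dotProduct_pow_four_gaussian {ι : Type*} [Fintype ι] (A : ι → ℝ) :
    ∫ z : ι → ℝ, (A ⬝ᵥ z) ^ 4 ∂(Measure.pi fun _ : ι => gaussianReal 0 1)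
      = (A ⬝ᵥ A) ^ 2 * gaussFourth := by
  have hnn : 0 ≤ A ⬝ᵥ A := by
    simp only [dotProduct, ← sq]; exact Finset.sum_nonneg fun _ _ => sq_nonneg _
  have h := (measurePreserving_dotProduct_gaussian A)
  have h1 : gaussianReal 0 (A ⬝ᵥ A).toNNReal = (gaussianReal 0 1).map (√(A ⬝ᵥ A) * ·) := by
    rw [gaussianReal_map_const_mul]
    congr 1
    · simp
    · ext; simp [hnn, Real.sq_sqrt]
  have h2 : ∫ y, y ^ 4 ∂(gaussianReal 0 (A ⬝ᵥ A).toNNReal) = (A ⬝ᵥ A) ^ 2 * gaussFourth := by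
    rw [h1, integral_map (by fun_prop) (by fun_prop), gaussFourth, ← integral_const_mul]
    congr 1
    ext y
    rw [mul_pow]
    congr 1
    rw [show (4 : ℕ) = 2 * 2 from rfl, pow_mul, Real.sq_sqrt hnn]
  rw [← h2, ← h.map_eq, integral_map h.measurable.aemeasurable (by fun_prop)]

theorem integrable_dotProduct_pow_gaussian {ι : Type*} [Fintype ι] (A : ι → ℝ) (k : ℕ)
    (hk : Even k) :
    Integrable (fun z : ι → ℝ => (A ⬝ᵥ z) ^ k) (Measure.pi fun _ : ι => gaussianReal 0 1) := by
  have h := (memLp_dotProduct_gaussian A k).integrable_norm_pow'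
  simpa [hk.pow_abs] using h

/-! ### Test functions of quadratic growth -/

/-- Functions of two variables which are controlled by second moments: the oscillation between two
points is estimated by a small multiple of the squared norms of the points, and a large multiple of
their squared distance. -/
structure QuadTame (Ψ : ℝ → ℝ → ℝ) : Prop where
  measurable : Measurable (Function.uncurry Ψ)
  est : ∀ ε : ℝ, 0 < ε → ∃ C : ℝ, 0 ≤ C ∧ ∀ x y x' y' : ℝ, |Ψ x y - Ψ x' y'|
    ≤ ε * (1 + x ^ 2 + y ^ 2 + x' ^ 2 + y' ^ 2) + C * ((x - x') ^ 2 + (y - y') ^ 2)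

theorem LipschitzWith.abs_sub_le_real {K : ℝ≥0} {g : ℝ → ℝ} (hg : LipschitzWith K g) (x y : ℝ) :
    |g x - g y| ≤ K * |x - y| := by
  simpa [Real.dist_eq] using hg.dist_le_mul x y

/-- Change one factor at a time: each change is Lipschitz, the other factor has linear growth, and
Young's inequality puts the small weight on the growth and the large one on the distance. -/
theorem quadTame_mul_of_lipschitz {K : ℝ≥0} {g : ℝ → ℝ} (hg : LipschitzWith K g) :
    QuadTame fun u v => g u * g v := by
  refine ⟨by
    have := hg.continuous.measurable
    exact (this.comp measurable_fst).mul (this.comp measurable_snd), fun ε hε => ?_⟩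
  set A := |g 0|
  have hgr : ∀ x, g x ^ 2 ≤ 2 * (A ^ 2 + K ^ 2) * (1 + x ^ 2) := by
    intro x
    have h := hg.abs_sub_le_real x 0
    rw [sub_zero] at h
    have h1 : |g x| ≤ A + K * |x| := by
      have := abs_sub_abs_le_abs_sub (g x) (g 0)
      linarith
    rw [← sq_abs]
    have h2 : |g x| ^ 2 ≤ (A + K * |x|) ^ 2 := pow_le_pow_left₀ (abs_nonneg _) h1 2
    have h3 : |x| ^ 2 = x ^ 2 := sq_abs x
    nlinarith [sq_nonneg (A - K * |x|), mul_nonneg (sq_nonneg A) (sq_nonneg x), sq_nonneg (K : ℝ)]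
  set D := 2 * (A ^ 2 + (K : ℝ) ^ 2) + 1
  have hD : 0 < D := by positivity
  have hgr' : ∀ x, g x ^ 2 ≤ D * (1 + x ^ 2) := fun x => (hgr x).trans (by
    gcongr
    simp [D])
  refine ⟨D * K ^ 2 / ε, by positivity, fun x y x' y' => ?_⟩
  have hx := hg.abs_sub_le_real x x'
  have hy := hg.abs_sub_le_real y y'
  -- The weight `ε / (2 D)` cancels the growth constant `D`; the product of the two weights is `1 /
  -- 2`, more than the `1 / 4` which Young's inequality requires.
  have young : ∀ d t : ℝ, |d| * |t| ≤ ε / (2 * D) * t ^ 2 + D / ε * d ^ 2 := by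
    intro d t
    rw [← sq_abs d, ← sq_abs t]
    have h1 : 0 ≤ (√(ε / (2 * D)) * |t| - √(D / ε) * |d|) ^ 2 := sq_nonneg _
    have h2 : √(ε / (2 * D)) ^ 2 = ε / (2 * D) := Real.sq_sqrt (by positivity)
    have h3 : √(D / ε) ^ 2 = D / ε := Real.sq_sqrt (by positivity)
    have h4 : √(ε / (2 * D)) * √(D / ε) = √(1 / 2) := by
      rw [← Real.sqrt_mul (by positivity)]
      congr 1
      field_simp
    have h5 : (1 / 2 : ℝ) ≤ √(1 / 2) := by
      apply Real.le_sqrt_of_sq_le; norm_num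
    have h6 : 0 ≤ |d| * |t| := by positivity
    nlinarith
  have e : g x * g y - g x' * g y' = (g x - g x') * g y + (g y - g y') * g x' := by ring
  rw [e]
  refine (abs_add_le _ _).trans ?_
  rw [abs_mul, abs_mul]
  have b1 := young (g x - g x') (g y)
  have b2 := young (g y - g y') (g x')
  have c1 : (g x - g x') ^ 2 ≤ K ^ 2 * (x - x') ^ 2 := by
    rw [← sq_abs, ← sq_abs (x - x'), ← mul_pow]
    exact pow_le_pow_left₀ (abs_nonneg _) hx 2
  have c2 : (g y - g y') ^ 2 ≤ K ^ 2 * (y - y') ^ 2 := by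
    rw [← sq_abs, ← sq_abs (y - y'), ← mul_pow]
    exact pow_le_pow_left₀ (abs_nonneg _) hy 2
  have d1 := mul_le_mul_of_nonneg_left (hgr' y) (by positivity : 0 ≤ ε / (2 * D))
  have d2 := mul_le_mul_of_nonneg_left (hgr' x') (by positivity : 0 ≤ ε / (2 * D))
  have d3 := mul_le_mul_of_nonneg_left c1 (by positivity : 0 ≤ D / ε)
  have d4 := mul_le_mul_of_nonneg_left c2 (by positivity : 0 ≤ D / ε)
  have s1 : ε / (2 * D) * (D * (1 + y ^ 2)) = ε / 2 * (1 + y ^ 2) := by field_simp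
  have s2 : ε / (2 * D) * (D * (1 + x' ^ 2)) = ε / 2 * (1 + x' ^ 2) := by field_simp
  have s3 : D / ε * (K ^ 2 * (x - x') ^ 2) = D * K ^ 2 / ε * (x - x') ^ 2 := by ring
  have s4 : D / ε * (K ^ 2 * (y - y') ^ 2) = D * K ^ 2 / ε * (y - y') ^ 2 := by ring
  nlinarith [mul_nonneg hε.le (sq_nonneg x), mul_nonneg hε.le (sq_nonneg y),
    mul_nonneg hε.le (sq_nonneg x'), mul_nonneg hε.le (sq_nonneg y')]

theorem QuadTame.exists_growth {Ψ : ℝ → ℝ → ℝ} (hΨ : QuadTame Ψ) :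
    ∃ C : ℝ, 0 ≤ C ∧ ∀ x y, |Ψ x y| ≤ C * (1 + x ^ 2 + y ^ 2) := by
  obtain ⟨C, hC, h⟩ := hΨ.est 1 one_pos
  refine ⟨1 + C + |Ψ 0 0|, by positivity, fun x y => ?_⟩
  have h1 := h x y 0 0
  have h2 := abs_sub_abs_le_abs_sub (Ψ x y) (Ψ 0 0)
  simp only [sub_zero] at h1
  nlinarith [abs_nonneg (Ψ 0 0), mul_nonneg (abs_nonneg (Ψ 0 0)) (sq_nonneg x),
    mul_nonneg (abs_nonneg (Ψ 0 0)) (sq_nonneg y)]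

theorem QuadTame.memLp {Ψ : ℝ → ℝ → ℝ} (hΨ : QuadTame Ψ) {ι : Type*} [Fintype ι] (A B : ι → ℝ) :
    MemLp (fun z : ι → ℝ => Ψ (A ⬝ᵥ z) (B ⬝ᵥ z)) 2 (Measure.pi fun _ : ι => gaussianReal 0 1) := by
  obtain ⟨C, hC, h⟩ := hΨ.exists_growth
  have hsq : ∀ A : ι → ℝ, MemLp (fun z : ι → ℝ => (A ⬝ᵥ z) ^ 2) 2
      (Measure.pi fun _ : ι => gaussianReal 0 1) := by
    intro A
    rw [memLp_two_iff_integrable_sq (by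
      exact (((measurePreserving_dotProduct_gaussian A).measurable.pow_const 2)).aestronglyMeasurable)]
    have e : ∀ z : ι → ℝ, ((A ⬝ᵥ z) ^ 2) ^ 2 = (A ⬝ᵥ z) ^ 4 := fun z => by ring
    simp_rw [e]
    exact integrable_dotProduct_pow_gaussian A 4 (by decide)
  have hb1 : MemLp (fun z : ι → ℝ => 1 + (A ⬝ᵥ z) ^ 2) 2
      (Measure.pi fun _ : ι => gaussianReal 0 1) := (memLp_const (1 : ℝ)).add (hsq A)
  have hb2 : MemLp (fun z : ι → ℝ => 1 + (A ⬝ᵥ z) ^ 2 + (B ⬝ᵥ z) ^ 2) 2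
      (Measure.pi fun _ : ι => gaussianReal 0 1) := hb1.add (hsq B)
  have hb : MemLp (fun z : ι → ℝ => C * (1 + (A ⬝ᵥ z) ^ 2 + (B ⬝ᵥ z) ^ 2)) 2
      (Measure.pi fun _ : ι => gaussianReal 0 1) := hb2.const_mul C
  refine hb.mono ?_ (ae_of_all _ fun z => ?_)
  · have h1 : Measurable fun z : ι → ℝ => (A ⬝ᵥ z, B ⬝ᵥ z) :=
      (measurePreserving_dotProduct_gaussian A).measurable.prodMk
        (measurePreserving_dotProduct_gaussian B).measurable
    exact (hΨ.measurable.comp h1).aestronglyMeasurable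
  · rw [Real.norm_eq_abs, Real.norm_eq_abs]
    exact (h _ _).trans (le_abs_self _)

/-- Quadratic growth reduces the variance to fourth moments of linear forms, which depend on `A ⬝ᵥ
A` and `B ⬝ᵥ B` only. The bound is therefore free of the dimension and of the direction of the
forms. -/
theorem QuadTame.exists_variance_le {Ψ : ℝ → ℝ → ℝ} (hΨ : QuadTame Ψ) (t : ℝ) :
    ∃ V : ℝ, 0 ≤ V ∧ ∀ {ι : Type} [Fintype ι] (A B : ι → ℝ), A ⬝ᵥ A ≤ t → B ⬝ᵥ B ≤ t →
      Var[fun z : ι → ℝ => Ψ (A ⬝ᵥ z) (B ⬝ᵥ z); Measure.pi fun _ : ι => gaussianReal 0 1] ≤ V := by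
  obtain ⟨C, hC, h⟩ := hΨ.exists_growth
  have hg := gaussFourth_nonneg
  refine ⟨C ^ 2 * (3 * (1 + t ^ 2 * gaussFourth + t ^ 2 * gaussFourth)), by positivity, ?_⟩
  intro ι _ A B hA hB
  have hA0 : 0 ≤ A ⬝ᵥ A := by
    simp only [dotProduct, ← sq]; exact Finset.sum_nonneg fun _ _ => sq_nonneg _
  have hB0 : 0 ≤ B ⬝ᵥ B := by
    simp only [dotProduct, ← sq]; exact Finset.sum_nonneg fun _ _ => sq_nonneg _
  have hm := hΨ.memLp A B
  refine (variance_le_expectation_sq hm.aestronglyMeasurable).trans ?_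
  have iA := integrable_dotProduct_pow_gaussian A 4 (by decide)
  have iB := integrable_dotProduct_pow_gaussian B 4 (by decide)
  have i1 : Integrable (fun z : ι → ℝ => 1 + (A ⬝ᵥ z) ^ 4)
      (Measure.pi fun _ : ι => gaussianReal 0 1) := (integrable_const 1).add iA
  have i2 : Integrable (fun z : ι → ℝ => 1 + (A ⬝ᵥ z) ^ 4 + (B ⬝ᵥ z) ^ 4)
      (Measure.pi fun _ : ι => gaussianReal 0 1) := i1.add iB
  have hle : ∫ z : ι → ℝ, (Ψ (A ⬝ᵥ z) (B ⬝ᵥ z)) ^ 2 ∂(Measure.pi fun _ : ι => gaussianReal 0 1)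
      ≤ ∫ z : ι → ℝ, C ^ 2 * (3 * (1 + (A ⬝ᵥ z) ^ 4 + (B ⬝ᵥ z) ^ 4))
        ∂(Measure.pi fun _ : ι => gaussianReal 0 1) := by
    refine integral_mono hm.integrable_sq ((i2.const_mul 3).const_mul _) fun z => ?_
    simp only
    set u := A ⬝ᵥ z
    set v := B ⬝ᵥ z
    have h1 : Ψ u v ^ 2 ≤ (C * (1 + u ^ 2 + v ^ 2)) ^ 2 := by
      rw [← sq_abs]
      exact pow_le_pow_left₀ (abs_nonneg _) (h u v) 2
    refine h1.trans ?_
    rw [mul_pow]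
    refine mul_le_mul_of_nonneg_left ?_ (sq_nonneg C)
    nlinarith [sq_nonneg (1 - u ^ 2), sq_nonneg (1 - v ^ 2), sq_nonneg (u ^ 2 - v ^ 2)]
  refine (show _ ≤ _ from hle).trans ?_
  rw [integral_const_mul, integral_const_mul, integral_add i1 iB,
    integral_add (integrable_const 1) iA, integral_dotProduct_pow_four_gaussian,
    integral_dotProduct_pow_four_gaussian]
  simp only [integral_const, probReal_univ, smul_eq_mul, one_mul]
  gcongr

/-- Both Gaussian pairs are linear images of the same standard Gaussian vector in the plane; the
tame estimate is integrated over this coupling. -/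
theorem QuadTame.abs_gaussPair_factor_sub_le {Ψ : ℝ → ℝ → ℝ} (hΨ : QuadTame Ψ) {ε C : ℝ}
    (hC : ∀ x y x' y' : ℝ, |Ψ x y - Ψ x' y'|
      ≤ ε * (1 + x ^ 2 + y ^ 2 + x' ^ 2 + y' ^ 2) + C * ((x - x') ^ 2 + (y - y') ^ 2))
    (A B A' B' : Fin 2 → ℝ) :
    |gaussPair Ψ (A ⬝ᵥ A) (A ⬝ᵥ B) (B ⬝ᵥ B) - gaussPair Ψ (A' ⬝ᵥ A') (A' ⬝ᵥ B') (B' ⬝ᵥ B')|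
      ≤ ε * (1 + A ⬝ᵥ A + B ⬝ᵥ B + A' ⬝ᵥ A' + B' ⬝ᵥ B')
        + C * ((A - A') ⬝ᵥ (A - A') + (B - B') ⬝ᵥ (B - B')) := by
  rw [gaussPair_gram A B hΨ.measurable, gaussPair_gram A' B' hΨ.measurable,
    ← integral_sub ((hΨ.memLp A B).integrable one_le_two) ((hΨ.memLp A' B').integrable one_le_two)]
  refine (abs_integral_le_integral_abs).trans ?_
  have i : ∀ A : Fin 2 → ℝ, Integrable (fun z : Fin 2 → ℝ => (A ⬝ᵥ z) ^ 2)
      (Measure.pi fun _ : Fin 2 => gaussianReal 0 1) :=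
    fun A => integrable_dotProduct_pow_gaussian A 2 (by decide)
  have j1 : Integrable (fun z : Fin 2 → ℝ => 1 + (A ⬝ᵥ z) ^ 2)
      (Measure.pi fun _ : Fin 2 => gaussianReal 0 1) := (integrable_const 1).add (i A)
  have j2 : Integrable (fun z : Fin 2 → ℝ => 1 + (A ⬝ᵥ z) ^ 2 + (B ⬝ᵥ z) ^ 2)
      (Measure.pi fun _ : Fin 2 => gaussianReal 0 1) := j1.add (i B)
  have j3 : Integrable (fun z : Fin 2 → ℝ => 1 + (A ⬝ᵥ z) ^ 2 + (B ⬝ᵥ z) ^ 2 + (A' ⬝ᵥ z) ^ 2)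
      (Measure.pi fun _ : Fin 2 => gaussianReal 0 1) := j2.add (i A')
  have j4 : Integrable (fun z : Fin 2 → ℝ =>
      1 + (A ⬝ᵥ z) ^ 2 + (B ⬝ᵥ z) ^ 2 + (A' ⬝ᵥ z) ^ 2 + (B' ⬝ᵥ z) ^ 2)
      (Measure.pi fun _ : Fin 2 => gaussianReal 0 1) := j3.add (i B')
  have j5 : Integrable (fun z : Fin 2 → ℝ => ((A - A') ⬝ᵥ z) ^ 2 + ((B - B') ⬝ᵥ z) ^ 2)
      (Measure.pi fun _ : Fin 2 => gaussianReal 0 1) := (i _).add (i _)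
  have e : ∫ z : Fin 2 → ℝ, (ε * (1 + (A ⬝ᵥ z) ^ 2 + (B ⬝ᵥ z) ^ 2 + (A' ⬝ᵥ z) ^ 2 + (B' ⬝ᵥ z) ^ 2)
      + C * (((A - A') ⬝ᵥ z) ^ 2 + ((B - B') ⬝ᵥ z) ^ 2))
      ∂(Measure.pi fun _ : Fin 2 => gaussianReal 0 1)
      = ε * (1 + A ⬝ᵥ A + B ⬝ᵥ B + A' ⬝ᵥ A' + B' ⬝ᵥ B')
        + C * ((A - A') ⬝ᵥ (A - A') + (B - B') ⬝ᵥ (B - B')) := by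
    rw [integral_add (j4.const_mul ε) (j5.const_mul C), integral_const_mul, integral_const_mul,
      integral_add j3 (i B'), integral_add j2 (i A'), integral_add j1 (i B),
      integral_add (integrable_const 1) (i A), integral_add (i _) (i _)]
    simp only [integral_dotProduct_sq_gaussian, integral_const, probReal_univ, smul_eq_mul, mul_one]
  rw [← e]
  refine integral_mono (((hΨ.memLp A B).integrable one_le_two).sub
    ((hΨ.memLp A' B').integrable one_le_two)).abs ((j4.const_mul ε).add (j5.const_mul C)) fun z => ?_
  simpa [sub_dotProduct] using hC (A ⬝ᵥ z) (B ⬝ᵥ z) (A' ⬝ᵥ z) (B' ⬝ᵥ z)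

/-- Gaussian expectations of tame functions depend continuously on the covariance. -/
theorem QuadTame.exists_abs_gaussPair_sub_le {Ψ : ℝ → ℝ → ℝ} (hΨ : QuadTame Ψ) {a c b : ℝ}
    (ε : ℝ) (hε : 0 < ε) :
    ∃ δ : ℝ, 0 < δ ∧ ∀ {a' c' b' : ℝ}, 0 ≤ a' → 0 ≤ b' → c' ^ 2 ≤ a' * b' → |a' - a| ≤ δ →
      |c' - c| ≤ δ → |b' - b| ≤ δ → |gaussPair Ψ a' c' b' - gaussPair Ψ a c b| ≤ ε := by
  -- Argument by compactness: the triangular factors of a sequence of counterexamples are bounded,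
  -- and a limit of them is a factor of the covariance `(a, c, b)` itself. No continuity of the
  -- factorization is needed, which would be delicate at `a = 0`.
  by_contra! hcon
  have hcon' : ∀ n : ℕ, ∃ v : ℝ × ℝ × ℝ, |v.1 ^ 2 - a| ≤ 1 / (n + 1) ∧ |v.1 * v.2.1 - c| ≤ 1 / (n + 1)
      ∧ |v.2.1 ^ 2 + v.2.2 ^ 2 - b| ≤ 1 / (n + 1) ∧
      ε < |gaussPair Ψ (v.1 ^ 2) (v.1 * v.2.1) (v.2.1 ^ 2 + v.2.2 ^ 2) - gaussPair Ψ a c b| := by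
    intro n
    obtain ⟨a', c', b', ha', hb', hc', h1, h2, h3, h4⟩ := hcon (1 / (n + 1)) (by positivity)
    obtain ⟨p, q, r, rfl, rfl, rfl⟩ := exists_gram_factor ha' hb' hc'
    exact ⟨(p, q, r), h1, h2, h3, h4⟩
  choose v hv1 hv2 hv3 hv4 using hcon'
  have hlim : Tendsto (fun n : ℕ => 1 / ((n : ℝ) + 1)) atTop (𝓝 0) :=
    tendsto_one_div_add_atTop_nhds_zero_nat
  have hbd : ∀ n : ℕ, 1 / ((n : ℝ) + 1) ≤ 1 := fun n => by
    rw [div_le_one (by positivity)]; linarith [(Nat.cast_nonneg n : (0 : ℝ) ≤ n)]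
  have hmem : ∀ n, v n ∈ Metric.closedBall (0 : ℝ × ℝ × ℝ) (1 + (|a| + |b| + 1)) := by
    intro n
    have key : ∀ y : ℝ, y ^ 2 ≤ |a| + |b| + 1 → |y| ≤ 1 + (|a| + |b| + 1) := by
      intro y hy
      nlinarith [sq_abs y, sq_nonneg (|y| - 1), abs_nonneg a, abs_nonneg b]
    have a1 := abs_le.mp ((hv1 n).trans (hbd n))
    have a3 := abs_le.mp ((hv3 n).trans (hbd n))
    have := le_abs_self a
    have := le_abs_self b
    simp only [Metric.mem_closedBall, dist_zero_right, Prod.norm_def, Real.norm_eq_abs,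
      max_le_iff]
    refine ⟨key _ ?_, key _ ?_, key _ ?_⟩
    · linarith [abs_nonneg b]
    · nlinarith [abs_nonneg a]
    · nlinarith [abs_nonneg a]
  obtain ⟨w, -, k, hk, hw⟩ := (isCompact_closedBall _ _).tendsto_subseq hmem
  have hlimk := hlim.comp hk.tendsto_atTop
  have hw1 : Tendsto (fun n => (v (k n)).1) atTop (𝓝 w.1) := (continuous_fst.tendsto w).comp hw
  have hw2 : Tendsto (fun n => (v (k n)).2.1) atTop (𝓝 w.2.1) :=
    ((continuous_fst.comp continuous_snd).tendsto w).comp hw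
  have hw3 : Tendsto (fun n => (v (k n)).2.2) atTop (𝓝 w.2.2) :=
    ((continuous_snd.comp continuous_snd).tendsto w).comp hw
  have lim_eq : ∀ {f : ℕ → ℝ} {x y : ℝ}, Tendsto (fun n => f (k n)) atTop (𝓝 x) →
      (∀ n, |f n - y| ≤ 1 / ((n : ℝ) + 1)) → x = y := by
    intro f x y hf hfy
    refine tendsto_nhds_unique hf ?_
    rw [tendsto_iff_norm_sub_tendsto_zero]
    exact squeeze_zero (fun _ => norm_nonneg _) (fun n => hfy (k n)) hlimk
  have ea := lim_eq (f := fun n => (v n).1 ^ 2) (hw1.pow 2) hv1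
  have ec := lim_eq (f := fun n => (v n).1 * (v n).2.1) (hw1.mul hw2) hv2
  have eb := lim_eq (f := fun n => (v n).2.1 ^ 2 + (v n).2.2 ^ 2) ((hw2.pow 2).add (hw3.pow 2)) hv3
  -- The denominator bounds the second moments of both couplings together, so that the growth term
  -- contributes at most `ε / 2`.
  obtain ⟨C, hC, hest⟩ := hΨ.est (ε / (2 * (1 + 2 * (|a| + |b| + 1)))) (by positivity)
  have hCdist : Tendsto (fun n => C * (((v (k n)).1 - w.1) ^ 2 + ((v (k n)).2.1 - w.2.1) ^ 2
      + ((v (k n)).2.2 - w.2.2) ^ 2)) atTop (𝓝 0) := by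
    have := (((hw1.sub_const w.1).pow 2).add ((hw2.sub_const w.2.1).pow 2)).add
      ((hw3.sub_const w.2.2).pow 2) |>.const_mul C
    simpa using this
  obtain ⟨n, hn⟩ := ((tendsto_order.mp hCdist).2 (ε / 2) (by positivity)).exists
  have hfin := hΨ.abs_gaussPair_factor_sub_le hest ![(v (k n)).1, 0] ![(v (k n)).2.1, (v (k n)).2.2]
    ![w.1, 0] ![w.2.1, w.2.2]
  simp only [dotProduct, Fin.sum_univ_two, Matrix.cons_val_zero, Matrix.cons_val_one,
    Matrix.cons_val_fin_one, zero_mul, Pi.sub_apply, sub_self, ← sq] at hfin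
  simp only [zero_pow two_ne_zero, add_zero] at hfin
  rw [ea, ec, eb] at hfin
  have a1 := abs_le.mp ((hv1 (k n)).trans (hbd (k n)))
  have a3 := abs_le.mp ((hv3 (k n)).trans (hbd (k n)))
  have e1 : ε / (2 * (1 + 2 * (|a| + |b| + 1))) * (1 + (v (k n)).1 ^ 2
      + ((v (k n)).2.1 ^ 2 + (v (k n)).2.2 ^ 2) + a + b) ≤ ε / 2 := by
    rw [div_mul_eq_mul_div, div_le_div_iff₀ (by positivity) (by positivity)]
    have := le_abs_self a
    have := le_abs_self b
    nlinarith
  have h4 := hv4 (k n)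
  linarith

/-! ### Coupling of Haar orthogonal matrices with Gaussian vectors -/

theorem dotProduct_self_nonneg_real {ι : Type*} [Fintype ι] (v : ι → ℝ) : 0 ≤ v ⬝ᵥ v :=
  Finset.sum_nonneg fun i _ => mul_self_nonneg (v i)

theorem OrthGroup.mulVec_single_dotProduct {N : ℕ} (R : OrthGroup N) (i j : Fin N) :
    (R.1 *ᵥ Pi.single i 1) ⬝ᵥ (R.1 *ᵥ Pi.single j 1) = if i = j then 1 else 0 := by
  rw [R.mulVec_dotProduct_mulVec]
  simp [Pi.single_apply, eq_comm]

theorem exists_unit_smul {N : ℕ} (i : Fin N) (v : Fin N → ℝ) :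
    ∃ f : Fin N → ℝ, f ⬝ᵥ f = 1 ∧ v = √(v ⬝ᵥ v) • f := by
  rcases (dotProduct_self_nonneg_real v).eq_or_lt with h | h
  · refine ⟨Pi.single i 1, by simp, ?_⟩
    rw [← h, Real.sqrt_zero, zero_smul]
    exact dotProduct_self_eq_zero.mp h.symm
  · have hs : √(v ⬝ᵥ v) ≠ 0 := (Real.sqrt_pos.mpr h).ne'
    refine ⟨(√(v ⬝ᵥ v))⁻¹ • v, ?_, ?_⟩
    · simp only [smul_dotProduct, dotProduct_smul, smul_eq_mul]
      rw [← mul_assoc, ← mul_inv, Real.mul_self_sqrt h.le, inv_mul_cancel₀ h.ne']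
    · rw [smul_smul, mul_inv_cancel₀ hs, one_smul]

/-- Two vectors written in an orthonormal frame, in triangular form. -/
theorem exists_orthGroup_frame {N : ℕ} {i j : Fin N} (hij : i ≠ j) (v v' : Fin N → ℝ) :
    ∃ (R : OrthGroup N) (p q r : ℝ), 0 ≤ p ∧ 0 ≤ r ∧ v = p • (R.1 *ᵥ Pi.single i 1) ∧
      v' = q • (R.1 *ᵥ Pi.single i 1) + r • (R.1 *ᵥ Pi.single j 1) := by
  obtain ⟨f, hf, hvf⟩ := exists_unit_smul i v
  set w := v' - (v' ⬝ᵥ f) • f with hw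
  have hfw : f ⬝ᵥ w = 0 := by
    simp [hw, dotProduct_sub, hf, dotProduct_comm f v']
  obtain ⟨g, hg, hfg, hwg⟩ : ∃ g : Fin N → ℝ, g ⬝ᵥ g = 1 ∧ f ⬝ᵥ g = 0 ∧ w = √(w ⬝ᵥ w) • g := by
    rcases (dotProduct_self_nonneg_real w).eq_or_lt with h | h
    · obtain ⟨R, hR⟩ := exists_orthGroup_single i hf
      refine ⟨R.1 *ᵥ Pi.single j 1, ?_, ?_, ?_⟩
      · rw [R.mulVec_dotProduct_mulVec]; simp
      · rw [← hR, R.mulVec_dotProduct_mulVec]; simp [hij]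
      · rw [← h, Real.sqrt_zero, zero_smul]
        exact dotProduct_self_eq_zero.mp h.symm
    · obtain ⟨g, hg, hwg⟩ := exists_unit_smul i w
      refine ⟨g, hg, ?_, hwg⟩
      rw [hwg, dotProduct_smul, smul_eq_mul] at hfw
      exact (mul_eq_zero.mp hfw).resolve_left (Real.sqrt_pos.mpr h).ne'
  obtain ⟨R, hRi, hRj⟩ := exists_orthGroup_pair hij hf hg hfg
  refine ⟨R, √(v ⬝ᵥ v), v' ⬝ᵥ f, √(w ⬝ᵥ w), Real.sqrt_nonneg _, Real.sqrt_nonneg _, ?_, ?_⟩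
  · rw [hRi]; exact hvf
  · rw [hRi, hRj, ← hwg, hw]; abel

theorem sq_sub_le_abs_sq_sub_sq {x y : ℝ} (hx : 0 ≤ x) (hy : 0 ≤ y) :
    (x - y) ^ 2 ≤ |x ^ 2 - y ^ 2| := by
  have : |x ^ 2 - y ^ 2| = |x - y| * (x + y) := by
    rw [sq_sub_sq, abs_mul, abs_of_nonneg (by positivity : 0 ≤ x + y), mul_comm]
  rw [this, ← sq_abs, sq]
  refine mul_le_mul_of_nonneg_left ?_ (abs_nonneg _)
  rw [abs_le]
  constructor <;> linarith

/-- `g` and `g'` are nearly orthogonal and have nearly the norm `√N`. -/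
def NearOrthogonal {N : ℕ} (δ : ℝ) (g g' : Fin N → ℝ) : Prop :=
  |g ⬝ᵥ g - N| ≤ δ * N ∧ |g' ⬝ᵥ g' - N| ≤ δ * N ∧ |g ⬝ᵥ g'| ≤ δ * N

/-- In the triangular form `g = p f`, `g' = q f + r f'` of a nearly orthogonal pair, `p` and `r` are
close to `√N` and `q` is small, so the orthonormal frame `f`, `f'` scaled by `√N` is close to the
pair. -/
theorem exists_orthGroup_near {N : ℕ} {i j : Fin N} (hij : i ≠ j) {δ : ℝ} (hδ : δ ≤ 1 / 2)
    {g g' : Fin N → ℝ} (h : NearOrthogonal δ g g') :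
    ∃ R : OrthGroup N,
      (√N • (R.1 *ᵥ Pi.single i 1) - g) ⬝ᵥ (√N • (R.1 *ᵥ Pi.single i 1) - g) ≤ 3 * δ * N ∧
      (√N • (R.1 *ᵥ Pi.single j 1) - g') ⬝ᵥ (√N • (R.1 *ᵥ Pi.single j 1) - g') ≤ 3 * δ * N := by
  obtain ⟨R, p, q, r, hp, hr, hg, hg'⟩ := exists_orthGroup_frame hij g g'
  obtain ⟨h1, h2, h3⟩ := h
  have hN : (0 : ℝ) < N := by exact_mod_cast i.pos
  set f := R.1 *ᵥ Pi.single i 1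
  set f' := R.1 *ᵥ Pi.single j 1
  have hff : f ⬝ᵥ f = 1 := by simp only [f, R.mulVec_single_dotProduct, if_true]
  have hff' : f' ⬝ᵥ f' = 1 := by simp only [f', R.mulVec_single_dotProduct, if_true]
  have hf0 : f ⬝ᵥ f' = 0 := by simp only [f, f', R.mulVec_single_dotProduct, hij, if_false]
  have hf0' : f' ⬝ᵥ f = 0 := by rw [dotProduct_comm, hf0]
  have e1 : g ⬝ᵥ g = p ^ 2 := by simp [hg, hff, sq]
  have e2 : g ⬝ᵥ g' = p * q := by simp [hg, hg', hff, hf0, mul_comm]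
  have e3 : g' ⬝ᵥ g' = q ^ 2 + r ^ 2 := by
    simp [hg', hff, hff', hf0, hf0', sq]
  rw [e1] at h1
  rw [e2] at h3
  rw [e3] at h2
  have hsN : √(N : ℝ) ^ 2 = N := Real.sq_sqrt hN.le
  have hδ0 : 0 ≤ δ := by
    have := (abs_nonneg _).trans h1
    exact nonneg_of_mul_nonneg_left this hN
  have a1 : (√(N : ℝ) - p) ^ 2 ≤ δ * N := by
    have := sq_sub_le_abs_sq_sub_sq (Real.sqrt_nonneg (N : ℝ)) hp
    rw [hsN, abs_sub_comm] at this
    exact this.trans h1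
  have hp2 : (N : ℝ) / 2 ≤ p ^ 2 := by
    have := (abs_le.mp h1).1
    nlinarith
  -- `p q` is the inner product of `g` and `g'`; dividing by `p ^ 2 ≥ N / 2` and using `δ ≤ 1 / 2`
  -- removes one factor `δ N`.
  have hq2 : q ^ 2 ≤ δ * N := by
    have h4 : p ^ 2 * q ^ 2 ≤ (δ * N) ^ 2 := by
      rw [← mul_pow, ← sq_abs]
      exact pow_le_pow_left₀ (abs_nonneg _) h3 2
    have h5 : (N : ℝ) / 2 * q ^ 2 ≤ (δ * N) ^ 2 :=
      (mul_le_mul_of_nonneg_right hp2 (sq_nonneg q)).trans h4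
    have h6 : (δ * N) ^ 2 ≤ (N / 2) * (δ * N) := by
      rw [sq]
      exact mul_le_mul_of_nonneg_right (by nlinarith) (mul_nonneg hδ0 hN.le)
    exact le_of_mul_le_mul_left (h5.trans h6) (by positivity)
  have a2 : (√(N : ℝ) - r) ^ 2 ≤ 2 * (δ * N) := by
    have := sq_sub_le_abs_sq_sub_sq (Real.sqrt_nonneg (N : ℝ)) hr
    rw [hsN] at this
    refine this.trans ?_
    have h7 := abs_le.mp h2
    rw [abs_le]
    constructor <;> nlinarith [sq_nonneg q]
  refine ⟨R, ?_, ?_⟩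
  · have : √(N : ℝ) • f - g = (√(N : ℝ) - p) • f := by rw [hg, sub_smul]
    rw [this]
    simp only [smul_dotProduct, dotProduct_smul, smul_eq_mul, hff]
    nlinarith
  · have : √(N : ℝ) • f' - g' = (-q) • f + (√(N : ℝ) - r) • f' := by
      rw [hg', sub_smul, neg_smul]; abel
    rw [this]
    simp only [smul_dotProduct, dotProduct_smul, smul_eq_mul, hff, hff', hf0, hf0',
      add_dotProduct, dotProduct_add]
    nlinarith

/-- Any pair of vectors in `ℝᴺ` can be rotated close to linear combinations of a nearly orthogonal
pair, with coefficients given by a triangular factorization of the Gram matrix. -/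
theorem exists_coupling_coeff {N : ℕ} (hN : 2 ≤ N) (u u' : Fin N → ℝ) :
    ∃ p q r : ℝ, p ^ 2 = u ⬝ᵥ u / N ∧ p * q = u ⬝ᵥ u' / N ∧ q ^ 2 + r ^ 2 = u' ⬝ᵥ u' / N ∧
      ∀ δ ≤ (1 / 2 : ℝ), ∀ g g' : Fin N → ℝ, NearOrthogonal δ g g' → ∃ R : OrthGroup N,
        (R.1 *ᵥ u - p • g) ⬝ᵥ (R.1 *ᵥ u - p • g) / N ≤ 3 * δ * (u ⬝ᵥ u / N) ∧
        (R.1 *ᵥ u' - (q • g + r • g')) ⬝ᵥ (R.1 *ᵥ u' - (q • g + r • g')) / N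
          ≤ 6 * δ * (u' ⬝ᵥ u' / N) := by
  have hN0 : (0 : ℝ) < N := by positivity
  have hij : (⟨0, by omega⟩ : Fin N) ≠ ⟨1, by omega⟩ := by simp
  set i : Fin N := ⟨0, by omega⟩
  set j : Fin N := ⟨1, by omega⟩
  obtain ⟨R, p, q, r, hp, hr, hu, hu'⟩ := exists_orthGroup_frame hij u u'
  have hff : (R.1 *ᵥ Pi.single i 1) ⬝ᵥ (R.1 *ᵥ Pi.single i 1) = 1 := by
    simp only [R.mulVec_single_dotProduct, if_true]
  have hff' : (R.1 *ᵥ Pi.single j 1) ⬝ᵥ (R.1 *ᵥ Pi.single j 1) = 1 := by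
    simp only [R.mulVec_single_dotProduct, if_true]
  have hf0 : (R.1 *ᵥ Pi.single i 1) ⬝ᵥ (R.1 *ᵥ Pi.single j 1) = 0 := by
    simp only [R.mulVec_single_dotProduct, hij, if_false]
  have hf0' : (R.1 *ᵥ Pi.single j 1) ⬝ᵥ (R.1 *ᵥ Pi.single i 1) = 0 := by
    rw [dotProduct_comm, hf0]
  have hsN : √(N : ℝ) ^ 2 = N := Real.sq_sqrt hN0.le
  have hs0 : √(N : ℝ) ≠ 0 := (Real.sqrt_pos.mpr hN0).ne'
  have e1 : (p / √N) ^ 2 = u ⬝ᵥ u / N := by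
    simp only [hu, smul_dotProduct, dotProduct_smul, smul_eq_mul, hff]
    rw [div_pow, hsN]; ring
  have e2 : (p / √N) * (q / √N) = u ⬝ᵥ u' / N := by
    simp only [hu, hu', smul_dotProduct, dotProduct_smul, smul_eq_mul, hff, hf0, dotProduct_add]
    rw [div_mul_div_comm, ← sq, hsN]; ring
  have e3 : (q / √N) ^ 2 + (r / √N) ^ 2 = u' ⬝ᵥ u' / N := by
    simp only [hu', smul_dotProduct, dotProduct_smul, smul_eq_mul, hff, hf0, hf0', hff',
      dotProduct_add, add_dotProduct]
    rw [div_pow, div_pow, hsN]; ring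
  -- The frame consists of unit vectors while `g` and `g'` have norm about `√N`; hence the division.
  refine ⟨p / √N, q / √N, r / √N, e1, e2, e3, fun δ hδ g g' hg => ?_⟩
  obtain ⟨R', h1, h2⟩ := exists_orthGroup_near hij hδ hg
  have hδ0 : 0 ≤ δ := nonneg_of_mul_nonneg_left ((abs_nonneg _).trans hg.1) hN0
  set d := √(N : ℝ) • (R'.1 *ᵥ Pi.single i 1) - g with hd
  set d' := √(N : ℝ) • (R'.1 *ᵥ Pi.single j 1) - g' with hd'
  have hRR : ∀ k : Fin N, (R' * R⁻¹).1 *ᵥ (R.1 *ᵥ Pi.single k 1) = R'.1 *ᵥ Pi.single k 1 := by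
    intro k
    rw [Matrix.mulVec_mulVec]
    congr 1
    have : ((R' * R⁻¹) * R).1 = R'.1 := by rw [inv_mul_cancel_right]
    exact this
  have f1 : (R' * R⁻¹).1 *ᵥ u - (p / √N) • g = (p / √N) • d := by
    rw [hu, Matrix.mulVec_smul, hRR, hd, smul_sub, smul_smul, div_mul_cancel₀ _ hs0]
  have f2 : (R' * R⁻¹).1 *ᵥ u' - ((q / √N) • g + (r / √N) • g')
      = (q / √N) • d + (r / √N) • d' := by
    rw [hu', Matrix.mulVec_add, Matrix.mulVec_smul, Matrix.mulVec_smul, hRR, hRR, hd, hd', smul_sub,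
      smul_sub, smul_smul, smul_smul, div_mul_cancel₀ _ hs0, div_mul_cancel₀ _ hs0]
    abel
  -- `R⁻¹` takes the frame of `u`, `u'` to two standard basis vectors, and `R'` takes these to the
  -- frame near `g`, `g'`.
  refine ⟨R' * R⁻¹, ?_, ?_⟩
  · rw [f1, ← e1, div_le_iff₀ hN0]
    simp only [smul_dotProduct, dotProduct_smul, smul_eq_mul]
    nlinarith [mul_le_mul_of_nonneg_left h1 (sq_nonneg (p / √N))]
  · rw [f2, ← e3, div_le_iff₀ hN0]
    have hcs := dotProduct_self_nonneg_real ((q / √N) • d - (r / √N) • d')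
    have hc := dotProduct_comm d d'
    simp only [smul_dotProduct, dotProduct_smul, smul_eq_mul, dotProduct_add, add_dotProduct,
      dotProduct_sub, sub_dotProduct] at hcs ⊢
    nlinarith [mul_le_mul_of_nonneg_left h1 (sq_nonneg (q / √N)),
      mul_le_mul_of_nonneg_left h2 (sq_nonneg (r / √N))]

/-! ### Empirical averages of pre-activations -/

theorem OrthGroup.measurable_apply {N : ℕ} (i j : Fin N) :
    Measurable fun Q : OrthGroup N => Q.1 i j := (OrthGroup.continuous_apply i j).measurable

/-- A coordinate of `∑ₛ Qₛ uₛ + σ β`. -/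
def rowPre {S : Type*} [Fintype S] {N a : ℕ} (e : Fin a → Fin N) (σ : ℝ) (Q : S → OrthGroup N)
    (β : Fin a → ℝ) (u : S → Fin N → ℝ) (i : Fin a) : ℝ :=
  ∑ s, ((Q s).1 *ᵥ u s) (e i) + σ * β i

/-- Independent Haar orthogonal matrices together with independent standard Gaussian biases. -/
noncomputable def haarBias (S : Type*) [Fintype S] (N a : ℕ) :
    Measure ((S → OrthGroup N) × (Fin a → ℝ)) :=
  (Measure.pi fun _ => haarOrth N).prod (Measure.pi fun _ => gaussianReal 0 1)

instance haarBias.instIsProbabilityMeasure (S : Type*) [Fintype S] (N a : ℕ) :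
    IsProbabilityMeasure (haarBias S N a) := by unfold haarBias; infer_instance

theorem measurable_rowPre {S : Type*} [Fintype S] {N a : ℕ} (e : Fin a → Fin N) (σ : ℝ)
    (u : S → Fin N → ℝ) (i : Fin a) :
    Measurable fun p : (S → OrthGroup N) × (Fin a → ℝ) => rowPre e σ p.1 p.2 u i := by
  unfold rowPre
  refine (Finset.measurable_sum _ fun s _ => ?_).add (by fun_prop)
  exact (OrthGroup.continuous_mulVec (u s) (e i)).measurable.comp
    ((measurable_pi_apply s).comp measurable_fst)

theorem measurePreserving_haarBias_orth {S : Type*} [Fintype S] {N a : ℕ} (s : S) :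
    MeasurePreserving (fun p : (S → OrthGroup N) × (Fin a → ℝ) => p.1 s) (haarBias S N a)
      (haarOrth N) :=
  (measurePreserving_eval (fun _ => haarOrth N) s).comp measurePreserving_fst

theorem measurePreserving_haarBias_bias {S : Type*} [Fintype S] {N a : ℕ} (i : Fin a) :
    MeasurePreserving (fun p : (S → OrthGroup N) × (Fin a → ℝ) => p.2 i) (haarBias S N a)
      (gaussianReal 0 1) :=
  (measurePreserving_eval (fun _ => gaussianReal 0 1) i).comp measurePreserving_snd

theorem integrable_haarBias_orth {S : Type*} [Fintype S] {N a : ℕ} (s : S) (w : Fin N → ℝ)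
    (k : Fin N) :
    Integrable (fun p : (S → OrthGroup N) × (Fin a → ℝ) => ((p.1 s).1 *ᵥ w) k ^ 2)
      (haarBias S N a) := by
  have h : Integrable (fun Q : OrthGroup N => (Q.1 *ᵥ w) k ^ 2) (haarOrth N) :=
    integrable_haarOrth_of_continuous ((OrthGroup.continuous_mulVec w k).pow 2)
  exact (measurePreserving_haarBias_orth s).integrable_comp_of_integrable h

theorem integral_haarBias_orth {S : Type*} [Fintype S] {N a : ℕ} (s : S) (w : Fin N → ℝ)
    (k : Fin N) :
    ∫ p, ((p.1 s).1 *ᵥ w) k ^ 2 ∂(haarBias S N a) = w ⬝ᵥ w / N := by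
  have h := measurePreserving_haarBias_orth (S := S) (N := N) (a := a) s
  rw [← integral_mulVec_sq_haarOrth w k, ← h.map_eq, integral_map h.measurable.aemeasurable]
  exact ((OrthGroup.continuous_mulVec w k).pow 2).measurable.aestronglyMeasurable

theorem integral_gaussian_sq : ∫ y, y ^ 2 ∂(gaussianReal 0 1) = 1 := by
  have := variance_id_gaussianReal (μ := 0) (v := 1)
  rw [variance_eq_sub (memLp_id_gaussianReal 2)] at this
  simpa using this

theorem integrable_gaussian_sq : Integrable (fun y : ℝ => y ^ 2) (gaussianReal 0 1) :=
  (memLp_id_gaussianReal (μ := 0) (v := 1) 2).integrable_sq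

theorem rowPre_sq_le {S : Type*} [Fintype S] {N a : ℕ} (e : Fin a → Fin N) (σ : ℝ)
    (Q : S → OrthGroup N) (β : Fin a → ℝ) (u : S → Fin N → ℝ) (i : Fin a) :
    rowPre e σ Q β u i ^ 2
      ≤ 2 * Fintype.card S * ∑ s, ((Q s).1 *ᵥ u s) (e i) ^ 2 + 2 * σ ^ 2 * β i ^ 2 := by
  have h := sq_sum_le_card_mul_sum_sq (s := Finset.univ) (f := fun s => ((Q s).1 *ᵥ u s) (e i))
  rw [Finset.card_univ] at h
  unfold rowPre
  nlinarith [sq_nonneg (∑ s, ((Q s).1 *ᵥ u s) (e i) - σ * β i)]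

theorem integrable_rowPre_bound {S : Type*} [Fintype S] {N a : ℕ} (e : Fin a → Fin N) (σ : ℝ)
    (u : S → Fin N → ℝ) (i : Fin a) :
    Integrable (fun p : (S → OrthGroup N) × (Fin a → ℝ) =>
      2 * Fintype.card S * ∑ s, ((p.1 s).1 *ᵥ u s) (e i) ^ 2 + 2 * σ ^ 2 * p.2 i ^ 2)
      (haarBias S N a) := by
  have h1 : Integrable (fun p : (S → OrthGroup N) × (Fin a → ℝ) =>
      ∑ s, ((p.1 s).1 *ᵥ u s) (e i) ^ 2) (haarBias S N a) :=
    integrable_finsetSum _ fun s _ => integrable_haarBias_orth s (u s) (e i)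
  have h2 : Integrable (fun p : (S → OrthGroup N) × (Fin a → ℝ) => p.2 i ^ 2) (haarBias S N a) :=
    (measurePreserving_haarBias_bias i).integrable_comp_of_integrable integrable_gaussian_sq
  exact (h1.const_mul _).add (h2.const_mul _)

theorem integrable_rowPre_sq {S : Type*} [Fintype S] {N a : ℕ} (e : Fin a → Fin N) (σ : ℝ)
    (u : S → Fin N → ℝ) (i : Fin a) :
    Integrable (fun p : (S → OrthGroup N) × (Fin a → ℝ) => rowPre e σ p.1 p.2 u i ^ 2)
      (haarBias S N a) := by
  refine (integrable_rowPre_bound e σ u i).mono'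
    ((measurable_rowPre e σ u i).pow_const 2).aestronglyMeasurable (ae_of_all _ fun p => ?_)
  rw [Real.norm_of_nonneg (sq_nonneg _)]
  exact rowPre_sq_le e σ p.1 p.2 u i

theorem integral_rowPre_sq_le {S : Type*} [Fintype S] {N a : ℕ} (e : Fin a → Fin N) (σ : ℝ)
    (u : S → Fin N → ℝ) (i : Fin a) :
    ∫ p, rowPre e σ p.1 p.2 u i ^ 2 ∂(haarBias S N a)
      ≤ 2 * Fintype.card S * ∑ s, u s ⬝ᵥ u s / N + 2 * σ ^ 2 := by
  refine (integral_mono (integrable_rowPre_sq e σ u i) (integrable_rowPre_bound e σ u i)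
    fun p => rowPre_sq_le e σ p.1 p.2 u i).trans ?_
  have h1 : Integrable (fun p : (S → OrthGroup N) × (Fin a → ℝ) =>
      ∑ s, ((p.1 s).1 *ᵥ u s) (e i) ^ 2) (haarBias S N a) :=
    integrable_finsetSum _ fun s _ => integrable_haarBias_orth s (u s) (e i)
  have h := measurePreserving_haarBias_bias (S := S) (N := N) (a := a) i
  have h2 : Integrable (fun p : (S → OrthGroup N) × (Fin a → ℝ) => p.2 i ^ 2) (haarBias S N a) :=
    h.integrable_comp_of_integrable integrable_gaussian_sq
  have h3 : ∫ p, p.2 i ^ 2 ∂(haarBias S N a) = 1 := by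
    rw [← integral_gaussian_sq, ← h.map_eq, integral_map h.measurable.aemeasurable (by fun_prop)]
  rw [integral_add (h1.const_mul _) (h2.const_mul _), integral_const_mul, integral_const_mul, h3,
    integral_finsetSum _ fun s _ => integrable_haarBias_orth s (u s) (e i)]
  simp only [integral_haarBias_orth, mul_one]
  exact le_rfl

/-- Adjoins the bias to the weight row as the extra coordinate `none`. -/
theorem measurePreserving_option_elim {T : Type*} [Fintype T] (μ : Measure ℝ)
    [IsProbabilityMeasure μ] :
    MeasurePreserving (fun p : (T → ℝ) × ℝ => fun o : Option T => o.elim p.2 p.1)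
      ((Measure.pi fun _ => μ).prod μ) (Measure.pi fun _ => μ) := by
  have hm : Measurable fun p : (T → ℝ) × ℝ => fun o : Option T => o.elim p.2 p.1 := by
    refine measurable_pi_lambda _ fun o => ?_
    cases o <;> simp <;> fun_prop
  refine ⟨hm, (Measure.pi_eq fun s hs => ?_).symm⟩
  rw [Measure.map_apply hm (MeasurableSet.univ_pi hs)]
  have : (fun p : (T → ℝ) × ℝ => fun o : Option T => o.elim p.2 p.1) ⁻¹' Set.univ.pi s
      = (Set.univ.pi fun t => s (some t)) ×ˢ s none := by
    ext p
    simp [Option.forall, and_comm]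
  rw [this, Measure.prod_prod, Measure.pi_pi, Fintype.prod_option, mul_comm]

/-- Averages over the rows of a Gaussian matrix converge in mean, at a rate depending only on a
bound for the variances. -/
theorem QuadTame.exists_lintegral_average_le {Ψ : ℝ → ℝ → ℝ} (hΨ : QuadTame Ψ) (t : ℝ) :
    ∃ V : ℝ, 0 ≤ V ∧ ∀ {T : Type} [Fintype T] {N a : ℕ} {e : Fin a → Fin N} (σ : ℝ) (A B : T → ℝ),
      Function.Injective e → 0 < a → A ⬝ᵥ A + σ ^ 2 ≤ t → B ⬝ᵥ B + σ ^ 2 ≤ t →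
      ∫⁻ w : (T → Fin N → ℝ) × (Fin a → ℝ), ENNReal.ofReal |(1 / a : ℝ) *
          ∑ i, Ψ (∑ k, A k * w.1 k (e i) + σ * w.2 i) (∑ k, B k * w.1 k (e i) + σ * w.2 i)
          - gaussPair Ψ (A ⬝ᵥ A + σ ^ 2) (A ⬝ᵥ B + σ ^ 2) (B ⬝ᵥ B + σ ^ 2)|
        ∂((Measure.pi fun _ => Measure.pi fun _ => gaussianReal 0 1).prod
          (Measure.pi fun _ => gaussianReal 0 1))
        ≤ ENNReal.ofReal √(V / a) := by
  obtain ⟨V, hV0, hV⟩ := hΨ.exists_variance_le t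
  refine ⟨V, hV0, ?_⟩
  intro T _ N a e σ A B he ha hA hB
  -- With the bias as a coordinate of coefficient `σ`, a pre-activation is a single linear form and
  -- its covariance is a plain Gram matrix.
  set A' : Option T → ℝ := fun o => o.elim σ A
  set B' : Option T → ℝ := fun o => o.elim σ B
  have eA : A' ⬝ᵥ A' = A ⬝ᵥ A + σ ^ 2 := by
    simp [A', dotProduct, Fintype.sum_option]; ring
  have eB : B' ⬝ᵥ B' = B ⬝ᵥ B + σ ^ 2 := by
    simp [B', dotProduct, Fintype.sum_option]; ring
  have eC : A' ⬝ᵥ B' = A ⬝ᵥ B + σ ^ 2 := by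
    simp [A', B', dotProduct, Fintype.sum_option]; ring
  have hmp1 : MeasurePreserving (fun w : (T → Fin N → ℝ) × (Fin a → ℝ) =>
      ((fun i k => w.1 k (e i) : Fin a → T → ℝ), w.2))
      ((Measure.pi fun _ => Measure.pi fun _ => gaussianReal 0 1).prod
        (Measure.pi fun _ => gaussianReal 0 1))
      ((Measure.pi fun _ => Measure.pi fun _ => gaussianReal 0 1).prod
        (Measure.pi fun _ => gaussianReal 0 1)) :=
    (measurePreserving_pi_flip_comp (gaussianReal 0 1) he).prod (MeasurePreserving.id _)
  have hmp2 := (measurePreserving_arrowProdEquivProdArrow (T → ℝ) ℝ (Fin a)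
    (fun _ => Measure.pi fun _ => gaussianReal 0 1) (fun _ => gaussianReal 0 1)).symm
  have hmp3 : MeasurePreserving (fun (x : Fin a → (T → ℝ) × ℝ) (i : Fin a) (o : Option T) =>
      o.elim (x i).2 (x i).1) (Measure.pi fun _ => (Measure.pi fun _ => gaussianReal 0 1).prod
        (gaussianReal 0 1)) (Measure.pi fun _ => Measure.pi fun _ => gaussianReal 0 1) :=
    measurePreserving_pi _ _ fun _ => measurePreserving_option_elim (gaussianReal 0 1)
  -- Rearranges the Gaussian columns and biases into independent identically distributed rows, one
  -- for each neuron.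
  have hmp := (hmp3.comp hmp2).comp hmp1
  have hmeas : Measurable fun z : Option T → ℝ => Ψ (A' ⬝ᵥ z) (B' ⬝ᵥ z) := by
    have h1 : Measurable fun z : Option T → ℝ => (A' ⬝ᵥ z, B' ⬝ᵥ z) :=
      (measurePreserving_dotProduct_gaussian A').measurable.prodMk
        (measurePreserving_dotProduct_gaussian B').measurable
    exact hΨ.measurable.comp h1
  have hlln := lintegral_abs_average_sub_integral_le (Measure.pi fun _ : Option T => gaussianReal 0 1)
    (hΨ.memLp A' B') ha
  rw [← gaussPair_gram A' B' hΨ.measurable, eA, eB, eC] at hlln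
  have hF : Measurable fun ω : Fin a → Option T → ℝ => ENNReal.ofReal |(1 / a : ℝ) *
      ∑ i, Ψ (A' ⬝ᵥ ω i) (B' ⬝ᵥ ω i)
      - gaussPair Ψ (A ⬝ᵥ A + σ ^ 2) (A ⬝ᵥ B + σ ^ 2) (B ⬝ᵥ B + σ ^ 2)| := by
    refine ENNReal.measurable_ofReal.comp (continuous_abs.measurable.comp ?_)
    refine (measurable_const.mul (Finset.measurable_sum _ fun i _ => ?_)).sub measurable_const
    exact hmeas.comp (measurable_pi_apply i)
  rw [← hmp.lintegral_comp hF] at hlln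
  have hVar : Var[fun z : Option T → ℝ => Ψ (A' ⬝ᵥ z) (B' ⬝ᵥ z);
      Measure.pi fun _ : Option T => gaussianReal 0 1] ≤ V :=
    hV A' B' (eA ▸ hA) (eB ▸ hB)
  refine le_trans (le_of_eq ?_) (hlln.trans (ENNReal.ofReal_le_ofReal (Real.sqrt_le_sqrt (by gcongr))))
  refine lintegral_congr fun w => ?_
  have e1 : ∀ (D : T → ℝ) (i : Fin a), (fun o : Option T => o.elim σ D) ⬝ᵥ
      (fun o : Option T => o.elim (w.2 i) (fun k => w.1 k (e i)))
      = ∑ k, D k * w.1 k (e i) + σ * w.2 i := by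
    intro D i
    simp [dotProduct, Fintype.sum_option, add_comm]
  simp only [← e1]
  rfl

theorem integral_dotProduct_mul_gaussian {ι : Type*} [Fintype ι] (A B : ι → ℝ) :
    ∫ z : ι → ℝ, (A ⬝ᵥ z) * (B ⬝ᵥ z) ∂(Measure.pi fun _ : ι => gaussianReal 0 1) = A ⬝ᵥ B := by
  have i : ∀ A : ι → ℝ, Integrable (fun z : ι → ℝ => (A ⬝ᵥ z) ^ 2)
      (Measure.pi fun _ : ι => gaussianReal 0 1) :=
    fun A => integrable_dotProduct_pow_gaussian A 2 (by decide)
  have e : ∀ z : ι → ℝ, (A ⬝ᵥ z) * (B ⬝ᵥ z)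
      = 1 / 4 * (((A + B) ⬝ᵥ z) ^ 2 - ((A - B) ⬝ᵥ z) ^ 2) := by
    intro z
    rw [add_dotProduct, sub_dotProduct]; ring
  simp_rw [e]
  rw [integral_const_mul, integral_sub (i _) (i _), integral_dotProduct_sq_gaussian,
    integral_dotProduct_sq_gaussian]
  simp only [add_dotProduct, dotProduct_add, sub_dotProduct, dotProduct_sub, dotProduct_comm B A]
  ring

/-- An inner product of two Gaussian vectors is an average over rows of the function `u v`, so the
law of large numbers already proved applies, with coordinate forms as coefficients and no bias;
Markov's inequality concludes. -/
theorem measure_gaussian_inner_le :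
    ∃ V : ℝ, 0 ≤ V ∧ ∀ {T : Type} [Fintype T] [DecidableEq T] {N : ℕ} {δ : ℝ}, 0 < N → 0 < δ →
      ∀ t t' : T, (Measure.pi fun _ : T => Measure.pi fun _ : Fin N => gaussianReal 0 1)
        {g | δ * N ≤ |g t ⬝ᵥ g t' - if t = t' then (N : ℝ) else 0|}
        ≤ ENNReal.ofReal (√(V / N) / δ) := by
  obtain ⟨V, hV0, hV⟩ :=
    (quadTame_mul_of_lipschitz (g := id) LipschitzWith.id).exists_lintegral_average_le 1
  refine ⟨V, hV0, ?_⟩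
  intro T _ _ N δ hN hδ t t'
  have hN' : (0 : ℝ) < N := by exact_mod_cast hN
  have h := hV (N := N) (a := N) (e := id) 0 (Pi.single t 1) (Pi.single t' (1 : ℝ))
    Function.injective_id hN (by simp) (by simp)
  have hg : gaussPair (fun u v => id u * id v) ((Pi.single t 1 : T → ℝ) ⬝ᵥ Pi.single t 1)
      ((Pi.single t 1 : T → ℝ) ⬝ᵥ Pi.single t' 1) ((Pi.single t' 1 : T → ℝ) ⬝ᵥ Pi.single t' 1)
      = if t = t' then 1 else 0 := by
    rw [gaussPair_gram _ _ (by simp only [id]; exact measurable_fst.mul measurable_snd)]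
    simp only [id]
    rw [integral_dotProduct_mul_gaussian]
    simp [Pi.single_apply, eq_comm]
  simp only [zero_pow two_ne_zero, add_zero, hg, zero_mul] at h
  have hm : Measurable fun g : T → Fin N → ℝ =>
      |1 / (N : ℝ) * (g t ⬝ᵥ g t') - if t = t' then 1 else 0| := by
    simp only [dotProduct]
    fun_prop
  have h1 : ∫⁻ g : T → Fin N → ℝ,
      ENNReal.ofReal |1 / (N : ℝ) * (g t ⬝ᵥ g t') - if t = t' then 1 else 0|
      ∂(Measure.pi fun _ : T => Measure.pi fun _ : Fin N => gaussianReal 0 1)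
      ≤ ENNReal.ofReal √(V / N) := by
    refine le_trans (le_of_eq ?_) h
    have hfst : MeasurePreserving (Prod.fst : (T → Fin N → ℝ) × (Fin N → ℝ) → _)
        ((Measure.pi fun _ => Measure.pi fun _ => gaussianReal 0 1).prod
          (Measure.pi fun _ => gaussianReal 0 1)) _ := measurePreserving_fst
    rw [← hfst.lintegral_comp hm.ennreal_ofReal]
    refine lintegral_congr fun w => ?_
    simp [dotProduct, Pi.single_apply]
  refine le_trans (measure_mono fun g hg => ?_) (measure_le_of_lintegral_ofReal_le hm hδ h1)
  simp only [Set.mem_ofPred_eq] at hg ⊢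
  have e : g t ⬝ᵥ g t' - (if t = t' then (N : ℝ) else 0)
      = N * (1 / (N : ℝ) * (g t ⬝ᵥ g t') - if t = t' then 1 else 0) := by
    split_ifs
    · field_simp
    · field_simp
      simp
  rw [e, abs_mul, abs_of_pos hN', mul_comm] at hg
  exact le_of_mul_le_mul_left hg hN'

/-- With high probability, all pairs of a finite number of Gaussian vectors are nearly orthogonal. -/
theorem exists_half_le_measure_nearOrthogonal (S : Type) [Fintype S] {δ : ℝ} (hδ : 0 < δ) :
    ∃ n₀ : ℕ, ∀ N ≥ n₀, ∃ G : Set (S × Bool → Fin N → ℝ), MeasurableSet G ∧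
      (∀ g ∈ G, ∀ s, NearOrthogonal δ (g (s, false)) (g (s, true))) ∧
      1 / 2 ≤ (Measure.pi fun _ : S × Bool => Measure.pi fun _ : Fin N => gaussianReal 0 1) G := by
  classical
  obtain ⟨V, hV0, hV⟩ := measure_gaussian_inner_le
  have hlim : Tendsto (fun N : ℕ => (Fintype.card (S × Bool) : ℝ) ^ 2 * (√(V / N) / δ)) atTop (𝓝 0) := by
    have h1 : Tendsto (fun N : ℕ => V / (N : ℝ)) atTop (𝓝 0) :=
      tendsto_const_nhds.div_atTop tendsto_natCast_atTop_atTop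
    have h2 := ((Real.continuous_sqrt.tendsto 0).comp h1).div_const δ
    simpa using h2.const_mul ((Fintype.card (S × Bool) : ℝ) ^ 2)
  obtain ⟨n₀, hn₀⟩ := eventually_atTop.mp ((tendsto_order.mp hlim).2 (1 / 2) (by norm_num))
  refine ⟨n₀ + 1, fun N hN => ?_⟩
  have hNpos : 0 < N := by omega
  set P := Measure.pi fun _ : S × Bool => Measure.pi fun _ : Fin N => gaussianReal 0 1
  set E : (S × Bool) × (S × Bool) → Set (S × Bool → Fin N → ℝ) := fun q =>
    {g | δ * N ≤ |g q.1 ⬝ᵥ g q.2 - if q.1 = q.2 then (N : ℝ) else 0|}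
  have hEm : ∀ q, MeasurableSet (E q) := by
    intro q
    refine measurableSet_le measurable_const ?_
    simp only [dotProduct]
    fun_prop
  have hU : P (⋃ q, E q) ≤ 1 / 2 := by
    calc P (⋃ q, E q) ≤ ∑ q, P (E q) := measure_iUnion_fintype_le _ _
      _ ≤ ∑ q : (S × Bool) × (S × Bool), ENNReal.ofReal (√(V / N) / δ) :=
          Finset.sum_le_sum fun q _ => hV hNpos hδ q.1 q.2
      _ = ENNReal.ofReal ((Fintype.card (S × Bool) : ℝ) ^ 2 * (√(V / N) / δ)) := by
          rw [Finset.sum_const, Finset.card_univ, Fintype.card_prod (S × Bool), nsmul_eq_mul,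
            ENNReal.ofReal_mul (by positivity), ← Nat.cast_pow, ENNReal.ofReal_natCast, sq]
      _ ≤ ENNReal.ofReal (1 / 2) := ENNReal.ofReal_le_ofReal (hn₀ N (by omega)).le
      _ = 1 / 2 := by
          rw [ENNReal.ofReal_div_of_pos (by norm_num)]; simp
  refine ⟨(⋃ q, E q)ᶜ, (MeasurableSet.iUnion hEm).compl, fun g hg s => ?_, ?_⟩
  · simp only [Set.mem_compl_iff, Set.mem_iUnion, not_exists, E, Set.mem_ofPred_eq, not_le] at hg
    have h1 := (hg ((s, false), (s, false))).le
    have h2 := (hg ((s, true), (s, true))).le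
    have h3 := (hg ((s, false), (s, true))).le
    simp only [if_true] at h1 h2
    simp only [Prod.mk.injEq, Bool.false_eq_true, and_false, if_false, sub_zero] at h3
    exact ⟨h1, h2, h3⟩
  · rw [prob_compl_eq_one_sub (MeasurableSet.iUnion hEm)]
    refine ENNReal.le_sub_of_add_le_right (by simp [measure_ne_top]) ?_
    calc (1 / 2 : ℝ≥0∞) + P (⋃ q, E q) ≤ 1 / 2 + 1 / 2 := by gcongr
      _ = 1 := ENNReal.add_halves 1

theorem rowPre_sub {S : Type*} [Fintype S] {N a : ℕ} (e : Fin a → Fin N) (σ : ℝ)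
    (Q : S → OrthGroup N) (β : Fin a → ℝ) (u v : S → Fin N → ℝ) (i : Fin a) :
    rowPre e σ Q β u i - rowPre e σ Q β v i = rowPre e 0 Q β (u - v) i := by
  simp only [rowPre, Pi.sub_apply, Matrix.mulVec_sub, Finset.sum_sub_distrib]
  ring

/-- Averages of tame functions of two nearby families of pre-activations. -/
theorem lintegral_abs_average_rowPre_sub_le {Ψ : ℝ → ℝ → ℝ} {ε C : ℝ} (hε : 0 ≤ ε) (hC : 0 ≤ C)
    (hest : ∀ x y x' y' : ℝ, |Ψ x y - Ψ x' y'|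
      ≤ ε * (1 + x ^ 2 + y ^ 2 + x' ^ 2 + y' ^ 2) + C * ((x - x') ^ 2 + (y - y') ^ 2))
    {S : Type*} [Fintype S] {N a : ℕ} (ha : 0 < a) (e : Fin a → Fin N) (σ : ℝ)
    (u u' v v' : S → Fin N → ℝ) {D D' : ℝ}
    (h1 : 2 * Fintype.card S * ∑ s, u s ⬝ᵥ u s / N + 2 * σ ^ 2 ≤ D)
    (h2 : 2 * Fintype.card S * ∑ s, u' s ⬝ᵥ u' s / N + 2 * σ ^ 2 ≤ D)
    (h3 : 2 * Fintype.card S * ∑ s, v s ⬝ᵥ v s / N + 2 * σ ^ 2 ≤ D)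
    (h4 : 2 * Fintype.card S * ∑ s, v' s ⬝ᵥ v' s / N + 2 * σ ^ 2 ≤ D)
    (h5 : 2 * Fintype.card S * ∑ s, (u s - v s) ⬝ᵥ (u s - v s) / N ≤ D')
    (h6 : 2 * Fintype.card S * ∑ s, (u' s - v' s) ⬝ᵥ (u' s - v' s) / N ≤ D') :
    ∫⁻ p, ENNReal.ofReal
      |(1 / a : ℝ) * ∑ i, Ψ (rowPre e σ p.1 p.2 u i) (rowPre e σ p.1 p.2 u' i)
        - (1 / a : ℝ) * ∑ i, Ψ (rowPre e σ p.1 p.2 v i) (rowPre e σ p.1 p.2 v' i)|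
      ∂(haarBias S N a) ≤ ENNReal.ofReal (ε * (1 + 4 * D) + C * (2 * D')) := by
  have ha' : (0 : ℝ) < a := by exact_mod_cast ha
  let G : Fin a → (S → OrthGroup N) × (Fin a → ℝ) → ℝ := fun i p =>
    ε * (1 + rowPre e σ p.1 p.2 u i ^ 2 + rowPre e σ p.1 p.2 u' i ^ 2 + rowPre e σ p.1 p.2 v i ^ 2
      + rowPre e σ p.1 p.2 v' i ^ 2)
      + C * (rowPre e 0 p.1 p.2 (u - v) i ^ 2 + rowPre e 0 p.1 p.2 (u' - v') i ^ 2)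
  have hG0 : ∀ i p, 0 ≤ G i p := fun i p => by
    simp only [G]; positivity
  have hGi : ∀ i, Integrable (G i) (haarBias S N a) ∧ ∫ p, G i p ∂(haarBias S N a)
      ≤ ε * (1 + 4 * D) + C * (2 * D') := by
    intro i
    have k := fun w => integrable_rowPre_sq (S := S) e σ w i
    have k0 := fun w => integrable_rowPre_sq (S := S) e 0 w i
    have j1 : Integrable (fun p : (S → OrthGroup N) × (Fin a → ℝ) =>
        1 + rowPre e σ p.1 p.2 u i ^ 2) (haarBias S N a) := (integrable_const 1).add (k u)
    have j2 : Integrable (fun p : (S → OrthGroup N) × (Fin a → ℝ) =>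
        1 + rowPre e σ p.1 p.2 u i ^ 2 + rowPre e σ p.1 p.2 u' i ^ 2) (haarBias S N a) := j1.add (k u')
    have j3 : Integrable (fun p : (S → OrthGroup N) × (Fin a → ℝ) =>
        1 + rowPre e σ p.1 p.2 u i ^ 2 + rowPre e σ p.1 p.2 u' i ^ 2
          + rowPre e σ p.1 p.2 v i ^ 2) (haarBias S N a) := j2.add (k v)
    have j4 : Integrable (fun p : (S → OrthGroup N) × (Fin a → ℝ) =>
        1 + rowPre e σ p.1 p.2 u i ^ 2 + rowPre e σ p.1 p.2 u' i ^ 2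
          + rowPre e σ p.1 p.2 v i ^ 2 + rowPre e σ p.1 p.2 v' i ^ 2) (haarBias S N a) := j3.add (k v')
    have j5 : Integrable (fun p : (S → OrthGroup N) × (Fin a → ℝ) =>
        rowPre e 0 p.1 p.2 (u - v) i ^ 2 + rowPre e 0 p.1 p.2 (u' - v') i ^ 2) (haarBias S N a) :=
      (k0 _).add (k0 _)
    refine ⟨(j4.const_mul ε).add (j5.const_mul C), ?_⟩
    simp only [G]
    rw [integral_add (j4.const_mul ε) (j5.const_mul C), integral_const_mul, integral_const_mul,
      integral_add j3 (k v'), integral_add j2 (k v), integral_add j1 (k u'),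
      integral_add (integrable_const 1) (k u), integral_add (k0 _) (k0 _)]
    have b1 := (integral_rowPre_sq_le e σ u i).trans h1
    have b2 := (integral_rowPre_sq_le e σ u' i).trans h2
    have b3 := (integral_rowPre_sq_le e σ v i).trans h3
    have b4 := (integral_rowPre_sq_le e σ v' i).trans h4
    have b5 := (integral_rowPre_sq_le e 0 (u - v) i).trans (by simpa using h5)
    have b6 := (integral_rowPre_sq_le e 0 (u' - v') i).trans (by simpa using h6)
    simp only [integral_const, probReal_univ, smul_eq_mul, one_mul]
    exact add_le_add (mul_le_mul_of_nonneg_left (by linarith) hε)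
      (mul_le_mul_of_nonneg_left (by linarith) hC)
  have hint : Integrable (fun p => (1 / a : ℝ) * ∑ i, G i p) (haarBias S N a) :=
    (integrable_finsetSum _ fun i _ => (hGi i).1).const_mul _
  refine lintegral_ofReal_le_of_le hint
    (fun p => mul_nonneg (by positivity) (Finset.sum_nonneg fun i _ => hG0 i p)) (fun p => ?_) ?_
  · rw [← mul_sub, ← Finset.sum_sub_distrib, abs_mul, abs_of_nonneg (by positivity : (0 : ℝ) ≤ 1 / a)]
    refine mul_le_mul_of_nonneg_left ?_ (by positivity)
    refine (Finset.abs_sum_le_sum_abs _ _).trans (Finset.sum_le_sum fun i _ => ?_)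
    refine (hest _ _ _ _).trans (le_of_eq ?_)
    rw [rowPre_sub, rowPre_sub]
  · rw [integral_const_mul, integral_finsetSum _ fun i _ => (hGi i).1]
    have hs := Finset.sum_le_sum fun i (_ : i ∈ (Finset.univ : Finset (Fin a))) => (hGi i).2
    simp only [Finset.sum_const, Finset.card_univ, Fintype.card_fin, nsmul_eq_mul] at hs
    rw [one_div, inv_mul_le_iff₀ ha']
    exact hs

theorem measurePreserving_haarBias_mul_right {S : Type*} [Fintype S] {N a : ℕ}
    (R : S → OrthGroup N) :
    MeasurePreserving (fun p : (S → OrthGroup N) × (Fin a → ℝ) => ((fun s => p.1 s * R s), p.2))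
      (haarBias S N a) (haarBias S N a) :=
  (measurePreserving_pi _ _ fun s => measurePreserving_mul_right_haarOrth (R s)).prod
    (MeasurePreserving.id _)

theorem rowPre_mul {S : Type*} [Fintype S] {N a : ℕ} (e : Fin a → Fin N) (σ : ℝ)
    (Q R : S → OrthGroup N) (β : Fin a → ℝ) (u : S → Fin N → ℝ) (i : Fin a) :
    rowPre e σ (fun s => Q s * R s) β u i = rowPre e σ Q β (fun s => (R s).1 *ᵥ u s) i := by
  simp only [rowPre, Matrix.mulVec_mulVec]
  rfl

theorem dotProduct_self_le_of_sub {N : ℕ} (v w : Fin N → ℝ) :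
    v ⬝ᵥ v ≤ 2 * (w ⬝ᵥ w) + 2 * ((w - v) ⬝ᵥ (w - v)) := by
  simp only [dotProduct, Finset.mul_sum, ← Finset.sum_add_distrib, Pi.sub_apply]
  refine Finset.sum_le_sum fun i _ => ?_
  nlinarith [sq_nonneg (v i - 2 * w i)]

theorem lintegral_ofReal_abs_sub_le {Ω : Type*} [MeasurableSpace Ω] {μ : Measure Ω} {X Y : Ω → ℝ}
    (c : ℝ) (hX : Measurable X) (hY : Measurable Y) :
    ∫⁻ ω, ENNReal.ofReal |X ω - c| ∂μ
      ≤ ∫⁻ ω, ENNReal.ofReal |X ω - Y ω| ∂μ + ∫⁻ ω, ENNReal.ofReal |Y ω - c| ∂μ := by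
  rw [← lintegral_add_left (f := fun ω => ENNReal.ofReal |X ω - Y ω|)
    (hX.sub hY).abs.ennreal_ofReal]
  refine lintegral_mono fun P => ?_
  rw [← ENNReal.ofReal_add (abs_nonneg _) (abs_nonneg _)]
  exact ENNReal.ofReal_le_ofReal (abs_sub_le _ _ _)

/-- Averages over the rows of a Gaussian matrix multiplied by a Haar orthogonal matrix. -/
theorem lintegral_lintegral_rowPre_gaussian {S : Type} [Fintype S] {N a : ℕ}
    (e : Fin a → Fin N) (σ : ℝ) (A B : S × Bool → ℝ) {f : (Fin a → ℝ) → (Fin a → ℝ) → ℝ≥0∞}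
    (hf : Measurable (Function.uncurry f)) :
    ∫⁻ g, ∫⁻ p, f
        (rowPre e σ p.1 p.2 fun s => A (s, false) • g (s, false) + A (s, true) • g (s, true))
        (rowPre e σ p.1 p.2 fun s => B (s, false) • g (s, false) + B (s, true) • g (s, true))
        ∂(haarBias S N a)
        ∂(Measure.pi fun _ : S × Bool => Measure.pi fun _ : Fin N => gaussianReal 0 1)
      = ∫⁻ w : (S × Bool → Fin N → ℝ) × (Fin a → ℝ),
          f (fun i => ∑ k, A k * w.1 k (e i) + σ * w.2 i)
            (fun i => ∑ k, B k * w.1 k (e i) + σ * w.2 i)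
          ∂((Measure.pi fun _ => Measure.pi fun _ => gaussianReal 0 1).prod
            (Measure.pi fun _ => gaussianReal 0 1)) := by
  have hQ : ∀ (A : S × Bool → ℝ) (Q : S → OrthGroup N) (β : Fin a → ℝ) (g : S × Bool → Fin N → ℝ),
      (rowPre e σ Q β fun s => A (s, false) • g (s, false) + A (s, true) • g (s, true))
        = fun i => ∑ k, A k * ((Q k.1).1 *ᵥ g k) (e i) + σ * β i := by
    intro A Q β g
    funext i
    simp only [rowPre, Matrix.mulVec_add, Matrix.mulVec_smul, Pi.add_apply, Pi.smul_apply,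
      smul_eq_mul, Fintype.sum_prod_type, Fintype.sum_bool]
    congr 1
    exact Finset.sum_congr rfl fun s _ => add_comm _ _
  simp_rw [hQ]
  have hm1 : ∀ A : S × Bool → ℝ, Measurable fun z : (S × Bool → Fin N → ℝ) ×
      ((S → OrthGroup N) × (Fin a → ℝ)) =>
        fun i => ∑ k, A k * ((z.2.1 k.1).1 *ᵥ z.1 k) (e i) + σ * z.2.2 i := by
    intro A
    refine measurable_pi_lambda _ fun i => ?_
    refine (Finset.measurable_sum _ fun k _ => Measurable.const_mul ?_ _).add (by fun_prop)
    simp only [Matrix.mulVec, dotProduct]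
    refine Finset.measurable_sum _ fun j _ => Measurable.mul ?_ (by fun_prop)
    exact (OrthGroup.measurable_apply (e i) j).comp (by fun_prop)
  rw [lintegral_lintegral_swap (f := fun (g : S × Bool → Fin N → ℝ)
    (p : (S → OrthGroup N) × (Fin a → ℝ)) =>
      f (fun i => ∑ k, A k * ((p.1 k.1).1 *ᵥ g k) (e i) + σ * p.2 i)
        (fun i => ∑ k, B k * ((p.1 k.1).1 *ᵥ g k) (e i) + σ * p.2 i))
    (hf.comp ((hm1 A).prodMk (hm1 B))).aemeasurable]
  have hm2 : ∀ A : S × Bool → ℝ, Measurable fun w : (S × Bool → Fin N → ℝ) × (Fin a → ℝ) =>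
      fun i => ∑ k, A k * w.1 k (e i) + σ * w.2 i := by
    intro A
    fun_prop
  have hm3 : Measurable fun w : (S × Bool → Fin N → ℝ) × (Fin a → ℝ) =>
      f (fun i => ∑ k, A k * w.1 k (e i) + σ * w.2 i)
        (fun i => ∑ k, B k * w.1 k (e i) + σ * w.2 i) := hf.comp ((hm2 A).prodMk (hm2 B))
  -- After exchanging the integrals the matrices are fixed, and rotation invariance of the Gaussian
  -- vectors removes them. The same matrix acts on both vectors `(s, false)` and `(s, true)`, which
  -- stay independent.
  have hin : ∀ p : (S → OrthGroup N) × (Fin a → ℝ),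
      ∫⁻ g : S × Bool → Fin N → ℝ, f (fun i => ∑ k, A k * ((p.1 k.1).1 *ᵥ g k) (e i) + σ * p.2 i)
          (fun i => ∑ k, B k * ((p.1 k.1).1 *ᵥ g k) (e i) + σ * p.2 i)
        ∂(Measure.pi fun _ => Measure.pi fun _ => gaussianReal 0 1)
      = ∫⁻ g : S × Bool → Fin N → ℝ, f (fun i => ∑ k, A k * g k (e i) + σ * p.2 i)
          (fun i => ∑ k, B k * g k (e i) + σ * p.2 i)
        ∂(Measure.pi fun _ => Measure.pi fun _ => gaussianReal 0 1) := by
    intro p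
    have hmp := measurePreserving_pi (fun _ : S × Bool => Measure.pi fun _ : Fin N => gaussianReal 0 1)
      (fun _ : S × Bool => Measure.pi fun _ : Fin N => gaussianReal 0 1)
      (fun k => measurePreserving_mulVec_gaussian (p.1 k.1))
    exact hmp.lintegral_comp (f := fun g => f (fun i => ∑ k, A k * g k (e i) + σ * p.2 i)
      (fun i => ∑ k, B k * g k (e i) + σ * p.2 i))
      (hm3.comp (measurable_id.prodMk measurable_const))
  simp_rw [hin]
  have hsnd : MeasurePreserving (Prod.snd : (S → OrthGroup N) × (Fin a → ℝ) → _)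
      (haarBias S N a) (Measure.pi fun _ => gaussianReal 0 1) := measurePreserving_snd
  rw [hsnd.lintegral_comp (f := fun β => ∫⁻ g : S × Bool → Fin N → ℝ,
      f (fun i => ∑ k, A k * g k (e i) + σ * β i) (fun i => ∑ k, B k * g k (e i) + σ * β i)
        ∂(Measure.pi fun _ => Measure.pi fun _ => gaussianReal 0 1)) hm3.lintegral_prod_left',
    lintegral_prod_symm _ hm3.aemeasurable]

set_option maxHeartbeats 1000000 in
/-- The empirical averages of a tame function over the coordinates of `∑ₛ Qₛ uₛ + σ β` and
`∑ₛ Qₛ u'ₛ + σ β`, with Haar orthogonal `Qₛ`, are close to a Gaussian expectation. -/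
theorem QuadTame.exists_lintegral_rowPre_le {Ψ : ℝ → ℝ → ℝ} (hΨ : QuadTame Ψ) (S : Type)
    [Fintype S] (t : ℝ) {ε : ℝ} (hε : 0 < ε) :
    ∃ n₀ : ℕ, ∀ {N a : ℕ} {e : Fin a → Fin N} (σ : ℝ) (u u' : S → Fin N → ℝ), n₀ ≤ a →
      Function.Injective e → ∑ s, u s ⬝ᵥ u s / N + σ ^ 2 ≤ t →
      ∑ s, u' s ⬝ᵥ u' s / N + σ ^ 2 ≤ t →
      ∫⁻ p, ENNReal.ofReal |(1 / a : ℝ) *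
          ∑ i, Ψ (rowPre e σ p.1 p.2 u i) (rowPre e σ p.1 p.2 u' i)
          - gaussPair Ψ (∑ s, u s ⬝ᵥ u s / N + σ ^ 2) (∑ s, u s ⬝ᵥ u' s / N + σ ^ 2)
            (∑ s, u' s ⬝ᵥ u' s / N + σ ^ 2)|
        ∂(haarBias S N a) ≤ ENNReal.ofReal ε := by
  obtain ⟨V, hV0, hV⟩ := hΨ.exists_lintegral_average_le t
  set m : ℝ := (Fintype.card S : ℝ) with hm
  -- Common bound for the second moments: the approximating vectors have squared norm at most `8
  -- |t|`, `rowPre_sq_le` costs `2 m`, and the bias adds `2 σ ^ 2`.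
  set D : ℝ := (16 * m + 2) * |t| with hD
  have hm0 : 0 ≤ m := by positivity
  have hD0 : 0 ≤ D := by positivity
  set ε₁ : ℝ := ε / (8 * (1 + 4 * D)) with hε₁
  have hε₁0 : 0 < ε₁ := by positivity
  obtain ⟨C, hC0, hC⟩ := hΨ.est ε₁ hε₁0
  -- The distance term of the tame estimate is at most `C * (24 * m * |t|) * δ`; the choice makes it
  -- at most `ε / 8`, like the growth term.
  set δ : ℝ := min (1 / 2) (ε / (8 * (C * (24 * m * |t|) + 1))) with hδ
  have hδ0 : 0 < δ := by positivity
  obtain ⟨n₁, hn₁⟩ := exists_half_le_measure_nearOrthogonal S hδ0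
  have hlim : Tendsto (fun a : ℕ => √(V / a)) atTop (𝓝 0) := by
    have h1 : Tendsto (fun N : ℕ => V / (N : ℝ)) atTop (𝓝 0) :=
      tendsto_const_nhds.div_atTop tendsto_natCast_atTop_atTop
    have h2 := (Real.continuous_sqrt.tendsto 0).comp h1
    rw [Real.sqrt_zero] at h2
    exact h2
  obtain ⟨n₂, hn₂⟩ := eventually_atTop.mp ((tendsto_order.mp hlim).2 (ε / 4) (by positivity))
  refine ⟨n₁ + n₂ + 2, ?_⟩
  intro N a e σ u u' ha he hu hu'
  have haN : a ≤ N := by simpa using Fintype.card_le_of_injective e he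
  have ha0 : 0 < a := by omega
  have hN0 : (0 : ℝ) < N := by exact_mod_cast (by omega : 0 < N)
  obtain ⟨G, hGm, hG, hGP⟩ := hn₁ N (by omega)
  choose p q r hp hpq hqr hR using fun s => exists_coupling_coeff (by omega : 2 ≤ N) (u s) (u' s)
  let A : S × Bool → ℝ := fun k => if k.2 then 0 else p k.1
  let B : S × Bool → ℝ := fun k => if k.2 then r k.1 else q k.1
  have hAA : A ⬝ᵥ A = ∑ s, u s ⬝ᵥ u s / N := by
    simp only [dotProduct, Fintype.sum_prod_type, Fintype.sum_bool, A]
    refine Finset.sum_congr rfl fun s _ => ?_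
    have := hp s
    simp only [dotProduct] at this
    rw [← this]; simp; ring
  have hAB : A ⬝ᵥ B = ∑ s, u s ⬝ᵥ u' s / N := by
    simp only [dotProduct, Fintype.sum_prod_type, Fintype.sum_bool, A, B]
    refine Finset.sum_congr rfl fun s _ => ?_
    have := hpq s
    simp only [dotProduct] at this
    rw [← this]; simp
  have hBB : B ⬝ᵥ B = ∑ s, u' s ⬝ᵥ u' s / N := by
    simp only [dotProduct, Fintype.sum_prod_type, Fintype.sum_bool, B]
    refine Finset.sum_congr rfl fun s _ => ?_
    have := hqr s
    simp only [dotProduct] at this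
    rw [← this]; simp; ring
  set c := gaussPair Ψ (∑ s, u s ⬝ᵥ u s / N + σ ^ 2) (∑ s, u s ⬝ᵥ u' s / N + σ ^ 2)
            (∑ s, u' s ⬝ᵥ u' s / N + σ ^ 2) with hc
  set L := ∫⁻ p, ENNReal.ofReal |(1 / a : ℝ) *
          ∑ i, Ψ (rowPre e σ p.1 p.2 u i) (rowPre e σ p.1 p.2 u' i) - c| ∂(haarBias S N a) with hL
  let f : (Fin a → ℝ) → (Fin a → ℝ) → ℝ≥0∞ := fun y y' =>
    ENNReal.ofReal |(1 / a : ℝ) * ∑ i, Ψ (y i) (y' i) - c|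
  have hfm : Measurable (Function.uncurry f) := by
    refine Measurable.ennreal_ofReal (Measurable.abs (Measurable.sub_const (Measurable.const_mul
      (Finset.measurable_sum _ fun i _ => ?_) _) _))
    exact hΨ.measurable.comp (f := fun z : (Fin a → ℝ) × (Fin a → ℝ) => (z.1 i, z.2 i))
      (by fun_prop)
  have hfam : ∀ w w' : S → Fin N → ℝ, Measurable fun P : (S → OrthGroup N) × (Fin a → ℝ) =>
      (1 / a : ℝ) * ∑ i, Ψ (rowPre e σ P.1 P.2 w i) (rowPre e σ P.1 P.2 w' i) := fun w w' =>
    (Finset.measurable_sum _ fun i _ => hΨ.measurable.comp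
      ((measurable_rowPre e σ w i).prodMk (measurable_rowPre e σ w' i))).const_mul _
  let J : (S × Bool → Fin N → ℝ) → ℝ≥0∞ := fun g => ∫⁻ P, f
        (rowPre e σ P.1 P.2 fun s => A (s, false) • g (s, false) + A (s, true) • g (s, true))
        (rowPre e σ P.1 P.2 fun s => B (s, false) • g (s, false) + B (s, true) • g (s, true))
        ∂(haarBias S N a)
  have hσt : 0 ≤ σ ^ 2 := sq_nonneg σ
  have hnn : ∀ w : S → Fin N → ℝ, 0 ≤ ∑ s, w s ⬝ᵥ w s / N := fun w =>
    Finset.sum_nonneg fun s _ => div_nonneg (dotProduct_self_nonneg_real _) hN0.le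
  have htt := le_abs_self t
  have hδ2 : δ ≤ 1 / 2 := min_le_left _ _
  -- The left side does not involve `g`: each good Gaussian configuration yields its own rotation,
  -- and right invariance of Haar measure absorbs it.
  have key : ∀ g ∈ G, L ≤ ENNReal.ofReal (ε / 4) + J g := by
    intro g hg
    choose R hR1 hR2 using fun s => hR s δ hδ2 _ _ (hG g hg s)
    have hvA : (fun s => A (s, false) • g (s, false) + A (s, true) • g (s, true))
        = fun s => p s • g (s, false) := by funext s; simp [A]
    have hvB : (fun s => B (s, false) • g (s, false) + B (s, true) • g (s, true))
        = fun s => q s • g (s, false) + r s • g (s, true) := by funext s; simp [B]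
    have hL' : L = ∫⁻ P, ENNReal.ofReal |(1 / a : ℝ) *
          ∑ i, Ψ (rowPre e σ P.1 P.2 (fun s => (R s).1 *ᵥ u s) i)
            (rowPre e σ P.1 P.2 (fun s => (R s).1 *ᵥ u' s) i) - c| ∂(haarBias S N a) := by
      have := (measurePreserving_haarBias_mul_right (a := a) R).lintegral_comp
        ((hfam u u').sub_const c).abs.ennreal_ofReal
      rw [hL, ← this]
      simp only [rowPre_mul]
    have hn : ∀ (w v : S → Fin N → ℝ) (κ : ℝ), κ ≤ 6 * δ → 0 ≤ κ → 
        ∑ s, w s ⬝ᵥ w s / N + σ ^ 2 ≤ t → (∀ s, ((R s).1 *ᵥ w s - v s) ⬝ᵥ ((R s).1 *ᵥ w s - v s) / N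
          ≤ κ * (w s ⬝ᵥ w s / N)) →
        2 * m * ∑ s, ((R s).1 *ᵥ w s) ⬝ᵥ ((R s).1 *ᵥ w s) / N + 2 * σ ^ 2 ≤ D ∧
        2 * m * ∑ s, v s ⬝ᵥ v s / N + 2 * σ ^ 2 ≤ D ∧
        2 * m * ∑ s, ((R s).1 *ᵥ w s - v s) ⬝ᵥ ((R s).1 *ᵥ w s - v s) / N
          ≤ 12 * m * δ * |t| := by
      intro w v κ hκ hκ0 hw hv
      have w0 := hnn w
      have hRw : ∑ s, ((R s).1 *ᵥ w s) ⬝ᵥ ((R s).1 *ᵥ w s) / N = ∑ s, w s ⬝ᵥ w s / N :=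
        Finset.sum_congr rfl fun s _ => by rw [OrthGroup.mulVec_dotProduct_mulVec]
      have hdiff : ∑ s, ((R s).1 *ᵥ w s - v s) ⬝ᵥ ((R s).1 *ᵥ w s - v s) / N
          ≤ κ * ∑ s, w s ⬝ᵥ w s / N := by
        rw [Finset.mul_sum]
        exact Finset.sum_le_sum fun s _ => hv s
      have hvv : ∑ s, v s ⬝ᵥ v s / N ≤ 2 * ∑ s, w s ⬝ᵥ w s / N
          + 2 * ∑ s, ((R s).1 *ᵥ w s - v s) ⬝ᵥ ((R s).1 *ᵥ w s - v s) / N := by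
        rw [Finset.mul_sum, Finset.mul_sum, ← Finset.sum_add_distrib]
        refine Finset.sum_le_sum fun s _ => ?_
        have := dotProduct_self_le_of_sub (v s) ((R s).1 *ᵥ w s)
        rw [OrthGroup.mulVec_dotProduct_mulVec] at this
        calc v s ⬝ᵥ v s / N ≤ _ := div_le_div_of_nonneg_right this hN0.le
          _ = _ := by ring
      set W := ∑ s, w s ⬝ᵥ w s / N
      set X := ∑ s, ((R s).1 *ᵥ w s - v s) ⬝ᵥ ((R s).1 *ᵥ w s - v s) / N
      have hW : W ≤ |t| := by linarith
      have hs : σ ^ 2 ≤ |t| := by linarith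
      have hX : X ≤ 6 * δ * |t| := hdiff.trans (mul_le_mul hκ hW w0 (by positivity))
      have hX3 : X ≤ 3 * |t| := hX.trans (by nlinarith [abs_nonneg t])
      have hmt : 0 ≤ m * |t| := by positivity
      refine ⟨?_, ?_, ?_⟩
      · rw [hRw]
        have := mul_le_mul_of_nonneg_left hW hm0
        simp only [hD]; nlinarith
      · have h8 : ∑ s, v s ⬝ᵥ v s / N ≤ 8 * |t| := by linarith
        have := mul_le_mul_of_nonneg_left h8 hm0
        simp only [hD]; nlinarith
      · have := mul_le_mul_of_nonneg_left hX hm0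
        nlinarith
    obtain ⟨a1, a2, a3⟩ := hn u (fun s => p s • g (s, false)) (3 * δ) (by linarith) (by linarith) hu hR1
    obtain ⟨b1, b2, b3⟩ := hn u' (fun s => q s • g (s, false) + r s • g (s, true)) (6 * δ) le_rfl
      (by linarith) hu' hR2
    have hmain := lintegral_abs_average_rowPre_sub_le hε₁0.le hC0 hC ha0 e σ
      (fun s => (R s).1 *ᵥ u s) (fun s => (R s).1 *ᵥ u' s) _ _ a1 b1 a2 b2 a3 b3
    have herr : ε₁ * (1 + 4 * D) + C * (2 * (12 * m * δ * |t|)) ≤ ε / 4 := by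
      have h1 : ε₁ * (1 + 4 * D) = ε / 8 := by
        rw [hε₁]; field_simp
      have h2 : δ * (C * (24 * m * |t|)) ≤ ε / 8 := by
        have hle : δ ≤ ε / (8 * (C * (24 * m * |t|) + 1)) := min_le_right _ _
        have hx : 0 ≤ C * (24 * m * |t|) := by positivity
        generalize C * (24 * m * |t|) = X at hle hx
        rw [le_div_iff₀ (by positivity)] at hle
        linarith
      linarith
    refine le_trans (le_of_eq hL') ?_
    refine le_trans ?_ (add_le_add (hmain.trans (ENNReal.ofReal_le_ofReal herr)) le_rfl)
    simp only [J, f, hvA, hvB]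
    exact lintegral_ofReal_abs_sub_le _ (hfam _ _) (hfam _ _)
  have hJ : ∫⁻ g, J g ∂(Measure.pi fun _ : S × Bool => Measure.pi fun _ : Fin N => gaussianReal 0 1)
      ≤ ENNReal.ofReal (ε / 4) := by
    rw [lintegral_lintegral_rowPre_gaussian e σ A B hfm]
    have h := hV (e := e) σ A B he ha0 (by rw [hAA]; exact hu) (by rw [hBB]; exact hu')
    rw [hAA, hAB, hBB, ← hc] at h
    exact h.trans (ENNReal.ofReal_le_ofReal (hn₂ a (by omega)).le)
  set P := Measure.pi fun _ : S × Bool => Measure.pi fun _ : Fin N => gaussianReal 0 1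
  -- As `L` is a constant, it suffices to integrate the bound over the good configurations, whose
  -- probability is at least one half. This avoids estimating anything on the bad ones.
  have hfin : L * (1 / 2) ≤ ENNReal.ofReal (ε / 4) + ENNReal.ofReal (ε / 4) := by
    calc L * (1 / 2) ≤ L * P G := by gcongr
      _ = ∫⁻ g in G, L ∂P := by rw [setLIntegral_const]
      _ ≤ ∫⁻ g in G, (ENNReal.ofReal (ε / 4) + J g) ∂P := setLIntegral_mono' hGm key
      _ ≤ ∫⁻ g, (ENNReal.ofReal (ε / 4) + J g) ∂P := setLIntegral_le_lintegral _ _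
      _ = ENNReal.ofReal (ε / 4) + ∫⁻ g, J g ∂P := by
          rw [lintegral_add_left measurable_const]; simp
      _ ≤ _ := by gcongr
  calc L = L * (1 / 2) * 2 := by
        rw [mul_assoc, ENNReal.div_mul_cancel (by simp) (by simp), mul_one]
    _ ≤ (ENNReal.ofReal (ε / 4) + ENNReal.ofReal (ε / 4)) * 2 := by gcongr
    _ = ENNReal.ofReal ε := by
        rw [← ENNReal.ofReal_add (by positivity) (by positivity),
          show (2 : ℝ≥0∞) = ENNReal.ofReal 2 by simp, ← ENNReal.ofReal_mul (by positivity)]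
        congr 1; ring

/-! ### Densities of pre-activations -/

theorem hasDerivAt_cos_add_sin (X Y θ : ℝ) :
    HasDerivAt (fun θ => Real.cos θ * X + Real.sin θ * Y)
      (-Real.sin θ * X + Real.cos θ * Y) θ :=
  ((Real.hasDerivAt_cos θ).mul_const X).add ((Real.hasDerivAt_sin θ).mul_const Y)

/-- Change of variables along `F θ = cos θ X + sin θ Y`: on the part of `[0, π]` where `F'` has a
fixed sign, `F` is injective, so each of the two signs contributes at most the integral of `f`. -/
theorem lintegral_rotation_le (X Y : ℝ) (f : ℝ → ℝ≥0∞) :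
    ∫⁻ θ in Set.Icc 0 Real.pi, ENNReal.ofReal |-Real.sin θ * X + Real.cos θ * Y|
        * f (Real.cos θ * X + Real.sin θ * Y) ≤ 2 * ∫⁻ x, f x := by
  set F : ℝ → ℝ := fun θ => Real.cos θ * X + Real.sin θ * Y with hF
  set F' : ℝ → ℝ := fun θ => -Real.sin θ * X + Real.cos θ * Y with hF'
  have hF'c : Continuous F' := by fun_prop
  have key : ∀ s : Set ℝ, MeasurableSet s → s ⊆ Set.Icc 0 Real.pi → Set.InjOn F s →
      ∫⁻ θ in s, ENNReal.ofReal |F' θ| * f (F θ) ≤ ∫⁻ x, f x := by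
    intro s hs hsub hinj
    rw [← lintegral_image_eq_lintegral_abs_deriv_mul hs
      (fun θ _ => (hasDerivAt_cos_add_sin X Y θ).hasDerivWithinAt) hinj]
    exact setLIntegral_le_lintegral _ _
  -- The values of `F` and `F'` determine `cos θ`, which is injective on `[0, π]`; and `F`
  -- determines `F'` up to sign because `F ^ 2 + F' ^ 2` is constant.
  have hinj : ∀ θ₁ ∈ Set.Icc 0 Real.pi, ∀ θ₂ ∈ Set.Icc 0 Real.pi, F θ₁ = F θ₂ → F' θ₁ = F' θ₂ →
      F' θ₁ ≠ 0 → θ₁ = θ₂ := by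
    intro θ₁ h₁ θ₂ h₂ h h' h0
    refine Real.injOn_cos h₁ h₂ ?_
    simp only [hF, hF'] at h h' h0
    have hne : X ^ 2 + Y ^ 2 ≠ 0 := by
      intro hz
      have hX : X = 0 := by nlinarith [sq_nonneg X, sq_nonneg Y]
      have hY : Y = 0 := by nlinarith [sq_nonneg X, sq_nonneg Y]
      simp [hX, hY] at h0
    have : (X ^ 2 + Y ^ 2) * (Real.cos θ₁ - Real.cos θ₂) = 0 := by
      linear_combination X * h + Y * h'
    rcases mul_eq_zero.mp this with h | h
    · exact absurd h hne
    · linarith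
  have hsq : ∀ θ, F θ ^ 2 + F' θ ^ 2 = X ^ 2 + Y ^ 2 := by
    intro θ
    simp only [hF, hF']
    linear_combination (X ^ 2 + Y ^ 2) * Real.sin_sq_add_cos_sq θ
  set I := Set.Icc 0 Real.pi with hI
  have hIm : MeasurableSet I := measurableSet_Icc
  set Ip := I ∩ {θ | 0 < F' θ}
  set In := I ∩ {θ | F' θ < 0}
  set Iz := I ∩ {θ | F' θ = 0}
  have hp := key Ip (hIm.inter (measurableSet_lt measurable_const hF'c.measurable))
    Set.inter_subset_left (by
      rintro a ⟨ha, ha'⟩ b ⟨hb, hb'⟩ hab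
      have := hsq a; have h2 := hsq b
      simp only [Set.mem_ofPred_eq] at ha' hb'
      refine hinj a ha b hb hab ?_ ha'.ne'
      rw [hab] at this
      exact (pow_left_inj₀ ha'.le hb'.le two_ne_zero).mp (by linarith))
  have hn := key In (hIm.inter (measurableSet_lt hF'c.measurable measurable_const))
    Set.inter_subset_left (by
      rintro a ⟨ha, ha'⟩ b ⟨hb, hb'⟩ hab
      have := hsq a; have h2 := hsq b
      simp only [Set.mem_ofPred_eq] at ha' hb'
      refine hinj a ha b hb hab ?_ ha'.ne
      rw [hab] at this
      have := (pow_left_inj₀ (neg_pos.mpr ha').le (neg_pos.mpr hb').le two_ne_zero).mp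
        (by rw [neg_sq, neg_sq]; linarith)
      linarith)
  have hz : ∫⁻ θ in Iz, ENNReal.ofReal |F' θ| * f (F θ) = 0 := by
    rw [setLIntegral_congr_fun (g := fun _ => 0)
      (hIm.inter (measurableSet_eq_fun hF'c.measurable measurable_const))]
    · simp
    · rintro θ ⟨_, hθ⟩
      simp only [Set.mem_ofPred_eq] at hθ
      simp [hθ]
  have hcov : I = Ip ∪ (In ∪ Iz) := by
    ext θ
    simp only [Ip, In, Iz, Set.mem_union, Set.mem_inter_iff, Set.mem_ofPred_eq]
    rcases lt_trichotomy (F' θ) 0 with h | h | h <;> tauto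
  calc ∫⁻ θ in I, ENNReal.ofReal |F' θ| * f (F θ)
      = ∫⁻ θ in Ip ∪ (In ∪ Iz), ENNReal.ofReal |F' θ| * f (F θ) := by rw [← hcov]
    _ ≤ (∫⁻ θ in Ip, ENNReal.ofReal |F' θ| * f (F θ))
        + ((∫⁻ θ in In, ENNReal.ofReal |F' θ| * f (F θ))
          + ∫⁻ θ in Iz, ENNReal.ofReal |F' θ| * f (F θ)) :=
        (lintegral_union_le _ _ _).trans (add_le_add le_rfl (lintegral_union_le _ _ _))
    _ ≤ (∫⁻ x, f x) + ((∫⁻ x, f x) + 0) := add_le_add hp (add_le_add hn hz.le)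
    _ = _ := by rw [add_zero, two_mul]

theorem exists_orthGroup_rotation {N : ℕ} {i j : Fin N} (hij : i ≠ j) (θ : ℝ) :
    ∃ R : OrthGroup N, ∀ v : Fin N → ℝ, (R.1 *ᵥ v) i = Real.cos θ * v i + Real.sin θ * v j ∧
      (R.1 *ᵥ v) j = -Real.sin θ * v i + Real.cos θ * v j := by
  have h := Real.sin_sq_add_cos_sq θ
  obtain ⟨R, hRi, hRj⟩ := exists_orthGroup_pair hij
    (f := Real.cos θ • Pi.single i 1 + Real.sin θ • Pi.single j 1)
    (g := -Real.sin θ • Pi.single i 1 + Real.cos θ • Pi.single j 1)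
    (by simp [hij, hij.symm]; linarith) (by simp [hij, hij.symm]; linarith)
    (by simp [hij, hij.symm]; ring)
  have hT : ∀ (v : Fin N → ℝ) (k : Fin N), ((R⁻¹ : OrthGroup N).1 *ᵥ v) k
      = (R.1 *ᵥ Pi.single k 1) ⬝ᵥ v := by
    intro v k
    have : (R⁻¹ : OrthGroup N).1 = R.1ᵀ := rfl
    rw [this, Matrix.mulVec_single_one]
    rfl
  refine ⟨R⁻¹, fun v => ⟨?_, ?_⟩⟩
  · rw [hT, hRi]; simp [add_dotProduct]
  · rw [hT, hRj]; simp [add_dotProduct]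

/-- A coordinate of a Haar rotated vector, weighted by another coordinate, has a density
bounded by `2 / π`. -/
theorem lintegral_haarOrth_coord_le {N : ℕ} {i j : Fin N} (hij : i ≠ j) (u : Fin N → ℝ)
    {f : ℝ → ℝ≥0∞} (hf : Measurable f) :
    ∫⁻ Q, ENNReal.ofReal |(Q.1 *ᵥ u) j| * f ((Q.1 *ᵥ u) i) ∂(haarOrth N) ≤ ∫⁻ x, f x := by
  set L := ∫⁻ Q, ENNReal.ofReal |(Q.1 *ᵥ u) j| * f ((Q.1 *ᵥ u) i) ∂(haarOrth N) with hL
  have hm : ∀ k, Measurable fun Q : OrthGroup N => (Q.1 *ᵥ u) k :=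
    fun k => (OrthGroup.continuous_mulVec u k).measurable
  -- Left invariance lets the rotation by any angle in the plane of `i` and `j` act first. The
  -- weight `|(Q u) j|` then becomes exactly the speed with which coordinate `i` moves, so averaging
  -- over the angle is a change of variables.
  have hθ : ∀ θ : ℝ, L = ∫⁻ Q, ENNReal.ofReal
      |-Real.sin θ * (Q.1 *ᵥ u) i + Real.cos θ * (Q.1 *ᵥ u) j|
      * f (Real.cos θ * (Q.1 *ᵥ u) i + Real.sin θ * (Q.1 *ᵥ u) j) ∂(haarOrth N) := by
    intro θ
    obtain ⟨R, hR⟩ := exists_orthGroup_rotation hij θ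
    have h := (measurePreserving_mul_left_haarOrth R).lintegral_comp
      (f := fun Q : OrthGroup N => ENNReal.ofReal |(Q.1 *ᵥ u) j| * f ((Q.1 *ᵥ u) i))
      ((hm j).abs.ennreal_ofReal.mul (hf.comp (hm i)))
    rw [hL, ← h]
    refine lintegral_congr fun Q => ?_
    have e : ((R * Q : OrthGroup N).1 *ᵥ u) = R.1 *ᵥ (Q.1 *ᵥ u) := by
      rw [Matrix.mulVec_mulVec]; rfl
    rw [e, (hR _).1, (hR _).2]
  have hint : ∫⁻ θ in Set.Icc 0 Real.pi, L ≤ 2 * ∫⁻ x, f x := by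
    calc ∫⁻ θ in Set.Icc 0 Real.pi, L
        = ∫⁻ θ in Set.Icc 0 Real.pi, ∫⁻ Q, ENNReal.ofReal
          |-Real.sin θ * (Q.1 *ᵥ u) i + Real.cos θ * (Q.1 *ᵥ u) j|
          * f (Real.cos θ * (Q.1 *ᵥ u) i + Real.sin θ * (Q.1 *ᵥ u) j) ∂(haarOrth N) :=
            lintegral_congr fun θ => hθ θ
      _ = ∫⁻ Q, (∫⁻ θ in Set.Icc 0 Real.pi, ENNReal.ofReal
          |-Real.sin θ * (Q.1 *ᵥ u) i + Real.cos θ * (Q.1 *ᵥ u) j|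
          * f (Real.cos θ * (Q.1 *ᵥ u) i + Real.sin θ * (Q.1 *ᵥ u) j)) ∂(haarOrth N) := by
          refine lintegral_lintegral_swap (Measurable.aemeasurable ?_)
          have hi : Measurable fun z : ℝ × OrthGroup N => (z.2.1 *ᵥ u) i := (hm i).comp measurable_snd
          have hj : Measurable fun z : ℝ × OrthGroup N => (z.2.1 *ᵥ u) j := (hm j).comp measurable_snd
          refine Measurable.mul (Measurable.ennreal_ofReal (Measurable.abs ?_)) (hf.comp ?_)
          · exact ((Real.measurable_sin.comp measurable_fst).neg.mul hi).add
              ((Real.measurable_cos.comp measurable_fst).mul hj)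
          · exact ((Real.measurable_cos.comp measurable_fst).mul hi).add
              ((Real.measurable_sin.comp measurable_fst).mul hj)
      _ ≤ ∫⁻ _ : OrthGroup N, (2 * ∫⁻ x, f x) ∂(haarOrth N) :=
          lintegral_mono fun Q => lintegral_rotation_le _ _ f
      _ = 2 * ∫⁻ x, f x := by simp
  rw [setLIntegral_const, Real.volume_Icc, sub_zero] at hint
  have h2 : L * 2 ≤ L * ENNReal.ofReal Real.pi := by
    gcongr
    rw [show (2 : ℝ≥0∞) = ENNReal.ofReal 2 by simp]
    exact ENNReal.ofReal_le_ofReal Real.two_le_pi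
  have h3 := h2.trans hint
  rw [mul_comm] at h3
  exact (ENNReal.mul_le_mul_iff_right (by simp) (by simp)).mp h3

theorem lintegral_gaussianReal_le {f : ℝ → ℝ≥0∞} (hf : Measurable f) :
    ∫⁻ x, f x ∂(gaussianReal 0 1) ≤ ∫⁻ x, f x := by
  rw [gaussianReal_of_var_ne_zero 0 one_ne_zero,
    lintegral_withDensity_eq_lintegral_mul _ (measurable_gaussianPDF 0 1) hf]
  refine lintegral_mono fun x => ?_
  refine mul_le_of_le_one_left (by simp) ?_
  rw [gaussianPDF, ENNReal.ofReal_le_one, gaussianPDFReal]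
  have h1 : (√(2 * Real.pi * (1 : ℝ≥0)))⁻¹ ≤ 1 := by
    refine inv_le_one_of_one_le₀ (Real.one_le_sqrt.mpr ?_)
    have := Real.two_le_pi
    simp only [NNReal.coe_one]; linarith
  have h2 : Real.exp (-(x - 0) ^ 2 / (2 * (1 : ℝ≥0))) ≤ 1 :=
    Real.exp_le_one_iff.mpr (by simp only [NNReal.coe_one]; nlinarith [sq_nonneg (x - 0)])
  calc _ ≤ (1 : ℝ) * 1 := mul_le_mul h1 h2 (Real.exp_pos _).le zero_le_one
    _ = 1 := one_mul 1

/-- Fubini in resampled form: one matrix is integrated with all other parameters frozen. -/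
theorem lintegral_haarBias_update_orth {S : Type*} [Fintype S] [DecidableEq S] {N a : ℕ} (s : S)
    {G : (S → OrthGroup N) × (Fin a → ℝ) → ℝ≥0∞} (hG : Measurable G) :
    ∫⁻ p, G p ∂(haarBias S N a)
      = ∫⁻ p, (∫⁻ Q, G (Function.update p.1 s Q, p.2) ∂(haarOrth N)) ∂(haarBias S N a) := by
  have hm : Measurable fun z : ((S → OrthGroup N) × (Fin a → ℝ)) × OrthGroup N =>
      G (Function.update z.1.1 s z.2, z.1.2) := by
    refine hG.comp (Measurable.prodMk ?_ (by fun_prop))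
    exact measurable_update'.comp ((measurable_fst.comp measurable_fst).prodMk measurable_snd)
  have hmp := measurePreserving_pi_update (fun _ : S => haarOrth N) s
  unfold haarBias
  rw [lintegral_prod_symm _ hG.aemeasurable,
    lintegral_prod_symm _ hm.lintegral_prod_right'.aemeasurable]
  refine lintegral_congr fun β => ?_
  have h1 : Measurable fun Q : S → OrthGroup N => G (Q, β) :=
    hG.comp (measurable_id.prodMk measurable_const)
  rw [← hmp.lintegral_comp h1]
  exact lintegral_prod _ (h1.comp hmp.measurable).aemeasurable

theorem lintegral_haarBias_update_bias {S : Type*} [Fintype S] {N a : ℕ} (i : Fin a)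
    {G : (S → OrthGroup N) × (Fin a → ℝ) → ℝ≥0∞} (hG : Measurable G) :
    ∫⁻ p, G p ∂(haarBias S N a)
      = ∫⁻ p, (∫⁻ b, G (p.1, Function.update p.2 i b) ∂(gaussianReal 0 1)) ∂(haarBias S N a) := by
  have hm : Measurable fun z : ((S → OrthGroup N) × (Fin a → ℝ)) × ℝ =>
      G (z.1.1, Function.update z.1.2 i z.2) := by
    refine hG.comp (Measurable.prodMk (by fun_prop) ?_)
    exact measurable_update'.comp ((measurable_snd.comp measurable_fst).prodMk measurable_snd)
  have hmp := measurePreserving_pi_update (fun _ : Fin a => gaussianReal 0 1) i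
  unfold haarBias
  rw [lintegral_prod _ hG.aemeasurable, lintegral_prod _ hm.lintegral_prod_right'.aemeasurable]
  refine lintegral_congr fun Q => ?_
  have h1 : Measurable fun β : Fin a → ℝ => G (Q, β) :=
    hG.comp (measurable_const.prodMk measurable_id)
  rw [← hmp.lintegral_comp h1]
  exact lintegral_prod _ (h1.comp hmp.measurable).aemeasurable

theorem rowPre_update_orth {S : Type*} [Fintype S] [DecidableEq S] {N a : ℕ} (e : Fin a → Fin N)
    (σ : ℝ) (Q : S → OrthGroup N) (β : Fin a → ℝ) (u : S → Fin N → ℝ) (i : Fin a) (s : S)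
    (Q' : OrthGroup N) :
    rowPre e σ (Function.update Q s Q') β u i = (Q'.1 *ᵥ u s) (e i)
      + (rowPre e σ Q β u i - ((Q s).1 *ᵥ u s) (e i)) := by
  simp only [rowPre]
  rw [← Finset.add_sum_erase _ _ (Finset.mem_univ s), ← Finset.add_sum_erase _ _ (Finset.mem_univ s),
    Function.update_self]
  have : ∑ x ∈ Finset.univ.erase s, ((Function.update Q s Q' x).1 *ᵥ u x) (e i)
      = ∑ x ∈ Finset.univ.erase s, ((Q x).1 *ᵥ u x) (e i) :=
    Finset.sum_congr rfl fun x hx => by rw [Function.update_of_ne (Finset.ne_of_mem_erase hx)]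
  rw [this]; ring

theorem rowPre_update_bias {S : Type*} [Fintype S] {N a : ℕ} (e : Fin a → Fin N)
    (σ : ℝ) (Q : S → OrthGroup N) (β : Fin a → ℝ) (u : S → Fin N → ℝ) (i : Fin a) (b : ℝ) :
    rowPre e σ Q (Function.update β i b) u i = σ * b + (rowPre e σ Q β u i - σ * β i) := by
  simp only [rowPre, Function.update_self]; ring

/-- Given the other matrices and the biases, the pre-activation is a coordinate of `Q u` plus a
constant, and Lebesgue measure ignores the shift. -/
theorem lintegral_coord_mul_rowPre_le {S : Type*} [Fintype S] {N a : ℕ} (e : Fin a → Fin N)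
    (σ : ℝ) (u : S → Fin N → ℝ) (i : Fin a) (s : S) {j : Fin N} (hj : e i ≠ j)
    {f : ℝ → ℝ≥0∞} (hf : Measurable f) :
    ∫⁻ p, ENNReal.ofReal |((p.1 s).1 *ᵥ u s) j| * f (rowPre e σ p.1 p.2 u i) ∂(haarBias S N a)
      ≤ ∫⁻ x, f x := by
  classical
  have hm : Measurable fun p : (S → OrthGroup N) × (Fin a → ℝ) =>
      ENNReal.ofReal |((p.1 s).1 *ᵥ u s) j| * f (rowPre e σ p.1 p.2 u i) := by
    refine Measurable.mul (Measurable.ennreal_ofReal (Measurable.abs ?_))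
      (hf.comp (measurable_rowPre e σ u i))
    exact (OrthGroup.continuous_mulVec (u s) j).measurable.comp
      ((measurable_pi_apply s).comp measurable_fst)
  rw [lintegral_haarBias_update_orth s hm]
  refine le_trans (lintegral_mono (g := fun _ => ∫⁻ x, f x) fun p => ?_) (by simp)
  simp only [rowPre_update_orth, Function.update_self]
  set w := rowPre e σ p.1 p.2 u i - ((p.1 s).1 *ᵥ u s) (e i)
  refine (lintegral_haarOrth_coord_le hj (u s) (f := fun x => f (x + w))
    (hf.comp (measurable_add_const w))).trans (le_of_eq ?_)
  exact lintegral_add_right_eq_self f w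

theorem lintegral_comp_mul_add {f : ℝ → ℝ≥0∞} (hf : Measurable f) {σ : ℝ} (hσ : σ ≠ 0) (w : ℝ) :
    ∫⁻ b, f (σ * b + w) = ENNReal.ofReal |σ⁻¹| * ∫⁻ x, f x := by
  have h := Real.map_volume_mul_left hσ
  have h1 : ∫⁻ b, f (σ * b + w) = ∫⁻ y, f (y + w) ∂(Measure.map (σ * ·) volume) := by
    rw [lintegral_map (f := fun y => f (y + w)) (hf.comp (measurable_add_const w))
      (measurable_const_mul σ)]
  rw [h1, h, lintegral_smul_measure, lintegral_add_right_eq_self f w, smul_eq_mul]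

theorem lintegral_rowPre_le_of_bias {S : Type*} [Fintype S] {N a : ℕ} (e : Fin a → Fin N)
    {σ : ℝ} (hσ : σ ≠ 0) (u : S → Fin N → ℝ) (i : Fin a) {f : ℝ → ℝ≥0∞} (hf : Measurable f) :
    ∫⁻ p, f (rowPre e σ p.1 p.2 u i) ∂(haarBias S N a) ≤ ENNReal.ofReal |σ⁻¹| * ∫⁻ x, f x := by
  rw [lintegral_haarBias_update_bias (G := fun p => f (rowPre e σ p.1 p.2 u i)) i
    (hf.comp (measurable_rowPre e σ u i))]
  refine le_trans (lintegral_mono (g := fun _ => ENNReal.ofReal |σ⁻¹| * ∫⁻ x, f x) fun p => ?_)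
    (by simp)
  simp only [rowPre_update_bias]
  rw [← lintegral_comp_mul_add hf hσ (rowPre e σ p.1 p.2 u i - σ * p.2 i)]
  exact lintegral_gaussianReal_le (hf.comp ((measurable_const_mul σ).add_const _))

/-- Pre-activations have no atoms on null sets. -/
theorem ae_rowPre_notMem {S : Type*} [Fintype S] {N a : ℕ} (hN : 2 ≤ N) (e : Fin a → Fin N)
    {σ : ℝ} (u : S → Fin N → ℝ) (h : σ ≠ 0 ∨ ∃ s, u s ≠ 0) (i : Fin a) {Z : Set ℝ}
    (hZ : MeasurableSet Z) (hZ0 : volume Z = 0) :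
    ∀ᵐ p ∂(haarBias S N a), rowPre e σ p.1 p.2 u i ∉ Z := by
  have hf : Measurable (Z.indicator (1 : ℝ → ℝ≥0∞)) := measurable_one.indicator hZ
  have hf0 : ∫⁻ x, Z.indicator (1 : ℝ → ℝ≥0∞) x = 0 := by
    rw [lintegral_indicator_one hZ, hZ0]
  have hme : Measurable fun p : (S → OrthGroup N) × (Fin a → ℝ) => rowPre e σ p.1 p.2 u i :=
    measurable_rowPre e σ u i
  rcases h with hσ | ⟨s, hs⟩
  · have := lintegral_rowPre_le_of_bias (S := S) (a := a) e hσ u i hf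
    rw [hf0, mul_zero, nonpos_iff_eq_zero] at this
    replace this := (lintegral_eq_zero_iff (hf.comp hme)).mp this
    filter_upwards [this] with p hp hpZ
    simp [hpZ] at hp
  · have hY : ∀ j, Measurable fun p : (S → OrthGroup N) × (Fin a → ℝ) =>
        ((p.1 s).1 *ᵥ u s) j := fun j =>
      (OrthGroup.continuous_mulVec (u s) j).measurable.comp
        ((measurable_pi_apply s).comp measurable_fst)
    -- The density bound carries the weight `|(Q u) j|`, so it only says that the weight vanishes
    -- when the pre-activation hits `Z`. Using all `j ≠ e i` leaves a single coordinate of `Q u`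
    -- undetermined.
    have h1 : ∀ᵐ p ∂(haarBias S N a), ∀ j, e i ≠ j → rowPre e σ p.1 p.2 u i ∈ Z →
        ((p.1 s).1 *ᵥ u s) j = 0 := by
      rw [ae_all_iff]
      intro j
      by_cases hj : e i ≠ j
      · have := lintegral_coord_mul_rowPre_le e σ u i s hj hf
        rw [hf0, nonpos_iff_eq_zero] at this
        replace this := (lintegral_eq_zero_iff ((hY j).abs.ennreal_ofReal.mul (hf.comp hme))).mp this
        filter_upwards [this] with p hp _ hpZ
        simpa [hpZ] using hp
      · exact ae_of_all _ fun p hj' => absurd hj' hj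
    obtain ⟨j, hj⟩ : ∃ j : Fin N, e i ≠ j := by
      have : Nontrivial (Fin N) := Fin.nontrivial_iff_two_le.mpr hN
      obtain ⟨j, hj⟩ := exists_ne (e i)
      exact ⟨j, hj.symm⟩
    -- The same bound with the roles of the coordinates exchanged and `Z = {0}` kills the remaining
    -- one; then `Q u = 0`, which contradicts `u ≠ 0`.
    have h2 : ∀ᵐ p ∂(haarBias S N a), ((p.1 s).1 *ᵥ u s) j = 0 → ((p.1 s).1 *ᵥ u s) (e i) = 0 := by
      refine (measurePreserving_haarBias_orth (S := S) (a := a) s).quasiMeasurePreserving.ae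
        (p := fun Q : OrthGroup N => (Q.1 *ᵥ u s) j = 0 → (Q.1 *ᵥ u s) (e i) = 0) ?_
      have hf' : Measurable (({0} : Set ℝ).indicator (1 : ℝ → ℝ≥0∞)) :=
        measurable_one.indicator (measurableSet_singleton 0)
      have := lintegral_haarOrth_coord_le hj.symm (u s) hf'
      rw [lintegral_indicator_one (measurableSet_singleton 0), Real.volume_singleton,
        nonpos_iff_eq_zero] at this
      replace this := (lintegral_eq_zero_iff (Measurable.mul
        (OrthGroup.continuous_mulVec (u s) (e i)).measurable.abs.ennreal_ofReal
        (hf'.comp (OrthGroup.continuous_mulVec (u s) j).measurable))).mp this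
      filter_upwards [this] with Q hQ hQ0
      simpa [hQ0] using hQ
    filter_upwards [h1, h2] with p hp1 hp2 hpZ
    refine hs ?_
    have h0 : (p.1 s).1 *ᵥ u s = 0 := by
      funext l
      by_cases hl : e i = l
      · rw [← hl]; exact hp2 (hp1 j hj hpZ)
      · exact hp1 l hl hpZ
    have h3 := OrthGroup.mulVec_dotProduct_mulVec (p.1 s) (u s) (u s)
    rw [h0] at h3
    exact dotProduct_self_eq_zero.mp (by simpa using h3.symm)

/-- Makes the mean absolute coordinate of `Q u` concentrate, which bounds the weight in the density
estimate from below. -/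
theorem quadTame_abs_fst : QuadTame fun x _ => |x| where
  measurable := measurable_fst.abs
  est ε hε := by
    refine ⟨1 / ε, by positivity, fun x y x' y' => ?_⟩
    have h1 : |(|x| - |x'|)| ≤ |x - x'| := abs_abs_sub_abs_le_abs_sub x x'
    have h2 : |x - x'| ≤ ε + 1 / ε * (x - x') ^ 2 := by
      have h3 : |x - x'| * ε ≤ ε * ε + (x - x') ^ 2 := by
        nlinarith [sq_abs (x - x'), sq_nonneg (|x - x'| - ε), sq_nonneg (|x - x'| + ε)]
      have h4 := (le_div_iff₀ hε).mpr h3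
      refine h4.trans (le_of_eq ?_)
      field_simp
    have h5 : 0 ≤ 1 / ε * (y - y') ^ 2 := by positivity
    have h6 : 0 ≤ ε * (x ^ 2 + y ^ 2 + x' ^ 2 + y' ^ 2) := by positivity
    nlinarith

theorem integrable_abs_gaussian : Integrable (fun x : ℝ => |x|) (gaussianReal 0 1) :=
  ((memLp_id_gaussianReal (μ := 0) (v := 1) 1).integrable (by simp)).abs

theorem integral_abs_gaussian_pos : 0 < ∫ x, |x| ∂(gaussianReal 0 1) := by
  refine lt_of_le_of_ne (integral_nonneg fun x => abs_nonneg x) fun h => ?_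
  have h1 := (integral_eq_zero_iff_of_nonneg (fun x => abs_nonneg x) integrable_abs_gaussian).mp
    h.symm
  have h2 : ∫ x, x ^ 2 ∂(gaussianReal 0 1) = 0 := by
    rw [integral_congr_ae (g := fun _ => 0) ?_]
    · simp
    · filter_upwards [h1] with x hx
      have : x = 0 := by simpa using hx
      simp [this]
  rw [integral_gaussian_sq] at h2
  exact one_ne_zero h2

theorem gaussPair_abs_fst {v : ℝ} (hv : 0 ≤ v) :
    gaussPair (fun x _ => |x|) v v v = √v * ∫ x, |x| ∂(gaussianReal 0 1) := by
  have h := gaussPair_factor (√v) (√v) 0 quadTame_abs_fst.measurable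
  rw [← sq, Real.sq_sqrt hv] at h
  simp only [zero_pow two_ne_zero, add_zero, abs_mul, abs_of_nonneg (Real.sqrt_nonneg v)] at h
  rw [h, integral_const_mul]
  congr 1
  have hmp := measurePreserving_eval (fun _ : Fin 2 => gaussianReal 0 1) 0
  conv_rhs => rw [← hmp.map_eq]
  rw [integral_map hmp.measurable.aemeasurable (by fun_prop)]

/-- The mean absolute coordinate of a Haar rotated vector concentrates. -/
theorem exists_lintegral_abs_coord_le (t : ℝ) {ε : ℝ} (hε : 0 < ε) :
    ∃ n₀ : ℕ, ∀ {N : ℕ} (u : Fin N → ℝ), n₀ ≤ N → u ⬝ᵥ u / N ≤ t →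
      ∫⁻ Q, ENNReal.ofReal |(1 / N : ℝ) * ∑ j, |(Q.1 *ᵥ u) j|
        - √(u ⬝ᵥ u / N) * ∫ x, |x| ∂(gaussianReal 0 1)| ∂(haarOrth N) ≤ ENNReal.ofReal ε := by
  obtain ⟨n₀, hn₀⟩ := quadTame_abs_fst.exists_lintegral_rowPre_le Unit t hε
  refine ⟨n₀, fun {N} u hN hu => ?_⟩
  have h := hn₀ (N := N) (a := N) (e := id) 0 (fun _ => u) (fun _ => u) hN Function.injective_id
    (by simpa using hu) (by simpa using hu)
  simp only [Fintype.univ_unit, Finset.sum_singleton, zero_pow two_ne_zero, add_zero, rowPre,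
    zero_mul, id] at h
  rw [gaussPair_abs_fst (div_nonneg (dotProduct_self_nonneg_real u) (Nat.cast_nonneg N))] at h
  refine le_trans (le_of_eq ?_) h
  have hm : Measurable fun Q : OrthGroup N => ENNReal.ofReal |(1 / N : ℝ) * ∑ j, |(Q.1 *ᵥ u) j|
        - √(u ⬝ᵥ u / N) * ∫ x, |x| ∂(gaussianReal 0 1)| := by
    refine Measurable.ennreal_ofReal (Measurable.abs (Measurable.sub_const
      (Measurable.const_mul (Finset.measurable_sum _ fun j _ => ?_) _) _))
    exact (OrthGroup.continuous_mulVec u j).measurable.abs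
  exact ((measurePreserving_haarBias_orth (a := N) ()).lintegral_comp hm).symm

/-- Averages the weighted density estimate over the weighting coordinate `j`. The estimate excludes
`j = e i`; this one term is bounded by the supremum of `f` and has weight `1 / N`. -/
theorem lintegral_average_coord_mul_rowPre_le {S : Type*} [Fintype S] {N a : ℕ} (hN : 0 < N)
    (e : Fin a → Fin N) (σ : ℝ) (u : S → Fin N → ℝ) (i : Fin a) (s : S) {t : ℝ}
    (ht : u s ⬝ᵥ u s / N ≤ t) {f : ℝ → ℝ≥0∞} (hf : Measurable f) {M : ℝ≥0∞} (hM : ∀ x, f x ≤ M) :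
    ∫⁻ p, ENNReal.ofReal ((1 / N : ℝ) * ∑ j, |((p.1 s).1 *ᵥ u s) j|) * f (rowPre e σ p.1 p.2 u i)
      ∂(haarBias S N a) ≤ (∫⁻ x, f x) + ENNReal.ofReal ((1 + t) / N) * M := by
  have hN' : (0 : ℝ) < N := by exact_mod_cast hN
  have hY : ∀ j, Measurable fun p : (S → OrthGroup N) × (Fin a → ℝ) =>
      ((p.1 s).1 *ᵥ u s) j := fun j =>
    (OrthGroup.continuous_mulVec (u s) j).measurable.comp
      ((measurable_pi_apply s).comp measurable_fst)
  have hX : ∫⁻ p, ENNReal.ofReal |((p.1 s).1 *ᵥ u s) (e i)| ∂(haarBias S N a)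
      ≤ ENNReal.ofReal (1 + t) := by
    have hi : Integrable (fun p : (S → OrthGroup N) × (Fin a → ℝ) =>
        1 + ((p.1 s).1 *ᵥ u s) (e i) ^ 2) (haarBias S N a) :=
      (integrable_const 1).add (integrable_haarBias_orth s (u s) (e i))
    refine lintegral_ofReal_le_of_le hi (fun p => by positivity) (fun p => ?_) ?_
    · nlinarith [sq_abs (((p.1 s).1 *ᵥ u s) (e i)), sq_nonneg (|((p.1 s).1 *ᵥ u s) (e i)| - 1),
        sq_nonneg (|((p.1 s).1 *ᵥ u s) (e i)|)]
    · rw [integral_add (integrable_const 1) (integrable_haarBias_orth s (u s) (e i)),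
        integral_haarBias_orth]
      simpa using ht
  have hterm : ∀ j, ∫⁻ p, ENNReal.ofReal |((p.1 s).1 *ᵥ u s) j| * f (rowPre e σ p.1 p.2 u i)
      ∂(haarBias S N a) ≤ (∫⁻ x, f x) + if e i = j then ENNReal.ofReal (1 + t) * M else 0 := by
    intro j
    by_cases hj : e i = j
    · subst hj
      rw [if_pos rfl]
      refine le_trans ?_ le_add_self
      calc _ ≤ ∫⁻ p, ENNReal.ofReal |((p.1 s).1 *ᵥ u s) (e i)| * M ∂(haarBias S N a) :=
            lintegral_mono fun p => mul_le_mul_right (hM _) _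
        _ = (∫⁻ p, ENNReal.ofReal |((p.1 s).1 *ᵥ u s) (e i)| ∂(haarBias S N a)) * M :=
            lintegral_mul_const _ (hY (e i)).abs.ennreal_ofReal
        _ ≤ _ := by gcongr
    · rw [if_neg hj, add_zero]
      exact lintegral_coord_mul_rowPre_le e σ u i s hj hf
  have hexp : ∀ p : (S → OrthGroup N) × (Fin a → ℝ),
      ENNReal.ofReal ((1 / N : ℝ) * ∑ j, |((p.1 s).1 *ᵥ u s) j|) * f (rowPre e σ p.1 p.2 u i)
      = ENNReal.ofReal (1 / N) * ∑ j, ENNReal.ofReal |((p.1 s).1 *ᵥ u s) j|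
        * f (rowPre e σ p.1 p.2 u i) := by
    intro p
    rw [ENNReal.ofReal_mul (by positivity), ENNReal.ofReal_sum_of_nonneg fun j _ => abs_nonneg _,
      mul_assoc, Finset.sum_mul]
  simp_rw [hexp]
  have hmj : ∀ j, Measurable fun p : (S → OrthGroup N) × (Fin a → ℝ) =>
      ENNReal.ofReal |((p.1 s).1 *ᵥ u s) j| * f (rowPre e σ p.1 p.2 u i) := fun j =>
    (hY j).abs.ennreal_ofReal.mul (hf.comp (measurable_rowPre e σ u i))
  rw [lintegral_const_mul _ (Finset.measurable_sum _ fun j _ => hmj j),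
    lintegral_finsetSum _ fun j _ => hmj j]
  calc _ ≤ ENNReal.ofReal (1 / N) * ∑ j : Fin N, ((∫⁻ x, f x)
          + if e i = j then ENNReal.ofReal (1 + t) * M else 0) := by
        gcongr with j
        exact hterm j
    _ = _ := by
        rw [Finset.sum_add_distrib, Finset.sum_ite_eq, if_pos (Finset.mem_univ _), mul_add,
          Finset.sum_const, Finset.card_univ, Fintype.card_fin, nsmul_eq_mul, ← mul_assoc,
          ← mul_assoc, ← ENNReal.ofReal_natCast, ← ENNReal.ofReal_mul (by positivity),
          ← ENNReal.ofReal_mul (by positivity), one_div, inv_mul_cancel₀ hN'.ne', 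
          ENNReal.ofReal_one, one_mul, ← div_eq_inv_mul]

set_option maxHeartbeats 400000 in
/-- Pre-activations have, up to a small error, a bounded density. -/
theorem exists_lintegral_rowPre_le_volume (S : Type) [Fintype S] {τ : ℝ} (hτ : 0 < τ) (t : ℝ) :
    ∃ C : ℝ, ∀ ε : ℝ, 0 < ε → ∃ n₀ : ℕ, ∀ {N a : ℕ} (e : Fin a → Fin N) (σ : ℝ)
      (u : S → Fin N → ℝ) (i : Fin a), n₀ ≤ N → τ ≤ ∑ s, u s ⬝ᵥ u s / N + σ ^ 2 →
      ∑ s, u s ⬝ᵥ u s / N + σ ^ 2 ≤ t →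
      ∀ {f : ℝ → ℝ≥0∞} {M : ℝ≥0∞}, Measurable f → (∀ x, f x ≤ M) →
      ∫⁻ p, f (rowPre e σ p.1 p.2 u i) ∂(haarBias S N a)
        ≤ ENNReal.ofReal C * (∫⁻ x, f x) + ENNReal.ofReal ε * M := by
  set κ := ∫ x, |x| ∂(gaussianReal 0 1) with hκ
  have hκ0 : 0 < κ := integral_abs_gaussian_pos
  set m : ℝ := (Fintype.card S : ℝ) with hm
  have hm0 : 0 ≤ m := by positivity
  -- Half the limiting mean absolute coordinate of a vector carrying the share `τ / (2 (m + 1))` of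
  -- the variance.
  set c : ℝ := κ * √(τ / (2 * (m + 1))) / 2 with hc
  have hc0 : 0 < c := by positivity
  refine ⟨1 / c + 1 / √(τ / 2), fun ε hε => ?_⟩
  obtain ⟨n₁, hn₁⟩ := exists_lintegral_abs_coord_le t (ε := c * (ε / 2)) (by positivity)
  obtain ⟨n₂, hn₂⟩ := exists_nat_gt ((1 + |t|) / (c * (ε / 2)))
  refine ⟨n₁ + n₂ + 1, ?_⟩
  intro N a e σ u i hN hlow hup f M hf hM
  have hN0 : 0 < N := by omega
  have hN' : (0 : ℝ) < N := by exact_mod_cast hN0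
  have hnn : ∀ s, 0 ≤ u s ⬝ᵥ u s / N := fun s =>
    div_nonneg (dotProduct_self_nonneg_real _) hN'.le
  -- Either the Gaussian bias carries half of the variance and supplies the density, or by
  -- pigeonhole some matrix acts on a vector that is not small.
  by_cases hσ : τ / 2 ≤ σ ^ 2
  · have hσ0 : σ ≠ 0 := by rintro rfl; norm_num at hσ; linarith
    refine (lintegral_rowPre_le_of_bias e hσ0 u i hf).trans (le_trans ?_ le_self_add)
    gcongr
    have h1 : √(τ / 2) ≤ |σ| := by rw [← Real.sqrt_sq_eq_abs]; exact Real.sqrt_le_sqrt hσ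
    rw [abs_inv, ← one_div]
    have h2 : 1 / |σ| ≤ 1 / √(τ / 2) := one_div_le_one_div_of_le (by positivity) h1
    have h3 : 0 ≤ 1 / c := by positivity
    linarith
  · push Not at hσ
    obtain ⟨s, hs⟩ : ∃ s, τ / (2 * (m + 1)) ≤ u s ⬝ᵥ u s / N := by
      by_contra! hcon
      have h1 : ∑ s, u s ⬝ᵥ u s / N ≤ ∑ _s : S, τ / (2 * (m + 1)) :=
        Finset.sum_le_sum fun s _ => (hcon s).le
      rw [Finset.sum_const, Finset.card_univ, nsmul_eq_mul, ← hm] at h1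
      have h2 : m * (τ / (2 * (m + 1))) ≤ τ / 2 := by
        rw [← mul_div_assoc, div_le_iff₀ (by positivity)]
        nlinarith
      linarith
    have hst : u s ⬝ᵥ u s / N ≤ t := by
      have := Finset.single_le_sum (f := fun s => u s ⬝ᵥ u s / N) (fun s _ => hnn s) (Finset.mem_univ s)
      linarith [sq_nonneg σ]
    set A : (S → OrthGroup N) × (Fin a → ℝ) → ℝ := fun p =>
      (1 / N : ℝ) * ∑ j, |((p.1 s).1 *ᵥ u s) j| with hA
    have hAm : Measurable A := by
      refine Measurable.const_mul (Finset.measurable_sum _ fun j _ => Measurable.abs ?_) _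
      exact (OrthGroup.continuous_mulVec (u s) j).measurable.comp
        ((measurable_pi_apply s).comp measurable_fst)
    set v := √(u s ⬝ᵥ u s / N) with hv
    have hcv : c ≤ v * κ / 2 := by
      have : √(τ / (2 * (m + 1))) ≤ v := Real.sqrt_le_sqrt hs
      have := mul_le_mul_of_nonneg_left this hκ0.le
      simp only [hc]; linarith
    have hP : haarBias S N a {p | A p < c} ≤ ENNReal.ofReal (ε / 2) := by
      have hle := hn₁ (u s) (by omega) hst
      have hmp := measurePreserving_haarBias_orth (S := S) (N := N) (a := a) s
      have hmQ : Measurable fun Q : OrthGroup N =>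
          |(1 / N : ℝ) * ∑ j, |(Q.1 *ᵥ u s) j| - v * κ| := by
        refine Measurable.abs (Measurable.sub_const
          (Measurable.const_mul (Finset.measurable_sum _ fun j _ => ?_) _) _)
        exact (OrthGroup.continuous_mulVec (u s) j).measurable.abs
      rw [← hmp.lintegral_comp hmQ.ennreal_ofReal] at hle
      have h := measure_le_of_lintegral_ofReal_le (hmQ.comp hmp.measurable) hc0 hle
      rw [mul_div_cancel_left₀ _ hc0.ne'] at h
      refine (measure_mono fun p hp => ?_).trans h
      simp only [Set.mem_ofPred_eq, hA] at hp
      simp only [Set.mem_ofPred_eq, Function.comp]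
      rw [abs_sub_comm]
      refine le_trans ?_ (le_abs_self _)
      linarith
    -- Where the averaged weight is at least `c` it may be inserted at the price `1 / c`; elsewhere,
    -- with small probability, `f` is bounded by `M`.
    have hpt : ∀ p, f (rowPre e σ p.1 p.2 u i) ≤ ENNReal.ofReal (1 / c) *
        (ENNReal.ofReal (A p) * f (rowPre e σ p.1 p.2 u i)) + {p | A p < c}.indicator (fun _ => M) p := by
      intro p
      by_cases hp : A p < c
      · rw [Set.indicator_of_mem (by exact hp)]
        exact (hM _).trans le_add_self
      · push Not at hp
        refine le_trans ?_ le_self_add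
        rw [← mul_assoc, ← ENNReal.ofReal_mul (by positivity)]
        refine le_mul_of_one_le_left (by simp) ?_
        rw [ENNReal.one_le_ofReal, one_div, ← div_eq_inv_mul, le_div_iff₀ hc0, one_mul]
        exact hp
    have hAf : Measurable fun p : (S → OrthGroup N) × (Fin a → ℝ) =>
        ENNReal.ofReal (A p) * f (rowPre e σ p.1 p.2 u i) :=
      hAm.ennreal_ofReal.mul (hf.comp (measurable_rowPre e σ u i))
    have hmain := lintegral_average_coord_mul_rowPre_le hN0 e σ u i s (hst.trans (le_abs_self t)) hf hM
    have hNe : (1 + |t|) / N ≤ c * (ε / 2) := by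
      have : (n₂ : ℝ) ≤ N := by exact_mod_cast (by omega : n₂ ≤ N)
      rw [div_lt_iff₀ (by positivity)] at hn₂
      rw [div_le_iff₀ hN']
      nlinarith [mul_le_mul_of_nonneg_left this (by positivity : 0 ≤ c * (ε / 2))]
    calc ∫⁻ p, f (rowPre e σ p.1 p.2 u i) ∂(haarBias S N a)
        ≤ ∫⁻ p, (ENNReal.ofReal (1 / c) * (ENNReal.ofReal (A p) * f (rowPre e σ p.1 p.2 u i))
          + {p | A p < c}.indicator (fun _ => M) p) ∂(haarBias S N a) := lintegral_mono hpt
      _ = ENNReal.ofReal (1 / c) * (∫⁻ p, ENNReal.ofReal (A p) * f (rowPre e σ p.1 p.2 u i)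
            ∂(haarBias S N a)) + M * haarBias S N a {p | A p < c} := by
          rw [lintegral_add_left (hAf.const_mul _), lintegral_const_mul _ hAf,
            lintegral_indicator_const (measurableSet_lt hAm measurable_const)]
      _ ≤ ENNReal.ofReal (1 / c) * ((∫⁻ x, f x) + ENNReal.ofReal (c * (ε / 2)) * M)
          + M * ENNReal.ofReal (ε / 2) := by
          gcongr
          refine hmain.trans ?_
          gcongr
      _ = ENNReal.ofReal (1 / c) * (∫⁻ x, f x) + ENNReal.ofReal ε * M := by
          rw [mul_add, ← mul_assoc (ENNReal.ofReal (1 / c)) (ENNReal.ofReal _),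
            ← ENNReal.ofReal_mul (by positivity), mul_comm M, add_assoc, ← add_mul,
            ← ENNReal.ofReal_add (by positivity) (by positivity)]
          congr 3
          field_simp
          ring
      _ ≤ _ := by
          gcongr
          have : 0 ≤ 1 / √(τ / 2) := by positivity
          linarith

/-! ### Gaussian limits of averages over neurons -/

theorem gram_cauchy_schwarz {S : Type*} [Fintype S] {N : ℕ} (σ : ℝ) (u u' : S → Fin N → ℝ) :
    (∑ s, u s ⬝ᵥ u' s / N + σ ^ 2) ^ 2
      ≤ (∑ s, u s ⬝ᵥ u s / N + σ ^ 2) * (∑ s, u' s ⬝ᵥ u' s / N + σ ^ 2) := by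
  have hs : (√(N : ℝ))⁻¹ * (√(N : ℝ))⁻¹ = (N : ℝ)⁻¹ := by
    rw [← mul_inv, Real.mul_self_sqrt (Nat.cast_nonneg N)]
  let A : (S → Fin N → ℝ) → Option (S × Fin N) → ℝ := fun u o =>
    o.elim σ fun k => (√(N : ℝ))⁻¹ * u k.1 k.2
  have hA : ∀ u u' : S → Fin N → ℝ, ∑ o, A u o * A u' o = ∑ s, u s ⬝ᵥ u' s / N + σ ^ 2 := by
    intro u u'
    rw [Fintype.sum_option, Fintype.sum_prod_type, add_comm]
    simp only [A, Option.elim, dotProduct, Finset.sum_div]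
    rw [sq]
    congr 1
    refine Finset.sum_congr rfl fun s _ => Finset.sum_congr rfl fun j _ => ?_
    rw [div_eq_mul_inv, ← hs]; ring
  have h := Finset.sum_mul_sq_le_sq_mul_sq Finset.univ (A u) (A u')
  simp only [sq (A u _), sq (A u' _), hA] at h
  exact h

theorem gram_nonneg {S : Type*} [Fintype S] {N : ℕ} (σ : ℝ) (u : S → Fin N → ℝ) :
    0 ≤ ∑ s, u s ⬝ᵥ u s / N + σ ^ 2 :=
  add_nonneg (Finset.sum_nonneg fun _ _ => div_nonneg (dotProduct_self_nonneg_real _)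
    (Nat.cast_nonneg N)) (sq_nonneg σ)

/-- Empirical averages of `Ψ` over the coordinates of `∑ₛ Qₛ uₛ + σ β` and `∑ₛ Qₛ u'ₛ + σ β` converge
to the Gaussian expectation of `Ψ` with covariance `(a, c, b)`, when the Gram matrix does. -/
def GaussLimit (S : Type) [Fintype S] (Ψ : ℝ → ℝ → ℝ) (a c b : ℝ) : Prop :=
  ∀ ε : ℝ, 0 < ε → ∃ δ : ℝ, 0 < δ ∧ ∃ n₀ : ℕ, ∀ {N w : ℕ} {e : Fin w → Fin N} (σ : ℝ)
    (u u' : S → Fin N → ℝ), n₀ ≤ w → Function.Injective e →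
    |∑ s, u s ⬝ᵥ u s / N + σ ^ 2 - a| ≤ δ → |∑ s, u s ⬝ᵥ u' s / N + σ ^ 2 - c| ≤ δ →
    |∑ s, u' s ⬝ᵥ u' s / N + σ ^ 2 - b| ≤ δ →
    ∫⁻ p, ENNReal.ofReal |(1 / w : ℝ) *
        ∑ i, Ψ (rowPre e σ p.1 p.2 u i) (rowPre e σ p.1 p.2 u' i) - gaussPair Ψ a c b|
      ∂(haarBias S N w) ≤ ENNReal.ofReal ε

/-- The average is near the Gaussian expectation for the actual Gram matrix, and that expectation is
continuous in the covariance, also at singular ones. -/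
theorem QuadTame.gaussLimit {Ψ : ℝ → ℝ → ℝ} (hΨ : QuadTame Ψ) (S : Type) [Fintype S] (a c b : ℝ) :
    GaussLimit S Ψ a c b := by
  intro ε hε
  obtain ⟨δ, hδ, hcont⟩ := hΨ.exists_abs_gaussPair_sub_le (a := a) (c := c) (b := b) (ε / 2)
    (by positivity)
  obtain ⟨n₀, hn₀⟩ := hΨ.exists_lintegral_rowPre_le S (|a| + |b| + 1) (ε := ε / 2) (by positivity)
  refine ⟨min δ 1, by positivity, n₀, ?_⟩
  intro N w e σ u u' hw he h1 h2 h3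
  have hu : ∑ s, u s ⬝ᵥ u s / N + σ ^ 2 ≤ |a| + |b| + 1 := by
    have := (abs_le.mp (h1.trans (min_le_right _ _))).2
    linarith [le_abs_self a, abs_nonneg b]
  have hu' : ∑ s, u' s ⬝ᵥ u' s / N + σ ^ 2 ≤ |a| + |b| + 1 := by
    have := (abs_le.mp (h3.trans (min_le_right _ _))).2
    linarith [le_abs_self b, abs_nonneg a]
  have hg := hcont (gram_nonneg σ u) (gram_nonneg σ u') (gram_cauchy_schwarz σ u u')
    (h1.trans (min_le_left _ _)) (h2.trans (min_le_left _ _)) (h3.trans (min_le_left _ _))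
  have hmain := hn₀ (e := e) σ u u' hw he hu hu'
  set G := gaussPair Ψ (∑ s, u s ⬝ᵥ u s / N + σ ^ 2) (∑ s, u s ⬝ᵥ u' s / N + σ ^ 2)
    (∑ s, u' s ⬝ᵥ u' s / N + σ ^ 2)
  refine (lintegral_ofReal_abs_sub_le (Y := fun _ => G) _ ?_ measurable_const).trans
    ((add_le_add hmain le_rfl).trans ?_)
  · exact (Finset.measurable_sum _ fun i _ => hΨ.measurable.comp
      ((measurable_rowPre e σ u i).prodMk (measurable_rowPre e σ u' i))).const_mul _
  · rw [lintegral_const, measure_univ, mul_one, ← ENNReal.ofReal_add (by positivity) (by positivity)]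
    exact ENNReal.ofReal_le_ofReal (by linarith)

/-! ### The derivative of a Lipschitz activation function -/

/-- Forward difference quotients. -/
noncomputable def diffQuot (φ : ℝ → ℝ) (n : ℕ) (x : ℝ) : ℝ :=
  ((n : ℝ) + 1) * (φ (x + 1 / ((n : ℝ) + 1)) - φ x)

theorem lipschitzWith_diffQuot {K : ℝ≥0} {φ : ℝ → ℝ} (hφ : LipschitzWith K φ) (n : ℕ) :
    LipschitzWith ((n + 1) * (2 * K)) (diffQuot φ n) := by
  refine LipschitzWith.of_dist_le_mul fun x y => ?_
  rw [Real.dist_eq, Real.dist_eq, diffQuot, diffQuot, ← mul_sub, abs_mul,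
    abs_of_nonneg (by positivity : (0 : ℝ) ≤ n + 1)]
  push_cast
  rw [mul_assoc]
  refine mul_le_mul_of_nonneg_left ?_ (by positivity)
  have h1 := hφ.abs_sub_le_real (x + 1 / ((n : ℝ) + 1)) (y + 1 / ((n : ℝ) + 1))
  have h2 := hφ.abs_sub_le_real y x
  rw [add_sub_add_right_eq_sub] at h1
  rw [abs_sub_comm y x] at h2
  have e : φ (x + 1 / ((n : ℝ) + 1)) - φ x - (φ (y + 1 / ((n : ℝ) + 1)) - φ y)
    = (φ (x + 1 / ((n : ℝ) + 1)) - φ (y + 1 / ((n : ℝ) + 1))) + (φ y - φ x) := by ring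
  rw [e]
  refine (abs_add_le _ _).trans ?_
  linarith

theorem abs_diffQuot_le {K : ℝ≥0} {φ : ℝ → ℝ} (hφ : LipschitzWith K φ) (n : ℕ) (x : ℝ) :
    |diffQuot φ n x| ≤ K := by
  have h := hφ.abs_sub_le_real (x + 1 / ((n : ℝ) + 1)) x
  have hp : (0 : ℝ) < n + 1 := by positivity
  rw [diffQuot, abs_mul, abs_of_pos hp]
  rw [add_sub_cancel_left, abs_of_pos (by positivity : (0 : ℝ) < 1 / (n + 1))] at h
  calc _ ≤ ((n : ℝ) + 1) * (K * (1 / (n + 1))) := mul_le_mul_of_nonneg_left h hp.le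
    _ = K := by field_simp

theorem abs_deriv_le_of_lipschitz {K : ℝ≥0} {φ : ℝ → ℝ} (hφ : LipschitzWith K φ) (x : ℝ) :
    |deriv φ x| ≤ K := by
  simpa using norm_deriv_le_of_lipschitz (x₀ := x) hφ

theorem tendsto_diffQuot {φ : ℝ → ℝ} {x : ℝ} (h : DifferentiableAt ℝ φ x) :
    Tendsto (fun n => diffQuot φ n x) atTop (𝓝 (deriv φ x)) := by
  have h1 := hasDerivAt_iff_tendsto_slope_zero.mp h.hasDerivAt
  have h2 : Tendsto (fun n : ℕ => 1 / ((n : ℝ) + 1)) atTop (𝓝[≠] 0) :=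
    tendsto_nhdsWithin_iff.mpr ⟨tendsto_one_div_add_atTop_nhds_zero_nat,
      Eventually.of_forall fun n => by
        have : (0 : ℝ) < 1 / ((n : ℝ) + 1) := by positivity
        exact this.ne'⟩
  refine (h1.comp h2).congr fun n => ?_
  simp [diffQuot]

theorem volume_not_differentiableAt {K : ℝ≥0} {φ : ℝ → ℝ} (hφ : LipschitzWith K φ) :
    volume {x | ¬ DifferentiableAt ℝ φ x} = 0 := hφ.ae_differentiableAt_real

theorem measurableSet_not_differentiableAt (φ : ℝ → ℝ) :
    MeasurableSet {x | ¬ DifferentiableAt ℝ φ x} :=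
  (measurableSet_of_differentiableAt ℝ φ).compl

/-- Lipschitz functions are differentiable almost everywhere, and `2 K` dominates; the bounded
interval makes this constant integrable. -/
theorem tendsto_lintegral_diffQuot {K : ℝ≥0} {φ : ℝ → ℝ} (hφ : LipschitzWith K φ) (T : ℝ) :
    Tendsto (fun n => ∫⁻ x in Set.Icc (-T) T, ENNReal.ofReal |deriv φ x - diffQuot φ n x|)
      atTop (𝓝 0) := by
  have hm : ∀ n, Measurable fun x => ENNReal.ofReal |deriv φ x - diffQuot φ n x| := fun n =>
    ((measurable_deriv φ).sub (lipschitzWith_diffQuot hφ n).continuous.measurable).abs.ennreal_ofReal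
  have h := tendsto_lintegral_of_dominated_convergence
    (μ := volume.restrict (Set.Icc (-T) T)) (F := fun n x => ENNReal.ofReal |deriv φ x - diffQuot φ n x|)
    (f := fun _ => 0) (fun _ => ENNReal.ofReal (2 * K)) hm (fun n => ae_of_all _ fun x => ?_) ?_ ?_
  · simpa using h
  · refine ENNReal.ofReal_le_ofReal ((abs_sub _ _).trans ?_)
    linarith [abs_deriv_le_of_lipschitz hφ x, abs_diffQuot_le hφ n x]
  · simp [ENNReal.mul_ne_top]
  · refine ae_restrict_of_ae ?_
    filter_upwards [hφ.ae_differentiableAt_real] with x hx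
    have h1 := ((tendsto_const_nhds (x := deriv φ x)).sub (tendsto_diffQuot hx)).abs
    rw [sub_self, abs_zero] at h1
    have h2 := (ENNReal.continuous_ofReal.tendsto 0).comp h1
    rw [ENNReal.ofReal_zero] at h2
    exact h2

/-- Both marginals have positive variance, hence almost surely avoid the points where `φ` is not
differentiable. Only the marginals matter, so perfect correlation is allowed. -/
theorem tendsto_gaussPair_diffQuot {K : ℝ≥0} {φ : ℝ → ℝ} (hφ : LipschitzWith K φ) {a c b : ℝ}
    (ha : 0 < a) (hb : 0 < b) (hc : c ^ 2 ≤ a * b) :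
    Tendsto (fun n => gaussPair (fun x y => diffQuot φ n x * diffQuot φ n y) a c b) atTop
      (𝓝 (gaussPair (fun x y => deriv φ x * deriv φ y) a c b)) := by
  obtain ⟨p, q, r, hp, hpq, hqr⟩ := exists_gram_factor ha.le hb.le hc
  have eA : (![p, 0] : Fin 2 → ℝ) ⬝ᵥ ![p, 0] = a := by simp [← hp, sq]
  have eAB : (![p, 0] : Fin 2 → ℝ) ⬝ᵥ ![q, r] = c := by simp [← hpq]
  have eB : (![q, r] : Fin 2 → ℝ) ⬝ᵥ ![q, r] = b := by simp [← hqr, sq]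
  have hd := measurable_deriv φ
  have hq : ∀ n, Measurable (diffQuot φ n) := fun n => (lipschitzWith_diffQuot hφ n).continuous.measurable
  have hmd : Measurable (Function.uncurry fun x y => deriv φ x * deriv φ y) :=
    (hd.comp measurable_fst).mul (hd.comp measurable_snd)
  have hmq : ∀ n, Measurable (Function.uncurry fun x y => diffQuot φ n x * diffQuot φ n y) :=
    fun n => ((hq n).comp measurable_fst).mul ((hq n).comp measurable_snd)
  rw [← eA, ← eAB, ← eB, gaussPair_gram _ _ hmd]
  simp_rw [fun n => gaussPair_gram ![p, 0] ![q, r] (hmq n)]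
  have hdot : ∀ A : Fin 2 → ℝ, Measurable fun z : Fin 2 → ℝ => A ⬝ᵥ z :=
    fun A => (measurePreserving_dotProduct_gaussian A).measurable
  have hae : ∀ A : Fin 2 → ℝ, 0 < A ⬝ᵥ A → ∀ᵐ z ∂(Measure.pi fun _ : Fin 2 => gaussianReal 0 1),
      DifferentiableAt ℝ φ (A ⬝ᵥ z) := by
    intro A hA
    refine (measurePreserving_dotProduct_gaussian A).quasiMeasurePreserving.ae ?_
    exact (gaussianReal_absolutelyContinuous 0 (by simpa using hA)).ae_le hφ.ae_differentiableAt_real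
  refine tendsto_integral_of_dominated_convergence (fun _ => (K : ℝ) * K) (fun n => ?_)
    (integrable_const _) (fun n => ae_of_all _ fun z => ?_) ?_
  · exact ((hmq n).comp ((hdot _).prodMk (hdot _))).aestronglyMeasurable
  · rw [Real.norm_eq_abs, abs_mul]
    exact mul_le_mul (abs_diffQuot_le hφ n _) (abs_diffQuot_le hφ n _) (abs_nonneg _) K.2
  · filter_upwards [hae ![p, 0] (by rw [eA]; exact ha), hae ![q, r] (by rw [eB]; exact hb)] with z h1 h2
    exact (tendsto_diffQuot h1).mul (tendsto_diffQuot h2)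

/-- On `[-T, T]` the almost bounded density compares with Lebesgue measure, where the difference
quotients converge in mean; outside, the second moment of the pre-activation is used. The quotient
index is fixed first, the width afterwards. -/
theorem exists_lintegral_rowPre_diffQuot_le {K : ℝ≥0} {φ : ℝ → ℝ} (hφ : LipschitzWith K φ) (S : Type)
    [Fintype S] {τ : ℝ} (hτ : 0 < τ) (t : ℝ) {ε : ℝ} (hε : 0 < ε) :
    ∃ n₁ : ℕ, ∀ n ≥ n₁, ∃ n₀ : ℕ, ∀ {N a : ℕ} (e : Fin a → Fin N) (σ : ℝ)
      (u : S → Fin N → ℝ) (i : Fin a), n₀ ≤ N → τ ≤ ∑ s, u s ⬝ᵥ u s / N + σ ^ 2 →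
      ∑ s, u s ⬝ᵥ u s / N + σ ^ 2 ≤ t →
      ∫⁻ p, ENNReal.ofReal |deriv φ (rowPre e σ p.1 p.2 u i) - diffQuot φ n (rowPre e σ p.1 p.2 u i)|
        ∂(haarBias S N a) ≤ ENNReal.ofReal ε := by
  obtain ⟨C, hC⟩ := exists_lintegral_rowPre_le_volume S hτ t
  set D : ℝ := (2 * (Fintype.card S : ℝ) + 2) * |t| with hD
  have hD0 : 0 ≤ D := by positivity
  -- Makes the Chebyshev tail `2 K D / T ^ 2` at most `ε / 3`; the summand one keeps `T` positive.
  set T : ℝ := √(6 * K * D / ε) + 1 with hT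
  have hT0 : 0 < T := by positivity
  have hTD : 2 * K / T ^ 2 * D ≤ ε / 3 := by
    have h1 : 6 * K * D / ε ≤ T ^ 2 := by
      have h2 := Real.sq_sqrt (by positivity : 0 ≤ 6 * K * D / ε)
      have h3 := Real.sqrt_nonneg (6 * K * D / ε)
      rw [hT]; nlinarith
    rw [div_le_iff₀ hε] at h1
    rw [div_mul_eq_mul_div, div_le_iff₀ (by positivity)]
    nlinarith
  have hlim : Tendsto (fun n => ENNReal.ofReal C *
      ∫⁻ x in Set.Icc (-T) T, ENNReal.ofReal |deriv φ x - diffQuot φ n x|) atTop (𝓝 0) := by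
    have := ENNReal.Tendsto.const_mul (tendsto_lintegral_diffQuot hφ T)
      (Or.inr (ENNReal.ofReal_ne_top (r := C)))
    rwa [mul_zero] at this
  obtain ⟨n₁, hn₁⟩ := eventually_atTop.mp
    ((tendsto_order.mp hlim).2 (ENNReal.ofReal (ε / 3)) (by simpa using hε))
  refine ⟨n₁, fun n hn => ?_⟩
  obtain ⟨n₀, hn₀⟩ := hC (ε / (3 * (2 * K + 1))) (by positivity)
  refine ⟨n₀, ?_⟩
  intro N a e σ u i hN hlow hup
  have hgm : Measurable fun x => ENNReal.ofReal |deriv φ x - diffQuot φ n x| :=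
    ((measurable_deriv φ).sub (lipschitzWith_diffQuot hφ n).continuous.measurable).abs.ennreal_ofReal
  have hgK : ∀ x, |deriv φ x - diffQuot φ n x| ≤ 2 * K := fun x =>
    (abs_sub _ _).trans (by linarith [abs_deriv_le_of_lipschitz hφ x, abs_diffQuot_le hφ n x])
  set f : ℝ → ℝ≥0∞ := (Set.Icc (-T) T).indicator
    fun x => ENNReal.ofReal |deriv φ x - diffQuot φ n x| with hf
  have hfm : Measurable f := hgm.indicator measurableSet_Icc
  have hmain := hn₀ e σ u i hN hlow hup hfm (M := ENNReal.ofReal (2 * K))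
    (fun x => (Set.indicator_le_self _ _ x).trans (ENNReal.ofReal_le_ofReal (hgK x)))
  rw [hf, lintegral_indicator measurableSet_Icc, ← hf] at hmain
  have hpt : ∀ x, ENNReal.ofReal |deriv φ x - diffQuot φ n x|
      ≤ f x + ENNReal.ofReal (2 * K / T ^ 2 * x ^ 2) := by
    intro x
    by_cases hx : x ∈ Set.Icc (-T) T
    · rw [hf, Set.indicator_of_mem hx]; exact le_self_add
    · refine le_trans (ENNReal.ofReal_le_ofReal ?_) le_add_self
      refine (hgK x).trans ?_
      have hx2 : T ^ 2 ≤ x ^ 2 := by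
        rw [← sq_abs x]
        refine pow_le_pow_left₀ hT0.le ?_ 2
        by_contra hcon
        exact hx (abs_le.mp (not_le.mp hcon).le)
      rw [div_mul_eq_mul_div, le_div_iff₀ (by positivity)]
      exact mul_le_mul_of_nonneg_left hx2 (by positivity)
  have hsq : ∫⁻ p, ENNReal.ofReal (2 * K / T ^ 2 * rowPre e σ p.1 p.2 u i ^ 2) ∂(haarBias S N a)
      ≤ ENNReal.ofReal (ε / 3) := by
    refine lintegral_ofReal_le_of_le ((integrable_rowPre_sq e σ u i).const_mul _)
      (fun p => by positivity) (fun p => le_rfl) ?_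
    rw [integral_const_mul]
    refine (mul_le_mul_of_nonneg_left ((integral_rowPre_sq_le e σ u i).trans ?_)
      (by positivity)).trans hTD
    have h0 : 0 ≤ ∑ s, u s ⬝ᵥ u s / N := by simpa using gram_nonneg 0 u
    have h1 : ∑ s, u s ⬝ᵥ u s / N ≤ |t| := by linarith [le_abs_self t, sq_nonneg σ]
    have h2 : σ ^ 2 ≤ |t| := by linarith [le_abs_self t]
    have h3 := mul_le_mul_of_nonneg_left h1 (Nat.cast_nonneg (α := ℝ) (Fintype.card S))
    rw [hD]; nlinarith
  calc _ ≤ ∫⁻ p, (f (rowPre e σ p.1 p.2 u i)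
        + ENNReal.ofReal (2 * K / T ^ 2 * rowPre e σ p.1 p.2 u i ^ 2)) ∂(haarBias S N a) :=
        lintegral_mono fun p => hpt _
    _ = (∫⁻ p, f (rowPre e σ p.1 p.2 u i) ∂(haarBias S N a))
        + ∫⁻ p, ENNReal.ofReal (2 * K / T ^ 2 * rowPre e σ p.1 p.2 u i ^ 2) ∂(haarBias S N a) :=
        lintegral_add_left (hfm.comp (measurable_rowPre e σ u i)) _
    _ ≤ (ENNReal.ofReal (ε / 3) + ENNReal.ofReal (ε / 3)) + ENNReal.ofReal (ε / 3) := by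
        refine add_le_add (hmain.trans (add_le_add (hn₁ n hn).le ?_)) hsq
        rw [← ENNReal.ofReal_mul (by positivity)]
        refine ENNReal.ofReal_le_ofReal ?_
        rw [div_mul_eq_mul_div, div_le_iff₀ (by positivity)]
        nlinarith [K.2]
    _ = ENNReal.ofReal ε := by
        rw [← ENNReal.ofReal_add (by positivity) (by positivity),
          ← ENNReal.ofReal_add (by positivity) (by positivity)]
        congr 1; ring

theorem lintegral_average_le {Ω : Type*} [MeasurableSpace Ω] {μ : Measure Ω} {w : ℕ} (hw : 0 < w)
    {F : Fin w → Ω → ℝ} (hm : ∀ i, Measurable (F i)) (h0 : ∀ i ω, 0 ≤ F i ω) {c : ℝ}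
    (h : ∀ i, ∫⁻ ω, ENNReal.ofReal (F i ω) ∂μ ≤ ENNReal.ofReal c) :
    ∫⁻ ω, ENNReal.ofReal ((1 / w : ℝ) * ∑ i, F i ω) ∂μ ≤ ENNReal.ofReal c := by
  have hw' : (0 : ℝ) < w := by exact_mod_cast hw
  have e : ∀ ω, ENNReal.ofReal ((1 / w : ℝ) * ∑ i, F i ω)
      = ENNReal.ofReal (1 / w) * ∑ i, ENNReal.ofReal (F i ω) := fun ω => by
    rw [ENNReal.ofReal_mul (by positivity), ENNReal.ofReal_sum_of_nonneg fun i _ => h0 i ω]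
  simp_rw [e]
  rw [lintegral_const_mul _ (Finset.measurable_sum _ fun i _ => (hm i).ennreal_ofReal),
    lintegral_finsetSum _ fun i _ => (hm i).ennreal_ofReal]
  calc _ ≤ ENNReal.ofReal (1 / w) * ∑ _i : Fin w, ENNReal.ofReal c := by
        gcongr with i
        exact h i
    _ = _ := by
        rw [Finset.sum_const, Finset.card_univ, Fintype.card_fin, nsmul_eq_mul, ← mul_assoc,
          ← ENNReal.ofReal_natCast, ← ENNReal.ofReal_mul (by positivity), one_div,
          inv_mul_cancel₀ hw'.ne', ENNReal.ofReal_one, one_mul]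

set_option maxHeartbeats 400000 in
-- A difference quotient is Lipschitz, so its products have Gaussian limits; replacing `deriv φ` by
-- it is cheap both in the averages, neuron by neuron, and in the limit.
theorem gaussLimit_deriv {K : ℝ≥0} {φ : ℝ → ℝ} (hφ : LipschitzWith K φ) (S : Type) [Fintype S]
    {a c b : ℝ} (ha : 0 < a) (hb : 0 < b) (hc : c ^ 2 ≤ a * b) :
    GaussLimit S (fun x y => deriv φ x * deriv φ y) a c b := by
  intro ε hε
  set t := |a| + |b| + 1 with ht
  -- A Gram matrix within `τ` of the limit still has both variances at least `τ`, as the density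
  -- estimate requires.
  set τ := min a b / 2 with hτ
  have hτ0 : 0 < τ := by positivity
  set η := ε / (8 * (K + 1)) with hη
  have hη0 : 0 < η := by positivity
  obtain ⟨n₁, hn₁⟩ := exists_lintegral_rowPre_diffQuot_le hφ S hτ0 t hη0
  obtain ⟨n₂, hn₂⟩ := (Metric.tendsto_atTop.mp (tendsto_gaussPair_diffQuot hφ ha hb hc)) (ε / 4)
    (by positivity)
  set n := max n₁ n₂
  obtain ⟨n₀, hn₀⟩ := hn₁ n (le_max_left _ _)
  have hn := (hn₂ n (le_max_right _ _)).le
  rw [Real.dist_eq] at hn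
  obtain ⟨δ, hδ, m₀, hm₀⟩ := (quadTame_mul_of_lipschitz (lipschitzWith_diffQuot hφ n)).gaussLimit S
    a c b (ε / 4) (by positivity)
  refine ⟨min δ (min 1 τ), by positivity, n₀ + m₀ + 1, ?_⟩
  intro N w e σ u u' hw he h1 h2 h3
  have hwN : w ≤ N := by simpa using Fintype.card_le_of_injective e he
  have hb1 : ∀ (v : S → Fin N → ℝ) (x : ℝ), min a b ≤ x → x ≤ |a| + |b| →
      |∑ s, v s ⬝ᵥ v s / N + σ ^ 2 - x| ≤ min δ (min 1 τ) →
      τ ≤ ∑ s, v s ⬝ᵥ v s / N + σ ^ 2 ∧ ∑ s, v s ⬝ᵥ v s / N + σ ^ 2 ≤ t := by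
    intro v x hx1 hx2 h
    have h4 := abs_le.mp (h.trans ((min_le_right _ _).trans (min_le_left _ _)))
    have h5 := abs_le.mp (h.trans ((min_le_right _ _).trans (min_le_right _ _)))
    constructor
    · linarith [h5.1]
    · linarith [h4.2]
  obtain ⟨l1, l2⟩ := hb1 u a (min_le_left _ _) (by linarith [le_abs_self a, abs_nonneg b]) h1
  obtain ⟨l3, l4⟩ := hb1 u' b (min_le_right _ _) (by linarith [le_abs_self b, abs_nonneg a]) h3
  have hlim := hm₀ (e := e) σ u u' (by omega) he (h1.trans (min_le_left _ _))
    (h2.trans (min_le_left _ _)) (h3.trans (min_le_left _ _))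
  have hd := measurable_deriv φ
  have hq : Measurable (diffQuot φ n) := (lipschitzWith_diffQuot hφ n).continuous.measurable
  set X : (S → OrthGroup N) × (Fin w → ℝ) → ℝ := fun p => (1 / w : ℝ) *
    ∑ i, deriv φ (rowPre e σ p.1 p.2 u i) * deriv φ (rowPre e σ p.1 p.2 u' i) with hX
  set Y : (S → OrthGroup N) × (Fin w → ℝ) → ℝ := fun p => (1 / w : ℝ) *
    ∑ i, diffQuot φ n (rowPre e σ p.1 p.2 u i) * diffQuot φ n (rowPre e σ p.1 p.2 u' i) with hY
  have hXm : Measurable X := Measurable.const_mul (Finset.measurable_sum _ fun i _ =>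
    (hd.comp (measurable_rowPre e σ u i)).mul (hd.comp (measurable_rowPre e σ u' i))) _
  have hYm : Measurable Y := Measurable.const_mul (Finset.measurable_sum _ fun i _ =>
    (hq.comp (measurable_rowPre e σ u i)).mul (hq.comp (measurable_rowPre e σ u' i))) _
  have hXY : ∫⁻ p, ENNReal.ofReal |X p - Y p| ∂(haarBias S N w) ≤ ENNReal.ofReal (ε / 2) := by
    let g : (S → Fin N → ℝ) → Fin w → (S → OrthGroup N) × (Fin w → ℝ) → ℝ := fun v i p =>
      |deriv φ (rowPre e σ p.1 p.2 v i) - diffQuot φ n (rowPre e σ p.1 p.2 v i)|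
    have hgm : ∀ v i, Measurable (g v i) := fun v i =>
      ((hd.comp (measurable_rowPre e σ v i)).sub (hq.comp (measurable_rowPre e σ v i))).abs
    have hdiff : ∀ p, |X p - Y p| ≤ (1 / w : ℝ) * ∑ i, (K * (g u i p + g u' i p)) := by
      intro p
      simp only [hX, hY]
      rw [← mul_sub, ← Finset.sum_sub_distrib, abs_mul, abs_of_nonneg (by positivity : (0 : ℝ) ≤ 1 / w)]
      refine mul_le_mul_of_nonneg_left ((Finset.abs_sum_le_sum_abs _ _).trans
        (Finset.sum_le_sum fun i _ => ?_)) (by positivity)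
      simp only [g]
      set x := rowPre e σ p.1 p.2 u i
      set y := rowPre e σ p.1 p.2 u' i
      have e1 : deriv φ x * deriv φ y - diffQuot φ n x * diffQuot φ n y
        = (deriv φ x - diffQuot φ n x) * deriv φ y + diffQuot φ n x * (deriv φ y - diffQuot φ n y) := by
        ring
      rw [e1]
      refine (abs_add_le _ _).trans ?_
      rw [abs_mul, abs_mul, mul_add]
      refine add_le_add ?_ ?_
      · rw [mul_comm]
        exact mul_le_mul_of_nonneg_right (abs_deriv_le_of_lipschitz hφ y) (abs_nonneg _)
      · exact mul_le_mul_of_nonneg_right (abs_diffQuot_le hφ n x) (abs_nonneg _)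
    refine (lintegral_mono fun p => ENNReal.ofReal_le_ofReal (hdiff p)).trans ?_
    refine lintegral_average_le (F := fun i p => (K : ℝ) * (g u i p + g u' i p)) (by omega)
      (fun i => ((hgm u i).add (hgm u' i)).const_mul _)
      (fun i p => mul_nonneg K.coe_nonneg (add_nonneg (abs_nonneg _) (abs_nonneg _))) (fun i => ?_)
    have e2 : ∀ p, ENNReal.ofReal (K * (g u i p + g u' i p))
        = ENNReal.ofReal K * (ENNReal.ofReal (g u i p) + ENNReal.ofReal (g u' i p)) := fun p => by
      rw [ENNReal.ofReal_mul K.coe_nonneg, ENNReal.ofReal_add (abs_nonneg _) (abs_nonneg _)]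
    simp_rw [e2]
    rw [lintegral_const_mul (f := fun p => ENNReal.ofReal (g u i p) + ENNReal.ofReal (g u' i p)) _
        ((hgm u i).ennreal_ofReal.add (hgm u' i).ennreal_ofReal),
      lintegral_add_left (hgm u i).ennreal_ofReal]
    calc _ ≤ ENNReal.ofReal K * (ENNReal.ofReal η + ENNReal.ofReal η) := by
          gcongr
          · exact hn₀ e σ u i (by omega) l1 l2
          · exact hn₀ e σ u' i (by omega) l3 l4
      _ = ENNReal.ofReal (K * (η + η)) := by
          rw [← ENNReal.ofReal_add hη0.le hη0.le, ← ENNReal.ofReal_mul K.coe_nonneg]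
      _ ≤ _ := by
          refine ENNReal.ofReal_le_ofReal ?_
          have : η * (8 * (K + 1)) = ε := by rw [hη]; field_simp
          nlinarith [K.coe_nonneg]
  set G := gaussPair (fun x y => diffQuot φ n x * diffQuot φ n y) a c b
  set G' := gaussPair (fun x y => deriv φ x * deriv φ y) a c b
  calc ∫⁻ p, ENNReal.ofReal |X p - G'| ∂(haarBias S N w)
      ≤ (∫⁻ p, ENNReal.ofReal |X p - Y p| ∂(haarBias S N w))
        + ∫⁻ p, ENNReal.ofReal |Y p - G'| ∂(haarBias S N w) := lintegral_ofReal_abs_sub_le _ hXm hYm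
    _ ≤ ENNReal.ofReal (ε / 2) + (ENNReal.ofReal (ε / 4) + ENNReal.ofReal (ε / 4)) := by
        refine add_le_add hXY ((lintegral_ofReal_abs_sub_le (Y := fun _ => G) _ hYm
          measurable_const).trans (add_le_add hlim ?_))
        rw [lintegral_const, measure_univ, mul_one]
        exact ENNReal.ofReal_le_ofReal hn
    _ = _ := by
        rw [← ENNReal.ofReal_add (by positivity) (by positivity),
          ← ENNReal.ofReal_add (by positivity) (by positivity)]
        congr 1; ring

/-! ### One layer of a network -/

/-- The pre-activations of a layer. Neuron `i` at position `β` receives the inputs of the positions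
`π β s`, through the weights `ω s`. -/
noncomputable def layerPre {S B B' : Type*} [Fintype S] (κ σ : ℝ) (π : B' → S → B) {a n : ℕ}
    (ω : S → Fin a → Fin n → ℝ) (b : Fin a → ℝ) (x : Fin n → B → ℝ) (i : Fin a) (β : B') : ℝ :=
  κ / √(n : ℝ) * ∑ s, ∑ j, ω s i j * x j (π β s) + σ * b i

/-- The tangent kernel of the pre-activations of a layer, in terms of the tangent kernel `M` of its
inputs. -/
noncomputable def layerKernel {S B B' : Type*} [Fintype S] (κ σ : ℝ) (π : B' → S → B) {a n : ℕ}
    (ω : S → Fin a → Fin n → ℝ) (x : Fin n → B → ℝ) (M : Fin n → B → Fin n → B → ℝ)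
    (i : Fin a) (β : B') (i' : Fin a) (β' : B') : ℝ :=
  κ ^ 2 / n * ∑ s, ∑ s', ∑ j, ∑ j', ω s i j * ω s' i' j' * M j (π β s) j' (π β' s')
    + if i = i' then κ ^ 2 / n * ∑ s, ∑ j, x j (π β s) * x j (π β' s) + σ ^ 2 else 0

/-- The limiting covariance of the pre-activations of a layer. -/
def limitSigma {S B B' : Type*} [Fintype S] (κ σ : ℝ) (π : B' → S → B) (Γ : B → B → ℝ)
    (β β' : B') : ℝ := κ ^ 2 * ∑ s, Γ (π β s) (π β' s) + σ ^ 2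

/-- The limiting tangent kernel of the pre-activations of a layer. -/
def limitTheta {S B B' : Type*} [Fintype S] (κ σ : ℝ) (π : B' → S → B) (Γ T : B → B → ℝ)
    (β γ : B') : ℝ := κ ^ 2 * ∑ s, T (π β s) (π γ s) + limitSigma κ σ π Γ β γ

/-- The empirical covariance and tangent kernel of a layer are `δ`-close to their limits. -/
def NearLimit {B : Type*} (Γ T : B → B → ℝ) (δ : ℝ) {n : ℕ} (x : Fin n → B → ℝ)
    (M : Fin n → B → Fin n → B → ℝ) : Prop :=
  ∀ β β', |1 / (n : ℝ) * ∑ j, x j β * x j β' - Γ β β'| ≤ δ ∧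
    |1 / (n : ℝ) * ∑ j, M j β j β' - T β β'| ≤ δ ∧
    (1 / (n : ℝ)) ^ 2 * ∑ j, ∑ j', M j β j' β' ^ 2 ≤ δ

/-- Extension of a vector by zero. -/
def padVec {n N : ℕ} (x : Fin n → ℝ) (l : Fin N) : ℝ := if h : l.1 < n then x ⟨l, h⟩ else 0

/-- Extension of a matrix by zero. -/
def padMat {n N : ℕ} (M : Fin n → Fin n → ℝ) : Matrix (Fin N) (Fin N) ℝ :=
  Matrix.of fun l l' => padVec (fun j => padVec (M j) l') l

theorem padVec_castLE {n N : ℕ} (h : n ≤ N) (x : Fin n → ℝ) (j : Fin n) :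
    padVec x (Fin.castLE h j) = x j := by simp [padVec]

theorem sum_mul_padVec {n N : ℕ} (h : n ≤ N) (x : Fin n → ℝ) (f : Fin N → ℝ) :
    ∑ l, f l * padVec x l = ∑ j, f (Fin.castLE h j) * x j := by
  refine (Fintype.sum_of_injective (Fin.castLE h) (Fin.castLE_injective h) _ _ (fun l hl => ?_)
    fun j => by rw [padVec_castLE]).symm
  have : ¬ l.1 < n := fun hl' => hl ⟨⟨l, hl'⟩, rfl⟩
  simp [padVec, this]

theorem dotProduct_padVec {n N : ℕ} (h : n ≤ N) (x y : Fin n → ℝ) :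
    (padVec x : Fin N → ℝ) ⬝ᵥ padVec y = ∑ j, x j * y j := by
  rw [dotProduct, sum_mul_padVec h]
  simp only [padVec_castLE]

theorem mul_padMat_mul_transpose {n N : ℕ} (h : n ≤ N) (M : Fin n → Fin n → ℝ)
    (A A' : Matrix (Fin N) (Fin N) ℝ) (i i' : Fin N) :
    (A * (padMat M : Matrix (Fin N) (Fin N) ℝ) * A'ᵀ) i i'
      = ∑ j, ∑ j', A i (Fin.castLE h j) * A' i' (Fin.castLE h j') * M j j' := by
  rw [Matrix.mul_assoc, Matrix.mul_apply]
  have h1 : ∀ l, ((padMat M : Matrix (Fin N) (Fin N) ℝ) * A'ᵀ) l i'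
      = padVec (fun j => ∑ j', A' i' (Fin.castLE h j') * M j j') l := by
    intro l
    simp only [Matrix.mul_apply, padMat, Matrix.of_apply, Matrix.transpose_apply]
    by_cases hl : l.1 < n
    · simp only [padVec, hl, dif_pos]
      rw [← sum_mul_padVec h (M ⟨l, hl⟩) (A' i')]
      exact Finset.sum_congr rfl fun _ _ => mul_comm _ _
    · simp [padVec, hl]
  simp_rw [h1]
  rw [sum_mul_padVec h]
  refine Finset.sum_congr rfl fun j _ => ?_
  rw [Finset.mul_sum]
  exact Finset.sum_congr rfl fun j' _ => by ring

theorem sum_sq_padMat {n N : ℕ} (h : n ≤ N) (M : Fin n → Fin n → ℝ) :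
    ∑ l : Fin N, ∑ l' : Fin N, padMat M l l' ^ 2 = ∑ j, ∑ j', M j j' ^ 2 := by
  have h1 : ∀ x : Fin n → ℝ, ∑ l : Fin N, padVec x l ^ 2 = ∑ j, x j ^ 2 := fun x => by
    simpa only [dotProduct, ← sq] using dotProduct_padVec (N := N) h x x
  rw [Finset.sum_comm]
  simp only [padMat, Matrix.of_apply, h1]
  rw [Finset.sum_comm]
  simp only [h1]

theorem trace_padMat {n N : ℕ} (h : n ≤ N) (M : Fin n → Fin n → ℝ) :
    (padMat M : Matrix (Fin N) (Fin N) ℝ).trace = ∑ j, M j j := by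
  rw [Matrix.trace]
  refine (Fintype.sum_of_injective (Fin.castLE h) (Fin.castLE_injective h) _ _ (fun l hl => ?_)
    fun j => by simp [padMat, padVec_castLE]).symm
  have : ¬ l.1 < n := fun hl' => hl ⟨⟨l, hl'⟩, rfl⟩
  simp [padMat, padVec, this]

/-- Padding by zeros treats wide and tall blocks alike: the block acts on `M` as the full orthogonal
matrix acts on the padded one. -/
theorem sum_scaledBlock_mul {a n : ℕ} (Q Q' : OrthGroup (max a n)) (M : Fin n → Fin n → ℝ)
    (i i' : Fin a) :
    ∑ j, ∑ j', scaledBlock a n Q i j * scaledBlock a n Q' i' j' * M j j'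
      = ((max a n : ℕ) : ℝ) * (Q.1 * (padMat M : Matrix (Fin (max a n)) (Fin (max a n)) ℝ) * Q'.1ᵀ)
        (Fin.castLE (le_max_left a n) i)
        (Fin.castLE (le_max_left a n) i') := by
  rw [mul_padMat_mul_transpose (le_max_right a n), Finset.mul_sum]
  refine Finset.sum_congr rfl fun j _ => ?_
  rw [Finset.mul_sum]
  refine Finset.sum_congr rfl fun j' _ => ?_
  have h : √((max a n : ℕ) : ℝ) * √((max a n : ℕ) : ℝ) = ((max a n : ℕ) : ℝ) :=
    Real.mul_self_sqrt (Nat.cast_nonneg _)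
  simp only [scaledBlock]
  linear_combination (Q.1 (Fin.castLE (le_max_left a n) i) (Fin.castLE (le_max_right a n) j)
    * Q'.1 (Fin.castLE (le_max_left a n) i') (Fin.castLE (le_max_right a n) j') * M j j') * h

/-- For independent matrices the second moment of one coordinate, used once on each side, gives the
Frobenius norm exactly; no trace has to be subtracted. -/
theorem lintegral_bilin_sq {N : ℕ} (M : Matrix (Fin N) (Fin N) ℝ) (i j : Fin N) :
    ∫⁻ Q' : OrthGroup N, ∫⁻ Q : OrthGroup N, ENNReal.ofReal ((N * (Q.1 * M * Q'.1ᵀ) i j) ^ 2)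
      ∂(haarOrth N) ∂(haarOrth N) = ENNReal.ofReal (∑ k, ∑ l, M k l ^ 2) := by
  have hN : (N : ℝ) ≠ 0 := by
    have := i.pos
    positivity
  have h1 : ∀ Q' : OrthGroup N, ∫⁻ Q : OrthGroup N, ENNReal.ofReal ((N * (Q.1 * M * Q'.1ᵀ) i j) ^ 2)
      ∂(haarOrth N) = ENNReal.ofReal (N * ∑ k, (Q'.1 *ᵥ M k) j ^ 2) := by
    intro Q'
    have e : ∀ Q : OrthGroup N, (Q.1 * M * Q'.1ᵀ) i j = (Q.1 *ᵥ fun k => (Q'.1 *ᵥ M k) j) i := by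
      intro Q
      rw [Matrix.mul_assoc, Matrix.mul_apply]
      simp [Matrix.mulVec, dotProduct, Matrix.mul_apply, mul_comm]
    simp_rw [e, mul_pow]
    generalize hw : (fun k => (Q'.1 *ᵥ M k) j) = w
    have hi : Integrable (fun Q : OrthGroup N => (N : ℝ) ^ 2 * (Q.1 *ᵥ w) i ^ 2) (haarOrth N) :=
      (integrable_haarOrth_of_continuous ((OrthGroup.continuous_mulVec w i).pow 2)).const_mul _
    rw [← ofReal_integral_eq_lintegral_ofReal hi (ae_of_all _ fun Q => mul_nonneg (sq_nonneg _)
      (sq_nonneg _)), integral_const_mul, integral_mulVec_sq_haarOrth, ← hw]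
    congr 1
    simp only [dotProduct, ← sq]
    field_simp
  simp_rw [h1]
  have hi : ∀ k, Integrable (fun Q : OrthGroup N => (Q.1 *ᵥ M k) j ^ 2) (haarOrth N) := fun k =>
    integrable_haarOrth_of_continuous ((OrthGroup.continuous_mulVec _ j).pow 2)
  rw [← ofReal_integral_eq_lintegral_ofReal ((integrable_finsetSum _ fun k _ => hi k).const_mul _)
      (ae_of_all _ fun Q => by positivity), integral_const_mul, integral_finsetSum _ fun k _ => hi k]
  simp_rw [integral_mulVec_sq_haarOrth]
  rw [← Finset.sum_div, mul_div_cancel₀ _ hN]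
  simp only [dotProduct, ← sq]

theorem lintegral_pi_pair {S X : Type*} [Fintype S] [DecidableEq S] [MeasurableSpace X]
    (μ : Measure X) [IsProbabilityMeasure μ] {s s' : S} (hs : s ≠ s') {F : X → X → ℝ≥0∞}
    (hF : Measurable (Function.uncurry F)) :
    ∫⁻ Q : S → X, F (Q s) (Q s') ∂(Measure.pi fun _ => μ) = ∫⁻ y, ∫⁻ x, F x y ∂μ ∂μ := by
  have hm : Measurable fun Q : S → X => F (Q s) (Q s') :=
    hF.comp (f := fun Q : S → X => (Q s, Q s')) (by fun_prop)
  have hmp := measurePreserving_pi_update (fun _ : S => μ) s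
  rw [← hmp.lintegral_comp hm]
  have := lintegral_prod (μ := Measure.pi fun _ : S => μ) (ν := μ) _ (hm.comp hmp.measurable).aemeasurable
  simp only [Function.comp] at this
  rw [this]
  simp only [Function.update_self, Function.update_of_ne hs.symm]
  exact (measurePreserving_eval (fun _ : S => μ) s').lintegral_comp
    (f := fun y => ∫⁻ x, F x y ∂μ) hF.lintegral_prod_left'

/-- The fluctuation of a conjugation of a matrix by independent Haar orthogonal matrices. -/
theorem lintegral_sum_scaledBlock_sub_sq_le {S : Type*} [Fintype S] [DecidableEq S] {a n : ℕ}
    (M : Fin n → Fin n → ℝ) (i i' : Fin a) (s s' : S) :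
    ∫⁻ Q : S → OrthGroup (max a n), ENNReal.ofReal
      ((∑ j, ∑ j', scaledBlock a n (Q s) i j * scaledBlock a n (Q s') i' j' * M j j'
        - if s = s' ∧ i = i' then ∑ j, M j j else 0) ^ 2) ∂(Measure.pi fun _ => haarOrth (max a n))
      ≤ ENNReal.ofReal (36 * ∑ j, ∑ j', M j j' ^ 2) := by
  simp_rw [sum_scaledBlock_mul]
  set N := max a n
  set P : Matrix (Fin N) (Fin N) ℝ := padMat M with hP
  have hinj := Fin.castLE_injective (le_max_left a n)
  set k := Fin.castLE (le_max_left a n) i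
  set k' := Fin.castLE (le_max_left a n) i'
  have hk : i = i' ↔ k = k' := hinj.eq_iff.symm
  rw [← sum_sq_padMat (le_max_right a n) M, ← trace_padMat (le_max_right a n) M, ← hP]
  -- Equal offsets share the matrix and give a quadratic form with mean `δ tr M`; distinct offsets
  -- have independent matrices and no mean.
  by_cases hs : s = s'
  · subst hs
    simp only [true_and, hk]
    have hc : Continuous fun Q : OrthGroup N =>
        ((N : ℝ) * (Q.1 * P * Q.1ᵀ) k k' - if k = k' then P.trace else 0) ^ 2 :=
      ((continuous_const.mul (OrthGroup.continuous_conj P k k')).sub continuous_const).pow 2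
    rw [(measurePreserving_eval (fun _ : S => haarOrth N) s).lintegral_comp
      (f := fun Q : OrthGroup N => ENNReal.ofReal
        (((N : ℝ) * (Q.1 * P * Q.1ᵀ) k k' - if k = k' then P.trace else 0) ^ 2))
      hc.measurable.ennreal_ofReal]
    exact lintegral_ofReal_le_of_le (integrable_haarOrth_of_continuous hc) (fun _ => sq_nonneg _)
      (fun _ => le_rfl) (integral_conj_sub_trace_sq_le P k k')
  · simp only [hs, false_and, if_false, sub_zero]
    rw [lintegral_pi_pair (haarOrth N) hs
      (F := fun Q Q' => ENNReal.ofReal (((N : ℝ) * (Q.1 * P * Q'.1ᵀ) k k') ^ 2)), lintegral_bilin_sq]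
    · refine ENNReal.ofReal_le_ofReal ?_
      have : 0 ≤ ∑ l, ∑ l', P l l' ^ 2 :=
        Finset.sum_nonneg fun _ _ => Finset.sum_nonneg fun _ _ => sq_nonneg _
      linarith
    · refine Measurable.ennreal_ofReal (Measurable.pow_const (Measurable.const_mul ?_ _) 2)
      simp only [Matrix.mul_apply, Matrix.transpose_apply]
      refine Finset.measurable_sum _ fun l _ => Measurable.mul
        (Finset.measurable_sum _ fun l' _ => Measurable.mul_const ?_ _) ?_
      · exact (OrthGroup.measurable_apply k l').comp measurable_fst
      · exact (OrthGroup.measurable_apply k' l).comp measurable_snd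

theorem measurable_scaledBlock_apply {a n : ℕ} (i : Fin a) (j : Fin n) :
    Measurable fun Q : OrthGroup (max a n) => scaledBlock a n Q i j :=
  (OrthGroup.measurable_apply _ _).const_mul _

/-- The kernel is a sum over pairs of offsets; after centring each summand, Cauchy-Schwarz over the
`(Fintype.card S) ^ 2` pairs reduces to a single conjugation, whose variance is the normalised
Hilbert-Schmidt norm of `M`. -/
theorem lintegral_layerKernel_sub_sq_le {S B B' : Type*} [Fintype S] (κ σ : ℝ) (π : B' → S → B)
    {a n : ℕ} (x : Fin n → B → ℝ) (M : Fin n → B → Fin n → B → ℝ) (i : Fin a) (β : B') (i' : Fin a)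
    (β' : B') {δ : ℝ} (hM : ∀ β β', (1 / (n : ℝ)) ^ 2 * ∑ j, ∑ j', M j β j' β' ^ 2 ≤ δ) :
    ∫⁻ Q : S → OrthGroup (max a n), ENNReal.ofReal
      ((layerKernel κ σ π (fun s => scaledBlock a n (Q s)) x M i β i' β'
        - if i = i' then κ ^ 2 * ∑ s, (1 / (n : ℝ) * ∑ j, M j (π β s) j (π β' s))
          + (κ ^ 2 / n * ∑ s, ∑ j, x j (π β s) * x j (π β' s) + σ ^ 2) else 0) ^ 2)
      ∂(Measure.pi fun _ => haarOrth (max a n))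
      ≤ ENNReal.ofReal (36 * κ ^ 4 * (Fintype.card S : ℝ) ^ 4 * δ) := by
  classical
  set m : ℝ := (Fintype.card S : ℝ) with hm
  let Z : S × S → (S → OrthGroup (max a n)) → ℝ := fun q Q =>
    ∑ j, ∑ j', scaledBlock a n (Q q.1) i j * scaledBlock a n (Q q.2) i' j' * M j (π β q.1) j' (π β' q.2)
      - if q.1 = q.2 ∧ i = i' then ∑ j, M j (π β q.1) j (π β' q.2) else 0
  have hZm : ∀ q, Measurable (Z q) := fun q => by
    refine Measurable.sub_const (Finset.measurable_sum _ fun j _ => Finset.measurable_sum _ fun j' _ =>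
      Measurable.mul_const (Measurable.mul ?_ ?_) _) _
    · exact (measurable_scaledBlock_apply i j).comp (measurable_pi_apply q.1)
    · exact (measurable_scaledBlock_apply i' j').comp (measurable_pi_apply q.2)
  have hZ : ∀ q, ∫⁻ Q, ENNReal.ofReal ((1 / (n : ℝ)) ^ 2 * Z q Q ^ 2)
      ∂(Measure.pi fun _ => haarOrth (max a n)) ≤ ENNReal.ofReal (36 * δ) := by
    intro q
    have h := lintegral_sum_scaledBlock_sub_sq_le (fun j j' => M j (π β q.1) j' (π β' q.2)) i i' q.1 q.2
    have e : ∀ Q, ENNReal.ofReal ((1 / (n : ℝ)) ^ 2 * Z q Q ^ 2)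
        = ENNReal.ofReal ((1 / (n : ℝ)) ^ 2) * ENNReal.ofReal (Z q Q ^ 2) := fun Q =>
      ENNReal.ofReal_mul (by positivity)
    simp_rw [e]
    rw [lintegral_const_mul _ ((hZm q).pow_const 2).ennreal_ofReal]
    calc _ ≤ ENNReal.ofReal ((1 / (n : ℝ)) ^ 2)
          * ENNReal.ofReal (36 * ∑ j, ∑ j', M j (π β q.1) j' (π β' q.2) ^ 2) := by gcongr
      _ ≤ _ := by
          rw [← ENNReal.ofReal_mul (by positivity)]
          refine ENNReal.ofReal_le_ofReal ?_
          have := hM (π β q.1) (π β' q.2)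
          linarith
  have hexp : ∀ Q : S → OrthGroup (max a n),
      layerKernel κ σ π (fun s => scaledBlock a n (Q s)) x M i β i' β'
        - (if i = i' then κ ^ 2 * ∑ s, (1 / (n : ℝ) * ∑ j, M j (π β s) j (π β' s))
          + (κ ^ 2 / n * ∑ s, ∑ j, x j (π β s) * x j (π β' s) + σ ^ 2) else 0)
        = κ ^ 2 * ∑ q, (1 / (n : ℝ)) * Z q Q := by
    intro Q
    simp only [layerKernel, Z, mul_sub, Finset.sum_sub_distrib, Fintype.sum_prod_type, ite_and]
    have e1 : ∀ s : S, ∑ s', (1 / (n : ℝ)) * (if s = s' then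
        if i = i' then ∑ j, M j (π β s) j (π β' s') else 0 else 0)
        = (1 / (n : ℝ)) * if i = i' then ∑ j, M j (π β s) j (π β' s) else 0 := by
      intro s
      rw [← Finset.mul_sum, Finset.sum_ite_eq, if_pos (Finset.mem_univ s)]
    simp only [e1]
    simp only [← Finset.mul_sum]
    split_ifs
    · ring
    · simp; ring
  have hbound : ∀ Q : S → OrthGroup (max a n), (κ ^ 2 * ∑ q, (1 / (n : ℝ)) * Z q Q) ^ 2
      ≤ κ ^ 4 * m ^ 2 * ∑ q, (1 / (n : ℝ)) ^ 2 * Z q Q ^ 2 := by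
    intro Q
    have h := sq_sum_le_card_mul_sum_sq (s := (Finset.univ : Finset (S × S)))
      (f := fun q => (1 / (n : ℝ)) * Z q Q)
    rw [Finset.card_univ, Fintype.card_prod] at h
    push_cast at h
    simp only [mul_pow (1 / (n : ℝ))] at h
    calc _ = κ ^ 4 * (∑ q, (1 / (n : ℝ)) * Z q Q) ^ 2 := by ring
      _ ≤ κ ^ 4 * (m * m * ∑ q, (1 / (n : ℝ)) ^ 2 * Z q Q ^ 2) :=
          mul_le_mul_of_nonneg_left h (by positivity)
      _ = _ := by ring
  simp_rw [hexp]
  have hmq : ∀ q, Measurable fun Q => ENNReal.ofReal ((1 / (n : ℝ)) ^ 2 * Z q Q ^ 2) := fun q =>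
    (((hZm q).pow_const 2).const_mul _).ennreal_ofReal
  calc _ ≤ ∫⁻ Q, ENNReal.ofReal (κ ^ 4 * m ^ 2) * ∑ q, ENNReal.ofReal ((1 / (n : ℝ)) ^ 2 * Z q Q ^ 2)
        ∂(Measure.pi fun _ => haarOrth (max a n)) := by
        refine lintegral_mono fun Q => (ENNReal.ofReal_le_ofReal (hbound Q)).trans (le_of_eq ?_)
        rw [ENNReal.ofReal_mul (by positivity), ENNReal.ofReal_sum_of_nonneg fun q _ => by positivity]
    _ = ENNReal.ofReal (κ ^ 4 * m ^ 2) * ∑ q, ∫⁻ Q, ENNReal.ofReal ((1 / (n : ℝ)) ^ 2 * Z q Q ^ 2)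
        ∂(Measure.pi fun _ => haarOrth (max a n)) := by
        rw [lintegral_const_mul _ (Finset.measurable_sum _ fun q _ => hmq q),
          lintegral_finsetSum _ fun q _ => hmq q]
    _ ≤ ENNReal.ofReal (κ ^ 4 * m ^ 2) * ∑ _q : S × S, ENNReal.ofReal (36 * δ) := by
        gcongr with q
        exact hZ q
    _ = _ := by
        rw [Finset.sum_const, Finset.card_univ, Fintype.card_prod, nsmul_eq_mul,
          ← ENNReal.ofReal_natCast, ← ENNReal.ofReal_mul (by positivity),
          ← ENNReal.ofReal_mul (by positivity)]
        congr 1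
        push_cast
        ring

theorem lintegral_ofReal_add_sq_le {Ω : Type*} [MeasurableSpace Ω] {μ : Measure Ω}
    [IsProbabilityMeasure μ] {X : Ω → ℝ} (hX : Measurable X) {c r d : ℝ} (hr : 0 ≤ r) (hd : |d| ≤ c)
    (h : ∫⁻ ω, ENNReal.ofReal (X ω ^ 2) ∂μ ≤ ENNReal.ofReal r) :
    ∫⁻ ω, ENNReal.ofReal ((X ω + d) ^ 2) ∂μ ≤ ENNReal.ofReal (2 * r + 2 * c ^ 2) := by
  have hpt : ∀ ω, ENNReal.ofReal ((X ω + d) ^ 2)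
      ≤ ENNReal.ofReal 2 * ENNReal.ofReal (X ω ^ 2) + ENNReal.ofReal (2 * c ^ 2) := by
    intro ω
    rw [← ENNReal.ofReal_mul (by norm_num), ← ENNReal.ofReal_add (by positivity) (by positivity)]
    refine ENNReal.ofReal_le_ofReal ?_
    have : d ^ 2 ≤ c ^ 2 := sq_le_sq' (by linarith [(abs_le.mp hd).1]) (abs_le.mp hd).2
    nlinarith [sq_nonneg (X ω - d)]
  refine (lintegral_mono hpt).trans ?_
  rw [lintegral_add_right _ measurable_const, lintegral_const, measure_univ, mul_one,
    lintegral_const_mul _ (hX.pow_const 2).ennreal_ofReal,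
    ENNReal.ofReal_add (by positivity) (by positivity),
    ENNReal.ofReal_mul (p := 2) (q := r) (by norm_num)]
  gcongr

/-- Pointwise `|X| ≤ X ^ 2 / η + η`, which avoids Hölder's inequality and square roots of lower
integrals. -/
theorem lintegral_abs_le_of_sq {Ω : Type*} [MeasurableSpace Ω] {μ : Measure Ω}
    [IsProbabilityMeasure μ] {X : Ω → ℝ} (hX : Measurable X) {η : ℝ} (hη : 0 < η)
    (h : ∫⁻ ω, ENNReal.ofReal (X ω ^ 2) ∂μ ≤ ENNReal.ofReal (η ^ 2)) :
    ∫⁻ ω, ENNReal.ofReal |X ω| ∂μ ≤ ENNReal.ofReal (2 * η) := by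
  have hpt : ∀ ω, ENNReal.ofReal |X ω|
      ≤ ENNReal.ofReal (1 / η) * ENNReal.ofReal (X ω ^ 2) + ENNReal.ofReal η := by
    intro ω
    rw [← ENNReal.ofReal_mul (by positivity), ← ENNReal.ofReal_add (by positivity) hη.le]
    refine ENNReal.ofReal_le_ofReal ?_
    rw [← sq_abs, one_div, ← div_eq_inv_mul, ← sub_le_iff_le_add, le_div_iff₀ hη]
    nlinarith [sq_nonneg (|X ω| - η), abs_nonneg (X ω)]
  refine (lintegral_mono hpt).trans ?_
  rw [lintegral_add_right _ measurable_const, lintegral_const, measure_univ, mul_one,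
    lintegral_const_mul _ (hX.pow_const 2).ennreal_ofReal, two_mul, ENNReal.ofReal_add hη.le hη.le]
  gcongr
  calc _ ≤ ENNReal.ofReal (1 / η) * ENNReal.ofReal (η ^ 2) := by gcongr
    _ = _ := by
        rw [← ENNReal.ofReal_mul (by positivity)]
        congr 1
        field_simp

theorem measurable_layerPre {Ω S B B' : Type*} [MeasurableSpace Ω] [Fintype S] (κ σ : ℝ)
    (π : B' → S → B) {a n : ℕ} {ω : Ω → S → Fin a → Fin n → ℝ} {b : Ω → Fin a → ℝ}
    {x : Ω → Fin n → B → ℝ} (hω : ∀ s i j, Measurable fun t => ω t s i j)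
    (hb : ∀ i, Measurable fun t => b t i) (hx : ∀ j β, Measurable fun t => x t j β)
    (i : Fin a) (β : B') : Measurable fun t => layerPre κ σ π (ω t) (b t) (x t) i β :=
  ((Finset.measurable_sum _ fun s _ => Finset.measurable_sum _ fun j _ =>
    (hω s i j).mul (hx j (π β s))).const_mul _).add ((hb i).const_mul _)

theorem measurable_layerKernel {Ω S B B' : Type*} [MeasurableSpace Ω] [Fintype S] (κ σ : ℝ)
    (π : B' → S → B) {a n : ℕ} {ω : Ω → S → Fin a → Fin n → ℝ}
    {x : Ω → Fin n → B → ℝ} {M : Ω → Fin n → B → Fin n → B → ℝ}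
    (hω : ∀ s i j, Measurable fun t => ω t s i j) (hx : ∀ j β, Measurable fun t => x t j β)
    (hM : ∀ j β j' β', Measurable fun t => M t j β j' β') (i : Fin a) (β : B') (i' : Fin a)
    (β' : B') : Measurable fun t => layerKernel κ σ π (ω t) (x t) (M t) i β i' β' := by
  refine Measurable.add (Measurable.const_mul (Finset.measurable_sum _ fun s _ =>
    Finset.measurable_sum _ fun s' _ => Finset.measurable_sum _ fun j _ =>
    Finset.measurable_sum _ fun j' _ => ((hω s i j).mul (hω s' i' j')).mul (hM _ _ _ _)) _) ?_
  by_cases h : i = i'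
  · simp only [h, if_true]
    exact Measurable.add_const (Measurable.const_mul (Finset.measurable_sum _ fun s _ =>
      Finset.measurable_sum _ fun j _ => (hx _ _).mul (hx _ _)) _) _
  · simp only [h, if_false]
    exact measurable_const

theorem measurable_layerKernel_weight {S B B' : Type*} [Fintype S] (κ σ : ℝ) (π : B' → S → B)
    {a n : ℕ} (x : Fin n → B → ℝ) (M : Fin n → B → Fin n → B → ℝ) (i : Fin a) (β : B') (i' : Fin a)
    (β' : B') : Measurable fun ω : S → Fin a → Fin n → ℝ => layerKernel κ σ π ω x M i β i' β' :=
  measurable_layerKernel (ω := fun ω => ω) (x := fun _ => x) (M := fun _ => M) κ σ π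
    (fun s i j => by fun_prop) (fun _ _ => measurable_const) (fun _ _ _ _ => measurable_const) i β i' β'

theorem measurePreserving_scaledBlock_pi (S : Type*) [Fintype S] (a n : ℕ) :
    MeasurePreserving (fun Q : S → OrthGroup (max a n) => fun s => scaledBlock a n (Q s))
      (Measure.pi fun _ => haarOrth (max a n)) (Measure.pi fun _ => orthInit a n) :=
  measurePreserving_pi _ _ fun _ => ⟨(continuous_scaledBlock a n).measurable, rfl⟩

theorem measurableSet_nearLimit {Ω B : Type*} [MeasurableSpace Ω] [Countable B] (Γ T : B → B → ℝ)
    (δ : ℝ) {n : ℕ} {x : Ω → Fin n → B → ℝ} {M : Ω → Fin n → B → Fin n → B → ℝ}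
    (hx : ∀ j β, Measurable fun t => x t j β) (hM : ∀ j β j' β', Measurable fun t => M t j β j' β') :
    MeasurableSet {t | NearLimit Γ T δ (x t) (M t)} := by
  simp only [NearLimit, Set.ofPred_forall]
  refine MeasurableSet.iInter fun β => MeasurableSet.iInter fun β' => ?_
  have h1 : Measurable fun t => 1 / (n : ℝ) * ∑ j, x t j β * x t j β' - Γ β β' :=
    ((Finset.measurable_sum _ fun j _ => (hx j β).mul (hx j β')).const_mul _).sub_const _
  have h2 : Measurable fun t => 1 / (n : ℝ) * ∑ j, M t j β j β' - T β β' :=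
    ((Finset.measurable_sum _ fun j _ => hM j β j β').const_mul _).sub_const _
  have h3 : Measurable fun t => (1 / (n : ℝ)) ^ 2 * ∑ j, ∑ j', M t j β j' β' ^ 2 :=
    (Finset.measurable_sum _ fun j _ => Finset.measurable_sum _ fun j' _ =>
      (hM j β j' β').pow_const 2).const_mul _
  exact (measurableSet_le h1.abs measurable_const).inter
    ((measurableSet_le h2.abs measurable_const).inter (measurableSet_le h3 measurable_const))

theorem NearLimit.mono {B : Type*} {Γ T : B → B → ℝ} {δ δ' : ℝ} (h : δ ≤ δ') {n : ℕ}
    {x : Fin n → B → ℝ} {M : Fin n → B → Fin n → B → ℝ} (hx : NearLimit Γ T δ x M) :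
    NearLimit Γ T δ' x M := fun β β' =>
  ⟨(hx β β').1.trans h, (hx β β').2.1.trans h, (hx β β').2.2.trans h⟩

theorem abs_gram_sub_limitSigma_le {S B B' : Type*} [Fintype S] (κ σ : ℝ) (π : B' → S → B)
    {Γ T : B → B → ℝ} {δ : ℝ} {n : ℕ} {x : Fin n → B → ℝ} {M : Fin n → B → Fin n → B → ℝ}
    (hx : NearLimit Γ T δ x M) (β β' : B') :
    |κ ^ 2 / n * ∑ s, ∑ j, x j (π β s) * x j (π β' s) + σ ^ 2 - limitSigma κ σ π Γ β β'|
      ≤ κ ^ 2 * Fintype.card S * δ := by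
  have e : κ ^ 2 / n * ∑ s, ∑ j, x j (π β s) * x j (π β' s) + σ ^ 2 - limitSigma κ σ π Γ β β'
      = κ ^ 2 * ∑ s, (1 / (n : ℝ) * ∑ j, x j (π β s) * x j (π β' s) - Γ (π β s) (π β' s)) := by
    rw [Finset.sum_sub_distrib, ← Finset.mul_sum, limitSigma]; ring
  rw [e, abs_mul, abs_of_nonneg (sq_nonneg κ), mul_assoc]
  refine mul_le_mul_of_nonneg_left ((Finset.abs_sum_le_sum_abs _ _).trans ?_) (sq_nonneg κ)
  refine (Finset.sum_le_sum fun s _ => (hx (π β s) (π β' s)).1).trans (le_of_eq ?_)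
  simp

theorem exists_lintegral_layerKernel_sub_limitTheta_le {S B B' : Type*} [Fintype S] (κ σ : ℝ)
    (π : B' → S → B) (Γ T : B → B → ℝ) {r : ℝ} (hr : 0 < r) :
    ∃ δ : ℝ, 0 < δ ∧ ∀ {a n : ℕ} {x : Fin n → B → ℝ} {M : Fin n → B → Fin n → B → ℝ},
      NearLimit Γ T δ x M → ∀ (i : Fin a) (β : B') (i' : Fin a) (β' : B'),
      ∫⁻ Q : S → OrthGroup (max a n), ENNReal.ofReal
        ((layerKernel κ σ π (fun s => scaledBlock a n (Q s)) x M i β i' β'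
          - if i = i' then limitTheta κ σ π Γ T β β' else 0) ^ 2)
        ∂(Measure.pi fun _ => haarOrth (max a n)) ≤ ENNReal.ofReal r := by
  set m : ℝ := (Fintype.card S : ℝ) with hm
  have hm0 : 0 ≤ m := by positivity
  -- Twice the variance bound `36 κ⁴ m⁴ δ` plus twice the square of the deterministic error `2 κ² m
  -- δ`, where `δ ^ 2 ≤ δ`.
  set C : ℝ := 72 * κ ^ 4 * m ^ 4 + 8 * κ ^ 4 * m ^ 2 with hC
  have hC0 : 0 ≤ C := by positivity
  refine ⟨min 1 (r / (C + 1)), by positivity, ?_⟩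
  intro a n x M hx i β i' β'
  set δ := min 1 (r / (C + 1)) with hδ
  have hδ0 : 0 < δ := by positivity
  have hδ1 : δ ≤ 1 := min_le_left _ _
  have hCδ : C * δ ≤ r := by
    have : δ ≤ r / (C + 1) := min_le_right _ _
    rw [le_div_iff₀ (by positivity)] at this
    nlinarith
  have h := lintegral_layerKernel_sub_sq_le κ σ π x M i β i' β' fun β β' => (hx β β').2.2
  obtain ⟨c, hc⟩ : ∃ c : ℝ, c = if i = i' then κ ^ 2 * ∑ s, (1 / (n : ℝ) *
      ∑ j, M j (π β s) j (π β' s)) + (κ ^ 2 / n * ∑ s, ∑ j, x j (π β s) * x j (π β' s) + σ ^ 2)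
      else 0 := ⟨_, rfl⟩
  rw [← hc, ← hm] at h
  set d : ℝ := c - if i = i' then limitTheta κ σ π Γ T β β' else 0 with hd
  have hdle : |d| ≤ 2 * κ ^ 2 * m * δ := by
    rw [hd, hc]
    split_ifs with hi
    · have h1 := abs_gram_sub_limitSigma_le κ σ π hx β β'
      have h2 : |κ ^ 2 * ∑ s, (1 / (n : ℝ) * ∑ j, M j (π β s) j (π β' s))
          - κ ^ 2 * ∑ s, T (π β s) (π β' s)| ≤ κ ^ 2 * m * δ := by
        rw [← mul_sub, ← Finset.sum_sub_distrib, abs_mul, abs_of_nonneg (sq_nonneg κ), mul_assoc]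
        refine mul_le_mul_of_nonneg_left ((Finset.abs_sum_le_sum_abs _ _).trans ?_) (sq_nonneg κ)
        refine (Finset.sum_le_sum fun s _ => (hx (π β s) (π β' s)).2.1).trans (le_of_eq ?_)
        simp [hm]
      rw [limitTheta, add_sub_add_comm]
      refine (abs_add_le _ _).trans ?_
      linarith
    · rw [sub_zero, abs_zero]; positivity
  have hX : Measurable fun Q : S → OrthGroup (max a n) =>
      layerKernel κ σ π (fun s => scaledBlock a n (Q s)) x M i β i' β' - c := by
    exact ((measurable_layerKernel_weight κ σ π x M i β i' β').comp
      (measurePreserving_scaledBlock_pi S a n).measurable).sub_const c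
  have hr0 : 0 ≤ 36 * κ ^ 4 * m ^ 4 * δ := by positivity
  have h2 := lintegral_ofReal_add_sq_le (μ := Measure.pi fun _ : S => haarOrth (max a n)) hX hr0 hdle h
  have e : ∀ Q : S → OrthGroup (max a n),
      layerKernel κ σ π (fun s => scaledBlock a n (Q s)) x M i β i' β' - c + d
      = layerKernel κ σ π (fun s => scaledBlock a n (Q s)) x M i β i' β'
        - if i = i' then limitTheta κ σ π Γ T β β' else 0 := fun Q => by rw [hd]; ring
  simp_rw [e] at h2
  refine h2.trans (ENNReal.ofReal_le_ofReal ?_)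
  have h3 : κ ^ 4 * m ^ 2 * (δ * δ) ≤ κ ^ 4 * m ^ 2 * (1 * δ) := by gcongr
  calc _ = 72 * κ ^ 4 * m ^ 4 * δ + 8 * (κ ^ 4 * m ^ 2 * (δ * δ)) := by ring
    _ ≤ 72 * κ ^ 4 * m ^ 4 * δ + 8 * (κ ^ 4 * m ^ 2 * (1 * δ)) := by linarith
    _ = C * δ := by rw [hC]; ring
    _ ≤ r := hCδ

/-- The law of the weights and biases of one layer. -/
noncomputable def layerInit (S : Type*) [Fintype S] (a n : ℕ) :
    Measure ((S → Fin a → Fin n → ℝ) × (Fin a → ℝ)) :=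
  (Measure.pi fun _ => orthInit a n).prod (Measure.pi fun _ => gaussianReal 0 1)

instance layerInit.instIsProbabilityMeasure (S : Type*) [Fintype S] (a n : ℕ) :
    IsProbabilityMeasure (layerInit S a n) := by unfold layerInit; infer_instance

theorem measurePreserving_layerInit (S : Type*) [Fintype S] (a n : ℕ) :
    MeasurePreserving (fun p : (S → OrthGroup (max a n)) × (Fin a → ℝ) =>
      ((fun s => scaledBlock a n (p.1 s)), p.2)) (haarBias S (max a n) a) (layerInit S a n) :=
  (measurePreserving_scaledBlock_pi S a n).prod (MeasurePreserving.id _)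

/-- The vector which the Haar orthogonal matrices act on in a layer with inputs `x`. -/
noncomputable def layerVec {S B B' : Type*} (κ : ℝ) (π : B' → S → B) (a : ℕ) {n : ℕ}
    (x : Fin n → B → ℝ) (β : B') (s : S) : Fin (max a n) → ℝ :=
  (κ * √((max a n : ℕ) : ℝ) / √(n : ℝ)) • padVec fun j => x j (π β s)

theorem layerPre_scaledBlock {S B B' : Type*} [Fintype S] (κ σ : ℝ) (π : B' → S → B) {a n : ℕ}
    (Q : S → OrthGroup (max a n)) (b : Fin a → ℝ) (x : Fin n → B → ℝ) (i : Fin a) (β : B') :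
    layerPre κ σ π (fun s => scaledBlock a n (Q s)) b x i β
      = rowPre (Fin.castLE (le_max_left a n)) σ Q b (layerVec κ π a x β) i := by
  rw [layerPre, rowPre, Finset.mul_sum]
  congr 1
  refine Finset.sum_congr rfl fun s _ => ?_
  rw [layerVec, Matrix.mulVec_smul, Pi.smul_apply, smul_eq_mul, Matrix.mulVec, dotProduct,
    sum_mul_padVec (le_max_right a n), Finset.mul_sum, Finset.mul_sum]
  refine Finset.sum_congr rfl fun j _ => ?_
  rw [scaledBlock]; ring

/-- The factor `√(max a n)` of the block cancels the division by the matrix size, so the Gram matrix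
seen by the Haar estimates is the empirical covariance of the layer, whatever the aspect ratio. -/
theorem sum_layerVec_dotProduct {S B B' : Type*} [Fintype S] (κ : ℝ) (π : B' → S → B) {a n : ℕ}
    (ha : 0 < a) (x : Fin n → B → ℝ) (β β' : B') :
    ∑ s, layerVec κ π a x β s ⬝ᵥ layerVec κ π a x β' s / ((max a n : ℕ) : ℝ)
      = κ ^ 2 / n * ∑ s, ∑ j, x j (π β s) * x j (π β' s) := by
  rw [Finset.mul_sum]
  refine Finset.sum_congr rfl fun s _ => ?_
  have hN : ((max a n : ℕ) : ℝ) ≠ 0 := by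
    have : 0 < max a n := lt_of_lt_of_le ha (le_max_left _ _)
    positivity
  rw [layerVec, layerVec, smul_dotProduct, dotProduct_smul, dotProduct_padVec (le_max_right a n),
    smul_eq_mul, smul_eq_mul]
  set N := ((max a n : ℕ) : ℝ)
  have h1 : √N * √N = N := Real.mul_self_sqrt (Nat.cast_nonneg _)
  have h2 : √(n : ℝ) * √(n : ℝ) = n := Real.mul_self_sqrt (Nat.cast_nonneg _)
  rw [← mul_assoc, div_mul_div_comm, h2]
  calc _ = κ * κ * (√N * √N) / n * (∑ j, x j (π β s) * x j (π β' s)) / N := by ring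
    _ = _ := by rw [h1]; field_simp

theorem GaussLimit.exists_lintegral_layerPre_le {S : Type} {B B' : Type*} [Fintype S] {κ σ : ℝ}
    {π : B' → S → B} {Γ : B → B → ℝ} (T : B → B → ℝ) {Ψ : ℝ → ℝ → ℝ} {β β' : B'}
    (h : GaussLimit S Ψ (limitSigma κ σ π Γ β β) (limitSigma κ σ π Γ β β')
      (limitSigma κ σ π Γ β' β')) {ρ : ℝ} (hρ : 0 < ρ) :
    ∃ δ : ℝ, 0 < δ ∧ ∃ n₀ : ℕ, ∀ {a n : ℕ} {x : Fin n → B → ℝ} {M : Fin n → B → Fin n → B → ℝ},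
      n₀ ≤ a → NearLimit Γ T δ x M →
      ∫⁻ p : (S → OrthGroup (max a n)) × (Fin a → ℝ), ENNReal.ofReal |(1 / a : ℝ) *
        ∑ i, Ψ (layerPre κ σ π (fun s => scaledBlock a n (p.1 s)) p.2 x i β)
          (layerPre κ σ π (fun s => scaledBlock a n (p.1 s)) p.2 x i β')
        - gaussPair Ψ (limitSigma κ σ π Γ β β) (limitSigma κ σ π Γ β β') (limitSigma κ σ π Γ β' β')|
        ∂(haarBias S (max a n) a) ≤ ENNReal.ofReal ρ := by
  obtain ⟨δ, hδ, n₀, hn₀⟩ := h ρ hρ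
  set m : ℝ := (Fintype.card S : ℝ) with hm
  refine ⟨δ / (κ ^ 2 * m + 1), by positivity, n₀ + 1, ?_⟩
  intro a n x M ha hx
  have hb : ∀ β β', |∑ s, layerVec κ π a x β s ⬝ᵥ layerVec κ π a x β' s / ((max a n : ℕ) : ℝ) + σ ^ 2
      - limitSigma κ σ π Γ β β'| ≤ δ := by
    intro β β'
    rw [sum_layerVec_dotProduct κ π (by omega)]
    refine (abs_gram_sub_limitSigma_le κ σ π hx β β').trans ?_
    rw [← mul_div_assoc, div_le_iff₀ (by positivity)]
    nlinarith
  simp_rw [layerPre_scaledBlock]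
  exact hn₀ σ _ _ (by omega) (Fin.castLE_injective _) (hb β β) (hb β β') (hb β' β')

/-! ### Concentration of one layer -/

section LayerStep

variable {S : Type} {B B' : Type*} [Fintype S] {K : ℝ≥0} {φ : ℝ → ℝ}

theorem measurable_layerPre_haarBias (κ σ : ℝ) (π : B' → S → B) {a n : ℕ} (x : Fin n → B → ℝ)
    (i : Fin a) (β : B') : Measurable fun p : (S → OrthGroup (max a n)) × (Fin a → ℝ) =>
      layerPre κ σ π (fun s => scaledBlock a n (p.1 s)) p.2 x i β := by
  simp_rw [layerPre_scaledBlock]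
  exact measurable_rowPre _ _ _ _

theorem measurable_layerKernel_haarBias (κ σ : ℝ) (π : B' → S → B) {a n : ℕ} (x : Fin n → B → ℝ)
    (M : Fin n → B → Fin n → B → ℝ) (i : Fin a) (β : B') (i' : Fin a) (β' : B') :
    Measurable fun p : (S → OrthGroup (max a n)) × (Fin a → ℝ) =>
      layerKernel κ σ π (fun s => scaledBlock a n (p.1 s)) x M i β i' β' :=
  ((measurable_layerKernel_weight κ σ π x M i β i' β').comp
    (measurePreserving_scaledBlock_pi S a n).measurable).comp measurable_fst

theorem exists_lintegral_haarBias_layerKernel_le (κ σ : ℝ)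
    (π : B' → S → B) (Γ T : B → B → ℝ) {r : ℝ} (hr : 0 < r) :
    ∃ δ : ℝ, 0 < δ ∧ ∀ {a n : ℕ} {x : Fin n → B → ℝ} {M : Fin n → B → Fin n → B → ℝ},
      NearLimit Γ T δ x M → ∀ (i : Fin a) (β : B') (i' : Fin a) (β' : B'),
      ∫⁻ p, ENNReal.ofReal
        ((layerKernel κ σ π (fun s => scaledBlock a n (p.1 s)) x M i β i' β'
          - if i = i' then limitTheta κ σ π Γ T β β' else 0) ^ 2)
        ∂(haarBias S (max a n) a) ≤ ENNReal.ofReal r := by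
  obtain ⟨δ, hδ, h⟩ := exists_lintegral_layerKernel_sub_limitTheta_le κ σ π Γ T hr
  refine ⟨δ, hδ, fun {a n x M} hx i β i' β' => le_trans (le_of_eq ?_) (h hx i β i' β')⟩
  have hm : Measurable fun Q : S → OrthGroup (max a n) => ENNReal.ofReal
      ((layerKernel κ σ π (fun s => scaledBlock a n (Q s)) x M i β i' β'
        - if i = i' then limitTheta κ σ π Γ T β β' else 0) ^ 2) :=
    (((((measurable_layerKernel_weight κ σ π x M i β i' β').comp
      (measurePreserving_scaledBlock_pi S a n).measurable)).sub_const _).pow_const 2).ennreal_ofReal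
  have hfst : MeasurePreserving (Prod.fst : (S → OrthGroup (max a n)) × (Fin a → ℝ) → _)
      (haarBias S (max a n) a) (Measure.pi fun _ => haarOrth (max a n)) := measurePreserving_fst
  exact hfst.lintegral_comp hm

/-- The same weights enter the derivatives and the kernel. As the derivatives are bounded and each
diagonal kernel entry is close to the constant `limitTheta` in mean square, the kernel is replaced
by that constant first, and no independence is needed. -/
theorem exists_lintegral_layer_kernel_average_le (hφ : LipschitzWith K φ) (κ σ : ℝ)
    (π : B' → S → B) (Γ T : B → B → ℝ) (β β' : B')
    (hdeg : limitTheta κ σ π Γ T β β' = 0 ∨ (0 < limitSigma κ σ π Γ β β ∧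
      0 < limitSigma κ σ π Γ β' β' ∧ limitSigma κ σ π Γ β β' ^ 2
        ≤ limitSigma κ σ π Γ β β * limitSigma κ σ π Γ β' β')) {ρ : ℝ} (hρ : 0 < ρ) :
    ∃ δ : ℝ, 0 < δ ∧ ∃ n₀ : ℕ, ∀ {a n : ℕ} {x : Fin n → B → ℝ} {M : Fin n → B → Fin n → B → ℝ},
      n₀ ≤ a → NearLimit Γ T δ x M →
      ∫⁻ p : (S → OrthGroup (max a n)) × (Fin a → ℝ), ENNReal.ofReal |(1 / a : ℝ) *
        ∑ i, deriv φ (layerPre κ σ π (fun s => scaledBlock a n (p.1 s)) p.2 x i β)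
          * deriv φ (layerPre κ σ π (fun s => scaledBlock a n (p.1 s)) p.2 x i β')
          * layerKernel κ σ π (fun s => scaledBlock a n (p.1 s)) x M i β i β'
        - gaussProd (deriv φ) (limitSigma κ σ π Γ β β) (limitSigma κ σ π Γ β β')
          (limitSigma κ σ π Γ β' β') * limitTheta κ σ π Γ T β β'|
        ∂(haarBias S (max a n) a) ≤ ENNReal.ofReal ρ := by
  set Θ := limitTheta κ σ π Γ T β β' with hΘ
  set G := gaussProd (deriv φ) (limitSigma κ σ π Γ β β) (limitSigma κ σ π Γ β β')
          (limitSigma κ σ π Γ β' β') with hG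
  obtain ⟨δ₁, hδ₁, n₀, h₁⟩ : ∃ δ : ℝ, 0 < δ ∧ ∃ n₀ : ℕ, ∀ {a n : ℕ} {x : Fin n → B → ℝ}
      {M : Fin n → B → Fin n → B → ℝ}, n₀ ≤ a → NearLimit Γ T δ x M →
      ∫⁻ p : (S → OrthGroup (max a n)) × (Fin a → ℝ), ENNReal.ofReal (|Θ| * |(1 / a : ℝ) *
        ∑ i, deriv φ (layerPre κ σ π (fun s => scaledBlock a n (p.1 s)) p.2 x i β)
          * deriv φ (layerPre κ σ π (fun s => scaledBlock a n (p.1 s)) p.2 x i β') - G|)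
        ∂(haarBias S (max a n) a) ≤ ENNReal.ofReal (ρ / 2) := by
    -- If the limiting kernel vanishes, the average of the derivatives is multiplied by zero and may
    -- fail to converge.
    rcases hdeg with h0 | ⟨ha, hb, hc⟩
    · refine ⟨1, one_pos, 0, fun {a n x M} _ _ => ?_⟩
      simp [h0]
    · obtain ⟨δ, hδ, n₀, h⟩ := (gaussLimit_deriv hφ S ha hb hc).exists_lintegral_layerPre_le T
        (ρ := ρ / (2 * (|Θ| + 1))) (by positivity)
      refine ⟨δ, hδ, n₀, fun {a n x M} hn hx => ?_⟩
      have h' := h hn hx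
      simp_rw [ENNReal.ofReal_mul (abs_nonneg Θ)]
      rw [lintegral_const_mul']
      · calc _ ≤ ENNReal.ofReal |Θ| * ENNReal.ofReal (ρ / (2 * (|Θ| + 1))) := by gcongr; exact h'
          _ ≤ _ := by
            rw [← ENNReal.ofReal_mul (abs_nonneg _)]
            refine ENNReal.ofReal_le_ofReal ?_
            rw [← mul_div_assoc, div_le_div_iff₀ (by positivity) (by positivity)]
            nlinarith [abs_nonneg Θ]
      · exact ENNReal.ofReal_ne_top
  set η : ℝ := ρ / (4 * (K ^ 2 + 1)) with hη
  have hη0 : 0 < η := by positivity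
  obtain ⟨δ₂, hδ₂, h₂⟩ := exists_lintegral_haarBias_layerKernel_le κ σ π Γ T (r := η ^ 2)
    (by positivity)
  refine ⟨min δ₁ δ₂, by positivity, n₀ + 1, fun {a n x M} ha hx => ?_⟩
  have b₁ := h₁ (a := a) (by omega) (hx.mono (min_le_left _ _))
  have b₂ := fun i : Fin a => h₂ (hx.mono (min_le_right _ _)) i β i β'
  let D : B' → Fin a → (S → OrthGroup (max a n)) × (Fin a → ℝ) → ℝ := fun β i p =>
    deriv φ (layerPre κ σ π (fun s => scaledBlock a n (p.1 s)) p.2 x i β)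
  let Y : Fin a → (S → OrthGroup (max a n)) × (Fin a → ℝ) → ℝ := fun i p =>
    layerKernel κ σ π (fun s => scaledBlock a n (p.1 s)) x M i β i β' - Θ
  have hDm : ∀ β i, Measurable (D β i) := fun β i =>
    (measurable_deriv φ).comp (measurable_layerPre_haarBias κ σ π x i β)
  have hYm : ∀ i, Measurable (Y i) := fun i =>
    (measurable_layerKernel_haarBias κ σ π x M i β i β').sub_const _
  have hDK : ∀ β i p, |D β i p| ≤ K := fun β i p => abs_deriv_le_of_lipschitz hφ _
  have hYb : ∀ i, ∫⁻ p, ENNReal.ofReal ((K : ℝ) ^ 2 * |Y i p|) ∂(haarBias S (max a n) a)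
      ≤ ENNReal.ofReal (ρ / 2) := by
    intro i
    have hsq : ∫⁻ p, ENNReal.ofReal (Y i p ^ 2) ∂(haarBias S (max a n) a)
        ≤ ENNReal.ofReal (η ^ 2) := by simpa [Y] using b₂ i
    have h := lintegral_abs_le_of_sq (hYm i) hη0 hsq
    simp_rw [ENNReal.ofReal_mul (sq_nonneg (K : ℝ))]
    rw [lintegral_const_mul' _ _ ENNReal.ofReal_ne_top]
    calc _ ≤ ENNReal.ofReal ((K : ℝ) ^ 2) * ENNReal.ofReal (2 * η) := by gcongr
      _ ≤ _ := by
        rw [← ENNReal.ofReal_mul (sq_nonneg _)]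
        refine ENNReal.ofReal_le_ofReal ?_
        have : η * (4 * (K ^ 2 + 1)) = ρ := by rw [hη]; field_simp
        nlinarith [sq_nonneg (K : ℝ)]
  have hav := lintegral_average_le (μ := haarBias S (max a n) a) (w := a) (by omega)
    (F := fun i p => (K : ℝ) ^ 2 * |Y i p|) (fun i => (hYm i).abs.const_mul _)
    (fun i p => by positivity) hYb
  have hpt : ∀ p, |(1 / a : ℝ) * ∑ i, D β i p * D β' i p
          * layerKernel κ σ π (fun s => scaledBlock a n (p.1 s)) x M i β i β' - G * Θ|
      ≤ (1 / a : ℝ) * ∑ i, (K : ℝ) ^ 2 * |Y i p| + |Θ| * |(1 / a : ℝ) * ∑ i, D β i p * D β' i p - G| := by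
    intro p
    have e : (1 / a : ℝ) * ∑ i, D β i p * D β' i p
          * layerKernel κ σ π (fun s => scaledBlock a n (p.1 s)) x M i β i β' - G * Θ
        = (1 / a : ℝ) * ∑ i, D β i p * D β' i p * Y i p
          + Θ * ((1 / a : ℝ) * ∑ i, D β i p * D β' i p - G) := by
      simp only [Y, mul_sub, Finset.sum_sub_distrib, ← Finset.sum_mul]
      ring
    rw [e]
    refine (abs_add_le _ _).trans (add_le_add ?_ (abs_mul _ _).le)
    rw [abs_mul, abs_of_nonneg (by positivity : (0 : ℝ) ≤ 1 / a)]
    refine mul_le_mul_of_nonneg_left ((Finset.abs_sum_le_sum_abs _ _).trans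
      (Finset.sum_le_sum fun i _ => ?_)) (by positivity)
    rw [abs_mul, abs_mul, sq]
    exact mul_le_mul_of_nonneg_right (mul_le_mul (hDK _ _ _) (hDK _ _ _) (abs_nonneg _) K.coe_nonneg)
      (abs_nonneg _)
  calc _ ≤ ∫⁻ p, (ENNReal.ofReal ((1 / a : ℝ) * ∑ i, (K : ℝ) ^ 2 * |Y i p|)
        + ENNReal.ofReal (|Θ| * |(1 / a : ℝ) * ∑ i, D β i p * D β' i p - G|))
        ∂(haarBias S (max a n) a) := by
        refine lintegral_mono fun p => ?_
        rw [← ENNReal.ofReal_add (mul_nonneg (by positivity)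
          (Finset.sum_nonneg fun i _ => by positivity)) (by positivity)]
        exact ENNReal.ofReal_le_ofReal (hpt p)
    _ = _ := lintegral_add_left (Measurable.ennreal_ofReal (Measurable.const_mul
        (Finset.measurable_sum _ fun i _ => (hYm i).abs.const_mul _) _)) _
    _ ≤ ENNReal.ofReal (ρ / 2) + ENNReal.ofReal (ρ / 2) := add_le_add hav b₁
    _ = ENNReal.ofReal ρ := by
        rw [← ENNReal.ofReal_add (by positivity) (by positivity), add_halves]

/-- Off-diagonal entries have limit zero and only `a` of the `a ^ 2` entries are diagonal, so the
normalised Hilbert-Schmidt norm is small again. This closes the induction for the third clause of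
`NearLimit`. -/
theorem exists_lintegral_layer_kernel_sq_le (hφ : LipschitzWith K φ) (κ σ : ℝ)
    (π : B' → S → B) (Γ T : B → B → ℝ) (β β' : B') {ρ : ℝ} (hρ : 0 < ρ) :
    ∃ δ : ℝ, 0 < δ ∧ ∃ n₀ : ℕ, ∀ {a n : ℕ} {x : Fin n → B → ℝ} {M : Fin n → B → Fin n → B → ℝ},
      n₀ ≤ a → NearLimit Γ T δ x M →
      ∫⁻ p : (S → OrthGroup (max a n)) × (Fin a → ℝ), ENNReal.ofReal ((1 / (a : ℝ)) ^ 2 *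
        ∑ i, ∑ i', (deriv φ (layerPre κ σ π (fun s => scaledBlock a n (p.1 s)) p.2 x i β)
          * deriv φ (layerPre κ σ π (fun s => scaledBlock a n (p.1 s)) p.2 x i' β')
          * layerKernel κ σ π (fun s => scaledBlock a n (p.1 s)) x M i β i' β') ^ 2)
        ∂(haarBias S (max a n) a) ≤ ENNReal.ofReal ρ := by
  set Θ := limitTheta κ σ π Γ T β β' with hΘ
  set r : ℝ := ρ / (4 * (K ^ 4 + 1)) with hr
  have hr0 : 0 < r := by positivity
  have hK4 : 0 ≤ (K : ℝ) ^ 4 := by positivity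
  obtain ⟨δ, hδ, h⟩ := exists_lintegral_haarBias_layerKernel_le κ σ π Γ T hr0
  obtain ⟨n₀, hn₀⟩ := exists_nat_gt (Θ ^ 2 / r)
  refine ⟨δ, hδ, n₀ + 1, fun {a n x M} ha hx => ?_⟩
  have ha0 : 0 < a := by omega
  have ha' : (0 : ℝ) < a := by exact_mod_cast ha0
  let Y : Fin a → Fin a → (S → OrthGroup (max a n)) × (Fin a → ℝ) → ℝ := fun i i' p =>
    layerKernel κ σ π (fun s => scaledBlock a n (p.1 s)) x M i β i' β' - if i = i' then Θ else 0
  have hYm : ∀ i i', Measurable (Y i i') := fun i i' =>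
    (measurable_layerKernel_haarBias κ σ π x M i β i' β').sub_const _
  have hΘa : Θ ^ 2 / a ≤ r := by
    rw [div_le_iff₀ ha']
    rw [div_lt_iff₀ hr0] at hn₀
    have : (n₀ : ℝ) ≤ a := by exact_mod_cast (by omega : n₀ ≤ a)
    nlinarith
  have hpt : ∀ p : (S → OrthGroup (max a n)) × (Fin a → ℝ), (1 / (a : ℝ)) ^ 2 *
        ∑ i, ∑ i', (deriv φ (layerPre κ σ π (fun s => scaledBlock a n (p.1 s)) p.2 x i β)
          * deriv φ (layerPre κ σ π (fun s => scaledBlock a n (p.1 s)) p.2 x i' β')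
          * layerKernel κ σ π (fun s => scaledBlock a n (p.1 s)) x M i β i' β') ^ 2
      ≤ (1 / (a : ℝ)) * ∑ i, ((1 / (a : ℝ)) * ∑ i', 2 * (K : ℝ) ^ 4 * Y i i' p ^ 2)
        + 2 * K ^ 4 * (Θ ^ 2 / a) := by
    intro p
    have hterm : ∀ i i', (deriv φ (layerPre κ σ π (fun s => scaledBlock a n (p.1 s)) p.2 x i β)
          * deriv φ (layerPre κ σ π (fun s => scaledBlock a n (p.1 s)) p.2 x i' β')
          * layerKernel κ σ π (fun s => scaledBlock a n (p.1 s)) x M i β i' β') ^ 2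
        ≤ 2 * (K : ℝ) ^ 4 * Y i i' p ^ 2 + if i = i' then 2 * (K : ℝ) ^ 4 * Θ ^ 2 else 0 := by
      intro i i'
      have h1 := abs_deriv_le_of_lipschitz hφ
        (layerPre κ σ π (fun s => scaledBlock a n (p.1 s)) p.2 x i β)
      have h2 := abs_deriv_le_of_lipschitz hφ
        (layerPre κ σ π (fun s => scaledBlock a n (p.1 s)) p.2 x i' β')
      set d := deriv φ (layerPre κ σ π (fun s => scaledBlock a n (p.1 s)) p.2 x i β)
      set d' := deriv φ (layerPre κ σ π (fun s => scaledBlock a n (p.1 s)) p.2 x i' β')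
      have h3 : d ^ 2 ≤ (K : ℝ) ^ 2 := by rw [← sq_abs]; gcongr
      have h4 : d' ^ 2 ≤ (K : ℝ) ^ 2 := by rw [← sq_abs]; gcongr
      have h5 : d ^ 2 * d' ^ 2 ≤ (K : ℝ) ^ 2 * K ^ 2 := mul_le_mul h3 h4 (sq_nonneg _) (sq_nonneg _)
      have e : layerKernel κ σ π (fun s => scaledBlock a n (p.1 s)) x M i β i' β'
          = Y i i' p + if i = i' then Θ else 0 := by simp only [Y]; ring
      rw [e, mul_pow, mul_pow]
      calc _ ≤ (K : ℝ) ^ 2 * K ^ 2 * (Y i i' p + if i = i' then Θ else 0) ^ 2 :=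
            mul_le_mul_of_nonneg_right h5 (sq_nonneg _)
        _ ≤ (K : ℝ) ^ 2 * K ^ 2 * (2 * Y i i' p ^ 2 + 2 * (if i = i' then Θ else 0) ^ 2) := by
            refine mul_le_mul_of_nonneg_left ?_ (by positivity)
            nlinarith [sq_nonneg (Y i i' p - if i = i' then Θ else 0)]
        _ = _ := by split_ifs <;> ring
    calc _ ≤ (1 / (a : ℝ)) ^ 2 * ∑ i, ∑ i', (2 * (K : ℝ) ^ 4 * Y i i' p ^ 2
          + if i = i' then 2 * (K : ℝ) ^ 4 * Θ ^ 2 else 0) := by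
          refine mul_le_mul_of_nonneg_left (Finset.sum_le_sum fun i _ => Finset.sum_le_sum fun i' _ =>
            hterm i i') (by positivity)
      _ = _ := by
          simp only [Finset.sum_add_distrib, Finset.sum_ite_eq, Finset.mem_univ, if_true,
            Finset.sum_const, Finset.card_univ, Fintype.card_fin, nsmul_eq_mul, ← Finset.mul_sum]
          field_simp
  have hb : ∀ i i', ∫⁻ p, ENNReal.ofReal (2 * (K : ℝ) ^ 4 * Y i i' p ^ 2) ∂(haarBias S (max a n) a)
      ≤ ENNReal.ofReal (2 * K ^ 4 * r) := by
    intro i i'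
    have hK2 : 0 ≤ 2 * (K : ℝ) ^ 4 := by positivity
    simp_rw [ENNReal.ofReal_mul hK2]
    rw [lintegral_const_mul' _ _ ENNReal.ofReal_ne_top]
    gcongr
    exact h hx i β i' β'
  have hav : ∫⁻ p, ENNReal.ofReal ((1 / (a : ℝ)) * ∑ i, ((1 / (a : ℝ)) *
      ∑ i', 2 * (K : ℝ) ^ 4 * Y i i' p ^ 2)) ∂(haarBias S (max a n) a)
      ≤ ENNReal.ofReal (2 * K ^ 4 * r) := by
    have hm : ∀ i i', Measurable fun p => 2 * (K : ℝ) ^ 4 * Y i i' p ^ 2 := fun i i' =>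
      ((hYm i i').pow_const 2).const_mul _
    refine lintegral_average_le (F := fun i p => (1 / (a : ℝ)) * ∑ i', 2 * (K : ℝ) ^ 4 * Y i i' p ^ 2)
      ha0 (fun i => (Finset.measurable_sum _ fun i' _ => hm i i').const_mul _)
      (fun i p => mul_nonneg (by positivity) (Finset.sum_nonneg fun i' _ => by positivity)) fun i => ?_
    exact lintegral_average_le (F := fun i' p => 2 * (K : ℝ) ^ 4 * Y i i' p ^ 2)
      ha0 (hm i) (fun i' p => by positivity) (hb i)
  calc _ ≤ ∫⁻ p, (ENNReal.ofReal ((1 / (a : ℝ)) * ∑ i, ((1 / (a : ℝ)) *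
      ∑ i', 2 * (K : ℝ) ^ 4 * Y i i' p ^ 2)) + ENNReal.ofReal (2 * K ^ 4 * (Θ ^ 2 / a)))
        ∂(haarBias S (max a n) a) := by
        refine lintegral_mono fun p => ?_
        rw [← ENNReal.ofReal_add (mul_nonneg (by positivity) (Finset.sum_nonneg fun i _ =>
          mul_nonneg (by positivity) (Finset.sum_nonneg fun i' _ => by positivity))) (by positivity)]
        exact ENNReal.ofReal_le_ofReal (hpt p)
    _ = _ := lintegral_add_right _ measurable_const
    _ ≤ ENNReal.ofReal (2 * K ^ 4 * r) + ENNReal.ofReal (2 * K ^ 4 * r) := by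
        refine add_le_add hav ?_
        rw [lintegral_const, measure_univ, mul_one]
        exact ENNReal.ofReal_le_ofReal (mul_le_mul_of_nonneg_left hΘa (by positivity))
    _ ≤ ENNReal.ofReal ρ := by
        rw [← ENNReal.ofReal_add (by positivity) (by positivity)]
        refine ENNReal.ofReal_le_ofReal ?_
        have : r * (4 * (K ^ 4 + 1)) = ρ := by rw [hr]; field_simp
        nlinarith

end LayerStep

theorem exists_pos_forall_le {ι : Type*} [Finite ι] {f : ι → ℝ} (hf : ∀ i, 0 < f i) :
    ∃ δ : ℝ, 0 < δ ∧ ∀ i, δ ≤ f i := by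
  rcases isEmpty_or_nonempty ι with h | h
  · exact ⟨1, one_pos, fun i => h.elim i⟩
  · obtain ⟨i, hi⟩ := Finite.exists_min f
    exact ⟨f i, hf i, hi⟩

theorem exists_nat_forall_le {ι : Type*} [Finite ι] (f : ι → ℕ) : ∃ n : ℕ, ∀ i, f i ≤ n := by
  obtain ⟨n, hn⟩ := (Set.finite_range f).bddAbove
  exact ⟨n, fun i => hn ⟨i, rfl⟩⟩

/-- The limiting covariance of the post-activations of a layer. -/
noncomputable def nextGamma {S B B' : Type*} [Fintype S] (φ : ℝ → ℝ) (κ σ : ℝ) (π : B' → S → B)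
    (Γ : B → B → ℝ) (β γ : B') : ℝ :=
  gaussProd φ (limitSigma κ σ π Γ β β) (limitSigma κ σ π Γ β γ) (limitSigma κ σ π Γ γ γ)

/-- The limiting tangent kernel of the post-activations of a layer. -/
noncomputable def nextTangent {S B B' : Type*} [Fintype S] (φ : ℝ → ℝ) (κ σ : ℝ) (π : B' → S → B)
    (Γ T : B → B → ℝ) (β γ : B') : ℝ :=
  gaussProd (deriv φ) (limitSigma κ σ π Γ β β) (limitSigma κ σ π Γ β γ)
    (limitSigma κ σ π Γ γ γ) * limitTheta κ σ π Γ T β γ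

/-- The post-activations of a layer. -/
noncomputable def layerPost {S B B' : Type*} [Fintype S] (φ : ℝ → ℝ) (κ σ : ℝ) (π : B' → S → B)
    {a n : ℕ} (ω : S → Fin a → Fin n → ℝ) (b : Fin a → ℝ) (x : Fin n → B → ℝ) (i : Fin a)
    (β : B') : ℝ := φ (layerPre κ σ π ω b x i β)

/-- The tangent kernel of the post-activations of a layer. -/
noncomputable def layerTangent {S B B' : Type*} [Fintype S] (φ : ℝ → ℝ) (κ σ : ℝ) (π : B' → S → B)
    {a n : ℕ} (ω : S → Fin a → Fin n → ℝ) (b : Fin a → ℝ) (x : Fin n → B → ℝ)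
    (M : Fin n → B → Fin n → B → ℝ) (i : Fin a) (β : B') (i' : Fin a) (γ : B') : ℝ :=
  deriv φ (layerPre κ σ π ω b x i β) * deriv φ (layerPre κ σ π ω b x i' γ)
    * layerKernel κ σ π ω x M i β i' γ

/-- The activation function is differentiable at all pre-activations which are not constant. -/
def LayerDiff {S B B' : Type*} [Fintype S] (φ : ℝ → ℝ) (κ σ : ℝ) (π : B' → S → B) (Γ : B → B → ℝ)
    {a n : ℕ} (ω : S → Fin a → Fin n → ℝ) (b : Fin a → ℝ) (x : Fin n → B → ℝ) : Prop :=
  ∀ i β, 0 < limitSigma κ σ π Γ β β → DifferentiableAt ℝ φ (layerPre κ σ π ω b x i β)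

theorem measurableSet_layerDiff {Ω S B B' : Type*} [MeasurableSpace Ω] [Fintype S] [Countable B']
    (φ : ℝ → ℝ) (κ σ : ℝ) (π : B' → S → B) (Γ : B → B → ℝ) {a n : ℕ}
    {ω : Ω → S → Fin a → Fin n → ℝ} {b : Ω → Fin a → ℝ}
    {x : Ω → Fin n → B → ℝ} (hω : ∀ s i j, Measurable fun t => ω t s i j)
    (hb : ∀ i, Measurable fun t => b t i) (hx : ∀ j β, Measurable fun t => x t j β) :
    MeasurableSet {t | LayerDiff φ κ σ π Γ (ω t) (b t) (x t)} := by
  simp only [LayerDiff, Set.ofPred_forall]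
  exact MeasurableSet.iInter fun i => MeasurableSet.iInter fun β => MeasurableSet.iInter fun _ =>
    (measurable_layerPre κ σ π hω hb hx i β) (measurableSet_of_differentiableAt ℝ φ)

theorem measurable_layerPost {Ω S B B' : Type*} [MeasurableSpace Ω] [Fintype S] {φ : ℝ → ℝ}
    (hφ : Measurable φ) (κ σ : ℝ) (π : B' → S → B) {a n : ℕ}
    {ω : Ω → S → Fin a → Fin n → ℝ} {b : Ω → Fin a → ℝ}
    {x : Ω → Fin n → B → ℝ} (hω : ∀ s i j, Measurable fun t => ω t s i j)
    (hb : ∀ i, Measurable fun t => b t i) (hx : ∀ j β, Measurable fun t => x t j β) (i : Fin a)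
    (β : B') : Measurable fun t => layerPost φ κ σ π (ω t) (b t) (x t) i β :=
  hφ.comp (measurable_layerPre κ σ π hω hb hx i β)

theorem measurable_layerTangent {Ω S B B' : Type*} [MeasurableSpace Ω] [Fintype S] (φ : ℝ → ℝ)
    (κ σ : ℝ) (π : B' → S → B) {a n : ℕ}
    {ω : Ω → S → Fin a → Fin n → ℝ} {b : Ω → Fin a → ℝ}
    {x : Ω → Fin n → B → ℝ} {M : Ω → Fin n → B → Fin n → B → ℝ}
    (hω : ∀ s i j, Measurable fun t => ω t s i j)
    (hb : ∀ i, Measurable fun t => b t i) (hx : ∀ j β, Measurable fun t => x t j β)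
    (hM : ∀ j β j' β', Measurable fun t => M t j β j' β') (i : Fin a) (β : B') (i' : Fin a)
    (β' : B') : Measurable fun t => layerTangent φ κ σ π (ω t) (b t) (x t) (M t) i β i' β' :=
  (((measurable_deriv φ).comp (measurable_layerPre κ σ π hω hb hx i β)).mul
    ((measurable_deriv φ).comp (measurable_layerPre κ σ π hω hb hx i' β'))).mul
      (measurable_layerKernel κ σ π hω hx hM i β i' β')

section LayerStep

variable {S : Type} {B B' : Type*} [Fintype S] {K : ℝ≥0} {φ : ℝ → ℝ}

theorem exists_ae_layerDiff [Finite B'] (hφ : LipschitzWith K φ) (κ σ : ℝ)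
    (π : B' → S → B) (Γ T : B → B → ℝ) :
    ∃ δ : ℝ, 0 < δ ∧ ∀ {a n : ℕ} {x : Fin n → B → ℝ} {M : Fin n → B → Fin n → B → ℝ},
      2 ≤ a → NearLimit Γ T δ x M → ∀ᵐ p ∂(haarBias S (max a n) a),
        LayerDiff φ κ σ π Γ (fun s => scaledBlock a n (p.1 s)) p.2 x := by
  set m : ℝ := (Fintype.card S : ℝ) with hm
  -- If the bias scale and all input vectors at `β` vanished, the empirical variance would be zero,
  -- at distance the full limiting variance; this threshold excludes it.
  obtain ⟨δ, hδ, hle⟩ := exists_pos_forall_le (f := fun β : B' =>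
    if 0 < limitSigma κ σ π Γ β β then limitSigma κ σ π Γ β β / (κ ^ 2 * m + 1) else 1) (by
      intro β
      split_ifs <;> positivity)
  refine ⟨δ, hδ, fun {a n x M} ha hx => ?_⟩
  simp only [LayerDiff]
  rw [ae_all_iff]
  intro i
  cases nonempty_fintype B'
  rw [ae_all_iff]
  intro β
  by_cases hβ : 0 < limitSigma κ σ π Γ β β
  · have hne : σ ≠ 0 ∨ ∃ s, layerVec κ π a x β s ≠ 0 := by
      by_contra! hcon
      have h1 := abs_gram_sub_limitSigma_le κ σ π hx β β
      rw [← sum_layerVec_dotProduct κ π (by omega : 0 < a)] at h1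
      simp only [hcon.1, hcon.2, dotProduct_zero, zero_div, Finset.sum_const_zero,
        zero_pow two_ne_zero, add_zero, zero_sub, abs_neg] at h1
      rw [hcon.1] at hβ hle
      have h2 := hle β
      rw [if_pos hβ, le_div_iff₀ (by positivity)] at h2
      rw [abs_of_pos hβ] at h1
      nlinarith
    filter_upwards [ae_rowPre_notMem (le_max_of_le_left ha) (Fin.castLE (le_max_left a n))
      (layerVec κ π a x β) hne i (measurableSet_not_differentiableAt φ)
      (volume_not_differentiableAt hφ)] with p hp _
    rw [layerPre_scaledBlock]
    simpa using hp
  · exact ae_of_all _ fun p h => absurd h hβ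

theorem measurable_layer_step [Fintype B'] (hφ : LipschitzWith K φ) (κ σ : ℝ)
    (π : B' → S → B) (Γ : B → B → ℝ) (a : ℕ) {n : ℕ} (x : Fin n → B → ℝ)
    (M : Fin n → B → Fin n → B → ℝ) :
    (∀ (i : Fin a) (β : B'), Measurable fun p : (S → Fin a → Fin n → ℝ) × (Fin a → ℝ) =>
      layerPost φ κ σ π p.1 p.2 x i β) ∧
    (∀ (i : Fin a) (β : B') (i' : Fin a) (β' : B'),
      Measurable fun p : (S → Fin a → Fin n → ℝ) × (Fin a → ℝ) =>
      layerTangent φ κ σ π p.1 p.2 x M i β i' β') ∧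
    MeasurableSet {p : (S → Fin a → Fin n → ℝ) × (Fin a → ℝ) |
      LayerDiff φ κ σ π Γ p.1 p.2 x} := by
  have hωm : ∀ (s : S) (i : Fin a) (j : Fin n), Measurable
      fun p : (S → Fin a → Fin n → ℝ) × (Fin a → ℝ) => p.1 s i j := fun s i j => by fun_prop
  have hbm : ∀ i : Fin a, Measurable
      fun p : (S → Fin a → Fin n → ℝ) × (Fin a → ℝ) => p.2 i := fun i => by fun_prop
  have hxm : ∀ (j : Fin n) (β : B), Measurable
      fun _ : (S → Fin a → Fin n → ℝ) × (Fin a → ℝ) => x j β := fun _ _ => measurable_const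
  have hMm : ∀ (j : Fin n) (β : B) (j' : Fin n) (β' : B), Measurable
      fun _ : (S → Fin a → Fin n → ℝ) × (Fin a → ℝ) => M j β j' β' := fun _ _ _ _ => measurable_const
  have hpost := fun i β => measurable_layerPost hφ.continuous.measurable κ σ π hωm hbm hxm i β
  have htan := fun i β i' β' => measurable_layerTangent φ κ σ π hωm hbm hxm hMm i β i' β'
  exact ⟨hpost, htan, measurableSet_layerDiff φ κ σ π Γ hωm hbm hxm⟩

/-- If the inputs of a layer are close to their limits, then with high probability so are its
outputs. -/
theorem exists_layer_step [Fintype B'] (hφ : LipschitzWith K φ) (κ σ : ℝ)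
    (π : B' → S → B) (Γ T : B → B → ℝ)
    (hdeg : ∀ β β', limitTheta κ σ π Γ T β β' = 0 ∨ (0 < limitSigma κ σ π Γ β β ∧
      0 < limitSigma κ σ π Γ β' β' ∧ limitSigma κ σ π Γ β β' ^ 2
        ≤ limitSigma κ σ π Γ β β * limitSigma κ σ π Γ β' β')) {ε : ℝ} (hε : 0 < ε) :
    ∃ δ : ℝ, 0 < δ ∧ ∃ n₀ : ℕ, ∀ {a n : ℕ} {x : Fin n → B → ℝ} {M : Fin n → B → Fin n → B → ℝ},
      n₀ ≤ a → NearLimit Γ T δ x M →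
      layerInit S a n {p | ¬ (NearLimit (nextGamma φ κ σ π Γ) (nextTangent φ κ σ π Γ T) ε
        (layerPost φ κ σ π p.1 p.2 x) (layerTangent φ κ σ π p.1 p.2 x M)
        ∧ LayerDiff φ κ σ π Γ p.1 p.2 x)} ≤ ENNReal.ofReal ε := by
  set q : ℝ := (Fintype.card (B' × B') : ℝ) with hq
  -- Markov's inequality at level `ε` costs a factor `1 / ε`, and the union runs over three clauses
  -- for each of the `q` pairs of positions.
  set ρ : ℝ := ε * ε / (3 * (q + 1)) with hρ
  have hρ0 : 0 < ρ := by positivity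
  choose δ₁ hδ₁ n₁ h₁ using fun r : B' × B' => ((quadTame_mul_of_lipschitz hφ).gaussLimit S
    (limitSigma κ σ π Γ r.1 r.1) (limitSigma κ σ π Γ r.1 r.2)
    (limitSigma κ σ π Γ r.2 r.2)).exists_lintegral_layerPre_le T hρ0
  choose δ₂ hδ₂ n₂ h₂ using fun r : B' × B' =>
    exists_lintegral_layer_kernel_average_le hφ κ σ π Γ T r.1 r.2 (hdeg r.1 r.2) hρ0
  choose δ₃ hδ₃ n₃ h₃ using fun r : B' × B' =>
    exists_lintegral_layer_kernel_sq_le hφ κ σ π Γ T r.1 r.2 hρ0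
  obtain ⟨δ₄, hδ₄, h₄⟩ := exists_ae_layerDiff hφ κ σ π Γ T
  obtain ⟨d₁, hd₁, e₁⟩ := exists_pos_forall_le hδ₁
  obtain ⟨d₂, hd₂, e₂⟩ := exists_pos_forall_le hδ₂
  obtain ⟨d₃, hd₃, e₃⟩ := exists_pos_forall_le hδ₃
  obtain ⟨m₁, f₁⟩ := exists_nat_forall_le n₁
  obtain ⟨m₂, f₂⟩ := exists_nat_forall_le n₂
  obtain ⟨m₃, f₃⟩ := exists_nat_forall_le n₃
  refine ⟨min (min d₁ d₂) (min d₃ δ₄), by positivity, m₁ + m₂ + m₃ + 2, ?_⟩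
  intro a n x M ha hx
  have hx1 : ∀ r, NearLimit Γ T (δ₁ r) x M := fun r =>
    hx.mono (((min_le_left _ _).trans (min_le_left _ _)).trans (e₁ r))
  have hx2 : ∀ r, NearLimit Γ T (δ₂ r) x M := fun r =>
    hx.mono (((min_le_left _ _).trans (min_le_right _ _)).trans (e₂ r))
  have hx3 : ∀ r, NearLimit Γ T (δ₃ r) x M := fun r =>
    hx.mono (((min_le_right _ _).trans (min_le_left _ _)).trans (e₃ r))
  have hx4 : NearLimit Γ T δ₄ x M := hx.mono ((min_le_right _ _).trans (min_le_right _ _))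
  have b₁ := fun r => h₁ r (a := a) ((f₁ r).trans (by omega)) (hx1 r)
  have b₂ := fun r => h₂ r (a := a) ((f₂ r).trans (by omega)) (hx2 r)
  have b₃ := fun r => h₃ r (a := a) ((f₃ r).trans (by omega)) (hx3 r)
  have b₄ := h₄ (a := a) (by omega) hx4
  obtain ⟨hpost, htan, hdiff⟩ := measurable_layer_step hφ κ σ π Γ a x M
  have hmp := measurePreserving_layerInit S a n
  let A₁ : B' × B' → Set ((S → Fin a → Fin n → ℝ) × (Fin a → ℝ)) := fun r => {p | ε ≤ |(1 / a : ℝ) *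
    ∑ i, layerPost φ κ σ π p.1 p.2 x i r.1 * layerPost φ κ σ π p.1 p.2 x i r.2
    - nextGamma φ κ σ π Γ r.1 r.2|}
  let A₂ : B' × B' → Set ((S → Fin a → Fin n → ℝ) × (Fin a → ℝ)) := fun r => {p | ε ≤ |(1 / a : ℝ) *
    ∑ i, layerTangent φ κ σ π p.1 p.2 x M i r.1 i r.2 - nextTangent φ κ σ π Γ T r.1 r.2|}
  let A₃ : B' × B' → Set ((S → Fin a → Fin n → ℝ) × (Fin a → ℝ)) := fun r => {p | ε ≤
    (1 / (a : ℝ)) ^ 2 * ∑ i, ∑ i', layerTangent φ κ σ π p.1 p.2 x M i r.1 i' r.2 ^ 2}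
  let A₄ : Set ((S → Fin a → Fin n → ℝ) × (Fin a → ℝ)) := {p | ¬ LayerDiff φ κ σ π Γ p.1 p.2 x}
  have p₁ : ∀ r, layerInit S a n (A₁ r) ≤ ENNReal.ofReal (ρ / ε) := fun r => by
    have hm := (((Finset.measurable_sum Finset.univ fun i _ =>
      (hpost i r.1).mul (hpost i r.2)).const_mul (1 / a : ℝ)).sub_const
      (nextGamma φ κ σ π Γ r.1 r.2)).abs
    refine measure_le_of_lintegral_ofReal_le hm hε ?_
    rw [← hmp.lintegral_comp hm.ennreal_ofReal]
    exact b₁ r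
  have p₂ : ∀ r, layerInit S a n (A₂ r) ≤ ENNReal.ofReal (ρ / ε) := fun r => by
    have hm := (((Finset.measurable_sum Finset.univ fun i _ =>
      htan i r.1 i r.2).const_mul (1 / a : ℝ)).sub_const (nextTangent φ κ σ π Γ T r.1 r.2)).abs
    refine measure_le_of_lintegral_ofReal_le hm hε ?_
    rw [← hmp.lintegral_comp hm.ennreal_ofReal]
    exact b₂ r
  have p₃ : ∀ r, layerInit S a n (A₃ r) ≤ ENNReal.ofReal (ρ / ε) := fun r => by
    have hm := (Finset.measurable_sum Finset.univ fun i _ =>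
      Finset.measurable_sum Finset.univ fun i' _ =>
        (htan i r.1 i' r.2).pow_const 2).const_mul ((1 / (a : ℝ)) ^ 2)
    refine measure_le_of_lintegral_ofReal_le hm hε ?_
    rw [← hmp.lintegral_comp hm.ennreal_ofReal]
    exact b₃ r
  have p₄ : layerInit S a n A₄ = 0 :=
    (hmp.measure_preimage hdiff.compl.nullMeasurableSet).symm.trans b₄
  have hsub : {p : (S → Fin a → Fin n → ℝ) × (Fin a → ℝ) | ¬ (NearLimit (nextGamma φ κ σ π Γ)
        (nextTangent φ κ σ π Γ T) ε (layerPost φ κ σ π p.1 p.2 x) (layerTangent φ κ σ π p.1 p.2 x M)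
        ∧ LayerDiff φ κ σ π Γ p.1 p.2 x)} ⊆ (⋃ r, (A₁ r ∪ (A₂ r ∪ A₃ r))) ∪ A₄ := by
    intro p hp
    by_contra hcon
    simp only [Set.mem_union, Set.mem_iUnion, not_or, not_exists, A₁, A₂, A₃, A₄, Set.mem_ofPred_eq,
      not_le, not_not] at hcon
    exact hp ⟨fun β β' => ⟨(hcon.1 (β, β')).1.le, (hcon.1 (β, β')).2.1.le, (hcon.1 (β, β')).2.2.le⟩,
      hcon.2⟩
  calc _ ≤ layerInit S a n ((⋃ r, (A₁ r ∪ (A₂ r ∪ A₃ r))) ∪ A₄) := measure_mono hsub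
    _ ≤ (∑ r, layerInit S a n (A₁ r ∪ (A₂ r ∪ A₃ r))) + 0 :=
        (measure_union_le _ _).trans (add_le_add (measure_iUnion_fintype_le _ _) p₄.le)
    _ ≤ (∑ _r : B' × B', (ENNReal.ofReal (ρ / ε) + (ENNReal.ofReal (ρ / ε)
          + ENNReal.ofReal (ρ / ε)))) + 0 := by
        refine add_le_add (Finset.sum_le_sum fun r _ => ?_) le_rfl
        refine (measure_union_le _ _).trans (add_le_add (p₁ r) ?_)
        exact (measure_union_le _ _).trans (add_le_add (p₂ r) (p₃ r))
    _ = ENNReal.ofReal (q * (ρ / ε + (ρ / ε + ρ / ε))) := by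
        rw [add_zero, Finset.sum_const, Finset.card_univ, nsmul_eq_mul,
          ENNReal.ofReal_mul (by positivity), ENNReal.ofReal_add (by positivity) (by positivity),
          ENNReal.ofReal_add (by positivity) (by positivity), hq, ENNReal.ofReal_natCast]
    _ ≤ ENNReal.ofReal ε := by
        refine ENNReal.ofReal_le_ofReal ?_
        have hq0 : 0 ≤ q := by positivity
        have e : q * (ρ / ε + (ρ / ε + ρ / ε)) = q * ε / (q + 1) := by
          rw [hρ]; field_simp; ring
        rw [e, div_le_iff₀ (by positivity)]
        nlinarith

/-- The tangent kernel of an output layer is close to its limit. -/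
theorem exists_output_step [Fintype B'] (κ σ : ℝ) (π : B' → S → B) (Γ T : B → B → ℝ) (a : ℕ)
    {ε : ℝ} (hε : 0 < ε) :
    ∃ δ : ℝ, 0 < δ ∧ ∀ {n : ℕ} {x : Fin n → B → ℝ} {M : Fin n → B → Fin n → B → ℝ},
      NearLimit Γ T δ x M → ∀ β β' : B',
      (Measure.pi fun _ : S => orthInit a n) {ω | ¬ ∀ i i' : Fin a,
        |layerKernel κ σ π ω x M i β i' β' - if i = i' then limitTheta κ σ π Γ T β β' else 0| < ε}
        ≤ ENNReal.ofReal ε := by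
  -- The squared deviation is compared with `ε ^ 2`, and the remaining factor of `r` pays for the
  -- union over the `a ^ 2` entries; the output width `a` stays fixed.
  obtain ⟨δ, hδ, h⟩ := exists_lintegral_layerKernel_sub_limitTheta_le κ σ π Γ T
    (r := ε ^ 2 * (ε / ((a : ℝ) ^ 2 + 1))) (by positivity)
  refine ⟨δ, hδ, fun {n x M} hx β β' => ?_⟩
  have hm : ∀ i i' : Fin a, Measurable fun ω : S → Fin a → Fin n → ℝ =>
      layerKernel κ σ π ω x M i β i' β' - if i = i' then limitTheta κ σ π Γ T β β' else 0 :=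
    fun i i' => (measurable_layerKernel_weight κ σ π x M i β i' β').sub_const _
  have hmp := measurePreserving_scaledBlock_pi S a n
  have hA : ∀ q : Fin a × Fin a, (Measure.pi fun _ : S => orthInit a n) {ω |
      ε ^ 2 ≤ (layerKernel κ σ π ω x M q.1 β q.2 β'
        - if q.1 = q.2 then limitTheta κ σ π Γ T β β' else 0) ^ 2}
      ≤ ENNReal.ofReal (ε / ((a : ℝ) ^ 2 + 1)) := by
    intro q
    have h1 := h hx q.1 β q.2 β'
    have h2 := hmp.lintegral_comp ((hm q.1 q.2).pow_const 2).ennreal_ofReal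
    rw [h2] at h1
    have h3 := measure_le_of_lintegral_ofReal_le ((hm q.1 q.2).pow_const 2) (sq_pos_of_pos hε) h1
    rwa [mul_div_cancel_left₀ _ (by positivity)] at h3
  calc _ ≤ (Measure.pi fun _ : S => orthInit a n) (⋃ q : Fin a × Fin a, {ω |
      ε ^ 2 ≤ (layerKernel κ σ π ω x M q.1 β q.2 β'
        - if q.1 = q.2 then limitTheta κ σ π Γ T β β' else 0) ^ 2}) := by
        refine measure_mono fun ω hω => ?_
        simp only [Set.mem_ofPred_eq, not_forall, not_lt] at hω
        obtain ⟨i, i', hi⟩ := hω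
        refine Set.mem_iUnion.mpr ⟨(i, i'), ?_⟩
        simp only [Set.mem_ofPred_eq]
        rw [← sq_abs (_ - _)]
        gcongr
    _ ≤ ∑ q : Fin a × Fin a, ENNReal.ofReal (ε / ((a : ℝ) ^ 2 + 1)) :=
        (measure_iUnion_fintype_le _ _).trans (Finset.sum_le_sum fun q _ => hA q)
    _ = ENNReal.ofReal ((a : ℝ) ^ 2 * (ε / ((a : ℝ) ^ 2 + 1))) := by
        rw [Finset.sum_const, Finset.card_univ, Fintype.card_prod, Fintype.card_fin, nsmul_eq_mul,
          ENNReal.ofReal_mul (by positivity), ← Nat.cast_pow, ENNReal.ofReal_natCast, sq]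
    _ ≤ _ := by
        refine ENNReal.ofReal_le_ofReal ?_
        rw [← mul_div_assoc, div_le_iff₀ (by positivity)]
        nlinarith

end LayerStep

/-! ### Limiting kernels -/

/-- The Gram vectors of a positive semidefinite pair. -/
theorem exists_gram_vectors {a c b : ℝ} (ha : 0 ≤ a) (hb : 0 ≤ b) (hc : c ^ 2 ≤ a * b) :
    ∃ A D : Fin 2 → ℝ, A ⬝ᵥ A = a ∧ A ⬝ᵥ D = c ∧ D ⬝ᵥ D = b := by
  obtain ⟨p, q, r, h1, h2, h3⟩ := exists_gram_factor ha hb hc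
  refine ⟨![p, 0], ![q, r], ?_, ?_, ?_⟩
  · simp [← h1, sq]
  · simp [← h2]
  · simp [← h3, sq]

theorem gaussProd_gram {g : ℝ → ℝ} (hg : Measurable g) {ι : Type*} [Fintype ι] (A D : ι → ℝ) :
    gaussProd g (A ⬝ᵥ A) (A ⬝ᵥ D) (D ⬝ᵥ D)
      = ∫ z, g (A ⬝ᵥ z) * g (D ⬝ᵥ z) ∂(Measure.pi fun _ : ι => gaussianReal 0 1) := by
  rw [gaussProd_eq_gaussPair]
  exact gaussPair_gram A D ((hg.comp measurable_fst).mul (hg.comp measurable_snd))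

/-- The form is the Gaussian expectation of the square of `s φ(u) + t φ(v)`. -/
theorem gaussProd_psd {K : ℝ≥0} {φ : ℝ → ℝ} (hφ : LipschitzWith K φ) {a c b : ℝ} (ha : 0 ≤ a)
    (hb : 0 ≤ b) (hc : c ^ 2 ≤ a * b) (s t : ℝ) :
    0 ≤ s ^ 2 * gaussProd φ a a a + 2 * s * t * gaussProd φ a c b + t ^ 2 * gaussProd φ b b b := by
  obtain ⟨A, D, rfl, rfl, rfl⟩ := exists_gram_vectors ha hb hc
  have hm := hφ.continuous.measurable
  have hi : ∀ A D : Fin 2 → ℝ, Integrable (fun z => φ (A ⬝ᵥ z) * φ (D ⬝ᵥ z))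
      (Measure.pi fun _ : Fin 2 => gaussianReal 0 1) := fun A D =>
    ((quadTame_mul_of_lipschitz hφ).memLp A D).integrable (by norm_num)
  have hs : Integrable (fun z => s ^ 2 * (φ (A ⬝ᵥ z) * φ (A ⬝ᵥ z))
      + 2 * s * t * (φ (A ⬝ᵥ z) * φ (D ⬝ᵥ z))) (Measure.pi fun _ : Fin 2 => gaussianReal 0 1) :=
    ((hi A A).const_mul _).add ((hi A D).const_mul _)
  rw [gaussProd_gram hm, gaussProd_gram hm, gaussProd_gram hm, ← integral_const_mul,
    ← integral_const_mul, ← integral_const_mul, ← integral_add ((hi A A).const_mul _)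
      ((hi A D).const_mul _), ← integral_add hs ((hi D D).const_mul _)]
  refine integral_nonneg fun z => ?_
  simp only [Pi.zero_apply]
  nlinarith [sq_nonneg (s * φ (A ⬝ᵥ z) + t * φ (D ⬝ᵥ z))]

theorem sq_le_of_psd {a c b : ℝ} (h : ∀ s t : ℝ, 0 ≤ s ^ 2 * a + 2 * s * t * c + t ^ 2 * b) :
    c ^ 2 ≤ a * b := by
  have := discrim_le_zero (a := a) (b := 2 * c) (c := b) fun s => by nlinarith [h s 1]
  rw [discrim] at this
  linarith

theorem gaussProd_zero (g : ℝ → ℝ) (hg : Measurable g) : gaussProd g 0 0 0 = g 0 * g 0 := by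
  have := gaussProd_gram hg (0 : Fin 2 → ℝ) 0
  simpa using this

/-- A Lipschitz function whose square has zero Gaussian mean vanishes. -/
theorem eq_zero_of_gaussProd_self_eq_zero {K : ℝ≥0} {φ : ℝ → ℝ} (hφ : LipschitzWith K φ) {a : ℝ}
    (ha : 0 < a) (h : gaussProd φ a a a = 0) : φ = 0 := by
  have hs : √a ≠ 0 := (Real.sqrt_pos.mpr ha).ne'
  have hm := hφ.continuous.measurable
  have e := gaussProd_gram hm (fun _ : Unit => √a) (fun _ => √a)
  have hdot : (fun _ : Unit => √a) ⬝ᵥ (fun _ => √a) = a := by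
    simp [dotProduct, Real.mul_self_sqrt ha.le]
  have hi := ((quadTame_mul_of_lipschitz hφ).memLp (fun _ : Unit => √a) (fun _ => √a)).integrable
    (by norm_num)
  rw [hdot, h] at e
  have h1 := (integral_eq_zero_iff_of_nonneg (fun z => mul_self_nonneg _) hi).mp e.symm
  have hmp := measurePreserving_funUnique (gaussianReal 0 1) Unit
  have h2 : ∀ᵐ y ∂(gaussianReal 0 1), φ (√a * y) = 0 := by
    have hset : MeasurableSet {y | φ (√a * y) = 0} :=
      (hm.comp (measurable_const_mul _)) (measurableSet_singleton (0 : ℝ))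
    rw [← hmp.map_eq, ae_map_iff hmp.measurable.aemeasurable hset]
    filter_upwards [h1] with z hz
    simpa [dotProduct] using hz
  have h3 : (fun y => φ (√a * y)) =ᵐ[volume] fun _ => 0 :=
    (gaussianReal_absolutelyContinuous' 0 one_ne_zero).ae_le h2
  have h4 := Continuous.ae_eq_iff_eq volume (f := fun y => φ (√a * y)) (g := fun _ => 0)
    (hφ.continuous.comp (continuous_const_mul _)) continuous_const |>.mp h3
  funext y
  have := congrFun h4 (y / √a)
  simpa [mul_div_cancel₀ _ hs] using this

/-- The properties of limiting covariances and tangent kernels used in the induction over layers. -/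
structure LimitAdmissible {B : Type*} (Γ T : B → B → ℝ) : Prop where
  psd : ∀ β β' (s t : ℝ), 0 ≤ s ^ 2 * Γ β β + 2 * s * t * Γ β β' + t ^ 2 * Γ β' β'
  deg : ∀ β, Γ β β = 0 → ∀ β', T β β' = 0 ∧ T β' β = 0

namespace LimitAdmissible

variable {S B B' : Type*} [Fintype S] {κ σ : ℝ} {π : B' → S → B} {Γ T : B → B → ℝ}

theorem diag_nonneg (h : LimitAdmissible Γ T) (β : B) : 0 ≤ Γ β β := by
  simpa using h.psd β β 1 0

theorem eq_zero (h : LimitAdmissible Γ T) {β : B} (hβ : Γ β β = 0) (β' : B) :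
    Γ β β' = 0 ∧ Γ β' β = 0 := by
  have h1 := sq_le_of_psd (h.psd β β')
  have h2 := sq_le_of_psd (h.psd β' β)
  rw [hβ] at h1 h2
  constructor
  · exact pow_eq_zero_iff two_ne_zero |>.mp (le_antisymm (by linarith) (sq_nonneg _))
  · exact pow_eq_zero_iff two_ne_zero |>.mp (le_antisymm (by linarith) (sq_nonneg _))

theorem limitSigma_psd (h : LimitAdmissible Γ T) (κ σ : ℝ) (π : B' → S → B) (β β' : B') (s t : ℝ) :
    0 ≤ s ^ 2 * limitSigma κ σ π Γ β β + 2 * s * t * limitSigma κ σ π Γ β β'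
      + t ^ 2 * limitSigma κ σ π Γ β' β' := by
  have e : s ^ 2 * limitSigma κ σ π Γ β β + 2 * s * t * limitSigma κ σ π Γ β β'
      + t ^ 2 * limitSigma κ σ π Γ β' β' = κ ^ 2 * ∑ r, (s ^ 2 * Γ (π β r) (π β r)
        + 2 * s * t * Γ (π β r) (π β' r) + t ^ 2 * Γ (π β' r) (π β' r)) + σ ^ 2 * (s + t) ^ 2 := by
    simp only [limitSigma, Finset.sum_add_distrib, ← Finset.mul_sum]
    ring
  rw [e]
  have : 0 ≤ ∑ r, (s ^ 2 * Γ (π β r) (π β r) + 2 * s * t * Γ (π β r) (π β' r)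
      + t ^ 2 * Γ (π β' r) (π β' r)) := Finset.sum_nonneg fun r _ => h.psd _ _ _ _
  positivity

theorem limitSigma_nonneg (h : LimitAdmissible Γ T) (κ σ : ℝ) (π : B' → S → B) (β : B') :
    0 ≤ limitSigma κ σ π Γ β β := by
  simpa using h.limitSigma_psd κ σ π β β 1 0

theorem eq_zero_of_limitSigma (h : LimitAdmissible Γ T) {β : B'}
    (hβ : limitSigma κ σ π Γ β β = 0) :
    σ = 0 ∧ (κ = 0 ∨ ∀ s, Γ (π β s) (π β s) = 0) := by
  have h0 : 0 ≤ ∑ s, Γ (π β s) (π β s) := Finset.sum_nonneg fun s _ => h.diag_nonneg _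
  have h1 : κ ^ 2 * ∑ s, Γ (π β s) (π β s) = 0 := by
    rw [limitSigma] at hβ
    nlinarith [mul_nonneg (sq_nonneg κ) h0, sq_nonneg σ]
  refine ⟨?_, ?_⟩
  · rw [limitSigma, h1, zero_add] at hβ
    exact pow_eq_zero_iff two_ne_zero |>.mp hβ
  · rcases mul_eq_zero.mp h1 with h2 | h2
    · exact Or.inl (pow_eq_zero_iff two_ne_zero |>.mp h2)
    · exact Or.inr fun s =>
        (Finset.sum_eq_zero_iff_of_nonneg fun s _ => h.diag_nonneg _).mp h2 s (Finset.mem_univ s)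

theorem limitTheta_eq_zero (h : LimitAdmissible Γ T) {β : B'}
    (hβ : limitSigma κ σ π Γ β β = 0) (β' : B') :
    limitTheta κ σ π Γ T β β' = 0 ∧ limitTheta κ σ π Γ T β' β = 0 := by
  obtain ⟨rfl, rfl | hs⟩ := h.eq_zero_of_limitSigma hβ
  · simp [limitTheta, limitSigma]
  · simp [limitTheta, limitSigma, h.deg _ (hs _), h.eq_zero (hs _)]

/-- A position with zero limiting variance has zero tangent kernel against every other one, so
averages of derivatives are only needed at nondegenerate pairs. -/
theorem limitTheta_alternative (h : LimitAdmissible Γ T) (κ σ : ℝ) (π : B' → S → B) (β β' : B') :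
    limitTheta κ σ π Γ T β β' = 0 ∨ (0 < limitSigma κ σ π Γ β β ∧
      0 < limitSigma κ σ π Γ β' β' ∧ limitSigma κ σ π Γ β β' ^ 2
        ≤ limitSigma κ σ π Γ β β * limitSigma κ σ π Γ β' β') := by
  rcases (h.limitSigma_nonneg κ σ π β).eq_or_lt with h1 | h1
  · exact Or.inl (h.limitTheta_eq_zero h1.symm β').1
  rcases (h.limitSigma_nonneg κ σ π β').eq_or_lt with h2 | h2
  · exact Or.inl (h.limitTheta_eq_zero h2.symm β).2
  exact Or.inr ⟨h1, h2, sq_le_of_psd (h.limitSigma_psd κ σ π β β')⟩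

/-- A post-activation variance can vanish in two ways: the pre-activation is degenerate, and its
kernel is already zero; or `φ` vanishes identically, and so does its derivative. -/
theorem next {K : ℝ≥0} {φ : ℝ → ℝ} (hφ : LipschitzWith K φ) (h : LimitAdmissible Γ T)
    (κ σ : ℝ) (π : B' → S → B) :
    LimitAdmissible (nextGamma φ κ σ π Γ) (nextTangent φ κ σ π Γ T) := by
  refine ⟨fun β β' s t => gaussProd_psd hφ (h.limitSigma_nonneg κ σ π β)
    (h.limitSigma_nonneg κ σ π β') (sq_le_of_psd (h.limitSigma_psd κ σ π β β')) s t,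
    fun β hβ β' => ?_⟩
  rcases (h.limitSigma_nonneg κ σ π β).eq_or_lt with h1 | h1
  · simp [nextTangent, h.limitTheta_eq_zero h1.symm β']
  · have h0 := eq_zero_of_gaussProd_self_eq_zero hφ h1 hβ
    simp [nextTangent, gaussProd, h0]

end LimitAdmissible

/-- The inputs vanish where their limiting variance does. -/
def VanishDegenerate {B : Type*} (Γ : B → B → ℝ) {n : ℕ} (x : Fin n → B → ℝ) : Prop :=
  ∀ β, Γ β β = 0 → ∀ j, x j β = 0

section VanishDegenerate

variable {S B B' : Type*} [Fintype S] {κ σ : ℝ} {π : B' → S → B} {Γ T : B → B → ℝ} {a n : ℕ}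
  {x : Fin n → B → ℝ}

/-- Zero limiting variance forces a zero bias scale and either zero weight scale or zero inputs. The
vanishing holds for all weights and biases, so a kink of `φ` at zero is invisible to the gradient.
-/
theorem VanishDegenerate.layerPre_eq_zero (hx : VanishDegenerate Γ x) (h : LimitAdmissible Γ T)
    {β : B'} (hβ : limitSigma κ σ π Γ β β = 0) (ω : S → Fin a → Fin n → ℝ) (b : Fin a → ℝ)
    (i : Fin a) : layerPre κ σ π ω b x i β = 0 := by
  obtain ⟨rfl, rfl | hs⟩ := h.eq_zero_of_limitSigma hβ
  · simp [layerPre]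
  · simp [layerPre, hx _ (hs _)]

theorem VanishDegenerate.layerPost {K : ℝ≥0} {φ : ℝ → ℝ} (hφ : LipschitzWith K φ)
    (hx : VanishDegenerate Γ x) (h : LimitAdmissible Γ T) (ω : S → Fin a → Fin n → ℝ)
    (b : Fin a → ℝ) : VanishDegenerate (nextGamma φ κ σ π Γ) (layerPost φ κ σ π ω b x) := by
  intro β hβ i
  rcases (h.limitSigma_nonneg κ σ π β).eq_or_lt with h1 | h1
  · rw [_root_.layerPost, hx.layerPre_eq_zero h h1.symm]
    rw [nextGamma, ← h1, gaussProd_zero φ hφ.continuous.measurable] at hβ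
    exact mul_self_eq_zero.mp hβ
  · rw [_root_.layerPost, eq_zero_of_gaussProd_self_eq_zero hφ h1 hβ]
    rfl

end VanishDegenerate

/-! ### Gradients and towers of layers -/

section LayerGradient

variable {E S B B' : Type*} [NormedAddCommGroup E] [NormedSpace ℝ E] [Fintype S]

/-- The gradient of the pre-activations of a layer, in terms of the gradient `G` of its inputs `x`
and the coordinate functionals `u` of the weights and `v` of the biases. -/
noncomputable def layerGrad (κ σ : ℝ) (π : B' → S → B) {a n : ℕ} (θ : E)
    (u : S → Fin a → Fin n → E →L[ℝ] ℝ) (v : Fin a → E →L[ℝ] ℝ) (x : Fin n → B → ℝ)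
    (G : Fin n → B → E →L[ℝ] ℝ) (i : Fin a) (β : B') : E →L[ℝ] ℝ :=
  (κ / √(n : ℝ)) • ∑ s, ∑ j, (u s i j θ • G j (π β s) + x j (π β s) • u s i j) + σ • v i

theorem hasFDerivAt_layerPre (κ σ : ℝ) (π : B' → S → B) {a n : ℕ} {θ : E}
    (u : S → Fin a → Fin n → E →L[ℝ] ℝ) (v : Fin a → E →L[ℝ] ℝ) {X : E → Fin n → B → ℝ}
    {G : Fin n → B → E →L[ℝ] ℝ} (hX : ∀ j β, HasFDerivAt (fun t => X t j β) (G j β) θ)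
    (i : Fin a) (β : B') :
    HasFDerivAt (fun t => layerPre κ σ π (fun s i j => u s i j t) (fun i => v i t) (X t) i β)
      (layerGrad κ σ π θ u v (X θ) G i β) θ := by
  refine HasFDerivAt.add ?_ ((v i).hasFDerivAt.const_mul σ)
  refine HasFDerivAt.const_mul ?_ _
  refine HasFDerivAt.fun_sum fun s _ => HasFDerivAt.fun_sum fun j _ => ?_
  exact (u s i j).hasFDerivAt.mul (hX j (π β s))

variable (pair : (E →L[ℝ] ℝ) →ₗ[ℝ] (E →L[ℝ] ℝ) →ₗ[ℝ] ℝ)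

theorem pair_layerGrad_left (κ σ : ℝ) (π : B' → S → B) {a n : ℕ} (θ : E)
    (u : S → Fin a → Fin n → E →L[ℝ] ℝ) (v : Fin a → E →L[ℝ] ℝ) (x : Fin n → B → ℝ)
    (G : Fin n → B → E →L[ℝ] ℝ) (i : Fin a) (β : B') (f : E →L[ℝ] ℝ) :
    pair (layerGrad κ σ π θ u v x G i β) f = κ / √(n : ℝ) * ∑ s, ∑ j,
      (u s i j θ * pair (G j (π β s)) f + x j (π β s) * pair (u s i j) f) + σ * pair (v i) f := by
  simp [layerGrad, LinearMap.sum_apply]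

/-- Product rule: the gradient splits into the part through the inputs and the part in the
parameters of this layer, and these are orthogonal. The hypothesis on the biases carries the factor
`σ ^ 2`, so that a layer without biases may use zero functionals with `σ = 0`. -/
theorem pair_layerGrad (hsymm : ∀ f g, pair f g = pair g f) [DecidableEq S] (κ σ : ℝ)
    (π : B' → S → B) {a n : ℕ} (θ : E)
    (u : S → Fin a → Fin n → E →L[ℝ] ℝ) (v : Fin a → E →L[ℝ] ℝ) (x : Fin n → B → ℝ)
    (G : Fin n → B → E →L[ℝ] ℝ)
    (huu : ∀ s i j s' i' j', pair (u s i j) (u s' i' j')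
      = if s = s' ∧ i = i' ∧ j = j' then 1 else 0)
    (hvv : ∀ i i', σ ^ 2 * pair (v i) (v i') = if i = i' then σ ^ 2 else 0)
    (huv : ∀ s i j i', pair (u s i j) (v i') = 0)
    (hGu : ∀ j β s i j', pair (G j β) (u s i j') = 0) (hGv : ∀ j β i, pair (G j β) (v i) = 0)
    (i : Fin a) (β : B') (i' : Fin a) (β' : B') :
    pair (layerGrad κ σ π θ u v x G i β) (layerGrad κ σ π θ u v x G i' β')
      = layerKernel κ σ π (fun s i j => u s i j θ) x
          (fun j γ j' γ' => pair (G j γ) (G j' γ')) i β i' β' := by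
  have hG : ∀ j γ, pair (G j γ) (layerGrad κ σ π θ u v x G i' β')
      = κ / √(n : ℝ) * ∑ s', ∑ j', u s' i' j' θ * pair (G j γ) (G j' (π β' s')) := fun j γ => by
    rw [hsymm, pair_layerGrad_left]
    simp only [hsymm (u _ _ _) (G j γ), hsymm (v _) (G j γ), hGu, hGv, mul_zero, add_zero,
      hsymm (G _ _) (G j γ)]
  have hu : ∀ s j, pair (u s i j) (layerGrad κ σ π θ u v x G i' β')
      = κ / √(n : ℝ) * if i = i' then x j (π β' s) else 0 := fun s j => by
    rw [hsymm, pair_layerGrad_left]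
    simp only [hGu, mul_zero, zero_add, huu, hsymm (v _) (u _ _ _), huv, add_zero]
    congr 1
    rw [Finset.sum_eq_single s, Finset.sum_eq_single j]
    · by_cases h : i = i'
      · simp [h]
      · simp [h, Ne.symm h]
    · intro j' _ hj
      simp [hj]
    · simp
    · intro s' _ hs
      simp [hs]
    · simp
  have hv : σ * pair (v i) (layerGrad κ σ π θ u v x G i' β') = if i = i' then σ ^ 2 else 0 := by
    rw [hsymm, pair_layerGrad_left]
    simp only [hGv, huv, mul_zero, add_zero, Finset.sum_const_zero, zero_add]
    rw [← hvv i i', hsymm (v i)]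
    ring
  have hκ : κ / √(n : ℝ) * (κ / √(n : ℝ)) = κ ^ 2 / n := by
    rw [div_mul_div_comm, Real.mul_self_sqrt (Nat.cast_nonneg n), sq]
  rw [pair_layerGrad_left, hv, layerKernel]
  simp only [hG, hu, Finset.sum_add_distrib, mul_add]
  rw [add_assoc]
  congr 1
  · rw [← hκ, mul_assoc]
    congr 1
    simp only [Finset.mul_sum]
    refine Finset.sum_congr rfl fun s _ => ?_
    rw [Finset.sum_comm]
    refine Finset.sum_congr rfl fun s' _ => Finset.sum_congr rfl fun j _ =>
      Finset.sum_congr rfl fun j' _ => ?_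
    ring
  · split_ifs with h
    · rw [← hκ, mul_assoc]
      congr 2
      simp only [Finset.mul_sum]
      exact Finset.sum_congr rfl fun s _ => Finset.sum_congr rfl fun j _ => by ring
    · simp

end LayerGradient

/-! ### Parameter spaces with independent layers -/

/-- A parameter space `E` with a law `P`, containing the parameters of `H` layers of widths `n`:
the coordinate functionals of the weights and the biases are orthonormal, and at initialization the
parameters of one layer are independent of all others. -/
structure LayeredParam (S : Type) [Fintype S] [DecidableEq S] (n : ℕ → ℕ) (H : ℕ) (E : Type)
    [NormedAddCommGroup E] [NormedSpace ℝ E] [MeasurableSpace E] (P : Measure E) where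
  weight : (l : ℕ) → S → Fin (n (l + 1)) → Fin (n l) → E →L[ℝ] ℝ
  bias : (l : ℕ) → Fin (n (l + 1)) → E →L[ℝ] ℝ
  pair : (E →L[ℝ] ℝ) →ₗ[ℝ] (E →L[ℝ] ℝ) →ₗ[ℝ] ℝ
  pair_comm : ∀ f g, pair f g = pair g f
  pair_weight : ∀ l < H, ∀ s i j s' i' j', pair (weight l s i j) (weight l s' i' j')
    = if s = s' ∧ i = i' ∧ j = j' then 1 else 0
  pair_bias : ∀ l < H, ∀ i i', pair (bias l i) (bias l i') = if i = i' then 1 else 0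
  pair_weight_bias : ∀ l < H, ∀ l' < H, ∀ s i j i', pair (weight l s i j) (bias l' i') = 0
  pair_weight_of_ne : ∀ l < H, ∀ l' < H, l ≠ l' → ∀ s i j s' i' j',
    pair (weight l s i j) (weight l' s' i' j') = 0
  pair_bias_of_ne : ∀ l < H, ∀ l' < H, l ≠ l' → ∀ i i', pair (bias l i) (bias l' i') = 0
  measurable_weight : ∀ l s i j, Measurable (weight l s i j)
  measurable_bias : ∀ l i, Measurable (bias l i)
  resample : (l : ℕ) → E × ((S → Fin (n (l + 1)) → Fin (n l) → ℝ) × (Fin (n (l + 1)) → ℝ)) → E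
  measurePreserving_resample : ∀ l < H,
    MeasurePreserving (resample l) (P.prod (layerInit S (n (l + 1)) (n l))) P
  weight_resample : ∀ l < H, ∀ θ p s i j, weight l s i j (resample l (θ, p)) = p.1 s i j
  bias_resample : ∀ l < H, ∀ θ p i, bias l i (resample l (θ, p)) = p.2 i
  weight_resample_of_lt : ∀ l < H, ∀ l' < l, ∀ θ p s i j,
    weight l' s i j (resample l (θ, p)) = weight l' s i j θ
  bias_resample_of_lt : ∀ l < H, ∀ l' < l, ∀ θ p i, bias l' i (resample l (θ, p)) = bias l' i θ

/-- The post-activations of a tower of layers. -/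
noncomputable def towerPost {S B : Type*} [Fintype S] (φ : ℝ → ℝ) (κ σ : ℝ) (π : B → S → B)
    {n : ℕ → ℕ} (ω : (l : ℕ) → S → Fin (n (l + 1)) → Fin (n l) → ℝ)
    (b : (l : ℕ) → Fin (n (l + 1)) → ℝ) (x : Fin (n 0) → B → ℝ) : (l : ℕ) → Fin (n l) → B → ℝ
  | 0 => x
  | l + 1 => layerPost φ κ σ π (ω l) (b l) (towerPost φ κ σ π ω b x l)

/-- The tangent kernel of the post-activations of a tower of layers. -/
noncomputable def towerTangent {S B : Type*} [Fintype S] (φ : ℝ → ℝ) (κ σ : ℝ) (π : B → S → B)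
    {n : ℕ → ℕ} (ω : (l : ℕ) → S → Fin (n (l + 1)) → Fin (n l) → ℝ)
    (b : (l : ℕ) → Fin (n (l + 1)) → ℝ) (x : Fin (n 0) → B → ℝ) :
    (l : ℕ) → Fin (n l) → B → Fin (n l) → B → ℝ
  | 0 => fun _ _ _ _ => 0
  | l + 1 => layerTangent φ κ σ π (ω l) (b l) (towerPost φ κ σ π ω b x l)
      (towerTangent φ κ σ π ω b x l)

/-- The limiting covariance and tangent kernel of the post-activations of a tower of layers. -/
noncomputable def towerLimit {S B : Type*} [Fintype S] (φ : ℝ → ℝ) (κ σ : ℝ) (π : B → S → B)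
    (Γ : B → B → ℝ) : ℕ → (B → B → ℝ) × (B → B → ℝ)
  | 0 => (Γ, 0)
  | l + 1 => (nextGamma φ κ σ π (towerLimit φ κ σ π Γ l).1,
      nextTangent φ κ σ π (towerLimit φ κ σ π Γ l).1 (towerLimit φ κ σ π Γ l).2)

theorem towerPost_congr {S B : Type*} [Fintype S] (φ : ℝ → ℝ) (κ σ : ℝ) (π : B → S → B)
    {n : ℕ → ℕ} {ω ω' : (l : ℕ) → S → Fin (n (l + 1)) → Fin (n l) → ℝ}
    {b b' : (l : ℕ) → Fin (n (l + 1)) → ℝ} (x : Fin (n 0) → B → ℝ) {l : ℕ}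
    (hω : ∀ l' < l, ω l' = ω' l') (hb : ∀ l' < l, b l' = b' l') :
    towerPost φ κ σ π ω b x l = towerPost φ κ σ π ω' b' x l := by
  induction l with
  | zero => rfl
  | succ l ih =>
    simp only [towerPost]
    rw [ih (fun l' h => hω l' (by omega)) (fun l' h => hb l' (by omega)), hω l (by omega),
      hb l (by omega)]

theorem towerTangent_congr {S B : Type*} [Fintype S] (φ : ℝ → ℝ) (κ σ : ℝ) (π : B → S → B)
    {n : ℕ → ℕ} {ω ω' : (l : ℕ) → S → Fin (n (l + 1)) → Fin (n l) → ℝ}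
    {b b' : (l : ℕ) → Fin (n (l + 1)) → ℝ} (x : Fin (n 0) → B → ℝ) {l : ℕ}
    (hω : ∀ l' < l, ω l' = ω' l') (hb : ∀ l' < l, b l' = b' l') :
    towerTangent φ κ σ π ω b x l = towerTangent φ κ σ π ω' b' x l := by
  induction l with
  | zero => rfl
  | succ l ih =>
    simp only [towerTangent]
    rw [ih (fun l' h => hω l' (by omega)) (fun l' h => hb l' (by omega)), hω l (by omega),
      hb l (by omega), towerPost_congr φ κ σ π x (fun l' h => hω l' (by omega))
        (fun l' h => hb l' (by omega))]

theorem measurable_towerPost {Ω S B : Type*} [MeasurableSpace Ω] [Fintype S] {φ : ℝ → ℝ}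
    (hφ : Measurable φ) (κ σ : ℝ) (π : B → S → B) {n : ℕ → ℕ}
    {ω : Ω → (l : ℕ) → S → Fin (n (l + 1)) → Fin (n l) → ℝ} {b : Ω → (l : ℕ) → Fin (n (l + 1)) → ℝ}
    (hω : ∀ l s i j, Measurable fun t => ω t l s i j) (hb : ∀ l i, Measurable fun t => b t l i)
    (x : Fin (n 0) → B → ℝ) (l : ℕ) (i : Fin (n l)) (β : B) :
    Measurable fun t => towerPost φ κ σ π (ω t) (b t) x l i β := by
  induction l generalizing β with
  | zero => exact measurable_const
  | succ l ih => exact measurable_layerPost hφ κ σ π (hω l) (hb l) (fun j β => ih j β) i β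

theorem measurable_towerTangent {Ω S B : Type*} [MeasurableSpace Ω] [Fintype S] {φ : ℝ → ℝ}
    (hφ : Measurable φ) (κ σ : ℝ) (π : B → S → B) {n : ℕ → ℕ}
    {ω : Ω → (l : ℕ) → S → Fin (n (l + 1)) → Fin (n l) → ℝ} {b : Ω → (l : ℕ) → Fin (n (l + 1)) → ℝ}
    (hω : ∀ l s i j, Measurable fun t => ω t l s i j) (hb : ∀ l i, Measurable fun t => b t l i)
    (x : Fin (n 0) → B → ℝ) (l : ℕ) (i : Fin (n l)) (β : B) (i' : Fin (n l)) (β' : B) :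
    Measurable fun t => towerTangent φ κ σ π (ω t) (b t) x l i β i' β' := by
  induction l generalizing β β' with
  | zero => exact measurable_const
  | succ l ih =>
    exact measurable_layerTangent φ κ σ π (hω l) (hb l)
      (measurable_towerPost hφ κ σ π hω hb x l) (fun j β j' β' => ih j β j' β') i β i' β'

theorem LimitAdmissible.towerLimit {S B : Type*} [Fintype S] {K : ℝ≥0} {φ : ℝ → ℝ}
    (hφ : LipschitzWith K φ) (κ σ : ℝ) (π : B → S → B) {Γ : B → B → ℝ}
    (h : LimitAdmissible Γ 0) (l : ℕ) :
    LimitAdmissible (towerLimit φ κ σ π Γ l).1 (towerLimit φ κ σ π Γ l).2 := by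
  induction l with
  | zero => exact h
  | succ l ih => exact ih.next hφ κ σ π

theorem VanishDegenerate.towerPost {S B : Type*} [Fintype S] {K : ℝ≥0} {φ : ℝ → ℝ}
    (hφ : LipschitzWith K φ) {κ σ : ℝ} {π : B → S → B} {Γ : B → B → ℝ}
    (h : LimitAdmissible Γ 0) {n : ℕ → ℕ} {x : Fin (n 0) → B → ℝ} (hx : VanishDegenerate Γ x)
    (ω : (l : ℕ) → S → Fin (n (l + 1)) → Fin (n l) → ℝ) (b : (l : ℕ) → Fin (n (l + 1)) → ℝ)
    (l : ℕ) : VanishDegenerate (towerLimit φ κ σ π Γ l).1 (towerPost φ κ σ π ω b x l) := by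
  induction l with
  | zero => exact hx
  | succ l ih => exact ih.layerPost hφ (h.towerLimit hφ κ σ π l) (ω l) (b l)

/-- Conditioning without conditional expectations: the law is unchanged when one block is redrawn,
so a bound over the redrawn block for every good state of the rest becomes a bound in total. The
measurable hull of `A` spares its measurability. -/
theorem measure_le_add_of_resample {Ω Ω' : Type*} [MeasurableSpace Ω] [MeasurableSpace Ω']
    {P : Measure Ω} [IsProbabilityMeasure P] {ν : Measure Ω'} [IsProbabilityMeasure ν]
    {g : Ω × Ω' → Ω} (hg : MeasurePreserving g (P.prod ν) P) {A D : Set Ω} (hD : MeasurableSet D)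
    {ε : ℝ≥0∞} (h : ∀ t ∉ A, ν {p | g (t, p) ∈ D} ≤ ε) : P D ≤ P A + ε := by
  rw [← hg.measure_preimage hD.nullMeasurableSet, Measure.prod_apply (hg.measurable hD)]
  calc _ ≤ ∫⁻ t, ((toMeasurable P A).indicator (fun _ => (1 : ℝ≥0∞)) t + ε) ∂P := by
        refine lintegral_mono fun t => ?_
        by_cases ht : t ∈ toMeasurable P A
        · simp only [ht, Set.indicator_of_mem]
          exact prob_le_one.trans le_self_add
        · exact (h t fun hA => ht (subset_toMeasurable P A hA)).trans le_add_self
    _ = P A + ε := by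
        rw [lintegral_add_right _ measurable_const, lintegral_indicator (measurableSet_toMeasurable P A)]
        simp

namespace LayeredParam

variable {S B : Type} [Fintype S] [DecidableEq S] {n : ℕ → ℕ} {H : ℕ} {E : Type}
  [NormedAddCommGroup E] [NormedSpace ℝ E] [MeasurableSpace E] {P : Measure E}
  (𝔪 : LayeredParam S n H E P) {K : ℝ≥0} {φ : ℝ → ℝ} {κ σ : ℝ} {π : B → S → B} {Γ : B → B → ℝ}
  {x : Fin (n 0) → B → ℝ}

/-- The post-activations of the network. -/
noncomputable def post (φ : ℝ → ℝ) (κ σ : ℝ) (π : B → S → B) (x : Fin (n 0) → B → ℝ) (θ : E)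
    (l : ℕ) : Fin (n l) → B → ℝ :=
  towerPost φ κ σ π (fun l s i j => 𝔪.weight l s i j θ) (fun l i => 𝔪.bias l i θ) x l

/-- The tangent kernel of the post-activations of the network. -/
noncomputable def tangent (φ : ℝ → ℝ) (κ σ : ℝ) (π : B → S → B) (x : Fin (n 0) → B → ℝ) (θ : E)
    (l : ℕ) : Fin (n l) → B → Fin (n l) → B → ℝ :=
  towerTangent φ κ σ π (fun l s i j => 𝔪.weight l s i j θ) (fun l i => 𝔪.bias l i θ) x l

/-- The activation function is differentiable at the pre-activations of layer `l`. -/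
def DiffAt (φ : ℝ → ℝ) (κ σ : ℝ) (π : B → S → B) (Γ : B → B → ℝ) (x : Fin (n 0) → B → ℝ) (θ : E)
    (l : ℕ) : Prop :=
  LayerDiff φ κ σ π (towerLimit φ κ σ π Γ l).1 (fun s i j => 𝔪.weight l s i j θ)
    (fun i => 𝔪.bias l i θ) (𝔪.post φ κ σ π x θ l)

/-- The parameters for which the first `l` layers behave as in the limit. -/
def Good (φ : ℝ → ℝ) (κ σ : ℝ) (π : B → S → B) (Γ : B → B → ℝ) (x : Fin (n 0) → B → ℝ) (ε : ℝ)
    (l : ℕ) (θ : E) : Prop :=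
  NearLimit (towerLimit φ κ σ π Γ l).1 (towerLimit φ κ σ π Γ l).2 ε (𝔪.post φ κ σ π x θ l)
    (𝔪.tangent φ κ σ π x θ l) ∧ ∀ l' < l, 𝔪.DiffAt φ κ σ π Γ x θ l'

/-- The last clause expresses that the gradient lies in the span of the coordinate functionals of
the earlier layers; it gives the orthogonality to the next layer's parameters in the induction. -/
theorem exists_gradient (hφ : LipschitzWith K φ) (hΓ : LimitAdmissible Γ 0)
    (hx : VanishDegenerate Γ x) {θ : E} {l : ℕ} (hl : l ≤ H)
    (hd : ∀ l' < l, 𝔪.DiffAt φ κ σ π Γ x θ l') :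
    ∃ G : Fin (n l) → B → E →L[ℝ] ℝ,
      (∀ j β, HasFDerivAt (fun t => 𝔪.post φ κ σ π x t l j β) (G j β) θ) ∧
      (∀ j β j' β', 𝔪.pair (G j β) (G j' β') = 𝔪.tangent φ κ σ π x θ l j β j' β') ∧
      ∀ f, (∀ l' < l, (∀ s i j, 𝔪.pair (𝔪.weight l' s i j) f = 0) ∧
        ∀ i, 𝔪.pair (𝔪.bias l' i) f = 0) → ∀ j β, 𝔪.pair (G j β) f = 0 := by
  induction l with
  | zero =>
    refine ⟨fun _ _ => 0, fun j β => hasFDerivAt_const _ _, fun j β j' β' => ?_, fun f _ j β => ?_⟩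
    · simp [tangent, towerTangent]
    · simp
  | succ l ih =>
    obtain ⟨G, hG, hGG, hGf⟩ := ih (by omega) fun l' h => hd l' (by omega)
    set D := layerGrad κ σ π θ (𝔪.weight l) (𝔪.bias l) (𝔪.post φ κ σ π x θ l) G with hD
    have hpre : ∀ i β, HasFDerivAt (fun t => layerPre κ σ π (fun s i j => 𝔪.weight l s i j t)
        (fun i => 𝔪.bias l i t) (𝔪.post φ κ σ π x t l) i β) (D i β) θ :=
      hasFDerivAt_layerPre κ σ π (𝔪.weight l) (𝔪.bias l) hG
    have hadm := hΓ.towerLimit hφ κ σ π l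
    refine ⟨fun i β => deriv φ (layerPre κ σ π (fun s i j => 𝔪.weight l s i j θ)
        (fun i => 𝔪.bias l i θ) (𝔪.post φ κ σ π x θ l) i β) • D i β, fun i β => ?_,
        fun i β i' β' => ?_, fun f hf i β => ?_⟩
    -- At a degenerate position the pre-activation is identically zero, so its derivative is zero
    -- and the chain rule formula holds with whatever value `deriv φ` has at zero.
    · rcases (hadm.limitSigma_nonneg κ σ π β).eq_or_lt with h0 | h0
      · have hz : ∀ t : E, layerPre κ σ π (fun s i j => 𝔪.weight l s i j t)
            (fun i => 𝔪.bias l i t) (𝔪.post φ κ σ π x t l) i β = 0 := fun t =>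
          (hx.towerPost hφ hΓ _ _ l).layerPre_eq_zero hadm h0.symm _ _ i
        have hD0 : D i β = 0 := by
          refine (hpre i β).unique ?_
          simp only [hz]
          exact hasFDerivAt_const _ _
        beta_reduce
        rw [hD0, smul_zero]
        have hc : (fun t => 𝔪.post φ κ σ π x t (l + 1) i β) = fun _ => φ 0 :=
          funext fun t => congrArg φ (hz t)
        rw [hc]
        exact hasFDerivAt_const _ _
      · exact (hd l (by omega) i β h0).hasDerivAt.comp_hasFDerivAt θ (hpre i β)
    · have hk : 𝔪.pair (D i β) (D i' β') = layerKernel κ σ π (fun s i j => 𝔪.weight l s i j θ)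
          (𝔪.post φ κ σ π x θ l) (𝔪.tangent φ κ σ π x θ l) i β i' β' := by
        have hlt : l < H := by omega
        rw [hD, pair_layerGrad 𝔪.pair 𝔪.pair_comm κ σ π θ _ _ _ _ (𝔪.pair_weight l hlt)
          (fun i i' => by rw [𝔪.pair_bias l hlt]; simp)
          (𝔪.pair_weight_bias l hlt l hlt) (fun j β s i j' => hGf _ (fun l' h => ⟨fun s' i' j' =>
            𝔪.pair_weight_of_ne l' (by omega) l hlt h.ne _ _ _ _ _ _, fun i' => by
              rw [𝔪.pair_comm]; exact 𝔪.pair_weight_bias l hlt l' (by omega) _ _ _ _⟩) j β)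
          (fun j β i => hGf _ (fun l' h => ⟨fun s' i' j' =>
            𝔪.pair_weight_bias l' (by omega) l hlt _ _ _ _, fun i' =>
            𝔪.pair_bias_of_ne l' (by omega) l hlt h.ne _ _⟩) j β)]
        simp only [hGG]
      beta_reduce
      rw [map_smul, map_smul, LinearMap.smul_apply, hk]
      simp only [smul_eq_mul, tangent, towerTangent, layerTangent, post]
      ring
    · beta_reduce
      rw [map_smul, LinearMap.smul_apply, hD, pair_layerGrad_left]
      simp [hGf f (fun l' h => hf l' (by omega)), hf l (by omega)]

theorem measurableSet_good [Fintype B] (hφ : Measurable φ) (ε : ℝ) (l : ℕ) :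
    MeasurableSet {θ | 𝔪.Good φ κ σ π Γ x ε l θ} := by
  have hpost := fun l => measurable_towerPost hφ κ σ π (n := n)
    (ω := fun t l s i j => 𝔪.weight l s i j t) (b := fun t l i => 𝔪.bias l i t)
    𝔪.measurable_weight 𝔪.measurable_bias x l
  refine (measurableSet_nearLimit _ _ ε (hpost l) (measurable_towerTangent hφ κ σ π
    (ω := fun t l s i j => 𝔪.weight l s i j t) (b := fun t l i => 𝔪.bias l i t)
    𝔪.measurable_weight 𝔪.measurable_bias x l)).inter ?_
  have : {θ | ∀ l' < l, 𝔪.DiffAt φ κ σ π Γ x θ l'}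
      = ⋂ l', ⋂ _ : l' < l, {θ | 𝔪.DiffAt φ κ σ π Γ x θ l'} := by
    ext; simp
  change MeasurableSet {θ | ∀ l' < l, 𝔪.DiffAt φ κ σ π Γ x θ l'}
  rw [this]
  exact MeasurableSet.iInter fun l' => MeasurableSet.iInter fun _ =>
    measurableSet_layerDiff φ κ σ π _ (𝔪.measurable_weight l') (𝔪.measurable_bias l') (hpost l')

theorem post_resample {l : ℕ} (hl : l < H) {l' : ℕ} (hl' : l' ≤ l) (θ : E)
    (p : (S → Fin (n (l + 1)) → Fin (n l) → ℝ) × (Fin (n (l + 1)) → ℝ)) :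
    𝔪.post φ κ σ π x (𝔪.resample l (θ, p)) l' = 𝔪.post φ κ σ π x θ l' :=
  towerPost_congr φ κ σ π x
    (fun l'' h => by ext s i j; exact 𝔪.weight_resample_of_lt l hl l'' (by omega) θ p s i j)
    (fun l'' h => by ext i; exact 𝔪.bias_resample_of_lt l hl l'' (by omega) θ p i)

theorem tangent_resample {l : ℕ} (hl : l < H) {l' : ℕ} (hl' : l' ≤ l) (θ : E)
    (p : (S → Fin (n (l + 1)) → Fin (n l) → ℝ) × (Fin (n (l + 1)) → ℝ)) :
    𝔪.tangent φ κ σ π x (𝔪.resample l (θ, p)) l' = 𝔪.tangent φ κ σ π x θ l' :=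
  towerTangent_congr φ κ σ π x
    (fun l'' h => by ext s i j; exact 𝔪.weight_resample_of_lt l hl l'' (by omega) θ p s i j)
    (fun l'' h => by ext i; exact 𝔪.bias_resample_of_lt l hl l'' (by omega) θ p i)

theorem good_succ_resample {l : ℕ} (hl : l < H) {θ : E}
    {p : (S → Fin (n (l + 1)) → Fin (n l) → ℝ) × (Fin (n (l + 1)) → ℝ)} {ε : ℝ}
    (hθ : ∀ l' < l, 𝔪.DiffAt φ κ σ π Γ x θ l')
    (h : NearLimit (towerLimit φ κ σ π Γ (l + 1)).1 (towerLimit φ κ σ π Γ (l + 1)).2 ε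
        (layerPost φ κ σ π p.1 p.2 (𝔪.post φ κ σ π x θ l))
        (layerTangent φ κ σ π p.1 p.2 (𝔪.post φ κ σ π x θ l) (𝔪.tangent φ κ σ π x θ l))
        ∧ LayerDiff φ κ σ π (towerLimit φ κ σ π Γ l).1 p.1 p.2 (𝔪.post φ κ σ π x θ l)) :
    𝔪.Good φ κ σ π Γ x ε (l + 1) (𝔪.resample l (θ, p)) := by
  have hw : (fun s i j => 𝔪.weight l s i j (𝔪.resample l (θ, p))) = p.1 := by
    ext s i j; exact 𝔪.weight_resample l hl θ p s i j
  have hb : (fun i => 𝔪.bias l i (𝔪.resample l (θ, p))) = p.2 := by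
    ext i; exact 𝔪.bias_resample l hl θ p i
  have hp := 𝔪.post_resample (φ := φ) (κ := κ) (σ := σ) (π := π) (x := x) hl le_rfl θ p
  have ht := 𝔪.tangent_resample (φ := φ) (κ := κ) (σ := σ) (π := π) (x := x) hl le_rfl θ p
  refine ⟨?_, fun l' hl' => ?_⟩
  · have e1 : 𝔪.post φ κ σ π x (𝔪.resample l (θ, p)) (l + 1)
        = layerPost φ κ σ π p.1 p.2 (𝔪.post φ κ σ π x θ l) := by
      rw [← hp, ← hw, ← hb]; rfl
    have e2 : 𝔪.tangent φ κ σ π x (𝔪.resample l (θ, p)) (l + 1)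
        = layerTangent φ κ σ π p.1 p.2 (𝔪.post φ κ σ π x θ l) (𝔪.tangent φ κ σ π x θ l) := by
      rw [← hp, ← ht, ← hw, ← hb]; rfl
    rw [e1, e2]
    exact h.1
  · rcases (Nat.lt_succ_iff.mp hl').eq_or_lt with rfl | hlt
    · rw [DiffAt, hw, hb, hp]
      exact h.2
    · have hw' : (fun s i j => 𝔪.weight l' s i j (𝔪.resample l (θ, p)))
          = fun s i j => 𝔪.weight l' s i j θ := by
        ext s i j; exact 𝔪.weight_resample_of_lt l hl l' hlt θ p s i j
      have hb' : (fun i => 𝔪.bias l' i (𝔪.resample l (θ, p))) = fun i => 𝔪.bias l' i θ := by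
        ext i; exact 𝔪.bias_resample_of_lt l hl l' hlt θ p i
      rw [DiffAt, hw', hb', 𝔪.post_resample hl hlt.le θ p]
      exact hθ l' hlt

end LayeredParam

/-! ### Induction over the layers -/

theorem exists_measure_not_good_le {S B : Type} [Fintype S] [DecidableEq S] [Fintype B] {K : ℝ≥0}
    {φ : ℝ → ℝ} (hφ : LipschitzWith K φ) (κ σ : ℝ) (π : B → S → B) {Γ : B → B → ℝ}
    (hΓ : LimitAdmissible Γ 0) (l : ℕ) {ε : ℝ} (hε : 0 < ε) :
    ∃ N : ℕ, ∀ {n : ℕ → ℕ} {H : ℕ} {E : Type} [NormedAddCommGroup E] [NormedSpace ℝ E]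
      [MeasurableSpace E] {P : Measure E} [IsProbabilityMeasure P] (𝔪 : LayeredParam S n H E P)
      {x : Fin (n 0) → B → ℝ}, (∀ β β', 1 / (n 0 : ℝ) * ∑ j, x j β * x j β' = Γ β β') → l ≤ H →
      (∀ l', 1 ≤ l' → l' ≤ l → N ≤ n l') →
      P {θ | ¬ 𝔪.Good φ κ σ π Γ x ε l θ} ≤ ENNReal.ofReal ε := by
  induction l generalizing ε with
  | zero =>
    refine ⟨0, fun {n H E} _ _ _ {P} _ 𝔪 {x} hx _ _ => ?_⟩
    have : {θ | ¬ 𝔪.Good φ κ σ π Γ x ε 0 θ} = ∅ := by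
      refine Set.eq_empty_of_forall_notMem fun θ hθ => hθ ⟨fun β β' => ⟨?_, ?_, ?_⟩, ?_⟩
      · simp only [LayeredParam.post, towerPost, towerLimit, hx, sub_self, abs_zero]
        exact hε.le
      · simp [LayeredParam.tangent, towerTangent, towerLimit, hε.le]
      · simp [LayeredParam.tangent, towerTangent, hε.le]
      · intro l' h
        omega
    rw [this]
    simp
  | succ l ih =>
    have hε2 : 0 < ε / 2 := by positivity
    obtain ⟨δ, hδ, n₀, hstep⟩ := exists_layer_step hφ κ σ π _ _
      ((hΓ.towerLimit hφ κ σ π l).limitTheta_alternative κ σ π) hε2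
    -- The tolerances are chosen from the last layer backwards: the earlier layers must be within
    -- the `δ` required by this step. The threshold `N` precedes the choice of all widths, which
    -- makes the limit simultaneous.
    obtain ⟨N, hN⟩ := ih (ε := min δ (ε / 2)) (by positivity)
    refine ⟨max N n₀, fun {n H E} _ _ _ {P} _ 𝔪 {x} hx hl hn => ?_⟩
    have h1 := hN 𝔪 hx (by omega) fun l' h h' => (le_max_left _ _).trans (hn l' h (by omega))
    refine (measure_le_add_of_resample (𝔪.measurePreserving_resample l (by omega))
      (𝔪.measurableSet_good hφ.continuous.measurable ε (l + 1)).compl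
      (A := {θ | ¬ 𝔪.Good φ κ σ π Γ x (min δ (ε / 2)) l θ})
      (ε := ENNReal.ofReal (ε / 2)) fun θ hθ => ?_).trans ?_
    · have hθ' : 𝔪.Good φ κ σ π Γ x (min δ (ε / 2)) l θ := not_not.mp hθ
      refine (measure_mono ?_).trans (hstep ((le_max_right _ _).trans (hn (l + 1) (by omega) le_rfl))
        (hθ'.1.mono (min_le_left _ _)))
      intro p hp hcon
      exact hp (𝔪.good_succ_resample (by omega) hθ'.2
        ⟨hcon.1.mono (by linarith), hcon.2⟩)
    · calc _ ≤ ENNReal.ofReal (ε / 2) + ENNReal.ofReal (ε / 2) :=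
            add_le_add (h1.trans (ENNReal.ofReal_le_ofReal (min_le_right _ _))) le_rfl
        _ = ENNReal.ofReal ε := by
            rw [← ENNReal.ofReal_add hε2.le hε2.le, add_halves]

/-- An output layer with `a` neurons on top of a tower of layers. -/
structure OutputParam {S : Type} [Fintype S] [DecidableEq S] {n : ℕ → ℕ} {H : ℕ} {E : Type}
    [NormedAddCommGroup E] [NormedSpace ℝ E] [MeasurableSpace E] {P : Measure E}
    (𝔪 : LayeredParam S n H E P) (S' : Type) [Fintype S'] [DecidableEq S'] (σ : ℝ) (a : ℕ) where
  weight : S' → Fin a → Fin (n H) → E →L[ℝ] ℝ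
  bias : Fin a → E →L[ℝ] ℝ
  pair_weight : ∀ s i j s' i' j', 𝔪.pair (weight s i j) (weight s' i' j')
    = if s = s' ∧ i = i' ∧ j = j' then 1 else 0
  pair_bias : ∀ i i', σ ^ 2 * 𝔪.pair (bias i) (bias i') = if i = i' then σ ^ 2 else 0
  pair_weight_bias : ∀ s i j i', 𝔪.pair (weight s i j) (bias i') = 0
  pair_layer_weight : ∀ l < H, ∀ s i j, (∀ s' i' j', 𝔪.pair (𝔪.weight l s' i' j') (weight s i j) = 0) ∧
    ∀ i', 𝔪.pair (𝔪.bias l i') (weight s i j) = 0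
  pair_layer_bias : ∀ l < H, ∀ i, (∀ s' i' j', 𝔪.pair (𝔪.weight l s' i' j') (bias i) = 0) ∧
    ∀ i', 𝔪.pair (𝔪.bias l i') (bias i) = 0
  measurable_weight : ∀ s i j, Measurable (weight s i j)
  resample : E × (S' → Fin a → Fin (n H) → ℝ) → E
  measurePreserving_resample :
    MeasurePreserving resample (P.prod (Measure.pi fun _ : S' => orthInit a (n H))) P
  weight_resample : ∀ θ p s i j, weight s i j (resample (θ, p)) = p s i j
  layer_weight_resample : ∀ l < H, ∀ θ p s i j,
    𝔪.weight l s i j (resample (θ, p)) = 𝔪.weight l s i j θ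
  layer_bias_resample : ∀ l < H, ∀ θ p i, 𝔪.bias l i (resample (θ, p)) = 𝔪.bias l i θ

/-- On good parameters the true gradient of the output pairs to the algebraic `layerKernel`, and the
weights of the output layer make this concentrate. The bad event of the hidden layers is paid twice,
once for concentration and once for differentiability; hence the thirds of `ε`. -/
theorem exists_measure_tangentKernel_le {S S' B B' : Type} [Fintype S] [DecidableEq S] [Fintype S']
    [DecidableEq S'] [Fintype B] [Fintype B'] {K : ℝ≥0} {φ : ℝ → ℝ} (hφ : LipschitzWith K φ)
    (κ σ : ℝ) (π : B → S → B) (κ' σ' : ℝ) (π' : B' → S' → B) {Γ : B → B → ℝ}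
    (hΓ : LimitAdmissible Γ 0) (H a : ℕ) {ε : ℝ} (hε : 0 < ε) :
    ∃ N : ℕ, ∀ {n : ℕ → ℕ} {E : Type} [NormedAddCommGroup E] [NormedSpace ℝ E]
      [MeasurableSpace E] {P : Measure E} [IsProbabilityMeasure P] (𝔪 : LayeredParam S n H E P)
      (𝔬 : OutputParam 𝔪 S' σ' a) {x : Fin (n 0) → B → ℝ},
      (∀ β β', 1 / (n 0 : ℝ) * ∑ j, x j β * x j β' = Γ β β') → VanishDegenerate Γ x →
      (∀ l', 1 ≤ l' → l' ≤ H → N ≤ n l') → ∀ {f : E → Fin a → B' → ℝ},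
      (∀ t i β, f t i β = layerPre κ' σ' π' (fun s i j => 𝔬.weight s i j t)
        (fun i => 𝔬.bias i t) (𝔪.post φ κ σ π x t H) i β) → ∀ β β' : B',
      P {θ | ¬ ∀ i i', |𝔪.pair (fderiv ℝ (fun t => f t i β) θ) (fderiv ℝ (fun t => f t i' β') θ)
        - if i = i' then limitTheta κ' σ' π' (towerLimit φ κ σ π Γ H).1 (towerLimit φ κ σ π Γ H).2
          β β' else 0| < ε} ≤ ENNReal.ofReal ε := by
  have hε3 : 0 < ε / 3 := by positivity
  obtain ⟨δ, hδ, hout⟩ := exists_output_step κ' σ' π' (towerLimit φ κ σ π Γ H).1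
    (towerLimit φ κ σ π Γ H).2 a hε3
  obtain ⟨N, hN⟩ := exists_measure_not_good_le hφ κ σ π hΓ H (ε := min δ (ε / 3)) (by positivity)
  refine ⟨N, fun {n E} _ _ _ {P} _ 𝔪 𝔬 {x} hx hxd hn {f} hf β β' => ?_⟩
  have h1 := (hN 𝔪 hx le_rfl hn).trans (ENNReal.ofReal_le_ofReal (min_le_right δ (ε / 3)))
  set A : Set E := {θ | ¬ 𝔪.Good φ κ σ π Γ x (min δ (ε / 3)) H θ} with hA
  let ker : E → Fin a → Fin a → ℝ := fun θ i i' => layerKernel κ' σ' π'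
    (fun s i j => 𝔬.weight s i j θ) (𝔪.post φ κ σ π x θ H) (𝔪.tangent φ κ σ π x θ H) i β i' β'
  set c := limitTheta κ' σ' π' (towerLimit φ κ σ π Γ H).1 (towerLimit φ κ σ π Γ H).2 β β' with hc
  let D : Set E := {θ | ∀ i i', |ker θ i i' - if i = i' then c else 0| < ε / 3}
  have hkm : ∀ i i', Measurable fun θ => ker θ i i' := fun i i' =>
    measurable_layerKernel κ' σ' π' 𝔬.measurable_weight
      (measurable_towerPost hφ.continuous.measurable κ σ π 𝔪.measurable_weight 𝔪.measurable_bias x H)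
      (measurable_towerTangent hφ.continuous.measurable κ σ π 𝔪.measurable_weight
        𝔪.measurable_bias x H) i β i' β'
  have hDm : MeasurableSet D := by
    simp only [D, Set.ofPred_forall]
    exact MeasurableSet.iInter fun i => MeasurableSet.iInter fun i' =>
      measurableSet_lt ((hkm i i').sub_const _).abs measurable_const
  have h2 : P Dᶜ ≤ P A + ENNReal.ofReal (ε / 3) := by
    refine measure_le_add_of_resample 𝔬.measurePreserving_resample hDm.compl fun θ hθ => ?_
    have hθ' : 𝔪.Good φ κ σ π Γ x (min δ (ε / 3)) H θ := not_not.mp hθ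
    refine (measure_mono ?_).trans (hout (hθ'.1.mono (min_le_left _ _)) β β')
    intro p hp hcon
    refine hp fun i i' => ?_
    have e1 : 𝔪.post φ κ σ π x (𝔬.resample (θ, p)) H = 𝔪.post φ κ σ π x θ H :=
      towerPost_congr φ κ σ π x
        (fun l h => by ext s i j; exact 𝔬.layer_weight_resample l h θ p s i j)
        (fun l h => by ext i; exact 𝔬.layer_bias_resample l h θ p i)
    have e2 : 𝔪.tangent φ κ σ π x (𝔬.resample (θ, p)) H = 𝔪.tangent φ κ σ π x θ H :=
      towerTangent_congr φ κ σ π x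
        (fun l h => by ext s i j; exact 𝔬.layer_weight_resample l h θ p s i j)
        (fun l h => by ext i; exact 𝔬.layer_bias_resample l h θ p i)
    have e3 : (fun s i j => 𝔬.weight s i j (𝔬.resample (θ, p))) = p := by
      ext s i j; exact 𝔬.weight_resample θ p s i j
    have := hcon i i'
    rw [← hc] at this
    simp only [ker, e1, e2, e3]
    exact this
  have hsub : {θ | ¬ ∀ i i', |𝔪.pair (fderiv ℝ (fun t => f t i β) θ) (fderiv ℝ (fun t => f t i' β') θ)
        - if i = i' then c else 0| < ε} ⊆ A ∪ Dᶜ := by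
    intro θ hθ
    by_contra hcon
    simp only [Set.mem_union, not_or, Set.mem_compl_iff, not_not, hA, Set.mem_ofPred_eq] at hcon
    refine hθ fun i i' => ?_
    obtain ⟨G, hG, hGG, hGf⟩ := 𝔪.exists_gradient hφ hΓ hxd le_rfl hcon.1.2
    have hder : ∀ i β, fderiv ℝ (fun t => f t i β) θ
        = layerGrad κ' σ' π' θ 𝔬.weight 𝔬.bias (𝔪.post φ κ σ π x θ H) G i β := fun i β => by
      simp only [hf]
      exact (hasFDerivAt_layerPre κ' σ' π' 𝔬.weight 𝔬.bias hG i β).fderiv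
    rw [hder, hder, pair_layerGrad 𝔪.pair 𝔪.pair_comm κ' σ' π' θ _ _ _ _ 𝔬.pair_weight 𝔬.pair_bias
      𝔬.pair_weight_bias (fun j β s i j' => hGf _ (fun l h => 𝔬.pair_layer_weight l h s i j') j β)
      (fun j β i => hGf _ (fun l h => 𝔬.pair_layer_bias l h i) j β)]
    simp only [hGG]
    exact (hcon.2 i i').trans (by linarith)
  calc _ ≤ P A + P Dᶜ := (measure_mono hsub).trans (measure_union_le _ _)
    _ ≤ ENNReal.ofReal (ε / 3) + (ENNReal.ofReal (ε / 3) + ENNReal.ofReal (ε / 3)) :=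
        add_le_add h1 (h2.trans (add_le_add h1 le_rfl))
    _ = ENNReal.ofReal ε := by
        rw [← ENNReal.ofReal_add hε3.le hε3.le, ← ENNReal.ofReal_add hε3.le (by positivity)]
        congr 1
        ring

/-! ### Resampling of product measures -/

theorem measurePreserving_update {ι : Type*} [Fintype ι] [DecidableEq ι] {α : ι → Type*}
    [∀ i, MeasurableSpace (α i)] (μ : (i : ι) → Measure (α i)) [∀ i, IsProbabilityMeasure (μ i)]
    (l : ι) : MeasurePreserving (fun p : ((i : ι) → α i) × α l => Function.update p.1 l p.2)
      ((Measure.pi μ).prod (μ l)) (Measure.pi μ) := by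
  refine ⟨measurable_update', ?_⟩
  refine (Measure.pi_eq fun s hs => ?_).symm
  rw [Measure.map_apply measurable_update' (MeasurableSet.univ_pi hs)]
  have : (fun p : ((i : ι) → α i) × α l => Function.update p.1 l p.2) ⁻¹' Set.univ.pi s
      = (Set.univ.pi (Function.update s l Set.univ)) ×ˢ s l := by
    ext p
    simp only [Set.mem_preimage, Set.mem_pi, Set.mem_univ, true_implies, Set.mem_prod]
    constructor
    · intro h
      refine ⟨fun i => ?_, by simpa using h l⟩
      rcases eq_or_ne i l with rfl | hi
      · simp
      · simpa [hi] using h i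
    · rintro ⟨h1, h2⟩ i
      rcases eq_or_ne i l with rfl | hi
      · simpa using h2
      · simpa [hi] using h1 i
  rw [this, Measure.prod_prod, Measure.pi_pi, Fintype.prod_eq_mul_prod_compl l,
    Fintype.prod_eq_mul_prod_compl l fun i => μ i (s i)]
  rw [Function.update_self, measure_univ, one_mul, mul_comm]
  congr 1
  refine Finset.prod_congr rfl fun i hi => ?_
  rw [Function.update_of_ne (by simpa using hi)]

section ProdComm

variable {α β γ δ : Type*} [MeasurableSpace α] [MeasurableSpace β] [MeasurableSpace γ]
  [MeasurableSpace δ] (μ : Measure α) (ν : Measure β) (τ : Measure γ) (ρ : Measure δ)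
  [SFinite μ] [SFinite ν] [SFinite τ] [SFinite ρ]

theorem measurePreserving_prod_right_comm :
    MeasurePreserving (fun p : (α × β) × γ => ((p.1.1, p.2), p.1.2))
      ((μ.prod ν).prod τ) ((μ.prod τ).prod ν) :=
  ((measurePreserving_prodAssoc μ τ ν).symm _).comp
    (((MeasurePreserving.id μ).prod (Measure.measurePreserving_swap (μ := ν) (ν := τ))).comp
      (measurePreserving_prodAssoc μ ν τ))

theorem measurePreserving_prod_prod_comm :
    MeasurePreserving (fun p : (α × β) × (γ × δ) => ((p.1.1, p.2.1), (p.1.2, p.2.2)))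
      ((μ.prod ν).prod (τ.prod ρ)) ((μ.prod τ).prod (ν.prod ρ)) :=
  (measurePreserving_prodAssoc (μ.prod τ) ν ρ).comp
    (((measurePreserving_prod_right_comm μ ν τ).prod (MeasurePreserving.id ρ)).comp
      ((measurePreserving_prodAssoc (μ.prod ν) τ ρ).symm _))

end ProdComm

theorem measurePreserving_pi_apply {ι α : Type*} [Fintype ι] [MeasurableSpace α] (μ : Measure α)
    [IsProbabilityMeasure μ] (i : ι) :
    MeasurePreserving (fun p : ι → α => p i) (Measure.pi fun _ : ι => μ) μ :=
  measurePreserving_eval (fun _ : ι => μ) i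

/-- A fully-connected layer has the single offset `()`, so its redrawn weight arrives as a function
on `Unit`. -/
theorem measurePreserving_update_unit {ι : Type*} [Fintype ι] [DecidableEq ι] {α : ι → Type*}
    [∀ i, MeasurableSpace (α i)] (μ : (i : ι) → Measure (α i)) [∀ i, IsProbabilityMeasure (μ i)]
    (l : ι) :
    MeasurePreserving (fun p : ((i : ι) → α i) × (Unit → α l) => Function.update p.1 l (p.2 ()))
      ((Measure.pi μ).prod (Measure.pi fun _ : Unit => μ l)) (Measure.pi μ) :=
  (measurePreserving_update μ l).comp
    ((MeasurePreserving.id (Measure.pi μ)).prod (measurePreserving_pi_apply (μ l) ()))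

theorem measurePreserving_update_unit_fst {ι β : Type*} [Fintype ι] [DecidableEq ι]
    {α : ι → Type*} [∀ i, MeasurableSpace (α i)] [MeasurableSpace β] (μ : (i : ι) → Measure (α i))
    [∀ i, IsProbabilityMeasure (μ i)] (ν : Measure β) [SFinite ν] (l : ι) :
    MeasurePreserving (fun p : (((i : ι) → α i) × β) × (Unit → α l) =>
        (Function.update p.1.1 l (p.2 ()), p.1.2))
      (((Measure.pi μ).prod ν).prod (Measure.pi fun _ : Unit => μ l)) ((Measure.pi μ).prod ν) :=
  ((measurePreserving_update_unit μ l).prod (MeasurePreserving.id ν)).comp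
    (measurePreserving_prod_right_comm _ _ _)

/-- A width threshold which is uniform in the network gives convergence along every sequence of
widths, since only finitely many layers must exceed it. -/
theorem tendstoInProbScalar_of_forall_exists {Ω : ℕ → Type*} [∀ s, MeasurableSpace (Ω s)]
    {P : ∀ s, Measure (Ω s)} {q : ℕ → ℕ} {X : ∀ s, Ω s → Matrix (Fin (q s)) (Fin (q s)) ℝ} {c : ℝ}
    {H : ℕ} {n : ℕ → ℕ → ℕ} (hn : ∀ l, 1 ≤ l → l ≤ H → Tendsto (fun s => n s l) atTop atTop)
    (h : ∀ ε : ℝ, 0 < ε → ∃ N : ℕ, ∀ s, (∀ l, 1 ≤ l → l ≤ H → N ≤ n s l) →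
      P s {ω | ¬ ∀ i j, |X s ω i j - if i = j then c else 0| < ε} ≤ ENNReal.ofReal ε) :
    TendstoInProbScalar P X c := by
  intro ε hε
  rw [ENNReal.tendsto_nhds_zero]
  intro η hη
  obtain ⟨r, hr, hrη⟩ : ∃ r : ℝ, 0 < r ∧ ENNReal.ofReal r ≤ η := by
    obtain ⟨r, hr, hrη⟩ := ENNReal.lt_iff_exists_nnreal_btwn.mp hη
    exact ⟨r, by exact_mod_cast hr, by simpa using hrη.le⟩
  obtain ⟨N, hN⟩ := h (min ε r) (by positivity)
  have hev : ∀ᶠ s in atTop, ∀ l ∈ Finset.Icc 1 H, N ≤ n s l :=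
    (Finset.eventually_all _).mpr fun l hl =>
      (hn l (Finset.mem_Icc.mp hl).1 (Finset.mem_Icc.mp hl).2).eventually_ge_atTop N
  filter_upwards [hev] with s hs
  refine (measure_mono ?_).trans ((hN s fun l h1 h2 => hs l (Finset.mem_Icc.mpr ⟨h1, h2⟩)).trans
    ((ENNReal.ofReal_le_ofReal (min_le_right _ _)).trans hrη))
  rintro ω ⟨i, j, hij⟩ hcon
  have := (hcon i j).trans_le (min_le_left _ _)
  simp only [Matrix.sub_apply, Matrix.smul_apply, Matrix.one_apply, smul_eq_mul, mul_ite, mul_one,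
    mul_zero] at hij
  linarith

/-- The covariance of the inputs. -/
noncomputable def inputGram {B : Type*} {n : ℕ} (x : Fin n → B → ℝ) (β β' : B) : ℝ :=
  1 / (n : ℝ) * ∑ j, x j β * x j β'

theorem limitAdmissible_inputGram {B : Type*} {n : ℕ} (x : Fin n → B → ℝ) :
    LimitAdmissible (inputGram x) 0 := by
  refine ⟨fun β β' s t => ?_, fun _ _ _ => ⟨rfl, rfl⟩⟩
  have e : s ^ 2 * inputGram x β β + 2 * s * t * inputGram x β β' + t ^ 2 * inputGram x β' β'
      = 1 / (n : ℝ) * ∑ j, (s * x j β + t * x j β') ^ 2 := by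
    simp only [inputGram, Finset.mul_sum, ← Finset.sum_add_distrib]
    exact Finset.sum_congr rfl fun j _ => by ring
  rw [e]
  positivity

theorem vanishDegenerate_inputGram {B : Type*} {n : ℕ} (x : Fin n → B → ℝ) :
    VanishDegenerate (inputGram x) x := by
  intro β hβ j
  have hn : (0 : ℝ) < n := by exact_mod_cast j.pos
  rcases mul_eq_zero.mp hβ with h | h
  · exact absurd h (by positivity)
  · exact mul_self_eq_zero.mp ((Finset.sum_eq_zero_iff_of_nonneg fun j _ => mul_self_nonneg _).mp h j
      (Finset.mem_univ j))

/-! ### Fully-connected networks -/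

section FCN

variable (n : ℕ → ℕ) (H : ℕ)

/-- The coordinate functional of the weight `ω^{l+1}_{ij}`. -/
def fcnCoordW (l : Fin (H + 1)) (i : Fin (n (l + 1))) (j : Fin (n l)) : FCNParam n H →L[ℝ] ℝ :=
  (ContinuousLinearMap.proj (R := ℝ) (φ := fun _ : Fin (n l) => ℝ) j).comp
    ((ContinuousLinearMap.proj (R := ℝ) (φ := fun _ : Fin (n (l + 1)) => Fin (n l) → ℝ) i).comp
      ((ContinuousLinearMap.proj (R := ℝ)
        (φ := fun l : Fin (H + 1) => Fin (n (l + 1)) → Fin (n l) → ℝ) l).comp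
        (ContinuousLinearMap.fst ℝ _ _)))

/-- The coordinate functional of the bias `β^{l+1}_i`. -/
def fcnCoordB (l : Fin (H + 1)) (i : Fin (n (l + 1))) : FCNParam n H →L[ℝ] ℝ :=
  (ContinuousLinearMap.proj (R := ℝ) (φ := fun _ : Fin (n (l + 1)) => ℝ) i).comp
    ((ContinuousLinearMap.proj (R := ℝ) (φ := fun l : Fin (H + 1) => Fin (n (l + 1)) → ℝ) l).comp
      (ContinuousLinearMap.snd ℝ _ _))

theorem fcnCoordW_apply (l : Fin (H + 1)) (i : Fin (n (l + 1))) (j : Fin (n l))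
    (θ : FCNParam n H) : fcnCoordW n H l i j θ = θ.1 l i j := rfl

theorem fcnCoordB_apply (l : Fin (H + 1)) (i : Fin (n (l + 1))) (θ : FCNParam n H) :
    fcnCoordB n H l i θ = θ.2 l i := rfl

/-- The inner product of gradients. -/
noncomputable def fcnPair :
    (FCNParam n H →L[ℝ] ℝ) →ₗ[ℝ] (FCNParam n H →L[ℝ] ℝ) →ₗ[ℝ] ℝ :=
  LinearMap.mk₂ ℝ (fun D D' => ∑ l, ∑ i, ∑ j, D (fcnDirW n H l i j) * D' (fcnDirW n H l i j)
      + ∑ l, ∑ i, D (fcnDirB n H l i) * D' (fcnDirB n H l i))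
    (fun f g h => by
      simp only [add_apply, add_mul, Finset.sum_add_distrib]; ring)
    (fun c f g => by
      simp only [smul_apply, smul_eq_mul, mul_assoc, ← Finset.mul_sum, mul_add])
    (fun f g h => by
      simp only [add_apply, mul_add, Finset.sum_add_distrib]; ring)
    (fun c f g => by
      simp only [smul_apply, smul_eq_mul, mul_left_comm _ c, ← Finset.mul_sum,
        mul_add])

theorem fcnPair_apply (D D' : FCNParam n H →L[ℝ] ℝ) :
    fcnPair n H D D' = ∑ l, ∑ i, ∑ j, D (fcnDirW n H l i j) * D' (fcnDirW n H l i j)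
      + ∑ l, ∑ i, D (fcnDirB n H l i) * D' (fcnDirB n H l i) := rfl

theorem fcnPair_comm (D D' : FCNParam n H →L[ℝ] ℝ) : fcnPair n H D D' = fcnPair n H D' D := by
  rw [fcnPair_apply, fcnPair_apply]
  exact congrArg₂ (· + ·) (Finset.sum_congr rfl fun l _ => Finset.sum_congr rfl fun i _ =>
    Finset.sum_congr rfl fun j _ => mul_comm _ _) (Finset.sum_congr rfl fun l _ =>
    Finset.sum_congr rfl fun i _ => mul_comm _ _)

/-- Coordinate functionals are dual to the coordinate directions, so pairing with one evaluates at
its direction; all orthogonality relations below follow by evaluation. -/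
theorem fcnPair_coordW (l : Fin (H + 1)) (i : Fin (n (l + 1))) (j : Fin (n l))
    (f : FCNParam n H →L[ℝ] ℝ) : fcnPair n H (fcnCoordW n H l i j) f = f (fcnDirW n H l i j) := by
  rw [fcnPair_apply, Finset.sum_eq_single l, Finset.sum_eq_single i, Finset.sum_eq_single j]
  · simp [fcnCoordW_apply, fcnDirW, fcnDirB]
  · intro j' _ h
    simp [fcnCoordW_apply, fcnDirW, h.symm]
  · simp
  · intro i' _ h
    simp [fcnCoordW_apply, fcnDirW, h.symm]
  · simp
  · intro l' _ h
    simp [fcnCoordW_apply, fcnDirW, h.symm]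
  · simp

theorem fcnPair_coordB (l : Fin (H + 1)) (i : Fin (n (l + 1)))
    (f : FCNParam n H →L[ℝ] ℝ) : fcnPair n H (fcnCoordB n H l i) f = f (fcnDirB n H l i) := by
  rw [fcnPair_apply, Finset.sum_eq_single (f := fun l' => ∑ i', fcnCoordB n H l i _ * _) l,
    Finset.sum_eq_single (f := fun i' => fcnCoordB n H l i _ * _) i]
  · simp [fcnCoordB_apply, fcnDirW, fcnDirB]
  · intro i' _ h
    simp [fcnCoordB_apply, fcnDirB, h.symm]
  · simp
  · intro l' _ h
    simp [fcnCoordB_apply, fcnDirB, h.symm]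
  · simp

theorem fcnPair_coordW_coordW (l : Fin (H + 1)) (i : Fin (n (l + 1))) (j : Fin (n l))
    (i' : Fin (n (l + 1))) (j' : Fin (n l)) :
    fcnPair n H (fcnCoordW n H l i j) (fcnCoordW n H l i' j')
      = if i = i' ∧ j = j' then 1 else 0 := by
  rw [fcnPair_coordW, fcnCoordW_apply, fcnDirW]
  dsimp only
  rw [Pi.single_eq_same]
  rcases eq_or_ne i i' with rfl | hi
  · simp [Pi.single_apply, eq_comm]
  · simp [hi, hi.symm]

theorem fcnPair_coordW_coordW_of_ne {l l' : Fin (H + 1)} (hl : l ≠ l') (i : Fin (n (l + 1)))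
    (j : Fin (n l)) (i' : Fin (n (l' + 1))) (j' : Fin (n l')) :
    fcnPair n H (fcnCoordW n H l i j) (fcnCoordW n H l' i' j') = 0 := by
  rw [fcnPair_coordW, fcnCoordW_apply, fcnDirW]
  dsimp only
  rw [Pi.single_eq_of_ne hl.symm]
  rfl

theorem fcnPair_coordW_coordB (l l' : Fin (H + 1)) (i : Fin (n (l + 1)))
    (j : Fin (n l)) (i' : Fin (n (l' + 1))) :
    fcnPair n H (fcnCoordW n H l i j) (fcnCoordB n H l' i') = 0 := by
  rw [fcnPair_coordW]
  rfl

theorem fcnPair_coordB_coordB (l : Fin (H + 1)) (i i' : Fin (n (l + 1))) :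
    fcnPair n H (fcnCoordB n H l i) (fcnCoordB n H l i') = if i = i' then 1 else 0 := by
  rw [fcnPair_coordB, fcnCoordB_apply, fcnDirB]
  dsimp only
  rw [Pi.single_eq_same, Pi.single_apply]
  simp only [eq_comm]

theorem fcnPair_coordB_coordB_of_ne {l l' : Fin (H + 1)} (hl : l ≠ l') (i : Fin (n (l + 1)))
    (i' : Fin (n (l' + 1))) :
    fcnPair n H (fcnCoordB n H l i) (fcnCoordB n H l' i') = 0 := by
  rw [fcnPair_coordB, fcnCoordB_apply, fcnDirB]
  dsimp only
  rw [Pi.single_eq_of_ne hl.symm]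
  rfl

instance fcnInit.instIsProbabilityMeasure : IsProbabilityMeasure (fcnInit n H) := by
  unfold fcnInit; infer_instance

/-- Replace the parameters of one layer. -/
def fcnResample (l : Fin (H + 1)) (p : FCNParam n H ×
    ((Unit → Fin (n (l + 1)) → Fin (n l) → ℝ) × (Fin (n (l + 1)) → ℝ))) : FCNParam n H :=
  (Function.update p.1.1 l (p.2.1 ()), Function.update p.1.2 l p.2.2)

theorem measurePreserving_fcnResample (l : Fin (H + 1)) :
    MeasurePreserving (fcnResample n H l)
      ((fcnInit n H).prod (layerInit Unit (n (l + 1)) (n l))) (fcnInit n H) := by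
  have h1 := measurePreserving_update_unit (fun l : Fin (H + 1) => orthInit (n (l + 1)) (n l)) l
  have h2 := measurePreserving_update (fun l : Fin (H + 1) =>
    Measure.pi fun _ : Fin (n (l + 1)) => gaussianReal 0 1) l
  have h4 := measurePreserving_prod_prod_comm
    (Measure.pi fun l : Fin (H + 1) => orthInit (n (l + 1)) (n l))
    (Measure.pi fun l : Fin (H + 1) => Measure.pi fun _ : Fin (n (l + 1)) => gaussianReal 0 1)
    (Measure.pi fun _ : Unit => orthInit (n (l + 1)) (n l))
    (Measure.pi fun _ : Fin (n (l + 1)) => gaussianReal 0 1)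
  exact (h1.prod h2).comp h4

/-- The coordinate functionals of the weights, indexed by natural numbers. -/
noncomputable def fcnWeight (l : ℕ) (i : Fin (n (l + 1))) (j : Fin (n l)) : FCNParam n H →L[ℝ] ℝ :=
  if h : l < H + 1 then fcnCoordW n H ⟨l, h⟩ i j else 0

/-- The coordinate functionals of the biases, indexed by natural numbers. -/
noncomputable def fcnBias (l : ℕ) (i : Fin (n (l + 1))) : FCNParam n H →L[ℝ] ℝ :=
  if h : l < H + 1 then fcnCoordB n H ⟨l, h⟩ i else 0

theorem fcnWeight_of_lt {l : ℕ} (h : l < H + 1) (i : Fin (n (l + 1))) (j : Fin (n l)) :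
    fcnWeight n H l i j = fcnCoordW n H ⟨l, h⟩ i j := dif_pos h

theorem fcnBias_of_lt {l : ℕ} (h : l < H + 1) (i : Fin (n (l + 1))) :
    fcnBias n H l i = fcnCoordB n H ⟨l, h⟩ i := dif_pos h

/-- Replace the parameters of one layer, indexed by natural numbers. -/
noncomputable def fcnResampleNat (l : ℕ) (p : FCNParam n H ×
    ((Unit → Fin (n (l + 1)) → Fin (n l) → ℝ) × (Fin (n (l + 1)) → ℝ))) : FCNParam n H :=
  if h : l < H + 1 then fcnResample n H ⟨l, h⟩ p else p.1

theorem fcnResampleNat_of_lt {l : ℕ} (h : l < H + 1) :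
    fcnResampleNat n H l = fcnResample n H ⟨l, h⟩ := funext fun _ => dif_pos h

/-- The hidden layers of a fully-connected network. -/
noncomputable def fcnLayered : LayeredParam Unit n H (FCNParam n H) (fcnInit n H) where
  weight l _ i j := fcnWeight n H l i j
  bias l i := fcnBias n H l i
  pair := fcnPair n H
  pair_comm := fcnPair_comm n H
  pair_weight l hl s i j s' i' j' := by
    rw [fcnWeight_of_lt n H (by omega), fcnWeight_of_lt n H (by omega),
      fcnPair_coordW_coordW n H ⟨l, by omega⟩ i j i' j']
    simp only [true_and]
  pair_bias l hl i i' := by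
    rw [fcnBias_of_lt n H (by omega), fcnBias_of_lt n H (by omega)]
    exact fcnPair_coordB_coordB n H ⟨l, by omega⟩ i i'
  pair_weight_bias l hl l' hl' s i j i' := by
    rw [fcnWeight_of_lt n H (by omega), fcnBias_of_lt n H (by omega)]
    exact fcnPair_coordW_coordB n H ⟨l, by omega⟩ ⟨l', by omega⟩ i j i'
  pair_weight_of_ne l hl l' hl' h s i j s' i' j' := by
    rw [fcnWeight_of_lt n H (by omega), fcnWeight_of_lt n H (by omega)]
    exact fcnPair_coordW_coordW_of_ne n H (l := ⟨l, by omega⟩) (l' := ⟨l', by omega⟩)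
      (fun e => h (congrArg Fin.val e)) i j i' j'
  pair_bias_of_ne l hl l' hl' h i i' := by
    rw [fcnBias_of_lt n H (by omega), fcnBias_of_lt n H (by omega)]
    exact fcnPair_coordB_coordB_of_ne n H (l := ⟨l, by omega⟩) (l' := ⟨l', by omega⟩)
      (fun e => h (congrArg Fin.val e)) i i'
  measurable_weight l s i j := (ContinuousLinearMap.continuous _).measurable
  measurable_bias l i := (ContinuousLinearMap.continuous _).measurable
  resample l := fcnResampleNat n H l
  measurePreserving_resample l hl := by
    rw [fcnResampleNat_of_lt n H (by omega)]
    exact measurePreserving_fcnResample n H ⟨l, by omega⟩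
  weight_resample l hl θ p s i j := by
    rw [fcnResampleNat_of_lt n H (by omega), fcnWeight_of_lt n H (by omega), fcnCoordW_apply]
    exact congrFun (congrFun (Function.update_self (⟨l, by omega⟩ : Fin (H + 1)) (p.1 ()) θ.1) i) j
  bias_resample l hl θ p i := by
    rw [fcnResampleNat_of_lt n H (by omega), fcnBias_of_lt n H (by omega), fcnCoordB_apply]
    exact congrFun (Function.update_self (⟨l, by omega⟩ : Fin (H + 1)) p.2 θ.2) i
  weight_resample_of_lt l hl l' hl' θ p s i j := by
    have h : (⟨l', by omega⟩ : Fin (H + 1)) ≠ ⟨l, by omega⟩ := fun e => hl'.ne (congrArg Fin.val e)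
    rw [fcnResampleNat_of_lt n H (by omega), fcnWeight_of_lt n H (by omega), fcnCoordW_apply,
      fcnCoordW_apply]
    exact congrFun (congrFun (Function.update_of_ne h (p.1 ()) θ.1) i) j
  bias_resample_of_lt l hl l' hl' θ p i := by
    have h : (⟨l', by omega⟩ : Fin (H + 1)) ≠ ⟨l, by omega⟩ := fun e => hl'.ne (congrArg Fin.val e)
    rw [fcnResampleNat_of_lt n H (by omega), fcnBias_of_lt n H (by omega), fcnCoordB_apply,
      fcnCoordB_apply]
    exact congrFun (Function.update_of_ne h p.2 θ.2) i

theorem fcnLayered_weight {l : ℕ} (h : l < H + 1) (s : Unit) (i : Fin (n (l + 1))) (j : Fin (n l)) :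
    (fcnLayered n H).weight l s i j = fcnCoordW n H ⟨l, h⟩ i j := dif_pos h

theorem fcnLayered_bias {l : ℕ} (h : l < H + 1) (i : Fin (n (l + 1))) :
    (fcnLayered n H).bias l i = fcnCoordB n H ⟨l, h⟩ i := dif_pos h

/-- The output layer of a fully-connected network. -/
noncomputable def fcnOutputParam (σ : ℝ) : OutputParam (fcnLayered n H) Unit σ (n (H + 1)) where
  weight _ i j := fcnCoordW n H (Fin.last H) i j
  bias i := fcnCoordB n H (Fin.last H) i
  pair_weight s i j s' i' j' := by
    simp only [true_and]
    exact fcnPair_coordW_coordW n H (Fin.last H) i j i' j'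
  pair_bias i i' := by
    have := fcnPair_coordB_coordB n H (Fin.last H) i i'
    rw [show (fcnLayered n H).pair = fcnPair n H from rfl, this]
    simp
  pair_weight_bias s i j i' := fcnPair_coordW_coordB n H (Fin.last H) (Fin.last H) i j i'
  pair_layer_weight l hl s i j := by
    have h : (⟨l, by omega⟩ : Fin (H + 1)) ≠ Fin.last H := fun e => hl.ne (congrArg Fin.val e)
    refine ⟨fun s' i' j' => ?_, fun i' => ?_⟩
    · rw [fcnLayered_weight n H (by omega)]
      exact fcnPair_coordW_coordW_of_ne n H h i' j' i j
    · rw [fcnLayered_bias n H (by omega), (fcnLayered n H).pair_comm]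
      exact fcnPair_coordW_coordB n H (Fin.last H) ⟨l, by omega⟩ i j i'
  pair_layer_bias l hl i := by
    have h : (⟨l, by omega⟩ : Fin (H + 1)) ≠ Fin.last H := fun e => hl.ne (congrArg Fin.val e)
    refine ⟨fun s' i' j' => ?_, fun i' => ?_⟩
    · rw [fcnLayered_weight n H (by omega)]
      exact fcnPair_coordW_coordB n H ⟨l, by omega⟩ (Fin.last H) i' j' i
    · rw [fcnLayered_bias n H (by omega)]
      exact fcnPair_coordB_coordB_of_ne n H h i' i
  measurable_weight s i j := (ContinuousLinearMap.continuous _).measurable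
  resample p := (Function.update p.1.1 (Fin.last H) (p.2 ()), p.1.2)
  measurePreserving_resample :=
    measurePreserving_update_unit_fst (fun l : Fin (H + 1) => orthInit (n (l + 1)) (n l))
      (Measure.pi fun l : Fin (H + 1) => Measure.pi fun _ : Fin (n (l + 1)) => gaussianReal 0 1)
      (Fin.last H)
  weight_resample θ p s i j := by
    rw [fcnCoordW_apply]
    exact congrFun (congrFun (Function.update_self (Fin.last H) (p ()) θ.1) i) j
  layer_weight_resample l hl θ p s i j := by
    have h : (⟨l, by omega⟩ : Fin (H + 1)) ≠ Fin.last H := fun e => hl.ne (congrArg Fin.val e)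
    rw [fcnLayered_weight n H (by omega), fcnCoordW_apply, fcnCoordW_apply]
    exact congrFun (congrFun (Function.update_of_ne h (p ()) θ.1) i) j
  layer_bias_resample l hl θ p i := by
    rw [fcnLayered_bias n H (by omega), fcnCoordB_apply, fcnCoordB_apply]

/-- The position `b` only labels which of the two inputs is propagated; a layer reads the position
it writes. -/
theorem fcnLayered_post (σw σb : ℝ) (φ : ℝ → ℝ) (x : Bool → Fin (n 0) → ℝ) (θ : FCNParam n H)
    {l : ℕ} (hl : l ≤ H) (i : Fin (n l)) (b : Bool) :
    (fcnLayered n H).post φ σw σb (fun b _ => b) (fun j b => x b j) θ l i b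
      = fcnPost σw σb φ n H θ (x b) l hl i := by
  induction l generalizing b with
  | zero => rfl
  | succ l ih =>
    change φ (layerPre σw σb _ _ _ ((fcnLayered n H).post φ σw σb _ _ θ l) i b) = _
    simp only [fcnPost, layerPre, fcnLayer, fcnLayered_weight n H (Nat.lt_succ_of_lt hl),
      fcnLayered_bias n H (Nat.lt_succ_of_lt hl),
      Finset.univ_unique, Finset.sum_singleton, ih (by omega)]
    rfl

end FCN

/-- Stage `l` of the tower records post-activations while `fcnSigma` records pre-activations, so the
linear map of the following layer shifts the index by one. -/
theorem limitSigma_towerLimit_fcn (σw σb : ℝ) (φ : ℝ → ℝ) {n₀ : ℕ} (x : Bool → Fin n₀ → ℝ) (l : ℕ)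
    (b b' : Bool) :
    limitSigma σw σb (fun b (_ : Unit) => b) (towerLimit φ σw σb (fun b (_ : Unit) => b)
      (inputGram fun j b => x b j) l).1 b b' = fcnSigma σw σb φ (l + 1) (x b) (x b') := by
  induction l generalizing b b' with
  | zero =>
    simp only [limitSigma, towerLimit, inputGram, fcnSigma, Finset.univ_unique, Finset.sum_const,
      Finset.card_singleton, one_smul]
    ring
  | succ l ih =>
    rw [fcnSigma, ← ih, ← ih, ← ih, limitSigma]
    simp [towerLimit, nextGamma]

theorem limitTheta_towerLimit_fcn (σw σb : ℝ) (φ : ℝ → ℝ) {n₀ : ℕ} (x : Bool → Fin n₀ → ℝ) (l : ℕ)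
    (b b' : Bool) :
    limitTheta σw σb (fun b (_ : Unit) => b) (towerLimit φ σw σb (fun b (_ : Unit) => b)
      (inputGram fun j b => x b j) l).1 (towerLimit φ σw σb (fun b (_ : Unit) => b)
      (inputGram fun j b => x b j) l).2 b b' = fcnTheta σw σb φ (l + 1) (x b) (x b') := by
  induction l generalizing b b' with
  | zero =>
    rw [limitTheta, limitSigma_towerLimit_fcn]
    simp [towerLimit, fcnTheta]
  | succ l ih =>
    rw [fcnTheta, ← ih, limitTheta, limitSigma_towerLimit_fcn, fcnSigmaDot]
    simp only [← limitSigma_towerLimit_fcn, show l + 2 - 1 = l + 1 from rfl]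
    simp [towerLimit, nextTangent, mul_assoc]

theorem exists_measure_fcnNTK_le {K : ℝ≥0} {φ : ℝ → ℝ} (hφ : LipschitzWith K φ) (σw σb : ℝ)
    {n₀ : ℕ} (nL H : ℕ) (x x' : Fin n₀ → ℝ) {ε : ℝ} (hε : 0 < ε) :
    ∃ N : ℕ, ∀ (n : ℕ → ℕ) (hn₀ : n 0 = n₀), n (H + 1) = nL →
      (∀ l, 1 ≤ l → l ≤ H → N ≤ n l) →
      fcnInit n H {θ | ¬ ∀ i j, |fcnNTK σw σb φ n H (fun j => x (Fin.cast hn₀ j))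
        (fun j => x' (Fin.cast hn₀ j)) θ i j
          - if i = j then fcnTheta σw σb φ (H + 1) x x' else 0| < ε} ≤ ENNReal.ofReal ε := by
  -- Both inputs form one input with two positions; the kernel of the pair is the entry at `false`,
  -- `true`.
  set y : Bool → Fin n₀ → ℝ := fun b => cond b x' x with hy
  obtain ⟨N, hN⟩ := exists_measure_tangentKernel_le hφ σw σb (fun b (_ : Unit) => b) σw σb
    (fun b (_ : Unit) => b) (limitAdmissible_inputGram fun j b => y b j) H nL hε
  refine ⟨N, fun n hn₀ hnL hn => ?_⟩
  subst hn₀ hnL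
  have := hN (fcnLayered n H) (fcnOutputParam n H σb) (x := fun j b => y b j) (fun _ _ => rfl)
    (vanishDegenerate_inputGram _) hn
    (f := fun t i b => fcnOutput σw σb φ n H (y b) t i) (fun t i b => by
      rw [layerPre, fcnOutput, fcnLayer]
      simp only [Finset.univ_unique, Finset.sum_singleton,
        fcnLayered_post n H σw σb φ y t le_rfl]
      rfl) false true
  rw [limitTheta_towerLimit_fcn] at this
  exact this

/-! ### Convolutional networks -/

theorem measurePreserving_update_middle {ι γ : Type*} [Fintype ι] [DecidableEq ι] {β : ι → Type*}
    {δ : ι → Type*} [MeasurableSpace γ] [∀ i, MeasurableSpace (β i)]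
    [∀ i, MeasurableSpace (δ i)] (μ : (i : ι) → Measure (β i)) (ν : (i : ι) → Measure (δ i))
    [∀ i, IsProbabilityMeasure (μ i)] [∀ i, IsProbabilityMeasure (ν i)] (τ : Measure γ) [SFinite τ]
    (l : ι) :
    MeasurePreserving (fun p : (((i : ι) → β i) × ((i : ι) → δ i) × γ) × (β l × δ l) =>
        (Function.update p.1.1 l p.2.1, Function.update p.1.2.1 l p.2.2, p.1.2.2))
      (((Measure.pi μ).prod ((Measure.pi ν).prod τ)).prod ((μ l).prod (ν l)))
      ((Measure.pi μ).prod ((Measure.pi ν).prod τ)) :=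
  ((measurePreserving_update μ l).prod (((measurePreserving_update ν l).prod
    (MeasurePreserving.id τ)).comp (measurePreserving_prod_right_comm _ _ _))).comp
    (measurePreserving_prod_prod_comm _ _ _ _)

theorem measurePreserving_replace_last {α β γ : Type*} [MeasurableSpace α] [MeasurableSpace β]
    [MeasurableSpace γ] (μ : Measure α) (ν : Measure β) (τ : Measure γ) [SFinite μ] [SFinite ν]
    [IsProbabilityMeasure τ] :
    MeasurePreserving (fun p : (α × β × γ) × γ => (p.1.1, p.1.2.1, p.2))
      ((μ.prod (ν.prod τ)).prod τ) (μ.prod (ν.prod τ)) :=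
  ((MeasurePreserving.id μ).prod ((measurePreserving_fst (μ := ν) (ν := τ)).prod
    (MeasurePreserving.id τ))).comp (measurePreserving_prodAssoc μ (ν.prod τ) τ)

section CNN

variable (n : ℕ → ℕ) (H m k : ℕ)

/-- The coordinate functional of the weight `ω^{l+1}_{s,ij}`. -/
def cnnCoordW (l : Fin H) (s : FilterPos k) (i : Fin (n (l + 1))) (j : Fin (n l)) :
    CNNParam n H m k →L[ℝ] ℝ :=
  (ContinuousLinearMap.proj (R := ℝ) (φ := fun _ : Fin (n l) => ℝ) j).comp
    ((ContinuousLinearMap.proj (R := ℝ) (φ := fun _ : Fin (n (l + 1)) => Fin (n l) → ℝ) i).comp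
      ((ContinuousLinearMap.proj (R := ℝ)
        (φ := fun _ : FilterPos k => Fin (n (l + 1)) → Fin (n l) → ℝ) s).comp
        ((ContinuousLinearMap.proj (R := ℝ)
          (φ := fun l : Fin H => FilterPos k → Fin (n (l + 1)) → Fin (n l) → ℝ) l).comp
          (ContinuousLinearMap.fst ℝ _ _))))

/-- The coordinate functional of the bias `β^{l+1}_i`. -/
def cnnCoordB (l : Fin H) (i : Fin (n (l + 1))) : CNNParam n H m k →L[ℝ] ℝ :=
  (ContinuousLinearMap.proj (R := ℝ) (φ := fun _ : Fin (n (l + 1)) => ℝ) i).comp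
    ((ContinuousLinearMap.proj (R := ℝ) (φ := fun l : Fin H => Fin (n (l + 1)) → ℝ) l).comp
      ((ContinuousLinearMap.fst ℝ _ _).comp (ContinuousLinearMap.snd ℝ _ _)))

/-- The coordinate functional of the output weight `ω^{H+1}_{α,ij}`. -/
def cnnCoordO (α : ZMod m) (i : Fin (n (H + 1))) (j : Fin (n H)) : CNNParam n H m k →L[ℝ] ℝ :=
  (ContinuousLinearMap.proj (R := ℝ) (φ := fun _ : Fin (n H) => ℝ) j).comp
    ((ContinuousLinearMap.proj (R := ℝ) (φ := fun _ : Fin (n (H + 1)) => Fin (n H) → ℝ) i).comp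
      ((ContinuousLinearMap.proj (R := ℝ)
        (φ := fun _ : ZMod m => Fin (n (H + 1)) → Fin (n H) → ℝ) α).comp
        ((ContinuousLinearMap.snd ℝ _ _).comp (ContinuousLinearMap.snd ℝ _ _))))

theorem cnnCoordW_apply (l : Fin H) (s : FilterPos k) (i : Fin (n (l + 1))) (j : Fin (n l))
    (θ : CNNParam n H m k) : cnnCoordW n H m k l s i j θ = θ.1 l s i j := rfl

theorem cnnCoordB_apply (l : Fin H) (i : Fin (n (l + 1))) (θ : CNNParam n H m k) :
    cnnCoordB n H m k l i θ = θ.2.1 l i := rfl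

theorem cnnCoordO_apply (α : ZMod m) (i : Fin (n (H + 1))) (j : Fin (n H))
    (θ : CNNParam n H m k) : cnnCoordO n H m k α i j θ = θ.2.2 α i j := rfl

/-- The coordinate functionals of the weights, indexed by natural numbers. -/
noncomputable def cnnWeight (l : ℕ) (s : FilterPos k) (i : Fin (n (l + 1))) (j : Fin (n l)) :
    CNNParam n H m k →L[ℝ] ℝ :=
  if h : l < H then cnnCoordW n H m k ⟨l, h⟩ s i j else 0

/-- The coordinate functionals of the biases, indexed by natural numbers. -/
noncomputable def cnnBias (l : ℕ) (i : Fin (n (l + 1))) : CNNParam n H m k →L[ℝ] ℝ :=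
  if h : l < H then cnnCoordB n H m k ⟨l, h⟩ i else 0

theorem cnnWeight_of_lt {l : ℕ} (h : l < H) (s : FilterPos k) (i : Fin (n (l + 1)))
    (j : Fin (n l)) : cnnWeight n H m k l s i j = cnnCoordW n H m k ⟨l, h⟩ s i j := dif_pos h

theorem cnnBias_of_lt {l : ℕ} (h : l < H) (i : Fin (n (l + 1))) :
    cnnBias n H m k l i = cnnCoordB n H m k ⟨l, h⟩ i := dif_pos h

/-- Replace the parameters of one convolutional layer. -/
noncomputable def cnnResample (l : ℕ) (p : CNNParam n H m k ×
    ((FilterPos k → Fin (n (l + 1)) → Fin (n l) → ℝ) × (Fin (n (l + 1)) → ℝ))) : CNNParam n H m k :=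
  if h : l < H then (Function.update p.1.1 ⟨l, h⟩ p.2.1, Function.update p.1.2.1 ⟨l, h⟩ p.2.2, p.1.2.2)
  else p.1

theorem cnnResample_of_lt {l : ℕ} (h : l < H) : cnnResample n H m k l = fun p =>
    (Function.update p.1.1 ⟨l, h⟩ p.2.1, Function.update p.1.2.1 ⟨l, h⟩ p.2.2, p.1.2.2) :=
  funext fun _ => dif_pos h

theorem measurable_cnnWeight (l : ℕ) (s : FilterPos k) (i : Fin (n (l + 1))) (j : Fin (n l)) :
    Measurable (cnnWeight n H m k l s i j) := by
  by_cases h : l < H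
  · rw [cnnWeight_of_lt n H m k h]
    exact (by fun_prop : Measurable fun θ : CNNParam n H m k => θ.1 ⟨l, h⟩ s i j)
  · rw [cnnWeight, dif_neg h]
    exact measurable_const

theorem measurable_cnnBias (l : ℕ) (i : Fin (n (l + 1))) : Measurable (cnnBias n H m k l i) := by
  by_cases h : l < H
  · rw [cnnBias_of_lt n H m k h]
    exact (by fun_prop : Measurable fun θ : CNNParam n H m k => θ.2.1 ⟨l, h⟩ i)
  · rw [cnnBias, dif_neg h]
    exact measurable_const

variable [NeZero m]

/-- The inner product of gradients. -/
noncomputable def cnnPair :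
    (CNNParam n H m k →L[ℝ] ℝ) →ₗ[ℝ] (CNNParam n H m k →L[ℝ] ℝ) →ₗ[ℝ] ℝ :=
  LinearMap.mk₂ ℝ (fun D D' =>
      ∑ l, ∑ s, ∑ p, ∑ j, D (cnnDirW n H m k l s p j) * D' (cnnDirW n H m k l s p j)
      + ∑ l, ∑ p, D (cnnDirB n H m k l p) * D' (cnnDirB n H m k l p)
      + ∑ α, ∑ p, ∑ j, D (cnnDirO n H m k α p j) * D' (cnnDirO n H m k α p j))
    (fun f g h => by
      simp only [add_apply, add_mul, Finset.sum_add_distrib]; ring)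
    (fun c f g => by
      simp only [smul_apply, smul_eq_mul, mul_assoc, ← Finset.mul_sum, mul_add])
    (fun f g h => by
      simp only [add_apply, mul_add, Finset.sum_add_distrib]; ring)
    (fun c f g => by
      simp only [smul_apply, smul_eq_mul, mul_left_comm _ c, ← Finset.mul_sum, mul_add])

theorem cnnPair_apply (D D' : CNNParam n H m k →L[ℝ] ℝ) :
    cnnPair n H m k D D' =
      ∑ l, ∑ s, ∑ p, ∑ j, D (cnnDirW n H m k l s p j) * D' (cnnDirW n H m k l s p j)
      + ∑ l, ∑ p, D (cnnDirB n H m k l p) * D' (cnnDirB n H m k l p)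
      + ∑ α, ∑ p, ∑ j, D (cnnDirO n H m k α p j) * D' (cnnDirO n H m k α p j) := rfl

theorem cnnPair_comm (D D' : CNNParam n H m k →L[ℝ] ℝ) :
    cnnPair n H m k D D' = cnnPair n H m k D' D := by
  rw [cnnPair_apply, cnnPair_apply]
  exact congrArg₂ (· + ·) (congrArg₂ (· + ·) (Finset.sum_congr rfl fun l _ =>
    Finset.sum_congr rfl fun s _ => Finset.sum_congr rfl fun i _ => Finset.sum_congr rfl fun j _ =>
    mul_comm _ _) (Finset.sum_congr rfl fun l _ => Finset.sum_congr rfl fun i _ => mul_comm _ _))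
    (Finset.sum_congr rfl fun α _ => Finset.sum_congr rfl fun i _ => Finset.sum_congr rfl fun j _ =>
    mul_comm _ _)

theorem cnnPair_coordW (l : Fin H) (s : FilterPos k) (i : Fin (n (l + 1))) (j : Fin (n l))
    (f : CNNParam n H m k →L[ℝ] ℝ) :
    cnnPair n H m k (cnnCoordW n H m k l s i j) f = f (cnnDirW n H m k l s i j) := by
  rw [cnnPair_apply, Finset.sum_eq_single l, Finset.sum_eq_single s, Finset.sum_eq_single i,
    Finset.sum_eq_single j]
  · simp [cnnCoordW_apply, cnnDirW, cnnDirB, cnnDirO]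
  · intro j' _ h
    simp [cnnCoordW_apply, cnnDirW, h.symm]
  · simp
  · intro i' _ h
    simp [cnnCoordW_apply, cnnDirW, h.symm]
  · simp
  · intro s' _ h
    simp [cnnCoordW_apply, cnnDirW, h.symm]
  · simp
  · intro l' _ h
    simp [cnnCoordW_apply, cnnDirW, h.symm]
  · simp

theorem cnnPair_coordB (l : Fin H) (i : Fin (n (l + 1)))
    (f : CNNParam n H m k →L[ℝ] ℝ) :
    cnnPair n H m k (cnnCoordB n H m k l i) f = f (cnnDirB n H m k l i) := by
  rw [cnnPair_apply, Finset.sum_eq_single (f := fun l' => ∑ i', cnnCoordB n H m k l i _ * _) l,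
    Finset.sum_eq_single (f := fun i' => cnnCoordB n H m k l i _ * _) i]
  · simp [cnnCoordB_apply, cnnDirW, cnnDirB, cnnDirO]
  · intro i' _ h
    simp [cnnCoordB_apply, cnnDirB, h.symm]
  · simp
  · intro l' _ h
    simp [cnnCoordB_apply, cnnDirB, h.symm]
  · simp

theorem cnnPair_coordO (α : ZMod m) (i : Fin (n (H + 1))) (j : Fin (n H))
    (f : CNNParam n H m k →L[ℝ] ℝ) :
    cnnPair n H m k (cnnCoordO n H m k α i j) f = f (cnnDirO n H m k α i j) := by
  have hz : ∑ l, ∑ s, ∑ p, ∑ q, cnnCoordO n H m k α i j (cnnDirW n H m k l s p q)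
      * f (cnnDirW n H m k l s p q) + ∑ l, ∑ p, cnnCoordO n H m k α i j (cnnDirB n H m k l p)
      * f (cnnDirB n H m k l p) = 0 := by
    simp [cnnCoordO_apply, cnnDirW, cnnDirB]
  rw [cnnPair_apply, hz, zero_add, Finset.sum_eq_single α, Finset.sum_eq_single i,
    Finset.sum_eq_single j]
  · simp [cnnCoordO_apply, cnnDirO]
  · intro j' _ h
    simp [cnnCoordO_apply, cnnDirO, h.symm]
  · simp
  · intro i' _ h
    simp [cnnCoordO_apply, cnnDirO, h.symm]
  · simp
  · intro l' _ h
    simp [cnnCoordO_apply, cnnDirO, h.symm]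
  · simp

theorem cnnPair_coordW_coordW (l : Fin H) (s : FilterPos k) (i : Fin (n (l + 1))) (j : Fin (n l))
    (s' : FilterPos k) (i' : Fin (n (l + 1))) (j' : Fin (n l)) :
    cnnPair n H m k (cnnCoordW n H m k l s i j) (cnnCoordW n H m k l s' i' j')
      = if s = s' ∧ i = i' ∧ j = j' then 1 else 0 := by
  rw [cnnPair_coordW, cnnCoordW_apply, cnnDirW]
  dsimp only
  rw [Pi.single_eq_same]
  rcases eq_or_ne s s' with rfl | hs
  · rcases eq_or_ne i i' with rfl | hi
    · simp [Pi.single_apply, eq_comm]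
    · simp [hi, hi.symm]
  · simp [hs, hs.symm]

theorem cnnPair_coordW_coordW_of_ne {l l' : Fin H} (hl : l ≠ l') (s : FilterPos k)
    (i : Fin (n (l + 1))) (j : Fin (n l)) (s' : FilterPos k) (i' : Fin (n (l' + 1)))
    (j' : Fin (n l')) :
    cnnPair n H m k (cnnCoordW n H m k l s i j) (cnnCoordW n H m k l' s' i' j') = 0 := by
  rw [cnnPair_coordW, cnnCoordW_apply, cnnDirW]
  dsimp only
  rw [Pi.single_eq_of_ne hl.symm]
  rfl

theorem cnnPair_coordW_coordB (l l' : Fin H) (s : FilterPos k) (i : Fin (n (l + 1)))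
    (j : Fin (n l)) (i' : Fin (n (l' + 1))) :
    cnnPair n H m k (cnnCoordW n H m k l s i j) (cnnCoordB n H m k l' i') = 0 := by
  rw [cnnPair_coordW]
  rfl

theorem cnnPair_coordW_coordO (l : Fin H) (s : FilterPos k) (i : Fin (n (l + 1)))
    (j : Fin (n l)) (α : ZMod m) (i' : Fin (n (H + 1))) (j' : Fin (n H)) :
    cnnPair n H m k (cnnCoordW n H m k l s i j) (cnnCoordO n H m k α i' j') = 0 := by
  rw [cnnPair_coordW]
  rfl

theorem cnnPair_coordB_coordO (l : Fin H) (i : Fin (n (l + 1))) (α : ZMod m)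
    (i' : Fin (n (H + 1))) (j' : Fin (n H)) :
    cnnPair n H m k (cnnCoordB n H m k l i) (cnnCoordO n H m k α i' j') = 0 := by
  rw [cnnPair_coordB]
  rfl

theorem cnnPair_coordB_coordB (l : Fin H) (i i' : Fin (n (l + 1))) :
    cnnPair n H m k (cnnCoordB n H m k l i) (cnnCoordB n H m k l i') = if i = i' then 1 else 0 := by
  rw [cnnPair_coordB, cnnCoordB_apply, cnnDirB]
  dsimp only
  rw [Pi.single_eq_same, Pi.single_apply]
  simp only [eq_comm]

theorem cnnPair_coordB_coordB_of_ne {l l' : Fin H} (hl : l ≠ l') (i : Fin (n (l + 1)))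
    (i' : Fin (n (l' + 1))) :
    cnnPair n H m k (cnnCoordB n H m k l i) (cnnCoordB n H m k l' i') = 0 := by
  rw [cnnPair_coordB, cnnCoordB_apply, cnnDirB]
  dsimp only
  rw [Pi.single_eq_of_ne hl.symm]
  rfl

theorem cnnPair_coordO_coordO (α : ZMod m) (i : Fin (n (H + 1))) (j : Fin (n H))
    (α' : ZMod m) (i' : Fin (n (H + 1))) (j' : Fin (n H)) :
    cnnPair n H m k (cnnCoordO n H m k α i j) (cnnCoordO n H m k α' i' j')
      = if α = α' ∧ i = i' ∧ j = j' then 1 else 0 := by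
  rw [cnnPair_coordO, cnnCoordO_apply, cnnDirO]
  dsimp only
  rcases eq_or_ne α α' with rfl | hs
  · rcases eq_or_ne i i' with rfl | hi
    · simp [Pi.single_apply, eq_comm]
    · simp [hi, hi.symm]
  · simp [hs, hs.symm]

instance cnnInit.instIsProbabilityMeasure : IsProbabilityMeasure (cnnInit n H m k) := by
  unfold cnnInit; infer_instance

theorem measurePreserving_cnnResample {l : ℕ} (h : l < H) :
    MeasurePreserving (cnnResample n H m k l)
      ((cnnInit n H m k).prod (layerInit (FilterPos k) (n (l + 1)) (n l))) (cnnInit n H m k) := by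
  rw [cnnResample_of_lt n H m k h]
  exact measurePreserving_update_middle
    (fun l : Fin H => Measure.pi fun _ : FilterPos k => orthInit (n (l + 1)) (n l))
    (fun l : Fin H => Measure.pi fun _ : Fin (n (l + 1)) => gaussianReal 0 1)
    (Measure.pi fun _ : ZMod m => orthInit (n (H + 1)) (n H)) ⟨l, h⟩

/-- The convolutional layers of a convolutional network. -/
noncomputable def cnnLayered :
    LayeredParam (FilterPos k) n H (CNNParam n H m k) (cnnInit n H m k) where
  weight := cnnWeight n H m k
  bias := cnnBias n H m k
  pair := cnnPair n H m k
  pair_comm := cnnPair_comm n H m k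
  pair_weight l hl s i j s' i' j' := by
    rw [cnnWeight_of_lt n H m k hl, cnnWeight_of_lt n H m k hl]
    exact cnnPair_coordW_coordW n H m k ⟨l, hl⟩ s i j s' i' j'
  pair_bias l hl i i' := by
    rw [cnnBias_of_lt n H m k hl, cnnBias_of_lt n H m k hl]
    exact cnnPair_coordB_coordB n H m k ⟨l, hl⟩ i i'
  pair_weight_bias l hl l' hl' s i j i' := by
    rw [cnnWeight_of_lt n H m k hl, cnnBias_of_lt n H m k hl']
    exact cnnPair_coordW_coordB n H m k ⟨l, hl⟩ ⟨l', hl'⟩ s i j i'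
  pair_weight_of_ne l hl l' hl' h s i j s' i' j' := by
    rw [cnnWeight_of_lt n H m k hl, cnnWeight_of_lt n H m k hl']
    exact cnnPair_coordW_coordW_of_ne n H m k (l := ⟨l, hl⟩) (l' := ⟨l', hl'⟩)
      (fun e => h (congrArg Fin.val e)) s i j s' i' j'
  pair_bias_of_ne l hl l' hl' h i i' := by
    rw [cnnBias_of_lt n H m k hl, cnnBias_of_lt n H m k hl']
    exact cnnPair_coordB_coordB_of_ne n H m k (l := ⟨l, hl⟩) (l' := ⟨l', hl'⟩)
      (fun e => h (congrArg Fin.val e)) i i'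
  measurable_weight := measurable_cnnWeight n H m k
  measurable_bias := measurable_cnnBias n H m k
  resample := cnnResample n H m k
  measurePreserving_resample l hl := measurePreserving_cnnResample n H m k hl
  weight_resample l hl θ p s i j := by
    rw [cnnResample_of_lt n H m k hl, cnnWeight_of_lt n H m k hl, cnnCoordW_apply]
    exact congrFun (congrFun (congrFun
      (Function.update_self (⟨l, hl⟩ : Fin H) p.1 θ.1) s) i) j
  bias_resample l hl θ p i := by
    rw [cnnResample_of_lt n H m k hl, cnnBias_of_lt n H m k hl, cnnCoordB_apply]
    exact congrFun (Function.update_self (⟨l, hl⟩ : Fin H) p.2 θ.2.1) i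
  weight_resample_of_lt l hl l' hl' θ p s i j := by
    have h : (⟨l', hl'.trans hl⟩ : Fin H) ≠ ⟨l, hl⟩ := fun e => hl'.ne (congrArg Fin.val e)
    rw [cnnResample_of_lt n H m k hl, cnnWeight_of_lt n H m k (hl'.trans hl), cnnCoordW_apply,
      cnnCoordW_apply]
    exact congrFun (congrFun (congrFun (Function.update_of_ne h p.1 θ.1) s) i) j
  bias_resample_of_lt l hl l' hl' θ p i := by
    have h : (⟨l', hl'.trans hl⟩ : Fin H) ≠ ⟨l, hl⟩ := fun e => hl'.ne (congrArg Fin.val e)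
    rw [cnnResample_of_lt n H m k hl, cnnBias_of_lt n H m k (hl'.trans hl), cnnCoordB_apply,
      cnnCoordB_apply]
    exact congrFun (Function.update_of_ne h p.2 θ.2.1) i

theorem cnnLayered_weight {l : ℕ} (h : l < H) (s : FilterPos k) (i : Fin (n (l + 1)))
    (j : Fin (n l)) :
    (cnnLayered n H m k).weight l s i j = cnnCoordW n H m k ⟨l, h⟩ s i j := dif_pos h

theorem cnnLayered_bias {l : ℕ} (h : l < H) (i : Fin (n (l + 1))) :
    (cnnLayered n H m k).bias l i = cnnCoordB n H m k ⟨l, h⟩ i := dif_pos h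

/-- The output layer of a convolutional network. -/
noncomputable def cnnOutputParam : OutputParam (cnnLayered n H m k) (ZMod m) 0 (n (H + 1)) where
  weight α i j := cnnCoordO n H m k α i j
  -- The output layer has no biases: with `σ = 0` the zero functional meets the requirement on bias
  -- pairings.
  bias _ := 0
  pair_weight s i j s' i' j' := cnnPair_coordO_coordO n H m k s i j s' i' j'
  pair_bias i i' := by simp
  pair_weight_bias s i j i' := by simp
  pair_layer_weight l hl s i j := by
    refine ⟨fun s' i' j' => ?_, fun i' => ?_⟩
    · rw [cnnLayered_weight n H m k hl]
      exact cnnPair_coordW_coordO n H m k ⟨l, hl⟩ s' i' j' s i j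
    · rw [cnnLayered_bias n H m k hl]
      exact cnnPair_coordB_coordO n H m k ⟨l, hl⟩ i' s i j
  pair_layer_bias l hl i := by simp
  measurable_weight s i j :=
    (by fun_prop : Measurable fun θ : CNNParam n H m k => θ.2.2 s i j)
  resample p := (p.1.1, p.1.2.1, p.2)
  measurePreserving_resample := measurePreserving_replace_last _ _ _
  weight_resample θ p s i j := rfl
  layer_weight_resample l hl θ p s i j := by
    rw [cnnLayered_weight n H m k hl, cnnCoordW_apply, cnnCoordW_apply]
  layer_bias_resample l hl θ p i := by
    rw [cnnLayered_bias n H m k hl, cnnCoordB_apply, cnnCoordB_apply]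

/-- The positions which a convolutional filter reads. -/
def cnnShift (m k : ℕ) (β : Bool × ZMod m) (s : FilterPos k) : Bool × ZMod m :=
  (β.1, β.2 + ((s : ℤ) : ZMod m))

/-- The filter normalisation is absorbed into the weight scale `σw / √(2 k + 1)`, so that only the
channel number remains under the root of the abstract layer. -/
theorem cnnLayered_post (σw σb : ℝ) (φ : ℝ → ℝ) (x : Bool → Fin (n 0) → ZMod m → ℝ)
    (θ : CNNParam n H m k) {l : ℕ} (hl : l ≤ H) (i : Fin (n l)) (β : Bool × ZMod m) :
    (cnnLayered n H m k).post φ (σw / √(2 * k + 1 : ℝ)) σb (cnnShift m k) (fun j β => x β.1 j β.2) θ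
      l i β = cnnPost σw σb φ n H m k θ (x β.1) l hl i β.2 := by
  induction l generalizing β with
  | zero => rfl
  | succ l ih =>
    change φ (layerPre (σw / √(2 * k + 1 : ℝ)) σb _ _ _
      ((cnnLayered n H m k).post φ (σw / √(2 * k + 1 : ℝ)) σb _ _ θ l) i β) = _
    have hκ : σw / √((2 * k + 1) * n l : ℝ) = σw / √(2 * k + 1 : ℝ) / √(n l : ℝ) := by
      rw [Real.sqrt_mul (by positivity), div_div]
    simp only [cnnPost, layerPre, cnnLayer, cnnLayered_weight n H m k hl,
      cnnLayered_bias n H m k hl, ih (by omega), hκ]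
    rfl

end CNN

section CNNLimit

variable (σw σb : ℝ) (φ : ℝ → ℝ) {n₀ m : ℕ} (k : ℕ) (x : Bool → Fin n₀ → ZMod m → ℝ)

/-- The limiting covariance and tangent kernel of the convolutional layers. -/
noncomputable def cnnLimit (l : ℕ) :
    (Bool × ZMod m → Bool × ZMod m → ℝ) × (Bool × ZMod m → Bool × ZMod m → ℝ) :=
  towerLimit φ (σw / √(2 * k + 1 : ℝ)) σb (cnnShift m k)
    (inputGram fun j (β : Bool × ZMod m) => x β.1 j β.2) l

theorem div_sqrt_filter_sq : (σw / √(2 * k + 1 : ℝ)) ^ 2 = σw ^ 2 / (2 * k + 1) := by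
  rw [div_pow, Real.sq_sqrt (by positivity)]

theorem limitSigma_cnnLimit (l : ℕ) (β β' : Bool × ZMod m) :
    limitSigma (σw / √(2 * k + 1 : ℝ)) σb (cnnShift m k) (cnnLimit σw σb φ k x l).1 β β'
      = cnnSigma σw σb φ k (l + 1) (x β.1) (x β'.1) β.2 β'.2 := by
  induction l generalizing β β' with
  | zero =>
    rw [limitSigma, div_sqrt_filter_sq, cnnSigma]
    simp only [cnnLimit, towerLimit, inputGram, cnnShift, ← Finset.mul_sum, ← mul_assoc]
    congr 2
    rw [div_mul_div_comm, mul_one, mul_comm (n₀ : ℝ)]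
  | succ l ih =>
    have e : ∀ γ γ' : Bool × ZMod m, (cnnLimit σw σb φ k x (l + 1)).1 γ γ'
        = gaussProd φ (cnnSigma σw σb φ k (l + 1) (x γ.1) (x γ.1) γ.2 γ.2)
          (cnnSigma σw σb φ k (l + 1) (x γ.1) (x γ'.1) γ.2 γ'.2)
          (cnnSigma σw σb φ k (l + 1) (x γ'.1) (x γ'.1) γ'.2 γ'.2) := fun γ γ' => by
      rw [← ih, ← ih, ← ih]; rfl
    rw [limitSigma, div_sqrt_filter_sq, cnnSigma]
    simp only [e, cnnShift]

theorem cnnLimit_succ_fst (l : ℕ) (β β' : Bool × ZMod m) :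
    (cnnLimit σw σb φ k x (l + 1)).1 β β'
      = cnnExpect φ σw σb φ k (l + 1) (x β.1) (x β'.1) β.2 β'.2 := by
  rw [cnnExpect, ← limitSigma_cnnLimit, ← limitSigma_cnnLimit, ← limitSigma_cnnLimit]
  rfl

theorem limitTheta_cnnLimit (l : ℕ) (β β' : Bool × ZMod m) :
    limitTheta (σw / √(2 * k + 1 : ℝ)) σb (cnnShift m k) (cnnLimit σw σb φ k x l).1
      (cnnLimit σw σb φ k x l).2 β β'
      = cnnTheta σw σb φ k (l + 1) (x β.1) (x β'.1) β.2 β'.2 := by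
  induction l generalizing β β' with
  | zero =>
    rw [limitTheta, limitSigma_cnnLimit]
    simp [cnnLimit, towerLimit, cnnTheta]
  | succ l ih =>
    have e : ∀ γ γ' : Bool × ZMod m, (cnnLimit σw σb φ k x (l + 1)).2 γ γ'
        = cnnSigmaDot σw σb φ k (l + 2) (x γ.1) (x γ'.1) γ.2 γ'.2
          * cnnTheta σw σb φ k (l + 1) (x γ.1) (x γ'.1) γ.2 γ'.2 := fun γ γ' => by
      rw [← ih, cnnSigmaDot, show l + 2 - 1 = l + 1 from rfl, cnnExpect, ← limitSigma_cnnLimit,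
        ← limitSigma_cnnLimit, ← limitSigma_cnnLimit]
      rfl
    rw [limitTheta, limitSigma_cnnLimit, div_sqrt_filter_sq, cnnTheta]
    simp only [e, cnnShift]

theorem cnnLimit_succ_snd (l : ℕ) (β β' : Bool × ZMod m) :
    (cnnLimit σw σb φ k x (l + 1)).2 β β'
      = cnnSigmaDot σw σb φ k (l + 2) (x β.1) (x β'.1) β.2 β'.2
        * cnnTheta σw σb φ k (l + 1) (x β.1) (x β'.1) β.2 β'.2 := by
  rw [← limitTheta_cnnLimit, cnnSigmaDot, show l + 2 - 1 = l + 1 from rfl, cnnExpect,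
    ← limitSigma_cnnLimit, ← limitSigma_cnnLimit, ← limitSigma_cnnLimit]
  rfl

/-- The output layer is an abstract layer whose offsets are all the positions of one input, which
produces the sum over `α`. At `H = 0` the tower starts from the input Gram matrix rather than from a
Gaussian expectation, hence `1 ≤ H`. -/
theorem limitTheta_output_cnnLimit [NeZero m] (σo : ℝ) {H : ℕ} (hH : 1 ≤ H) (b b' : Bool) :
    limitTheta σo 0 (fun (b : Bool) (α : ZMod m) => (b, α)) (cnnLimit σw σb φ k x H).1
      (cnnLimit σw σb φ k x H).2 b b' = cnnThetaOut σw σb σo φ k H (x b) (x b') := by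
  obtain ⟨l, rfl⟩ : ∃ l, H = l + 1 := ⟨H - 1, by omega⟩
  rw [limitTheta, limitSigma, cnnThetaOut]
  simp only [cnnLimit_succ_fst, cnnLimit_succ_snd, Finset.sum_add_distrib]
  ring

end CNNLimit

theorem exists_measure_cnnNTK_le {K : ℝ≥0} {φ : ℝ → ℝ} (hφ : LipschitzWith K φ) (σw σb σo : ℝ)
    {n₀ : ℕ} (nL : ℕ) {H : ℕ} (hH : 1 ≤ H) (m k : ℕ) [NeZero m] (x x' : Fin n₀ → ZMod m → ℝ)
    {ε : ℝ} (hε : 0 < ε) :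
    ∃ N : ℕ, ∀ (n : ℕ → ℕ) (hn₀ : n 0 = n₀), n (H + 1) = nL →
      (∀ l, 1 ≤ l → l ≤ H → N ≤ n l) →
      cnnInit n H m k {θ | ¬ ∀ i j, |cnnNTK σw σb σo φ n H m k (fun j => x (Fin.cast hn₀ j))
        (fun j => x' (Fin.cast hn₀ j)) θ i j
          - if i = j then cnnThetaOut σw σb σo φ k H x x' else 0| < ε} ≤ ENNReal.ofReal ε := by
  set y : Bool → Fin n₀ → ZMod m → ℝ := fun b => cond b x' x with hy
  obtain ⟨N, hN⟩ := exists_measure_tangentKernel_le hφ (σw / √(2 * k + 1 : ℝ)) σb (cnnShift m k) σo 0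
    (fun (b : Bool) (α : ZMod m) => (b, α))
    (limitAdmissible_inputGram fun j (β : Bool × ZMod m) => y β.1 j β.2) H nL hε
  refine ⟨N, fun n hn₀ hnL hn => ?_⟩
  subst hn₀ hnL
  have := hN (cnnLayered n H m k) (cnnOutputParam n H m k)
    (x := fun j (β : Bool × ZMod m) => y β.1 j β.2) (fun _ _ => rfl)
    (vanishDegenerate_inputGram _) hn
    (f := fun t i b => cnnOutput σw σb σo φ n H m k (y b) t i) (fun t i b => by
      rw [layerPre, cnnOutput, zero_mul, add_zero]
      simp only [cnnLayered_post n H m k σw σb φ y t le_rfl]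
      rfl) false true
  have e := limitTheta_output_cnnLimit σw σb φ k y σo hH false true
  rw [cnnLimit] at e
  rw [e] at this
  exact this

theorem theorem2 (σw σb σo : ℝ) (φ : ℝ → ℝ) (K : ℝ≥0) (hφ : LipschitzWith K φ)
    (n₀ nL H : ℕ) (n : ℕ → ℕ → ℕ)
    (hn₀ : ∀ s, n s 0 = n₀) (hnL : ∀ s, n s (H + 1) = nL)
    (hn : ∀ l, 1 ≤ l → l ≤ H → Tendsto (fun s => n s l) atTop atTop) :
    (∀ x x' : Fin n₀ → ℝ,
      TendstoInProbScalar (fun s => fcnInit (n s) H)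
        (fun s => fcnNTK σw σb φ (n s) H
          (fun j => x (Fin.cast (hn₀ s) j)) (fun j => x' (Fin.cast (hn₀ s) j)))
        (fcnTheta σw σb φ (H + 1) x x')) ∧
    (∀ (m k : ℕ) [NeZero m], 1 ≤ H → ∀ x x' : Fin n₀ → ZMod m → ℝ,
      TendstoInProbScalar (fun s => cnnInit (n s) H m k)
        (fun s => cnnNTK σw σb σo φ (n s) H m k
          (fun j => x (Fin.cast (hn₀ s) j)) (fun j => x' (Fin.cast (hn₀ s) j)))
        (cnnThetaOut σw σb σo φ k H x x')) := by
  refine ⟨fun x x' => tendstoInProbScalar_of_forall_exists hn fun ε hε => ?_,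
    fun m k _ hH x x' => tendstoInProbScalar_of_forall_exists hn fun ε hε => ?_⟩
  · obtain ⟨N, hN⟩ := exists_measure_fcnNTK_le hφ σw σb nL H x x' hε
    exact ⟨N, fun s hs => hN (n s) (hn₀ s) (hnL s) hs⟩
  · obtain ⟨N, hN⟩ := exists_measure_cnnNTK_le hφ σw σb σo nL hH m k x x' hε
    exact ⟨N, fun s hs => hN (n s) (hn₀ s) (hnL s) hs⟩
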